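/- **Setting.** Let $0<T<\infty$, $\Omega=\{(x,t): 0\le x<\infty,\ 0\le t<T\}$, and let the real-valued function $u(x,t)$ be a solution in $\Omega$ of the Degasperis–Procesi equation $$u_t-u_{txx}+3u_x+4uu_x-3u_xu_{xx}-uu_{xxx}=0$$ which is of class $C^4$ up to the boundary, on $[0,\infty)\times[0,T]$ (i.e. the restriction of a $C^4$ function on the plane), with $|\partial_x^a u(x,t)|\le C(1+x)^{-2}$ for $0\le a\le 4$, $x\ge 0$, $0\le t\le T$. Assume $$u(x,0)-u_{xx}(x,0)+1>0\ (x\ge 0),\qquad u(0,t)-u_{xx}(0,t)+1>0,\quad g_0(t):=u(0,t)\le 0\ (0\le t<T).$$ Put $q=(u-u_{xx}+1)^{1/3}$ and $y(x,t)=\int_{(0,0)}^{(x,t)}q\,(dx'-u\,dt')$, the path being $(0,0)\to(0,t)\to(x,t)$. With $\omega=e^{2\pi i/3}$ let $$\lambda=\tfrac{1}{3\sqrt3}(k^3+k^{-3}),\quad l_j=\tfrac1{\sqrt3}\Bigl(\omega^jk+\tfrac1{\omega^jk}\Bigr),\quad z_j=\sqrt3\,\frac{(\omega^jk)^2+(\omega^jk)^{-2}}{k^3+k^{-3}}\quad(j=1,2,3),$$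 $\mathcal L=\mathrm{diag}(l_1,l_2,l_3)$, $\mathcal Z=\mathrm{diag}(z_1,z_2,z_3)$, $P=(l_j^{\,i-1})_{i,j=1}^3$, and $$\tilde V_1=P^{-1}\begin{pmatrix}\frac{q_x}{q}&0&0\\0&0&0\\0&\frac1q-q&-\frac{q_x}{q}\end{pmatrix}P,\qquad \tilde V_2=P^{-1}\left[\begin{pmatrix}-\frac{uq_x}{q}&0&0\\\frac{u+1}{q}-1&0&0\\\frac{u_x}{q^2}&\frac1q-1+uq&\frac{uq_x}{q}\end{pmatrix}+\frac{q^2-1}{\lambda}\begin{pmatrix}0&0&1\\0&0&0\\0&0&0\end{pmatrix}\right]P .$$ Let $K_j=e^{\pi ij/3-\pi i/6}$ and $\varkappa_j=e^{\pi i(j-1)/3}$, $j=1,\dots,6$. For $n=1,\dots,18$ let $D_n$ be the open set of all $k\in\mathbb C$ for which $\mathrm{Re}\,l_1,\mathrm{Re}\,l_2,\mathrm{Re}\,l_3$ and $\mathrm{Re}\,z_1,\mathrm{Re}\,z_2,\mathrm{Re}\,z_3$ are in strictly increasing order when their indices are arranged as follows, $(abc\,|\,def)$ meaning $\mathrm{Re}\,l_a<\mathrm{Re}\,l_b<\mathrm{Re}\,l_c$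 and $\mathrm{Re}\,z_d<\mathrm{Re}\,z_e<\mathrm{Re}\,z_f$: for $n=1,\dots,6$, $(123|123)$, $(132|132)$, $(312|312)$, $(321|321)$, $(231|231)$, $(213|213)$; for $n=7,\dots,18$, $(123|213)$, $(123|132)$, $(132|123)$, $(132|312)$, $(312|132)$, $(312|321)$, $(321|312)$, $(321|231)$, $(231|321)$, $(231|213)$, $(213|231)$, $(213|123)$. Consider the contours $\gamma_1:(0,T)\to(0,t)\to(x,t)$, $\gamma_2:(0,0)\to(0,t)\to(x,t)$, $\gamma_3:(\infty,t)\to(x,t)$ consisting of straight segments, and let $\gamma^n_{ij}$ be $\gamma_1$ if on $D_n$ one has $\mathrm{Re}\,l_i<\mathrm{Re}\,l_j$ and $\mathrm{Re}\,z_i\ge\mathrm{Re}\,z_j$; $\gamma_2$ if $\mathrm{Re}\,l_i<\mathrm{Re}\,l_j$ and $\mathrm{Re}\,z_i<\mathrm{Re}\,z_j$; and $\gamma_3$ if $\mathrm{Re}\,l_i\ge\mathrm{Re}\,l_j$. For a constant $3\times3$ matrix $A$ let $(\ast)_{n,k,A}$ be the problem of finding a solution $\tilde\Phi$ on $\Omega$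 of the Lax pair $$\tilde\Phi_x-[q\mathcal L,\tilde\Phi]=\tilde V_1\tilde\Phi,\qquad \tilde\Phi_t-[\mathcal Z-uq\mathcal L,\tilde\Phi]=\tilde V_2\tilde\Phi$$ that satisfies, with convergent integrals, for $i,j=1,2,3$ and $(x,t)\in\Omega$, $$\tilde\Phi_{ij}(x,t)=A_{ij}+\int_{\gamma^n_{ij}}e^{(l_i-l_j)(y(x,t)-y(x',t'))+(z_i-z_j)(t-t')}\bigl((\tilde V_1dx'+\tilde V_2dt')\tilde\Phi(x',t')\bigr)_{ij}.$$ Let $\Sigma_n$ (the Fredholm singular set) be the set of all $k\ne0$ in the closure of $D_n$ in $\mathbb C$, other than the $\varkappa_j$ and $K_j$, for which the homogeneous problem $(\ast)_{n,k,0}$ has a nonzero solution. **Proposition.** For each $n=1,\dots,18$: 1. $\Sigma_n$ is discrete in $D_n$: no point of $D_n$ is an accumulation point of $\Sigma_n$. 2. For each $k\in D_n\setminus\Sigma_n$ the problem $(\ast)_{n,k,I}$ has exactly one solution $\tilde\Phi_n(\cdot,\cdot,k)$ on $\Omega$. 3. For each fixed $(x,t)\in\Omega$, $k\mapsto\tilde\Phi_n(x,t,k)$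 is analytic in $D_n\setminus\Sigma_n$. (The set $D_n$ contains none of the $\varkappa_j$, $K_j$.) Moreover, let $n\in\{1,\dots,6\}$, $(x,t)\in\Omega$, let $\bar D_n$ be the closure of $D_n$ in the Riemann sphere $\mathbb C\cup\{\infty\}$, and $E_n=\{\varkappa_j,K_j\}_{j=1}^6\cup\Sigma_n$. Then $\tilde\Phi_n(x,t,\cdot)$ is bounded on $D_n\setminus U$ for every open set $U\supseteq E_n$ of the sphere, and it has an extension to $\bar D_n\setminus E_n$ (the points $0$ and $\infty$ included) which is continuous there and bounded on $\bar D_n\setminus U$ for every such $U$. -/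

import Mathlib

open Set Filter Topology MeasureTheory

noncomputable section

namespace DegasperisProcesi

/-! ### The equation on the half-line (with `κ = 1`) -/

/-- The domain `0 ≤ x < ∞`, `0 ≤ t < T`. -/
def halfLine (T : ℝ) : Set (ℝ × ℝ) := {p | 0 ≤ p.1 ∧ 0 ≤ p.2 ∧ p.2 < T}

/-- The partial derivative `∂ₓᵃ u` at `(x, t)`. -/
def dx (a : ℕ) (u : ℝ → ℝ → ℝ) (x t : ℝ) : ℝ := iteratedDeriv a (fun ξ => u ξ t) x

/-- A solution of the Degasperis-Procesi equation with `κ = 1` in the half-line domain, smooth up to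
the boundary of the domain (the line `t = T`, where one of the contours starts, included) and
decaying as `x → ∞`. Smoothness up to the boundary is expressed by letting `u` be the restriction of
a function of class `C⁴` on the plane; its values outside the closed domain play no role. -/
structure IsHalfLineSolution (T : ℝ) (u : ℝ → ℝ → ℝ) : Prop where
  smooth : ContDiff ℝ 4 (fun p : ℝ × ℝ => u p.1 p.2)
  decay : ∃ C : ℝ, ∀ a : ℕ, a ≤ 4 → ∀ x t : ℝ, 0 ≤ x → 0 ≤ t → t ≤ T →
    |dx a u x t| ≤ C / (1 + x) ^ 2
  equation : ∀ x t : ℝ, (x, t) ∈ halfLine T →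
    deriv (fun s => u x s) t - deriv (fun s => dx 2 u x s) t + 3 * dx 1 u x t
      + 4 * u x t * dx 1 u x t - 3 * dx 1 u x t * dx 2 u x t - u x t * dx 3 u x t = 0

/-- `q = (u - uₓₓ + 1)^(1/3)`. -/
def q (u : ℝ → ℝ → ℝ) (x t : ℝ) : ℝ := (u x t - dx 2 u x t + 1) ^ (1 / 3 : ℝ)

/-- `qₓ`. -/
def qx (u : ℝ → ℝ → ℝ) (x t : ℝ) : ℝ := deriv (fun ξ => q u ξ t) x

/-- `y(x,t) = ∫ q (dx' - u dt')` from `(0,0)` to `(x,t)`, along the path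
`(0,0) → (0,t) → (x,t)`. -/
def y (u : ℝ → ℝ → ℝ) (x t : ℝ) : ℝ :=
  -(∫ s in (0 : ℝ)..t, q u 0 s * u 0 s) + ∫ ξ in (0 : ℝ)..x, q u ξ t

/-! ### The spectral quantities -/

/-- The primitive cube root of unity `exp(2πi/3)`. -/
def om : ℂ := Complex.exp (2 * Real.pi * Complex.I / 3)

/-- `λ(k) = (k³ + k⁻³) / (3√3)`. -/
def lam (k : ℂ) : ℂ := 1 / (3 * (Real.sqrt 3 : ℂ)) * (k ^ 3 + 1 / k ^ 3)

/-- `l_{j+1}(k)`; the indices `1, 2, 3` are represented by `0, 1, 2 : Fin 3`. -/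
def l (k : ℂ) (j : Fin 3) : ℂ :=
  1 / (Real.sqrt 3 : ℂ) * (om ^ (j.val + 1) * k + 1 / (om ^ (j.val + 1) * k))

/-- `z_{j+1}(k)`. -/
def z (k : ℂ) (j : Fin 3) : ℂ :=
  (Real.sqrt 3 : ℂ) * (((om ^ (j.val + 1) * k) ^ 2 + 1 / (om ^ (j.val + 1) * k) ^ 2)
    / (k ^ 3 + 1 / k ^ 3))

/-- `ℒ = diag(l₁, l₂, l₃)`. -/
def calL (k : ℂ) : Matrix (Fin 3) (Fin 3) ℂ := Matrix.diagonal (l k)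

/-- `𝒵 = diag(z₁, z₂, z₃)`. -/
def calZ (k : ℂ) : Matrix (Fin 3) (Fin 3) ℂ := Matrix.diagonal (z k)

/-- The matrix with rows `1`, `l_j`, `l_j²`. -/
def P (k : ℂ) : Matrix (Fin 3) (Fin 3) ℂ := Matrix.of fun i j => l k j ^ i.val

/-- The points `K_j = exp(πij/3 - πi/6)`, `j = 1, …, 6`, at which `λ = 0`. -/
def Kpts : Set ℂ :=
  {k | ∃ j : ℕ, 1 ≤ j ∧ j ≤ 6 ∧
    k = Complex.exp (Real.pi * Complex.I * j / 3 - Real.pi * Complex.I / 6)}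

/-- The sixth roots of unity `ϰ_j = exp(πi(j-1)/3)`, `j = 1, …, 6`. -/
def kappas : Set ℂ :=
  {k | ∃ j : ℕ, 1 ≤ j ∧ j ≤ 6 ∧ k = Complex.exp (Real.pi * Complex.I * ((j : ℂ) - 1) / 3)}

/-! ### The Lax pair -/

/-- The coefficient of the `x`-part. -/
def V1 (u : ℝ → ℝ → ℝ) (x t : ℝ) (k : ℂ) : Matrix (Fin 3) (Fin 3) ℂ :=
  (P k)⁻¹ *
    !![((qx u x t / q u x t : ℝ) : ℂ), 0, 0;
       0, 0, 0;
       0, ((1 / q u x t - q u x t : ℝ) : ℂ), ((-(qx u x t / q u x t) : ℝ) : ℂ)] * P k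

/-- The coefficient of the `t`-part. -/
def V2 (u : ℝ → ℝ → ℝ) (x t : ℝ) (k : ℂ) : Matrix (Fin 3) (Fin 3) ℂ :=
  (P k)⁻¹ *
    (!![((-(u x t * qx u x t / q u x t) : ℝ) : ℂ), 0, 0;
        (((u x t + 1) / q u x t - 1 : ℝ) : ℂ), 0, 0;
        ((dx 1 u x t / q u x t ^ 2 : ℝ) : ℂ), ((1 / q u x t - 1 + u x t * q u x t : ℝ) : ℂ),
          ((u x t * qx u x t / q u x t : ℝ) : ℂ)]
      + (((q u x t ^ 2 - 1 : ℝ) : ℂ) / lam k) • !![0, 0, 1; 0, 0, 0; 0, 0, 0]) * P k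

/-- `Φ` solves, in the half-line domain, the Lax pair
`Φₓ - [qℒ, Φ] = V₁Φ`, `Φₜ - [𝒵 - uqℒ, Φ] = V₂Φ`
(with one-sided derivatives at the boundary of the domain). -/
def SolvesLaxPair (T : ℝ) (u : ℝ → ℝ → ℝ) (k : ℂ) (Φ : ℝ → ℝ → Matrix (Fin 3) (Fin 3) ℂ) :
    Prop :=
  ∀ x t : ℝ, (x, t) ∈ halfLine T → ∀ i j : Fin 3,
    HasDerivWithinAt (fun ξ => Φ ξ t i j)
      ((((q u x t : ℂ) • calL k) * Φ x t - Φ x t * ((q u x t : ℂ) • calL k)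
        + V1 u x t k * Φ x t) i j) (Ici 0) x ∧
    HasDerivWithinAt (fun s => Φ x s i j)
      (((calZ k - ((u x t * q u x t : ℝ) : ℂ) • calL k) * Φ x t
        - Φ x t * (calZ k - ((u x t * q u x t : ℝ) : ℂ) • calL k)
        + V2 u x t k * Φ x t) i j) (Ico 0 T) t

/-! ### The sets `D_n` and the contours -/

/-- The increasing order of `Re l₁, Re l₂, Re l₃` in `D_{n+1}`. -/
def lOrder : Fin 18 → Fin 3 → Fin 3 :=
  ![![0, 1, 2], ![0, 2, 1], ![2, 0, 1], ![2, 1, 0], ![1, 2, 0], ![1, 0, 2],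
    ![0, 1, 2], ![0, 1, 2], ![0, 2, 1], ![0, 2, 1], ![2, 0, 1], ![2, 0, 1],
    ![2, 1, 0], ![2, 1, 0], ![1, 2, 0], ![1, 2, 0], ![1, 0, 2], ![1, 0, 2]]

/-- The increasing order of `Re z₁, Re z₂, Re z₃` in `D_{n+1}`. -/
def zOrder : Fin 18 → Fin 3 → Fin 3 :=
  ![![0, 1, 2], ![0, 2, 1], ![2, 0, 1], ![2, 1, 0], ![1, 2, 0], ![1, 0, 2],
    ![1, 0, 2], ![0, 2, 1], ![0, 1, 2], ![2, 0, 1], ![0, 2, 1], ![2, 1, 0],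
    ![2, 0, 1], ![1, 2, 0], ![2, 1, 0], ![1, 0, 2], ![1, 2, 0], ![0, 1, 2]]

/-- The set `D_{n+1}`. It contains neither `0` nor the points `K_j`: there the conventions for
division by zero make all the `l_j`, respectively all the `z_j`, vanish. -/
def D (n : Fin 18) : Set ℂ :=
  {k | (l k (lOrder n 0)).re < (l k (lOrder n 1)).re ∧
       (l k (lOrder n 1)).re < (l k (lOrder n 2)).re ∧
       (z k (zOrder n 0)).re < (z k (zOrder n 1)).re ∧
       (z k (zOrder n 1)).re < (z k (zOrder n 2)).re}

/-- `i` stands strictly before `j` in the order `σ`. -/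
def Precedes (σ : Fin 3 → Fin 3) (i j : Fin 3) : Prop := ∃ a b : Fin 3, a < b ∧ σ a = i ∧ σ b = j

/-- The three contours ending at `(x,t)`: `γ₁ : (0,T) → (0,t) → (x,t)`,
`γ₂ : (0,0) → (0,t) → (x,t)`, `γ₃ : (∞,t) → (x,t)`. -/
inductive Contour
  | γ₁
  | γ₂
  | γ₃

/-- The integral of the one-form `f dx + g dt` along a contour ending at `(x,t)`. -/
def contourIntegral (T : ℝ) (f g : ℝ → ℝ → ℂ) (x t : ℝ) : Contour → ℂ
  | .γ₁ => (∫ s in T..t, g 0 s) + ∫ ξ in (0 : ℝ)..x, f ξ t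
  | .γ₂ => (∫ s in (0 : ℝ)..t, g 0 s) + ∫ ξ in (0 : ℝ)..x, f ξ t
  | .γ₃ => -∫ ξ in Ioi x, f ξ t

/-- The one-form `f dx + g dt` is integrable along a contour ending at `(x,t)`. -/
def ContourIntegrable (T : ℝ) (f g : ℝ → ℝ → ℂ) (x t : ℝ) : Contour → Prop
  | .γ₁ => IntervalIntegrable (fun s => g 0 s) volume T t ∧
      IntervalIntegrable (fun ξ => f ξ t) volume 0 x
  | .γ₂ => IntervalIntegrable (fun s => g 0 s) volume 0 t ∧
      IntervalIntegrable (fun ξ => f ξ t) volume 0 x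
  | .γ₃ => IntegrableOn (fun ξ => f ξ t) (Ioi x)

open Classical in
/-- The contour `γ_{ij}^n`: for `k ∈ D_n` it is `γ₁` if `Re l_i < Re l_j` and `Re z_i ≥ Re z_j`,
`γ₂` if `Re l_i < Re l_j` and `Re z_i < Re z_j`, and `γ₃` if `Re l_i ≥ Re l_j`. -/
def contour (n : Fin 18) (i j : Fin 3) : Contour :=
  if Precedes (lOrder n) i j then
    if Precedes (zOrder n) i j then .γ₂ else .γ₁
  else .γ₃

/-- The factor `exp((l_i - l_j)(y(x,t) - y(x',t')) + (z_i - z_j)(t - t'))` which the operator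
`exp(ℒ̂ (y(x,t) - y(x',t')) + 𝒵̂ (t - t'))`, `exp(Â)B = exp(A) B exp(-A)`, puts in front of the
entry `(i,j)` of a matrix. -/
def expFactor (u : ℝ → ℝ → ℝ) (k : ℂ) (i j : Fin 3) (x t x' t' : ℝ) : ℂ :=
  Complex.exp ((l k i - l k j) * ((y u x t - y u x' t' : ℝ) : ℂ)
    + (z k i - z k j) * ((t - t' : ℝ) : ℂ))

/-- `Φ` solves the Lax pair and the system of integral equations
`Φ_{ij}(x,t) = A_{ij} + ∫_{γ_{ij}^n} (exp(ℒ̂ (y(x,t) - y) + 𝒵̂ (t - t')) (V₁ dx' + V₂ dt') Φ)_{ij}`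
in the half-line domain. The eigenfunction belongs to `A = 1`, the homogeneous problem to
`A = 0`. -/
def SolvesSystem (T : ℝ) (u : ℝ → ℝ → ℝ) (n : Fin 18) (k : ℂ) (A : Matrix (Fin 3) (Fin 3) ℂ)
    (Φ : ℝ → ℝ → Matrix (Fin 3) (Fin 3) ℂ) : Prop :=
  SolvesLaxPair T u k Φ ∧
  ∀ x t : ℝ, (x, t) ∈ halfLine T → ∀ i j : Fin 3,
    ContourIntegrable T
      (fun x' t' => expFactor u k i j x t x' t' * (V1 u x' t' k * Φ x' t') i j)
      (fun x' t' => expFactor u k i j x t x' t' * (V2 u x' t' k * Φ x' t') i j)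
      x t (contour n i j) ∧
    Φ x t i j = A i j + contourIntegral T
      (fun x' t' => expFactor u k i j x t x' t' * (V1 u x' t' k * Φ x' t') i j)
      (fun x' t' => expFactor u k i j x t x' t' * (V2 u x' t' k * Φ x' t') i j)
      x t (contour n i j)

/-- The Fredholm singular set of the index `n`: the points `k ≠ 0` of the closure of `D_n`, other
than the `ϰ_j` and `K_j`, at which the homogeneous system has a nonzero solution. -/
def singularSet (T : ℝ) (u : ℝ → ℝ → ℝ) (n : Fin 18) : Set ℂ :=
  {k | k ∈ closure (D n) ∧ k ≠ 0 ∧ k ∉ kappas ∧ k ∉ Kpts ∧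
    ∃ Φ : ℝ → ℝ → Matrix (Fin 3) (Fin 3) ℂ, SolvesSystem T u n k 0 Φ ∧
      ∃ x t : ℝ, (x, t) ∈ halfLine T ∧ Φ x t ≠ 0}

/-- The closure of `D_n` in the Riemann sphere. -/
def sphereClosure (n : Fin 18) : Set (OnePoint ℂ) := closure ((fun k : ℂ => (k : OnePoint ℂ)) '' D n)

/-- The points `ϰ_j`, `K_j` and the singular set, as a subset of the Riemann sphere. -/
def exceptionalSet (T : ℝ) (u : ℝ → ℝ → ℝ) (n : Fin 18) : Set (OnePoint ℂ) :=
  (fun k : ℂ => (k : OnePoint ℂ)) '' (kappas ∪ Kpts ∪ singularSet T u n)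

end DegasperisProcesi

end

open Set Filter Topology MeasureTheory

noncomputable section



namespace DegasperisProcesi

/-! The problem reduces to linear algebra in three dimensions, with coefficients depending
analytically on `k`.

Write m = u - u_xx + 1 and ψ = (φ, φ_x, φ_xx), where φ_xxx = φ_x + λmφ. The Degasperis-Procesi
equation is the compatibility condition of this system with a t-equation which is a Laurent
polynomial in λ. Hence there is a common fundamental matrix `laxMat`, holomorphic in λ ≠ 0 and of
determinant 1. A gauge by powers of q and a conjugation by P turn it into the propagator Y = `propT`
of the given Lax pair. Every solution of that pair has columns exp(-(l_j y + z_j t)) Y v_j with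
constant v_j (`eq_waveMat`), so the unknown is three vectors of ℂ³. If column j is given the weight
exp(-(l_i y + z_i t)) instead, its i-th component has no diagonal term, and the integrand of
equation (i,j) is its derivative up to a constant factor. Each integral equation therefore only
prescribes that component at the start of its contour: at (0,T), at (0,0), or as x → ∞
(`EndConditions`).

Order the indices by Re l and call them 0, 1, 2. As the perturbation is O((1+x)⁻²), the behaviour at
infinity is governed by two objects. A functional ρ (`rhoVec`) gives the limit of the last component
in the last weight; a vector J (`jVec`) is the base vector of the solution tending to the first unit
vector in the first weight. If ρ·v = 0, the solution is bounded in the middle weight and its middle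
component has a limit κ, with J·(v×w) = κ ρ·w for all w (`triple_product_eq`). With the functionals
η of the finite contours, the first column is J, the second a multiple of ρ×η₀₁ and the third a
multiple of η₀₂×η₁₂. The normalizing denominators are η₀₁·J and ρ·(η₀₂×η₁₂). Where both are nonzero
the problem is uniquely solvable; where one vanishes the homogeneous problem has a nonzero solution.
So the singular set is their zero set (`mem_singularSet_iff`).

Both ρ and J are locally uniform limits of functions analytic in k, hence analytic in the open
sector of the given order of the Re l_j and continuous on the closed one. For discreteness the
denominators must not vanish identically. A unipotent change of gauge (`shear`) makes the
perturbation O(1/|k|) as k → ∞ and O(|k|) as k → 0 (`beta_le`), while z → 0. The condition u(0,t) ≤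
0 keeps the t-evolution along x = 0 from amplifying the relevant components. Consequently the
columns and both denominators have nonzero limits far out, and the identity theorem along rays
isolates the zeros. For the first six indices all finite contours start at the origin and the
eigenfunction tends to the identity at 0 and ∞; this gives the continuous extension to the sphere,
and compactness gives the bounds.

The same sign condition enters once more, at x = 0 in the minimum argument which keeps m positive,
so that q and the gauge make sense throughout the strip (`exists_mass_ge`). -/

/-! ### Linear differential equations -/

section LinearODE

variable {E : Type*} [NormedAddCommGroup E] [NormedSpace ℝ E]

/-- The Picard iterates of a linear differential equation with initial value `v`. -/
def picardIterate (A : ℝ → E →L[ℝ] E) (v : E) : ℕ → ℝ → E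
  | 0 => fun _ => v
  | n + 1 => fun x => ∫ s in (0 : ℝ)..x, A s (picardIterate A v n s)

lemma continuous_picardIterate {A : ℝ → E →L[ℝ] E} (hA : Continuous A) (v : E) [CompleteSpace E]
    (n : ℕ) : Continuous (picardIterate A v n) := by
  induction n with
  | zero => exact continuous_const
  | succ n ih =>
    exact intervalIntegral.continuous_primitive
      (fun a b => (hA.clm_apply ih).intervalIntegrable a b) 0

lemma hasDerivAt_picardIterate {A : ℝ → E →L[ℝ] E} (hA : Continuous A) (v : E) [CompleteSpace E]
    (n : ℕ) (x : ℝ) :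
    HasDerivAt (picardIterate A v (n + 1)) (A x (picardIterate A v n x)) x :=
  intervalIntegral.integral_hasDerivAt_right
    ((hA.clm_apply (continuous_picardIterate hA v n)).intervalIntegrable _ _)
    ((hA.clm_apply (continuous_picardIterate hA v n)).stronglyMeasurableAtFilter _ _)
    (hA.clm_apply (continuous_picardIterate hA v n)).continuousAt

/-- Reflection in the origin carries the bound of the iterates from the right half-line to the left
one. -/
lemma picardIterate_neg (A : ℝ → E →L[ℝ] E) (v : E) (n : ℕ) (x : ℝ) :
    picardIterate A v n (-x) = picardIterate (fun s => -A (-s)) v n x := by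
  induction n generalizing x with
  | zero => rfl
  | succ n ih =>
    simp only [picardIterate]
    have := intervalIntegral.integral_comp_neg (a := 0) (b := x)
      (f := fun s => A s (picardIterate A v n s))
    rw [neg_zero] at this
    rw [intervalIntegral.integral_symm (-x) 0, ← this, ← intervalIntegral.integral_neg]
    simp [ih]

lemma norm_picardIterate_le_of_nonneg {A : ℝ → E →L[ℝ] E} (hA : Continuous A) (v : E)
    [CompleteSpace E] {R M : ℝ} (hM : ∀ x ∈ Icc 0 R, ‖A x‖ ≤ M) (n : ℕ) :
    ∀ x ∈ Icc 0 R, ‖picardIterate A v n x‖ ≤ ‖v‖ * ((M * x) ^ n / n.factorial) := by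
  induction n with
  | zero => intro x _; simp [picardIterate]
  | succ n ih =>
    intro x hx
    have hd : ∀ x : ℝ, HasDerivAt (fun x : ℝ => ‖v‖ * ((M * x) ^ (n + 1) / (n + 1).factorial))
        (M * (‖v‖ * ((M * x) ^ n / n.factorial))) x := by
      intro x
      have h := ((((hasDerivAt_id x).const_mul M).pow (n + 1)).div_const
        ((n + 1).factorial : ℝ)).const_mul ‖v‖
      refine h.congr_deriv ?_
      have : (n.factorial : ℝ) ≠ 0 := by positivity
      simp only [id, Nat.factorial_succ, Nat.cast_mul, Nat.cast_succ]
      field_simp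
      simp
    refine image_norm_le_of_norm_deriv_right_le_deriv_boundary
      (f' := fun x => A x (picardIterate A v n x))
      (B' := fun x => M * (‖v‖ * ((M * x) ^ n / n.factorial)))
      (continuous_picardIterate hA v (n + 1)).continuousOn
      (fun x _ => (hasDerivAt_picardIterate hA v n x).hasDerivWithinAt) ?_ hd ?_ hx
    · simp [picardIterate]
    · intro x hx
      have hx' := Ico_subset_Icc_self hx
      refine (ContinuousLinearMap.le_opNorm _ _).trans ?_
      exact mul_le_mul (hM x hx') (ih x hx') (norm_nonneg _) ((norm_nonneg _).trans (hM x hx'))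

lemma norm_picardIterate_le {A : ℝ → E →L[ℝ] E} (hA : Continuous A) (v : E)
    [CompleteSpace E] {R M : ℝ} (hM : ∀ x ∈ Icc (-R) R, ‖A x‖ ≤ M) (n : ℕ) :
    ∀ x ∈ Icc (-R) R, ‖picardIterate A v n x‖ ≤ ‖v‖ * ((M * R) ^ n / n.factorial) := by
  intro x hx
  have hR : 0 ≤ R := by linarith [hx.1, hx.2]
  have hM0 : 0 ≤ M := (norm_nonneg _).trans (hM x hx)
  rcases le_total 0 x with h | h
  · refine (norm_picardIterate_le_of_nonneg hA v
      (fun s hs => hM s ⟨by linarith [hs.1], hs.2⟩) n x ⟨h, hx.2⟩).trans ?_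
    have := hx.2
    gcongr
  · have hA' : Continuous (fun s => -A (-s)) := (hA.comp continuous_neg).neg
    have := norm_picardIterate_le_of_nonneg hA' v (R := R) (M := M)
      (fun s hs => by rw [norm_neg]; exact hM _ ⟨by linarith [hs.2], by linarith [hs.1]⟩) n (-x)
      ⟨by linarith, by linarith [hx.1]⟩
    rw [← picardIterate_neg, neg_neg] at this
    refine this.trans ?_
    have h1 : -x ≤ R := by linarith [hx.1]
    have h2 : 0 ≤ -x := by linarith
    gcongr

/-- A linear differential equation with continuous coefficients has a global solution. -/
theorem exists_linear_solution [CompleteSpace E] {A : ℝ → E →L[ℝ] E} (hA : Continuous A) (v : E) :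
    ∃ f : ℝ → E, f 0 = v ∧ ∀ x, HasDerivAt f (A x (f x)) x := by
  have hbd : ∀ R : ℝ, ∃ M, 0 ≤ M ∧ ∀ x ∈ Icc (-R) R, ‖A x‖ ≤ M := by
    intro R
    obtain ⟨M, hM⟩ := (isCompact_Icc (a := -R) (b := R)).exists_bound_of_continuousOn
      hA.continuousOn
    exact ⟨max M 0, le_max_right _ _, fun x hx => (hM x hx).trans (le_max_left _ _)⟩
  have hsum : ∀ x : ℝ, Summable fun n => picardIterate A v n x := by
    intro x
    obtain ⟨M, hM0, hM⟩ := hbd |x|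
    refine Summable.of_norm_bounded ((Real.summable_pow_div_factorial (M * |x|)).mul_left ‖v‖)
      fun n => norm_picardIterate_le hA v hM n x ⟨neg_abs_le x, le_abs_self x⟩
  refine ⟨fun x => ∑' n, picardIterate A v n x, ?_, fun x => ?_⟩
  · beta_reduce
    rw [tsum_eq_single 0]
    · rfl
    · intro n hn
      obtain ⟨m, rfl⟩ := Nat.exists_eq_succ_of_ne_zero hn
      simp [picardIterate]
  · have hsplit : ∀ x : ℝ, ∑' n, picardIterate A v n x
        = v + ∑' n, picardIterate A v (n + 1) x := fun x => (hsum x).tsum_eq_zero_add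
    simp only [hsplit]
    obtain ⟨M, hM0, hM⟩ := hbd (|x| + 1)
    have hmem : ∀ y ∈ Ioo (-(|x| + 1)) (|x| + 1), y ∈ Icc (-(|x| + 1)) (|x| + 1) :=
      fun y hy => Ioo_subset_Icc_self hy
    have hx : x ∈ Ioo (-(|x| + 1)) (|x| + 1) :=
      ⟨by linarith [neg_abs_le x], by linarith [le_abs_self x]⟩
    have key := hasDerivAt_tsum_of_isPreconnected
      (u := fun n : ℕ => M * (‖v‖ * ((M * (|x| + 1)) ^ n / n.factorial)))
      (g := fun n => picardIterate A v (n + 1)) (g' := fun n y => A y (picardIterate A v n y))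
      (y₀ := x) (y := x) (t := Ioo (-(|x| + 1)) (|x| + 1))
      (((Real.summable_pow_div_factorial _).mul_left _).mul_left _) isOpen_Ioo isPreconnected_Ioo
      (fun n y _ => hasDerivAt_picardIterate hA v n y) ?_ hx
      ((summable_nat_add_iff 1).2 (hsum x)) hx
    · rw [← (A x).map_tsum (hsum x), hsplit x] at key
      exact key.const_add v
    · intro n y hy
      refine (ContinuousLinearMap.le_opNorm _ _).trans ?_
      exact mul_le_mul (hM y (hmem y hy)) (norm_picardIterate_le hA v hM n y (hmem y hy))
        (norm_nonneg _) hM0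

/-- For K ≥ 1 the division by K can be dropped. What remains is linear in the data δ and ε, as
needed for an o(|s - s₀|) estimate. -/
lemma gronwallBound_le {δ K ε x : ℝ} (hε : 0 ≤ ε) (hK : 1 ≤ K) (hx : 0 ≤ x) :
    gronwallBound δ K ε x ≤ (δ + ε) * Real.exp (K * x) := by
  rw [gronwallBound_of_K_ne_0 (by linarith)]
  have h1 : 1 ≤ Real.exp (K * x) := Real.one_le_exp (by positivity)
  have h2 : ε / K ≤ ε := div_le_self hε hK
  have h3 : ε / K * (Real.exp (K * x) - 1) ≤ ε * (Real.exp (K * x) - 1) :=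
    mul_le_mul_of_nonneg_right h2 (by linarith)
  nlinarith

/-- Differentiability of the solutions of a family of linear differential equations with respect to
the parameter, with a prescribed candidate `Z` for the derivative. -/
theorem hasDerivAt_of_linear_family {𝕜 : Type*} [RCLike 𝕜] [NormedSpace 𝕜 E]
    [SMulCommClass ℝ 𝕜 E] {A : 𝕜 → ℝ → E →L[𝕜] E} {A' : ℝ → E →L[𝕜] E} {ψ : 𝕜 → ℝ → E}
    {Z : ℝ → E} {s₀ : 𝕜} {X : ℝ} (hX : 0 ≤ X)
    (hA : ContinuousOn (A s₀) (Icc 0 X)) (hA' : ContinuousOn A' (Icc 0 X))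
    (hψ : ∀ s, ∀ ξ ∈ Icc 0 X, HasDerivAt (ψ s) (A s ξ (ψ s ξ)) ξ)
    (hZ : ∀ ξ ∈ Icc 0 X, HasDerivAt Z (A s₀ ξ (Z ξ) + A' ξ (ψ s₀ ξ)) ξ)
    (h0 : HasDerivAt (fun s => ψ s 0) (Z 0) s₀)
    (hrem : ∀ ε > 0, ∀ᶠ s in 𝓝 s₀, ∀ ξ ∈ Icc 0 X,
      ‖A s ξ - A s₀ ξ - (s - s₀) • A' ξ‖ ≤ ε * ‖s - s₀‖) :
    HasDerivAt (fun s => ψ s X) (Z X) s₀ := by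
  have hψc : ContinuousOn (ψ s₀) (Icc 0 X) :=
    fun ξ hξ => (hψ s₀ ξ hξ).continuousAt.continuousWithinAt
  have hZc : ContinuousOn Z (Icc 0 X) := fun ξ hξ => (hZ ξ hξ).continuousAt.continuousWithinAt
  obtain ⟨M₁, hM₁⟩ := isCompact_Icc.exists_bound_of_continuousOn hA
  obtain ⟨M₂, hM₂⟩ := isCompact_Icc.exists_bound_of_continuousOn hA'
  obtain ⟨M₃, hM₃⟩ := isCompact_Icc.exists_bound_of_continuousOn hψc
  obtain ⟨M₄, hM₄⟩ := isCompact_Icc.exists_bound_of_continuousOn hZc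
  have h0X : (0 : ℝ) ∈ Icc 0 X := ⟨le_rfl, hX⟩
  have p₁ := (norm_nonneg _).trans (hM₁ 0 h0X)
  have p₂ := (norm_nonneg _).trans (hM₂ 0 h0X)
  have p₃ := (norm_nonneg _).trans (hM₃ 0 h0X)
  have p₄ := (norm_nonneg _).trans (hM₄ 0 h0X)
  set K := M₁ + M₂ + 2 with hK
  rw [hasDerivAt_iff_isLittleO, Asymptotics.isLittleO_iff]
  intro c hc
  set D := (1 + M₃ + (M₂ + 1) * M₄) * Real.exp (K * X) with hD
  have hDpos : 0 < D := by positivity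
  -- The accuracy is chosen so that, after the Grönwall factor contained in `D`, the error is still
  -- at most c.
  set η := min 1 (c / D) with hη
  have hηpos : 0 < η := lt_min one_pos (by positivity)
  have e1 := (Asymptotics.isLittleO_iff.1 (hasDerivAt_iff_isLittleO.1 h0)) hηpos
  have e2 : ∀ᶠ s in 𝓝 s₀, ‖s - s₀‖ < η := by
    filter_upwards [Metric.ball_mem_nhds s₀ hηpos] with s hs
    simpa [dist_eq_norm] using hs
  filter_upwards [e1, hrem η hηpos, e2] with s h1 h2 h3
  have hη1 : η ≤ 1 := min_le_left _ _
  have hs1 : ‖s - s₀‖ ≤ 1 := h3.le.trans hη1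
  have hdiff : ∀ ξ ∈ Icc 0 X, ‖A s ξ - A s₀ ξ‖ ≤ (M₂ + 1) * ‖s - s₀‖ := by
    intro ξ hξ
    have : A s ξ - A s₀ ξ = (A s ξ - A s₀ ξ - (s - s₀) • A' ξ) + (s - s₀) • A' ξ := by abel
    rw [this]
    refine (norm_add_le _ _).trans ?_
    rw [norm_smul]
    have a1 := h2 ξ hξ
    have a2 := hM₂ ξ hξ
    have a3 : η * ‖s - s₀‖ ≤ 1 * ‖s - s₀‖ := mul_le_mul_of_nonneg_right hη1 (norm_nonneg _)
    have a4 : ‖s - s₀‖ * ‖A' ξ‖ ≤ ‖s - s₀‖ * M₂ := mul_le_mul_of_nonneg_left a2 (norm_nonneg _)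
    linarith
  have hAs : ∀ ξ ∈ Icc 0 X, ‖A s ξ‖ ≤ K := by
    intro ξ hξ
    have : A s ξ = A s₀ ξ + (A s ξ - A s₀ ξ) := by abel
    rw [this]
    refine (norm_add_le _ _).trans ?_
    have a1 := hdiff ξ hξ
    have a2 : (M₂ + 1) * ‖s - s₀‖ ≤ (M₂ + 1) * 1 := mul_le_mul_of_nonneg_left hs1 (by linarith)
    linarith [hM₁ ξ hξ]
  have key := norm_le_gronwallBound_of_norm_deriv_right_le (a := 0) (b := X) (K := K)
    (f := fun ξ => ψ s ξ - ψ s₀ ξ - (s - s₀) • Z ξ) (δ := η * ‖s - s₀‖)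
    (f' := fun ξ => A s ξ (ψ s ξ) - A s₀ ξ (ψ s₀ ξ)
      - (s - s₀) • (A s₀ ξ (Z ξ) + A' ξ (ψ s₀ ξ)))
    (ε := (M₃ + (M₂ + 1) * M₄) * (η * ‖s - s₀‖))
    (fun ξ hξ => (((hψ s ξ hξ).sub (hψ s₀ ξ hξ)).sub
      ((hZ ξ hξ).const_smul (s - s₀))).continuousAt.continuousWithinAt)
    (fun ξ hξ => (((hψ s ξ (Ico_subset_Icc_self hξ)).sub (hψ s₀ ξ (Ico_subset_Icc_self hξ))).sub
      ((hZ ξ (Ico_subset_Icc_self hξ)).const_smul (s - s₀))).hasDerivWithinAt)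
    h1 ?_ X ⟨hX, le_rfl⟩
  · refine key.trans ?_
    rw [sub_zero]
    refine (gronwallBound_le (by positivity) (by linarith) hX).trans ?_
    have : (η * ‖s - s₀‖ + (M₃ + (M₂ + 1) * M₄) * (η * ‖s - s₀‖)) * Real.exp (K * X)
        = η * D * ‖s - s₀‖ := by rw [hD]; ring
    rw [this]
    refine mul_le_mul_of_nonneg_right ?_ (norm_nonneg _)
    calc η * D ≤ c / D * D := mul_le_mul_of_nonneg_right (min_le_right _ _) hDpos.le
      _ = c := by field_simp
  · intro ξ hξ'
    have hξ := Ico_subset_Icc_self hξ'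
    -- The Taylor remainder r = ψ_s - ψ_{s₀} - (s - s₀)Z solves r' = A_s r + forcing. Both forcing
    -- terms are bounded by a constant times η|s - s₀|.
    have : A s ξ (ψ s ξ) - A s₀ ξ (ψ s₀ ξ) - (s - s₀) • (A s₀ ξ (Z ξ) + A' ξ (ψ s₀ ξ))
        = A s ξ (ψ s ξ - ψ s₀ ξ - (s - s₀) • Z ξ)
          + (A s ξ - A s₀ ξ - (s - s₀) • A' ξ) (ψ s₀ ξ)
          + (s - s₀) • (A s ξ - A s₀ ξ) (Z ξ) := by
      simp only [map_sub, map_smul, sub_apply, smul_apply,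
        smul_add, smul_sub]
      abel
    rw [this]
    refine (norm_add₃_le).trans ?_
    have b1 : ‖A s ξ (ψ s ξ - ψ s₀ ξ - (s - s₀) • Z ξ)‖
        ≤ K * ‖ψ s ξ - ψ s₀ ξ - (s - s₀) • Z ξ‖ :=
      ((A s ξ).le_opNorm _).trans (mul_le_mul_of_nonneg_right (hAs ξ hξ) (norm_nonneg _))
    have b2 : ‖(A s ξ - A s₀ ξ - (s - s₀) • A' ξ) (ψ s₀ ξ)‖ ≤ (η * ‖s - s₀‖) * M₃ :=
      (ContinuousLinearMap.le_opNorm _ _).trans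
        (mul_le_mul (h2 ξ hξ) (hM₃ ξ hξ) (norm_nonneg _) (by positivity))
    have b3 : ‖(s - s₀) • (A s ξ - A s₀ ξ) (Z ξ)‖ ≤ η * (((M₂ + 1) * ‖s - s₀‖) * M₄) := by
      rw [norm_smul]
      refine mul_le_mul h3.le ?_ (norm_nonneg _) hηpos.le
      exact (ContinuousLinearMap.le_opNorm _ _).trans
        (mul_le_mul (hdiff ξ hξ) (hM₄ ξ hξ) (norm_nonneg _) (by positivity))
    linarith

end LinearODE


/-! ### Energy estimates -/

/-- The Euclidean norm of the components with index in `s`. -/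
def partialNorm {ι : Type*} (s : Finset ι) (φ : ι → ℂ) : ℝ := √(∑ i ∈ s, ‖φ i‖ ^ 2)

section Energy

variable {ι : Type*} {s : Finset ι}

lemma partialNorm_nonneg (s : Finset ι) (φ : ι → ℂ) : 0 ≤ partialNorm s φ := Real.sqrt_nonneg _

lemma norm_le_partialNorm {φ : ι → ℂ} {i : ι} (hi : i ∈ s) : ‖φ i‖ ≤ partialNorm s φ := by
  refine Real.le_sqrt_of_sq_le ?_
  exact Finset.single_le_sum (f := fun i => ‖φ i‖ ^ 2) (fun j _ => by positivity) hi

lemma partialNorm_le_sum (s : Finset ι) (φ : ι → ℂ) : partialNorm s φ ≤ ∑ i ∈ s, ‖φ i‖ := by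
  refine Real.sqrt_le_iff.2 ⟨Finset.sum_nonneg fun _ _ => norm_nonneg _, ?_⟩
  exact Finset.sum_sq_le_sq_sum_of_nonneg fun _ _ => norm_nonneg _

lemma sum_norm_le_partialNorm (s : Finset ι) (φ : ι → ℂ) :
    ∑ i ∈ s, ‖φ i‖ ≤ s.card * partialNorm s φ := by
  rw [← nsmul_eq_mul]
  exact Finset.sum_le_card_nsmul _ _ _ fun i hi => norm_le_partialNorm hi

lemma partialNorm_smul (s : Finset ι) (c : ℂ) (φ : ι → ℂ) :
    partialNorm s (fun i => c * φ i) = ‖c‖ * partialNorm s φ := by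
  unfold partialNorm
  rw [show ∑ i ∈ s, ‖c * φ i‖ ^ 2 = ‖c‖ ^ 2 * ∑ i ∈ s, ‖φ i‖ ^ 2 by
    rw [Finset.mul_sum]; exact Finset.sum_congr rfl fun i _ => by rw [norm_mul]; ring]
  rw [Real.sqrt_mul (by positivity), Real.sqrt_sq (norm_nonneg _)]

/-- A Grönwall estimate for a system whose diagonal part does not expand. -/
theorem energy_estimate {φ f Λ : ℝ → ι → ℂ} {g G : ℝ → ℝ} {a b c : ℝ} (hab : a ≤ b)
    (hφ : ∀ x ∈ Icc a b, ∀ i ∈ s,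
      HasDerivWithinAt (fun x => φ x i) (Λ x i * φ x i + f x i) (Icc a b) x)
    (hΛ : ∀ x ∈ Icc a b, ∀ i ∈ s, (Λ x i).re ≤ g x)
    (hf : ∀ x ∈ Icc a b, ∀ i ∈ s, ‖f x i‖ ≤ g x * (partialNorm s (φ x) + c))
    (hG : ∀ x ∈ Icc a b, HasDerivWithinAt G ((s.card + 1) * g x) (Icc a b) x)
    (hg : ∀ x ∈ Icc a b, 0 ≤ g x) (hc : 0 ≤ c) :
    partialNorm s (φ b) + c ≤ Real.exp (G b - G a) * (partialNorm s (φ a) + c) := by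
  -- The square root is not differentiable where all components vanish; adding δ² under the root
  -- removes the difficulty, and δ tends to 0 at the end.
  have main : ∀ δ > 0, √(∑ i ∈ s, ‖φ b i‖ ^ 2 + δ ^ 2) + c
      ≤ Real.exp (G b - G a) * (√(∑ i ∈ s, ‖φ a i‖ ^ 2 + δ ^ 2) + c) := by
    intro δ hδ
    set S : ℝ → ℝ := fun x => √(∑ i ∈ s, ‖φ x i‖ ^ 2 + δ ^ 2) with hS
    have hpos : ∀ x, 0 < ∑ i ∈ s, ‖φ x i‖ ^ 2 + δ ^ 2 := fun x =>
      add_pos_of_nonneg_of_pos (Finset.sum_nonneg fun _ _ => by positivity) (by positivity)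
    have hSpos : ∀ x, 0 < S x := fun x => Real.sqrt_pos.2 (hpos x)
    have hSsq : ∀ x, S x ^ 2 = ∑ i ∈ s, ‖φ x i‖ ^ 2 + δ ^ 2 := fun x => Real.sq_sqrt (hpos x).le
    have hSN : ∀ x, partialNorm s (φ x) ≤ S x := fun x =>
      Real.sqrt_le_sqrt (by linarith [sq_nonneg δ])
    have hSd : ∀ x ∈ Icc a b, HasDerivWithinAt S
        ((∑ i ∈ s, 2 * inner ℝ (φ x i) (Λ x i * φ x i + f x i)) / (2 * S x)) (Icc a b) x := by
      intro x hx
      have h1 : HasDerivWithinAt (fun x => ∑ i ∈ s, ‖φ x i‖ ^ 2 + δ ^ 2)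
          (∑ i ∈ s, 2 * inner ℝ (φ x i) (Λ x i * φ x i + f x i)) (Icc a b) x :=
        (HasDerivWithinAt.fun_sum fun i hi => (hφ x hx i hi).norm_sq).add_const _
      exact h1.sqrt (hpos x).ne'
    have hbound : ∀ x ∈ Icc a b,
        (∑ i ∈ s, 2 * inner ℝ (φ x i) (Λ x i * φ x i + f x i)) / (2 * S x)
          ≤ (s.card + 1) * g x * (S x + c) := by
      intro x hx
      rw [div_le_iff₀ (by linarith [hSpos x])]
      have h1 : ∀ i ∈ s, 2 * inner ℝ (φ x i) (Λ x i * φ x i + f x i)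
          ≤ 2 * g x * ‖φ x i‖ ^ 2 + 2 * S x * (g x * (S x + c)) := by
        intro i hi
        have e1 : inner ℝ (φ x i) (Λ x i * φ x i + f x i)
            = (Λ x i).re * ‖φ x i‖ ^ 2 + inner ℝ (φ x i) (f x i) := by
          rw [inner_add_right]
          congr 1
          rw [Complex.inner, ← Complex.normSq_eq_norm_sq, Complex.normSq_apply]
          simp only [Complex.mul_re, Complex.conj_re, Complex.conj_im, Complex.mul_im]
          ring
        have e2 : inner ℝ (φ x i) (f x i) ≤ S x * (g x * (S x + c)) := by
          refine (real_inner_le_norm _ _).trans ?_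
          refine mul_le_mul ((norm_le_partialNorm hi).trans (hSN x)) ?_ (norm_nonneg _)
            (hSpos x).le
          exact (hf x hx i hi).trans (mul_le_mul_of_nonneg_left (by linarith [hSN x]) (hg x hx))
        have e3 : (Λ x i).re * ‖φ x i‖ ^ 2 ≤ g x * ‖φ x i‖ ^ 2 :=
          mul_le_mul_of_nonneg_right (hΛ x hx i hi) (by positivity)
        rw [e1]
        linarith
      refine (Finset.sum_le_sum h1).trans ?_
      rw [Finset.sum_add_distrib, ← Finset.mul_sum, Finset.sum_const, nsmul_eq_mul]
      have h2 : ∑ i ∈ s, ‖φ x i‖ ^ 2 ≤ S x ^ 2 := by rw [hSsq]; linarith [sq_nonneg δ]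
      have h3 := mul_le_mul_of_nonneg_left h2 (hg x hx)
      have h4 : 0 ≤ g x * c * S x := mul_nonneg (mul_nonneg (hg x hx) hc) (hSpos x).le
      nlinarith
    -- The diagonal part contributes g S and the `s.card` forcing terms at most g (S + c) each, so
    -- S' ≤ G'(S + c) and (S + c)e^{-G} decreases.
    have hanti : AntitoneOn (fun x => (S x + c) * Real.exp (-G x)) (Icc a b) := by
      have hd : ∀ x ∈ Icc a b, HasDerivWithinAt (fun x => (S x + c) * Real.exp (-G x))
          (((∑ i ∈ s, 2 * inner ℝ (φ x i) (Λ x i * φ x i + f x i)) / (2 * S x))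
            * Real.exp (-G x) + (S x + c) * (Real.exp (-G x) * -((s.card + 1) * g x)))
          (Icc a b) x := fun x hx => ((hSd x hx).add_const c).mul (hG x hx).neg.exp
      refine antitoneOn_of_hasDerivWithinAt_nonpos (convex_Icc a b)
        (fun x hx => (hd x hx).continuousWithinAt)
        (fun x hx => (hd x (interior_subset hx)).mono interior_subset) ?_
      intro x hx
      have h1 := hbound x (interior_subset hx)
      have h2 := Real.exp_pos (-G x)
      nlinarith
    have h1 := hanti ⟨le_rfl, hab⟩ ⟨hab, le_rfl⟩ hab
    simp only at h1
    have h2 := mul_le_mul_of_nonneg_right h1 (Real.exp_pos (G b)).le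
    rw [mul_assoc, ← Real.exp_add, neg_add_cancel, Real.exp_zero, mul_one, mul_assoc,
      ← Real.exp_add] at h2
    rw [mul_comm (Real.exp _), show G b - G a = -G a + G b by ring]
    exact h2
  have hcont : ∀ v : ι → ℂ, Tendsto (fun δ : ℝ => √(∑ i ∈ s, ‖v i‖ ^ 2 + δ ^ 2)) (𝓝[>] 0)
      (𝓝 (partialNorm s v)) := by
    intro v
    have : Continuous fun δ : ℝ => √(∑ i ∈ s, ‖v i‖ ^ 2 + δ ^ 2) := by fun_prop
    have h := (this.tendsto 0).mono_left (nhdsWithin_le_nhds (s := Ioi 0))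
    simpa [partialNorm] using h
  exact le_of_tendsto_of_tendsto ((hcont (φ b)).add_const c)
    (((hcont (φ a)).add_const c).const_mul _)
    (eventually_nhdsWithin_of_forall fun δ hδ => main δ hδ)

/-- The weight K(1+x)⁻² has finite total mass; this is what turns Grönwall estimates on the
half-line into bounds. -/
lemma hasDerivAt_neg_div_one_add (K : ℝ) {x : ℝ} (hx : 0 ≤ x) :
    HasDerivAt (fun x : ℝ => -(K / (1 + x))) (K / (1 + x) ^ 2) x := by
  have h1 : (1 + x) ≠ 0 := by positivity
  have h := ((hasDerivAt_const x K).div ((hasDerivAt_id x).const_add 1) h1).neg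
  refine h.congr_deriv ?_
  simp [neg_div]

lemma norm_sum_mul_le [Fintype ι] {V : ι → ι → ℂ} {g : ℝ} (hg : 0 ≤ g)
    (hV : ∀ i r, ‖V i r‖ ≤ g) (φ : ι → ℂ) (i : ι) :
    ‖∑ r, V i r * φ r‖ ≤ Fintype.card ι * g * partialNorm Finset.univ φ := by
  calc ‖∑ r, V i r * φ r‖ ≤ ∑ r, g * ‖φ r‖ := norm_sum_le_of_le _ fun r _ => by
        rw [norm_mul]; exact mul_le_mul_of_nonneg_right (hV i r) (norm_nonneg _)
    _ = g * ∑ r, ‖φ r‖ := by rw [Finset.mul_sum]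
    _ ≤ g * (Fintype.card ι * partialNorm Finset.univ φ) :=
        mul_le_mul_of_nonneg_left (sum_norm_le_partialNorm _ _) hg
    _ = _ := by ring

/-- Solutions of a system with non-expanding diagonal part and integrable perturbation are
bounded. -/
theorem partialNorm_le_of_system {φ Λ : ℝ → Fin 3 → ℂ} {V : ℝ → Fin 3 → Fin 3 → ℂ} {C x₀ : ℝ}
    (hx₀ : 0 ≤ x₀) (hC : 0 ≤ C)
    (hφ : ∀ x, x₀ ≤ x → ∀ i, HasDerivWithinAt (fun x => φ x i)
      (Λ x i * φ x i + ∑ r, V x i r * φ x r) (Ici x₀) x)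
    (hΛ : ∀ x, x₀ ≤ x → ∀ i, (Λ x i).re ≤ 0)
    (hV : ∀ x, x₀ ≤ x → ∀ i r, ‖V x i r‖ ≤ C / (1 + x) ^ 2) {x x' : ℝ} (hx : x₀ ≤ x)
    (hxx' : x ≤ x') :
    partialNorm Finset.univ (φ x')
      ≤ Real.exp (12 * C / (1 + x) - 12 * C / (1 + x')) * partialNorm Finset.univ (φ x) := by
  -- The constant 12 is (3 + 1)·3: one more than the number of components, times the factor lost by
  -- bounding a sum over three components.
  have key := energy_estimate (s := Finset.univ) (φ := φ) (Λ := Λ) (c := 0)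
    (f := fun x i => ∑ r, V x i r * φ x r) (g := fun x => 3 * C / (1 + x) ^ 2)
    (G := fun x => -(12 * C / (1 + x))) hxx'
    (fun y hy i _ => (hφ y (hx.trans hy.1) i).mono fun z hz => hx.trans hz.1)
    (fun y hy i _ => (hΛ y (hx.trans hy.1) i).trans (by positivity))
    (fun y hy i _ => ?_) (fun y hy => ?_) (fun y hy => by positivity) le_rfl
  · simpa [neg_add_eq_sub] using key
  · have := norm_sum_mul_le (by positivity) (hV y (hx.trans hy.1)) (φ y) i
    rw [add_zero]
    refine this.trans (le_of_eq ?_)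
    rw [Fintype.card_fin]
    push_cast
    ring
  · have := (hasDerivAt_neg_div_one_add (12 * C) (hx₀.trans (hx.trans hy.1))).hasDerivWithinAt
      (s := Icc x x')
    refine this.congr_deriv ?_
    simp
    ring

/-- In such a system the component whose diagonal coefficient vanishes has a limit. -/
theorem exists_limit_of_system {φ Λ : ℝ → Fin 3 → ℂ} {V : ℝ → Fin 3 → Fin 3 → ℂ} {C x₀ : ℝ}
    (hx₀ : 0 ≤ x₀) (hC : 0 ≤ C)
    (hφ : ∀ x, x₀ ≤ x → ∀ i, HasDerivWithinAt (fun x => φ x i)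
      (Λ x i * φ x i + ∑ r, V x i r * φ x r) (Ici x₀) x)
    (hΛ : ∀ x, x₀ ≤ x → ∀ i, (Λ x i).re ≤ 0)
    (hV : ∀ x, x₀ ≤ x → ∀ i r, ‖V x i r‖ ≤ C / (1 + x) ^ 2) {c : Fin 3}
    (hc : ∀ x, x₀ ≤ x → Λ x c = 0) :
    ∃ L : ℂ, Tendsto (fun x => φ x c) atTop (𝓝 L) ∧ ∀ x, x₀ ≤ x →
      ‖φ x c - L‖ ≤ (Real.exp (12 * C / (1 + x)) - 1) * partialNorm Finset.univ (φ x) := by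
  have hdiff : ∀ x x', x₀ ≤ x → x ≤ x' → ‖φ x' c - φ x c‖
      ≤ (Real.exp (12 * C / (1 + x)) - 1) * partialNorm Finset.univ (φ x) := by
    intro x x' hx hxx'
    set N := partialNorm Finset.univ (φ x) with hN
    have hN0 : 0 ≤ N := partialNorm_nonneg _ _
    -- The barrier is the primitive of the bound for the derivative: (exp(12C/(1+x) - 12C/(1+z)) -
    -- 1) N grows at least as fast as the component can, and it vanishes at z = x.
    have key := image_norm_le_of_norm_deriv_right_le_deriv_boundary' (a := x) (b := x')
      (f := fun z => φ z c - φ x c) (f' := fun z => Λ z c * φ z c + ∑ r, V z c r * φ z r)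
      (B := fun z => (Real.exp (12 * C / (1 + x) + -(12 * C / (1 + z))) - 1) * N)
      (B' := fun z => Real.exp (12 * C / (1 + x) + -(12 * C / (1 + z)))
        * (12 * C / (1 + z) ^ 2) * N)
      (fun z hz => (((hφ z (hx.trans hz.1) c).continuousWithinAt).mono
        fun w hw => hx.trans hw.1).sub continuousWithinAt_const)
      (fun z hz => ((hφ z (hx.trans hz.1) c).mono
        fun w hw => (hx.trans hz.1).trans hw).sub_const _)
      (by simp) ?_ ?_ ?_ (right_mem_Icc.2 hxx')
    · refine key.trans (mul_le_mul_of_nonneg_right ?_ hN0)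
      have : 0 ≤ 12 * C / (1 + x') := div_nonneg (by positivity) (by linarith)
      have := Real.exp_le_exp.2
        (show 12 * C / (1 + x) + -(12 * C / (1 + x')) ≤ 12 * C / (1 + x) by linarith)
      linarith
    · intro z hz
      have := ((hasDerivAt_neg_div_one_add (12 * C)
        (hx₀.trans (hx.trans hz.1))).const_add (12 * C / (1 + x))).exp
      exact ((this.sub_const 1).mul_const N).continuousAt.continuousWithinAt
    · intro z hz
      have := ((hasDerivAt_neg_div_one_add (12 * C)
        (hx₀.trans (hx.trans hz.1))).const_add (12 * C / (1 + x))).exp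
      exact ((this.sub_const 1).mul_const N).hasDerivWithinAt
    · intro z hz
      have hz0 : x₀ ≤ z := hx.trans hz.1
      rw [hc z hz0, zero_mul, zero_add]
      refine (norm_sum_mul_le (by positivity) (hV z hz0) (φ z) c).trans ?_
      have h1 := partialNorm_le_of_system hx₀ hC hφ hΛ hV hx hz.1
      rw [← hN, sub_eq_add_neg] at h1
      have hCz : 0 ≤ C / (1 + z) ^ 2 := by positivity
      calc (Fintype.card (Fin 3) : ℝ) * (C / (1 + z) ^ 2) * partialNorm Finset.univ (φ z)
          ≤ (12 * (C / (1 + z) ^ 2)) * (Real.exp (12 * C / (1 + x) + -(12 * C / (1 + z))) * N) := by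
            refine mul_le_mul ?_ h1 (partialNorm_nonneg _ _) (by positivity)
            simp only [Fintype.card_fin]
            push_cast
            linarith
        _ = _ := by ring
  have hbd : ∀ x, x₀ ≤ x → partialNorm Finset.univ (φ x)
      ≤ Real.exp (12 * C / (1 + x₀)) * partialNorm Finset.univ (φ x₀) := by
    intro x hx
    refine (partialNorm_le_of_system hx₀ hC hφ hΛ hV le_rfl hx).trans
      (mul_le_mul_of_nonneg_right (Real.exp_le_exp.2 ?_) (partialNorm_nonneg _ _))
    have : 0 ≤ 12 * C / (1 + x) := div_nonneg (by positivity) (by linarith)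
    linarith
  have hzero : Tendsto (fun x : ℝ => (Real.exp (12 * C / (1 + x)) - 1)
      * (Real.exp (12 * C / (1 + x₀)) * partialNorm Finset.univ (φ x₀))) atTop (𝓝 0) := by
    have h1 : Tendsto (fun x : ℝ => 12 * C / (1 + x)) atTop (𝓝 0) :=
      tendsto_const_nhds.div_atTop (tendsto_atTop_add_const_left _ _ tendsto_id)
    have h2 := ((Real.continuous_exp.tendsto 0).comp h1).sub_const 1
    rw [Real.exp_zero, sub_self] at h2
    simpa using h2.mul_const (Real.exp (12 * C / (1 + x₀)) * partialNorm Finset.univ (φ x₀))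
  have hdiff' : ∀ x x', x₀ ≤ x → x ≤ x' → ‖φ x' c - φ x c‖ ≤ (Real.exp (12 * C / (1 + x)) - 1)
      * (Real.exp (12 * C / (1 + x₀)) * partialNorm Finset.univ (φ x₀)) := by
    intro x x' hx hxx'
    refine (hdiff x x' hx hxx').trans (mul_le_mul_of_nonneg_left (hbd x hx) ?_)
    have : 0 ≤ 12 * C / (1 + x) := div_nonneg (by positivity) (by linarith)
    linarith [Real.one_le_exp this]
  have hcauchy : CauchySeq fun x => φ x c := by
    rw [Metric.cauchySeq_iff']
    intro ε hε
    obtain ⟨x, hx, hx'⟩ := ((hzero.eventually (gt_mem_nhds hε)).and (eventually_ge_atTop x₀)).exists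
    refine ⟨x, fun x' hxx' => ?_⟩
    rw [dist_eq_norm]
    exact (hdiff' x x' hx' hxx').trans_lt hx
  obtain ⟨L, hL⟩ := cauchySeq_tendsto_of_complete hcauchy
  refine ⟨L, hL, fun x hx => ?_⟩
  have h1 : Tendsto (fun x' => ‖φ x' c - φ x c‖) atTop (𝓝 ‖L - φ x c‖) := (hL.sub_const _).norm
  rw [norm_sub_rev]
  exact le_of_tendsto h1 ((eventually_ge_atTop x).mono fun x' hx' => hdiff x x' hx hx')

end Energy


/-! ### Partial derivatives in the plane -/

/-- The partial derivative in the first variable. -/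
def partialX (g : ℝ × ℝ → ℝ) (p : ℝ × ℝ) : ℝ := fderiv ℝ g p (1, 0)

/-- The partial derivative in the second variable. -/
def partialT (g : ℝ × ℝ → ℝ) (p : ℝ × ℝ) : ℝ := fderiv ℝ g p (0, 1)

lemma contDiff_partialX {g : ℝ × ℝ → ℝ} {n : ℕ} (hg : ContDiff ℝ (n + 1 : ℕ) g) :
    ContDiff ℝ n (partialX g) :=
  (hg.fderiv_right (m := (n : WithTop ℕ∞)) (by norm_cast)).clm_apply contDiff_const

lemma contDiff_partialT {g : ℝ × ℝ → ℝ} {n : ℕ} (hg : ContDiff ℝ (n + 1 : ℕ) g) :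
    ContDiff ℝ n (partialT g) :=
  (hg.fderiv_right (m := (n : WithTop ℕ∞)) (by norm_cast)).clm_apply contDiff_const

lemma hasDerivAt_partialX {g : ℝ × ℝ → ℝ} (hg : Differentiable ℝ g) (x t : ℝ) :
    HasDerivAt (fun ξ => g (ξ, t)) (partialX g (x, t)) x :=
  (hg (x, t)).hasFDerivAt.comp_hasDerivAt x
    ((hasDerivAt_id x).prodMk (hasDerivAt_const x t))

lemma hasDerivAt_partialT {g : ℝ × ℝ → ℝ} (hg : Differentiable ℝ g) (x t : ℝ) :
    HasDerivAt (fun s => g (x, s)) (partialT g (x, t)) t :=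
  (hg (x, t)).hasFDerivAt.comp_hasDerivAt t
    ((hasDerivAt_const t x).prodMk (hasDerivAt_id t))

lemma partialX_partialT {g : ℝ × ℝ → ℝ} (hg : ContDiff ℝ 2 g) (p : ℝ × ℝ) :
    partialX (partialT g) p = partialT (partialX g) p := by
  have hd : DifferentiableAt ℝ (fderiv ℝ g) p :=
    ((hg.fderiv_right (m := 1) (by norm_num)).differentiable (by norm_num)) p
  have hs : IsSymmSndFDerivAt ℝ g p := hg.contDiffAt.isSymmSndFDerivAt (by simp)
  have e : ∀ v w : ℝ × ℝ, fderiv ℝ (fun p => fderiv ℝ g p v) p w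
      = fderiv ℝ (fderiv ℝ g) p w v := by
    intro v w
    rw [fderiv_clm_apply hd (differentiableAt_const v)]
    simp
  unfold partialX partialT
  rw [e, e]
  exact hs _ _

lemma nonneg_of_min_right {f : ℝ → ℝ} {f' x R : ℝ} (h : HasDerivAt f f' x) (hx : x < R)
    (hmin : ∀ z ∈ Icc x R, f x ≤ f z) : 0 ≤ f' := by
  have h1 := (hasDerivWithinAt_iff_tendsto_slope' (s := Ioi x) (by simp)).1 h.hasDerivWithinAt
  refine ge_of_tendsto h1 ?_
  filter_upwards [Ioo_mem_nhdsGT hx] with z hz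
  rw [slope_def_field]
  exact div_nonneg (by linarith [hmin z ⟨hz.1.le, hz.2.le⟩]) (by linarith [hz.1])

lemma nonpos_of_min_left {f : ℝ → ℝ} {f' x R : ℝ} (h : HasDerivAt f f' x) (hx : R < x)
    (hmin : ∀ z ∈ Icc R x, f x ≤ f z) : f' ≤ 0 := by
  have h1 : HasDerivAt (fun z => f (-z)) (-f') (-x) := by
    have h2 : HasDerivAt f f' (-(-x)) := by rwa [neg_neg]
    exact (h2.comp (-x) (hasDerivAt_neg (-x))).congr_deriv (by ring)
  have := nonneg_of_min_right h1 (neg_lt_neg hx) fun z hz => by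
    simpa using hmin (-z) ⟨by linarith [hz.2], by linarith [hz.1]⟩
  linarith

/-! ### The momentum -/

/-- The momentum `u - uₓₓ + 1`. -/
def mass (u : ℝ → ℝ → ℝ) (x t : ℝ) : ℝ := u x t - dx 2 u x t + 1

lemma dx_zero (u : ℝ → ℝ → ℝ) (x t : ℝ) : dx 0 u x t = u x t := by simp [dx]

namespace IsHalfLineSolution

variable {T : ℝ} {u : ℝ → ℝ → ℝ} (hu : IsHalfLineSolution T u)

include hu

lemma contDiff_iterate {a : ℕ} (ha : a ≤ 4) :
    ContDiff ℝ (4 - a : ℕ) (partialX^[a] fun p => u p.1 p.2) := by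
  induction a with
  | zero => exact hu.smooth
  | succ a ih =>
    rw [Function.iterate_succ_apply']
    refine contDiff_partialX ?_
    rw [show 4 - (a + 1) + 1 = 4 - a by omega]
    exact ih (by omega)

lemma dx_eq {a : ℕ} (ha : a ≤ 4) (x t : ℝ) :
    dx a u x t = (partialX^[a] fun p => u p.1 p.2) (x, t) := by
  induction a generalizing x with
  | zero => simp [dx]
  | succ a ih =>
    rw [Function.iterate_succ_apply']
    have h := hasDerivAt_partialX ((hu.contDiff_iterate (a := a) (by omega)).differentiable
      (by norm_cast; omega)) x t
    rw [← h.deriv]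
    unfold dx
    rw [iteratedDeriv_succ]
    congr 1
    ext ξ
    exact ih (by omega) ξ

lemma contDiff_dx {a : ℕ} (ha : a ≤ 4) :
    ContDiff ℝ (4 - a : ℕ) (fun p : ℝ × ℝ => dx a u p.1 p.2) := by
  convert hu.contDiff_iterate ha using 1
  ext p
  exact hu.dx_eq ha p.1 p.2

lemma continuous_dx {a : ℕ} (ha : a ≤ 4) : Continuous (fun p : ℝ × ℝ => dx a u p.1 p.2) :=
  (hu.contDiff_dx ha).continuous

lemma hasDerivAt_dx {a : ℕ} (ha : a ≤ 3) (x t : ℝ) :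
    HasDerivAt (fun ξ => dx a u ξ t) (dx (a + 1) u x t) x := by
  have h := hasDerivAt_partialX ((hu.contDiff_iterate (a := a) (by omega)).differentiable
      (by norm_cast; omega)) x t
  rw [hu.dx_eq (by omega), Function.iterate_succ_apply']
  convert h using 1
  ext ξ
  exact hu.dx_eq (by omega) ξ t

lemma hasDerivAt_u (x t : ℝ) : HasDerivAt (fun ξ => u ξ t) (dx 1 u x t) x := by
  simpa only [dx_zero] using hu.hasDerivAt_dx (a := 0) (by norm_num) x t

lemma continuous_u : Continuous (fun p : ℝ × ℝ => u p.1 p.2) := hu.smooth.continuous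

lemma contDiff_mass : ContDiff ℝ 2 (fun p : ℝ × ℝ => mass u p.1 p.2) :=
  ((hu.smooth.of_le (by norm_num)).sub (hu.contDiff_dx (a := 2) (by norm_num))).add contDiff_const

lemma hasDerivAt_mass (x t : ℝ) :
    HasDerivAt (fun ξ => mass u ξ t) (dx 1 u x t - dx 3 u x t) x :=
  ((hu.hasDerivAt_u x t).sub (hu.hasDerivAt_dx (a := 2) (by norm_num) x t)).add_const 1

lemma hasDerivAt_mass_x (x t : ℝ) :
    HasDerivAt (fun ξ => dx 1 u ξ t - dx 3 u ξ t) (dx 2 u x t - dx 4 u x t) x :=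
  (hu.hasDerivAt_dx (a := 1) (by norm_num) x t).sub (hu.hasDerivAt_dx (a := 3) (by norm_num) x t)

lemma hasDerivAt_mass_t (x t : ℝ) :
    HasDerivAt (fun s => mass u x s) (partialT (fun p => mass u p.1 p.2) (x, t)) t :=
  hasDerivAt_partialT (hu.contDiff_mass.differentiable (by norm_num)) x t

lemma partialX_mass (p : ℝ × ℝ) :
    partialX (fun p => mass u p.1 p.2) p = dx 1 u p.1 p.2 - dx 3 u p.1 p.2 :=
  (hasDerivAt_partialX (hu.contDiff_mass.differentiable (by norm_num)) p.1 p.2).unique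
    (hu.hasDerivAt_mass p.1 p.2)

lemma partialT_mass_of_mem {x t : ℝ} (h : (x, t) ∈ halfLine T) :
    partialT (fun p => mass u p.1 p.2) (x, t)
      = -(u x t * (dx 1 u x t - dx 3 u x t) + 3 * dx 1 u x t * mass u x t) := by
  have h1 := hu.equation x t h
  have d1 : DifferentiableAt ℝ (fun s => u x s) t :=
    (hasDerivAt_partialT (hu.smooth.differentiable (by norm_num)) x t).differentiableAt
  have d2 : DifferentiableAt ℝ (fun s => dx 2 u x s) t :=
    (hasDerivAt_partialT ((hu.contDiff_dx (a := 2) (by norm_num)).differentiable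
      (by norm_num)) x t).differentiableAt
  have h2 : deriv (fun s => mass u x s) t
      = deriv (fun s => u x s) t - deriv (fun s => dx 2 u x s) t :=
    ((d1.hasDerivAt.sub d2.hasDerivAt).add_const 1).deriv
  rw [← (hu.hasDerivAt_mass_t x t).deriv, h2]
  unfold mass
  linear_combination h1

/-- The equation in the form `mₜ + u mₓ + 3 uₓ m = 0`, on the closed strip. -/
lemma partialT_mass (hT : 0 < T) {x t : ℝ} (hx : 0 ≤ x) (ht : t ∈ Icc 0 T) :
    partialT (fun p => mass u p.1 p.2) (x, t)
      = -(u x t * (dx 1 u x t - dx 3 u x t) + 3 * dx 1 u x t * mass u x t) := by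
  have c0 : Continuous fun s : ℝ => (x, s) := by fun_prop
  have c1 : Continuous fun s => partialT (fun p => mass u p.1 p.2) (x, s) :=
    (contDiff_partialT (n := 1) hu.contDiff_mass).continuous.comp c0
  have c2 := hu.continuous_u.comp c0
  have c3 := (hu.continuous_dx (a := 1) (by norm_num)).comp c0
  have c4 := (hu.continuous_dx (a := 3) (by norm_num)).comp c0
  have c5 := hu.contDiff_mass.continuous.comp c0
  have c6 : Continuous fun s =>
      -(u x s * (dx 1 u x s - dx 3 u x s) + 3 * dx 1 u x s * mass u x s) :=
    ((c2.mul (c3.sub c4)).add ((continuous_const.mul c3).mul c5)).neg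
  have hcl : t ∈ closure (Ico 0 T) := by rwa [closure_Ico hT.ne]
  have heq : EqOn (fun s => partialT (fun p => mass u p.1 p.2) (x, s)) (fun s =>
      -(u x s * (dx 1 u x s - dx 3 u x s) + 3 * dx 1 u x s * mass u x s)) (Ico 0 T) :=
    fun s hs => hu.partialT_mass_of_mem ⟨hx, hs.1, hs.2⟩
  exact heq.closure c1 c6 hcl

/-- Differentiate the transport equation of the momentum in x and use the symmetry of second
derivatives. The equation holds only for x ≥ 0, so the comparison is made with derivatives within
that half-line. -/
lemma hasDerivAt_mass_xt (hT : 0 < T) {x t : ℝ} (hx : 0 ≤ x) (ht : t ∈ Icc 0 T) :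
    HasDerivAt (fun s => dx 1 u x s - dx 3 u x s)
      (-(u x t * (dx 2 u x t - dx 4 u x t) + 4 * dx 1 u x t * (dx 1 u x t - dx 3 u x t)
        + 3 * dx 2 u x t * mass u x t)) t := by
  have h1 : ContDiff ℝ 1 (partialX fun p => mass u p.1 p.2) :=
    contDiff_partialX (n := 1) hu.contDiff_mass
  have h2 := hasDerivAt_partialT (h1.differentiable (by norm_num)) x t
  rw [← partialX_partialT hu.contDiff_mass] at h2
  have h3 := hasDerivAt_partialX ((contDiff_partialT (n := 1) hu.contDiff_mass).differentiable
    (by norm_num)) x t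
  have h4 : HasDerivWithinAt
      (fun ξ => -(u ξ t * (dx 1 u ξ t - dx 3 u ξ t) + 3 * dx 1 u ξ t * mass u ξ t))
      (partialX (partialT fun p => mass u p.1 p.2) (x, t)) (Ici 0) x :=
    h3.hasDerivWithinAt.congr (fun ξ hξ => (hu.partialT_mass hT hξ ht).symm)
      (hu.partialT_mass hT hx ht).symm
  have h5 := (((hu.hasDerivAt_u x t).mul (hu.hasDerivAt_mass_x x t)).add
    (((hu.hasDerivAt_dx (a := 1) (by norm_num) x t).const_mul 3).mul
      (hu.hasDerivAt_mass x t))).neg.hasDerivWithinAt (s := Ici 0)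
  have h6 := (uniqueDiffOn_Ici (0 : ℝ) x hx).eq_deriv _ h4 h5
  rw [h6] at h2
  simp only [hu.partialX_mass] at h2
  refine h2.congr_deriv ?_
  ring

/-- A nonnegative decay constant. -/
lemma exists_decay : ∃ C : ℝ, 0 ≤ C ∧ ∀ a : ℕ, a ≤ 4 → ∀ x t : ℝ, 0 ≤ x → t ∈ Icc 0 T →
    |dx a u x t| ≤ C / (1 + x) ^ 2 := by
  obtain ⟨C, hC⟩ := hu.decay
  refine ⟨max C 0, le_max_right _ _, fun a ha x t hx ht => (hC a ha x t hx ht.1 ht.2).trans ?_⟩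
  gcongr
  exact le_max_left _ _

/-- The momentum stays positive. -/
theorem exists_mass_ge (hT : 0 < T) (hu₀ : ∀ x : ℝ, 0 ≤ x → 0 < u x 0 - dx 2 u x 0 + 1)
    (hg₀ : ∀ t : ℝ, 0 ≤ t → t < T → u 0 t ≤ 0) :
    ∃ μ > 0, ∀ x t : ℝ, 0 ≤ x → t ∈ Icc 0 T → μ ≤ mass u x t := by
  obtain ⟨C, hC0, hC⟩ := hu.exists_decay
  have hg : ∀ t ∈ Icc 0 T, u 0 t ≤ 0 := by
    intro t ht
    have hcl : t ∈ closure (Ico 0 T) := by rwa [closure_Ico hT.ne]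
    have hc : Continuous fun s => u 0 s := hu.continuous_u.comp (by fun_prop : Continuous fun s : ℝ => ((0 : ℝ), s))
    exact closure_minimal (fun s hs => hg₀ s hs.1 hs.2) (isClosed_le hc continuous_const) hcl
  have hb : ∀ a ≤ 4, ∀ x t : ℝ, 0 ≤ x → t ∈ Icc 0 T → |dx a u x t| ≤ C := fun a ha x t hx ht =>
    (hC a ha x t hx ht).trans (div_le_self hC0 (one_le_pow₀ (by linarith)))
  set R := 4 * C + 1 with hR
  have hfar : ∀ x t : ℝ, R ≤ x → t ∈ Icc 0 T → 1 / 2 ≤ mass u x t := by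
    intro x t hx ht
    have hx0 : 0 ≤ x := by linarith
    have h1 := hC 0 (by norm_num) x t hx0 ht
    have h2 := hC 2 (by norm_num) x t hx0 ht
    have h3 : C / (1 + x) ^ 2 ≤ 1 / 4 := by
      rw [div_le_iff₀ (by positivity)]
      nlinarith
    rw [dx_zero] at h1
    have := abs_le.1 h1
    have := abs_le.1 h2
    unfold mass
    linarith
  have hmc := hu.contDiff_mass.continuous
  obtain ⟨x₁, hx₁, hmin₁⟩ := (isCompact_Icc (a := (0 : ℝ)) (b := R)).exists_isMinOn
    ⟨0, by constructor <;> linarith⟩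
    (f := fun x => mass u x 0) (hmc.comp (by fun_prop : Continuous fun s : ℝ => (s, (0 : ℝ)))).continuousOn
  set δ := min (mass u x₁ 0) (1 / 2) with hδ
  have hδ0 : 0 < δ := lt_min (hu₀ x₁ hx₁.1) (by norm_num)
  -- Chosen to exceed 3|u_x|. In `w`, one exponential lets the barrier decrease in time, and the
  -- other damps the term 3u_x m.
  set K := 3 * C + 1 with hK
  set w : ℝ × ℝ → ℝ := fun p => (mass u p.1 p.2 - δ * Real.exp (-K * p.2)) * Real.exp (-K * p.2)
    with hw
  have hwc : Continuous w := by
    have : Continuous fun p : ℝ × ℝ => Real.exp (-K * p.2) := by fun_prop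
    exact (hmc.sub (continuous_const.mul this)).mul this
  obtain ⟨⟨x₀, t₀⟩, hp, hmin⟩ := ((isCompact_Icc (a := (0 : ℝ)) (b := R)).prod
    (isCompact_Icc (a := (0 : ℝ)) (b := T))).exists_isMinOn
    ⟨(0, 0), ⟨⟨le_rfl, by linarith⟩, ⟨le_rfl, hT.le⟩⟩⟩ hwc.continuousOn
  have hx₀ : x₀ ∈ Icc 0 R := hp.1
  have ht₀ : t₀ ∈ Icc 0 T := hp.2
  have hexp : ∀ t ∈ Icc (0 : ℝ) T, Real.exp (-K * t) ≤ 1 := by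
    intro t ht
    refine Real.exp_le_one_iff.2 ?_
    have := mul_nonneg (show 0 ≤ K by linarith) ht.1
    linarith
  have hfin : 0 ≤ w (x₀, t₀) := by
    by_contra hneg
    push Not at hneg
    have hn : mass u x₀ t₀ - δ * Real.exp (-K * t₀) < 0 := by
      by_contra h
      push Not at h
      exact absurd (mul_nonneg h (Real.exp_pos _).le) (not_le.2 hneg)
    have hxR : x₀ < R := by
      rcases hx₀.2.lt_or_eq with h | h
      · exact h
      · exfalso
        have h1 := hfar x₀ t₀ h.ge ht₀
        have h2 : δ * Real.exp (-K * t₀) ≤ δ * 1 :=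
          mul_le_mul_of_nonneg_left (hexp t₀ ht₀) hδ0.le
        have h3 : δ ≤ 1 / 2 := min_le_right _ _
        linarith
    have ht0 : 0 < t₀ := by
      rcases ht₀.1.lt_or_eq with h | h
      · exact h
      · exfalso
        rw [← h] at hn
        have h1 : mass u x₁ 0 ≤ mass u x₀ 0 := hmin₁ hx₀
        have h2 : δ ≤ mass u x₁ 0 := min_le_left _ _
        simp only [mul_zero, Real.exp_zero, mul_one] at hn
        linarith
    have dX : HasDerivAt (fun ξ => w (ξ, t₀))
        ((dx 1 u x₀ t₀ - dx 3 u x₀ t₀) * Real.exp (-K * t₀)) x₀ :=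
      ((hu.hasDerivAt_mass x₀ t₀).sub_const (δ * Real.exp (-K * t₀))).mul_const
        (Real.exp (-K * t₀))
    have dE : HasDerivAt (fun s : ℝ => Real.exp (-K * s)) (Real.exp (-K * t₀) * (-K)) t₀ := by
      simpa using ((hasDerivAt_id t₀).const_mul (-K)).exp
    have dT : HasDerivAt (fun s => w (x₀, s)) _ t₀ :=
      ((hu.hasDerivAt_mass_t x₀ t₀).sub (dE.const_mul δ)).mul dE
    have hX : 0 ≤ (dx 1 u x₀ t₀ - dx 3 u x₀ t₀) * Real.exp (-K * t₀) :=
      nonneg_of_min_right dX hxR fun z hz => hmin ⟨⟨hx₀.1.trans hz.1, hz.2⟩, ht₀⟩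
    have hE := Real.exp_pos (-K * t₀)
    have hX' : 0 ≤ dx 1 u x₀ t₀ - dx 3 u x₀ t₀ := nonneg_of_mul_nonneg_left hX hE
    -- At an interior minimum m_x = 0. At x = 0 only m_x ≥ 0 is known, and there the sign of u(0,t)
    -- gives u m_x ≤ 0.
    have hum : u x₀ t₀ * (dx 1 u x₀ t₀ - dx 3 u x₀ t₀) ≤ 0 := by
      rcases hx₀.1.lt_or_eq with h | h
      · have h1 : (dx 1 u x₀ t₀ - dx 3 u x₀ t₀) * Real.exp (-K * t₀) ≤ 0 :=
          nonpos_of_min_left dX h fun z hz => hmin ⟨⟨hz.1, hz.2.trans hx₀.2⟩, ht₀⟩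
        have h2 : dx 1 u x₀ t₀ - dx 3 u x₀ t₀ = 0 := by nlinarith
        rw [h2, mul_zero]
      · rw [← h] at hX' ⊢
        exact mul_nonpos_of_nonpos_of_nonneg (hg t₀ ht₀) hX'
    have hTd := nonpos_of_min_left dT ht0
      fun z hz => hmin ⟨hx₀, ⟨hz.1, hz.2.trans ht₀.2⟩⟩
    rw [hu.partialT_mass hT hx₀.1 ht₀] at hTd
    have hux := abs_le.1 (hb 1 (by norm_num) x₀ t₀ hx₀.1 ht₀)
    set E := Real.exp (-K * t₀)
    have h1 : -(u x₀ t₀ * (dx 1 u x₀ t₀ - dx 3 u x₀ t₀) + 3 * dx 1 u x₀ t₀ * mass u x₀ t₀)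
        - δ * (E * -K) + (mass u x₀ t₀ - δ * E) * -K ≤ 0 := by
      by_contra h
      push Not at h
      have := mul_pos h hE
      simp only [Pi.sub_apply] at hTd
      linarith
    -- The left side of `h1` equals -u m_x plus the two products in `h2` and `h3`, both strictly
    -- positive; this contradicts `h1`.
    have h2 : 0 < (K - 3 * dx 1 u x₀ t₀) * (δ * E) := mul_pos (by linarith) (mul_pos hδ0 hE)
    have h3 : 0 < (K + 3 * dx 1 u x₀ t₀) * -(mass u x₀ t₀ - δ * E) :=
      mul_pos (by linarith) (by linarith)
    linarith
  refine ⟨min (δ * Real.exp (-K * T)) (1 / 2), lt_min (mul_pos hδ0 (Real.exp_pos _)) (by norm_num),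
    fun x t hx ht => ?_⟩
  rcases le_total R x with h | h
  · exact (min_le_right _ _).trans (hfar x t h ht)
  · refine (min_le_left _ _).trans ?_
    have h1 : 0 ≤ w (x, t) := hfin.trans (hmin ⟨⟨hx, h⟩, ht⟩)
    have h2 : 0 ≤ mass u x t - δ * Real.exp (-K * t) := nonneg_of_mul_nonneg_left h1 (Real.exp_pos _)
    have h3 : Real.exp (-K * T) ≤ Real.exp (-K * t) := by
      refine Real.exp_le_exp.2 ?_
      have := mul_le_mul_of_nonneg_left ht.2 (show 0 ≤ K by linarith)
      linarith
    have h4 := mul_le_mul_of_nonneg_left h3 hδ0.le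
    linarith

end IsHalfLineSolution


/-! ### Quantities built from the momentum: evolution, phase and decay -/

/-- The standing assumptions, on the closed strip. -/
structure Regular (T : ℝ) (u : ℝ → ℝ → ℝ) : Prop where
  pos : 0 < T
  sol : IsHalfLineSolution T u
  mass_ge : ∃ μ > 0, ∀ x t : ℝ, 0 ≤ x → t ∈ Icc 0 T → μ ≤ mass u x t
  boundary : ∀ t ∈ Icc 0 T, u 0 t ≤ 0

/-- The quantity `qₓ / q²`. -/
def bq (u : ℝ → ℝ → ℝ) (x t : ℝ) : ℝ := (dx 1 u x t - dx 3 u x t) / (3 * q u x t ^ 4)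

/-- The `x`-derivative of `qₓ / q²`. -/
def bqx (u : ℝ → ℝ → ℝ) (x t : ℝ) : ℝ :=
  (dx 2 u x t - dx 4 u x t) / (3 * q u x t ^ 4) - 4 * bq u x t ^ 2 * q u x t

/-- The function decays like `(1 + x)⁻²` on the strip. -/
def Decays (T : ℝ) (f : ℝ → ℝ → ℝ) : Prop :=
  ∃ C : ℝ, 0 ≤ C ∧ ∀ x t : ℝ, 0 ≤ x → t ∈ Icc 0 T → |f x t| ≤ C / (1 + x) ^ 2

/-- The function is bounded on the strip. -/
def BoundedOnStrip (T : ℝ) (f : ℝ → ℝ → ℝ) : Prop :=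
  ∃ C : ℝ, 0 ≤ C ∧ ∀ x t : ℝ, 0 ≤ x → t ∈ Icc 0 T → |f x t| ≤ C

lemma Decays.bounded {T : ℝ} {f : ℝ → ℝ → ℝ} (hf : Decays T f) : BoundedOnStrip T f := by
  obtain ⟨C, hC, h⟩ := hf
  exact ⟨C, hC, fun x t hx ht =>
    (h x t hx ht).trans (div_le_self hC (one_le_pow₀ (by linarith)))⟩

lemma Decays.add {T : ℝ} {f g : ℝ → ℝ → ℝ} (hf : Decays T f) (hg : Decays T g) :
    Decays T fun x t => f x t + g x t := by
  obtain ⟨C, hC, h⟩ := hf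
  obtain ⟨C', hC', h'⟩ := hg
  refine ⟨C + C', by positivity, fun x t hx ht => (abs_add_le _ _).trans ?_⟩
  rw [add_div]
  exact add_le_add (h x t hx ht) (h' x t hx ht)

lemma BoundedOnStrip.add {T : ℝ} {f g : ℝ → ℝ → ℝ} (hf : BoundedOnStrip T f)
    (hg : BoundedOnStrip T g) : BoundedOnStrip T fun x t => f x t + g x t := by
  obtain ⟨C, hC, h⟩ := hf
  obtain ⟨C', hC', h'⟩ := hg
  exact ⟨C + C', by positivity, fun x t hx ht =>
    (abs_add_le _ _).trans (add_le_add (h x t hx ht) (h' x t hx ht))⟩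

lemma BoundedOnStrip.mul {T : ℝ} {f g : ℝ → ℝ → ℝ} (hf : BoundedOnStrip T f)
    (hg : BoundedOnStrip T g) : BoundedOnStrip T fun x t => f x t * g x t := by
  obtain ⟨C, hC, h⟩ := hf
  obtain ⟨C', hC', h'⟩ := hg
  refine ⟨C * C', by positivity, fun x t hx ht => ?_⟩
  rw [abs_mul]
  exact mul_le_mul (h x t hx ht) (h' x t hx ht) (abs_nonneg _) hC

lemma Decays.mul {T : ℝ} {f g : ℝ → ℝ → ℝ} (hf : BoundedOnStrip T f)
    (hg : Decays T g) : Decays T fun x t => f x t * g x t := by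
  obtain ⟨C, hC, h⟩ := hf
  obtain ⟨C', hC', h'⟩ := hg
  refine ⟨C * C', by positivity, fun x t hx ht => ?_⟩
  rw [abs_mul, mul_div_assoc]
  exact mul_le_mul (h x t hx ht) (h' x t hx ht) (abs_nonneg _) hC

lemma boundedOnStrip_const (T c : ℝ) : BoundedOnStrip T fun _ _ => c :=
  ⟨|c|, abs_nonneg _, fun _ _ _ _ => le_rfl⟩

lemma Decays.congr {T : ℝ} {f g : ℝ → ℝ → ℝ} (hf : Decays T f)
    (h : ∀ x t : ℝ, 0 ≤ x → t ∈ Icc 0 T → g x t = f x t) : Decays T g := by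
  obtain ⟨C, hC, h'⟩ := hf
  exact ⟨C, hC, fun x t hx ht => by rw [h x t hx ht]; exact h' x t hx ht⟩

namespace Regular

variable {T : ℝ} {u : ℝ → ℝ → ℝ} (S : Regular T u)

include S

lemma mass_pos {x t : ℝ} (hx : 0 ≤ x) (ht : t ∈ Icc 0 T) : 0 < mass u x t := by
  obtain ⟨μ, hμ, h⟩ := S.mass_ge
  exact hμ.trans_le (h x t hx ht)

lemma continuous_q : Continuous fun p : ℝ × ℝ => q u p.1 p.2 :=
  S.sol.contDiff_mass.continuous.rpow_const fun _ => Or.inr (by norm_num)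

lemma continuous_q_x (t : ℝ) : Continuous fun ξ => q u ξ t :=
  S.continuous_q.comp (by fun_prop : Continuous fun ξ : ℝ => (ξ, t))

lemma continuous_q_t (x : ℝ) : Continuous fun s => q u x s :=
  S.continuous_q.comp (by fun_prop : Continuous fun s : ℝ => (x, s))

omit S in
lemma q_pos_of_mass {x t : ℝ} (h : 0 < mass u x t) : 0 < q u x t := Real.rpow_pos_of_pos h _

omit S in
lemma q_cube_of_mass {x t : ℝ} (h : 0 < mass u x t) : q u x t ^ 3 = mass u x t := by
  change (mass u x t ^ (1 / 3 : ℝ)) ^ 3 = mass u x t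
  rw [← Real.rpow_natCast, ← Real.rpow_mul h.le]
  norm_num

omit S in
lemma hasDerivAt_rpow_mass {f : ℝ → ℝ} {f' a : ℝ} (hf : HasDerivAt f f' a) (h : 0 < f a) :
    HasDerivAt (fun x => f x ^ (1 / 3 : ℝ)) (f' / (3 * (f a ^ (1 / 3 : ℝ)) ^ 2)) a := by
  refine (hf.rpow_const (Or.inl h.ne')).congr_deriv ?_
  have h1 : (f a ^ (1 / 3 : ℝ)) ^ 2 * f a ^ ((1 / 3 : ℝ) - 1) = 1 := by
    rw [← Real.rpow_natCast, ← Real.rpow_mul h.le, ← Real.rpow_add h]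
    norm_num
  have h2 : f a ^ (1 / 3 : ℝ) ≠ 0 := (Real.rpow_pos_of_pos h _).ne'
  rw [eq_div_iff (by positivity)]
  linear_combination f' * h1

lemma q_pos {x t : ℝ} (hx : 0 ≤ x) (ht : t ∈ Icc 0 T) : 0 < q u x t :=
  q_pos_of_mass (S.mass_pos hx ht)

lemma q_cube {x t : ℝ} (hx : 0 ≤ x) (ht : t ∈ Icc 0 T) : q u x t ^ 3 = mass u x t :=
  q_cube_of_mass (S.mass_pos hx ht)

lemma hasDerivAt_q_of_mass {x t : ℝ} (h : 0 < mass u x t) :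
    HasDerivAt (fun ξ => q u ξ t) (bq u x t * q u x t ^ 2) x := by
  refine (hasDerivAt_rpow_mass (S.sol.hasDerivAt_mass x t) h).congr_deriv ?_
  have h0 : q u x t ≠ 0 := (q_pos_of_mass h).ne'
  change _ / (3 * q u x t ^ 2) = _
  unfold bq
  field_simp

lemma qx_eq {x t : ℝ} (hx : 0 ≤ x) (ht : t ∈ Icc 0 T) : qx u x t = bq u x t * q u x t ^ 2 :=
  (S.hasDerivAt_q_of_mass (S.mass_pos hx ht)).deriv

lemma hasDerivAt_q_x {x t : ℝ} (hx : 0 ≤ x) (ht : t ∈ Icc 0 T) :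
    HasDerivAt (fun ξ => q u ξ t) (bq u x t * q u x t ^ 2) x :=
  S.hasDerivAt_q_of_mass (S.mass_pos hx ht)

/-- The cube root of m satisfies the conservation law q_t + (uq)_x = 0, written here with q_x = b
q². -/
lemma hasDerivAt_q_t {x t : ℝ} (hx : 0 ≤ x) (ht : t ∈ Icc 0 T) :
    HasDerivAt (fun s => q u x s)
      (-(dx 1 u x t * q u x t + u x t * bq u x t * q u x t ^ 2)) t := by
  refine (hasDerivAt_rpow_mass (S.sol.hasDerivAt_mass_t x t) (S.mass_pos hx ht)).congr_deriv ?_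
  have h0 : q u x t ≠ 0 := (S.q_pos hx ht).ne'
  change _ / (3 * q u x t ^ 2) = _
  rw [S.sol.partialT_mass S.pos hx ht, ← S.q_cube hx ht]
  unfold bq
  field_simp
  ring

lemma hasDerivAt_bq_x {x t : ℝ} (hx : 0 ≤ x) (ht : t ∈ Icc 0 T) :
    HasDerivAt (fun ξ => bq u ξ t) (bqx u x t) x := by
  have h0 : q u x t ≠ 0 := (S.q_pos hx ht).ne'
  refine ((S.sol.hasDerivAt_mass_x x t).div (((S.hasDerivAt_q_x hx ht).pow 4).const_mul 3)
    (mul_ne_zero three_ne_zero (pow_ne_zero 4 h0))).congr_deriv ?_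
  unfold bqx bq
  simp only [Pi.pow_apply]
  field_simp
  ring

/-- The quantity b = q_x/q² is transported by u up to a source: b_t + u b_x = -u_xx/q. -/
lemma hasDerivAt_bq_t {x t : ℝ} (hx : 0 ≤ x) (ht : t ∈ Icc 0 T) :
    HasDerivAt (fun s => bq u x s) (-(dx 2 u x t / q u x t) - u x t * bqx u x t) t := by
  have h0 : q u x t ≠ 0 := (S.q_pos hx ht).ne'
  refine ((S.sol.hasDerivAt_mass_xt S.pos hx ht).div (((S.hasDerivAt_q_t hx ht).pow 4).const_mul 3)
    (mul_ne_zero three_ne_zero (pow_ne_zero 4 h0))).congr_deriv ?_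
  rw [← S.q_cube hx ht]
  unfold bqx bq
  simp only [Pi.pow_apply]
  field_simp
  ring

/-! ### The phase -/

lemma hasDerivAt_y_x (x t : ℝ) : HasDerivAt (fun ξ => y u ξ t) (q u x t) x :=
  (intervalIntegral.integral_hasDerivAt_right ((S.continuous_q_x t).intervalIntegrable _ _)
    ((S.continuous_q_x t).stronglyMeasurableAtFilter _ _)
    (S.continuous_q_x t).continuousAt).const_add _

omit S in
lemma y_zero_zero : y u 0 0 = 0 := by simp [y]

/-- The one-form q(dx - u dt) is closed by the conservation law of q, so the path chosen in the
definition of y is immaterial on the strip. -/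
lemma hasDerivAt_y_t {x t : ℝ} (hx : 0 ≤ x) (ht : t ∈ Icc 0 T) :
    HasDerivAt (fun s => y u x s) (-(u x t * q u x t)) t := by
  have cu : Continuous fun s => u 0 s :=
    S.sol.continuous_u.comp (by fun_prop : Continuous fun s : ℝ => ((0 : ℝ), s))
  have c0 := (S.continuous_q_t 0).mul cu
  have h1 : HasDerivAt (fun s => -(∫ r in (0 : ℝ)..s, q u 0 r * u 0 r)) (-(q u 0 t * u 0 t)) t :=
    (intervalIntegral.integral_hasDerivAt_right (c0.intervalIntegrable _ _)
      (c0.stronglyMeasurableAtFilter _ _) c0.continuousAt).neg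
  set F' : ℝ → ℝ → ℝ := fun s ξ =>
    partialT (fun p => mass u p.1 p.2) (ξ, s) / (3 * q u ξ s ^ 2) with hF'
  -- Differentiation under the integral needs times on both sides of t, possibly outside [0,T]. By
  -- compactness the momentum stays positive on [0,x] for all nearby times.
  have hev : ∀ᶠ s in 𝓝 t, ∀ ξ ∈ Icc 0 x, 0 < mass u ξ s := by
    refine isCompact_Icc.eventually_forall_of_forall_eventually fun ξ hξ => ?_
    have hc : Continuous fun z : ℝ × ℝ => mass u z.2 z.1 :=
      S.sol.contDiff_mass.continuous.comp continuous_swap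
    exact hc.continuousAt.eventually (lt_mem_nhds (S.mass_pos hξ.1 ht))
  obtain ⟨ε, hε, hball⟩ := Metric.nhds_basis_closedBall.mem_iff.1 hev
  have hF'c : ContinuousOn (fun z : ℝ × ℝ => F' z.1 z.2) (Metric.closedBall t ε ×ˢ Icc 0 x) := by
    have c1 : Continuous fun z : ℝ × ℝ => partialT (fun p => mass u p.1 p.2) (z.2, z.1) :=
      (contDiff_partialT (n := 1) S.sol.contDiff_mass).continuous.comp continuous_swap
    have c2 : Continuous fun z : ℝ × ℝ => q u z.2 z.1 := S.continuous_q.comp continuous_swap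
    refine c1.continuousOn.div (continuous_const.mul (c2.pow 2)).continuousOn fun z hz => ?_
    have := q_pos_of_mass (hball hz.1 z.2 hz.2)
    positivity
  obtain ⟨B, hB⟩ := ((isCompact_closedBall t ε).prod isCompact_Icc).exists_bound_of_continuousOn
    hF'c
  have h2 := (intervalIntegral.hasDerivAt_integral_of_dominated_loc_of_deriv_le
    (μ := volume) (a := 0) (b := x) (F := fun s ξ => q u ξ s) (F' := F') (x₀ := t)
    (bound := fun _ => B)
    (Metric.closedBall_mem_nhds t hε)
    (Eventually.of_forall fun s => (S.continuous_q_x s).aestronglyMeasurable)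
    ((S.continuous_q_x t).intervalIntegrable _ _) ?_ ?_ intervalIntegrable_const ?_).2
  · have h3 : ∫ ξ in (0 : ℝ)..x, F' t ξ = -(u x t * q u x t) - -(u 0 t * q u 0 t) := by
      have hd : ∀ ξ ∈ uIcc 0 x, HasDerivAt (fun ξ => -(u ξ t * q u ξ t)) (F' t ξ) ξ := by
        intro ξ hξ
        rw [uIcc_of_le hx] at hξ
        have h0 : q u ξ t ≠ 0 := (S.q_pos hξ.1 ht).ne'
        refine ((S.sol.hasDerivAt_u ξ t).mul (S.hasDerivAt_q_x hξ.1 ht)).neg.congr_deriv ?_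
        rw [hF']
        simp only
        rw [S.sol.partialT_mass S.pos hξ.1 ht, ← S.q_cube hξ.1 ht]
        unfold bq
        field_simp
        ring
      refine intervalIntegral.integral_eq_sub_of_hasDerivAt hd ?_
      refine ContinuousOn.intervalIntegrable ?_
      rw [uIcc_of_le hx]
      exact hF'c.comp (f := fun ξ => (t, ξ)) (by fun_prop)
        fun ξ hξ => ⟨Metric.mem_closedBall_self hε.le, hξ⟩
    rw [h3] at h2
    refine (h1.add h2).congr_deriv ?_
    ring
  · refine ContinuousOn.aestronglyMeasurable ?_ measurableSet_uIoc
    rw [uIoc_of_le hx]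
    exact (hF'c.comp (f := fun ξ => (t, ξ)) (by fun_prop)
      fun ξ hξ => ⟨Metric.mem_closedBall_self hε.le, Ioc_subset_Icc_self hξ⟩)
  · refine Eventually.of_forall fun ξ hξ s hs => hB (s, ξ) ⟨hs, ?_⟩
    rw [uIoc_of_le hx] at hξ
    exact Ioc_subset_Icc_self hξ
  · refine Eventually.of_forall fun ξ hξ s hs => ?_
    rw [uIoc_of_le hx] at hξ
    exact hasDerivAt_rpow_mass (S.sol.hasDerivAt_mass_t ξ s) (hball hs ξ (Ioc_subset_Icc_self hξ))

/-! ### Decay -/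

lemma decays_dx {a : ℕ} (ha : a ≤ 4) : Decays T (dx a u) := by
  obtain ⟨C, hC, h⟩ := S.sol.exists_decay
  exact ⟨C, hC, h a ha⟩

lemma decays_u : Decays T u := by
  obtain ⟨C, hC, h⟩ := S.sol.exists_decay
  refine ⟨C, hC, fun x t hx ht => ?_⟩
  have := h 0 (by norm_num) x t hx ht
  rwa [dx_zero] at this

/-- From q³ - 1 = u - u_xx and q³ - 1 = (q - 1)(q² + q + 1), where the second factor is at least 1.
-/
lemma decays_q_sub_one : Decays T fun x t => q u x t - 1 := by
  have h := S.decays_u.add (Decays.mul (boundedOnStrip_const T (-1)) (S.decays_dx (a := 2)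
    (by norm_num)))
  obtain ⟨C, hC, h⟩ := h
  refine ⟨C, hC, fun x t hx ht => le_trans ?_ (h x t hx ht)⟩
  have h1 := S.q_cube hx ht
  have h2 := S.q_pos hx ht
  have h3 : u x t + -1 * dx 2 u x t = (q u x t - 1) * (q u x t ^ 2 + q u x t + 1) := by
    unfold mass at h1
    linear_combination -h1
  beta_reduce
  rw [h3, abs_mul]
  refine le_mul_of_one_le_right (abs_nonneg _) ?_
  rw [abs_of_pos (by positivity)]
  nlinarith [sq_nonneg (q u x t)]

lemma bounded_q : BoundedOnStrip T (q u) := by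
  obtain ⟨C, hC, h⟩ := S.decays_q_sub_one.bounded.add (boundedOnStrip_const T 1)
  exact ⟨C, hC, fun x t hx ht => by simpa using h x t hx ht⟩

lemma bounded_inv_q : BoundedOnStrip T fun x t => (q u x t)⁻¹ := by
  obtain ⟨μ, hμ, h⟩ := S.mass_ge
  refine ⟨(μ ^ (1 / 3 : ℝ))⁻¹, by positivity, fun x t hx ht => ?_⟩
  rw [abs_of_pos (inv_pos.2 (S.q_pos hx ht))]
  have : μ ^ (1 / 3 : ℝ) ≤ q u x t := Real.rpow_le_rpow hμ.le (h x t hx ht) (by norm_num)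
  exact inv_anti₀ (Real.rpow_pos_of_pos hμ _) this

lemma decays_bq : Decays T (bq u) := by
  have h1 := (S.decays_dx (a := 1) (by norm_num)).add (Decays.mul (boundedOnStrip_const T (-1))
    (S.decays_dx (a := 3) (by norm_num)))
  have h2 := S.bounded_inv_q
  refine (Decays.mul ((boundedOnStrip_const T (1 / 3)).mul ((h2.mul h2).mul (h2.mul h2))) h1).congr
    fun x t hx ht => ?_
  have h0 : q u x t ≠ 0 := (S.q_pos hx ht).ne'
  unfold bq
  field_simp
  ring

lemma decays_bqx : Decays T (bqx u) := by
  have h1 := (S.decays_dx (a := 2) (by norm_num)).add (Decays.mul (boundedOnStrip_const T (-1))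
    (S.decays_dx (a := 4) (by norm_num)))
  have h2 := S.bounded_inv_q
  have h3 := Decays.mul ((boundedOnStrip_const T (1 / 3)).mul ((h2.mul h2).mul (h2.mul h2))) h1
  have h4 := Decays.mul (((boundedOnStrip_const T (-4)).mul S.bounded_q).mul S.decays_bq.bounded)
    S.decays_bq
  refine (h3.add h4).congr fun x t hx ht => ?_
  have h0 : q u x t ≠ 0 := (S.q_pos hx ht).ne'
  unfold bqx
  field_simp
  ring

end Regular


/-! ### Parameter dependence of flows -/

section Flow

variable {E : Type*} [NormedAddCommGroup E] [NormedSpace ℝ E] [CompleteSpace E]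

/-- A second coordinate, constant and equal to 1, makes the inhomogeneous equation a homogeneous
linear one on E × ℝ. -/
theorem exists_affine_solution {A : ℝ → E →L[ℝ] E} (hA : Continuous A) {w : ℝ → E}
    (hw : Continuous w) (z : E) :
    ∃ Z : ℝ → E, Z 0 = z ∧ ∀ x, HasDerivAt Z (A x (Z x) + w x) x := by
  set L : ℝ → E × ℝ →L[ℝ] E × ℝ := fun x => (ContinuousLinearMap.inl ℝ E ℝ).comp
    ((A x).comp (ContinuousLinearMap.fst ℝ E ℝ)
      + (ContinuousLinearMap.snd ℝ E ℝ).smulRight (w x)) with hL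
  have hLc : Continuous L := by
    have h1 : Continuous fun x => (A x).comp (ContinuousLinearMap.fst ℝ E ℝ) :=
      hA.clm_comp continuous_const
    have h2 : Continuous fun x => (ContinuousLinearMap.snd ℝ E ℝ).smulRight (w x) :=
      (ContinuousLinearMap.smulRightL ℝ (E × ℝ) E (ContinuousLinearMap.snd ℝ E ℝ)).continuous.comp hw
    exact continuous_const.clm_comp (h1.add h2)
  obtain ⟨f, hf0, hf⟩ := exists_linear_solution hLc (z, 1)
  have hfst : ∀ x, HasDerivAt (fun x => (f x).1) (A x (f x).1 + (f x).2 • w x) x := fun x => by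
    have h := (ContinuousLinearMap.fst ℝ E ℝ).hasFDerivAt.comp_hasDerivAt x (hf x)
    simpa [hL, Function.comp_def] using h
  have hsnd : ∀ x, HasDerivAt (fun x => (f x).2) 0 x := fun x => by
    have h := (ContinuousLinearMap.snd ℝ E ℝ).hasFDerivAt.comp_hasDerivAt x (hf x)
    simpa [hL, Function.comp_def] using h
  have hone : ∀ x, (f x).2 = 1 := by
    intro x
    have := is_const_of_deriv_eq_zero (fun x => (hsnd x).differentiableAt)
      (fun x => (hsnd x).deriv) x 0
    rw [this, hf0]
  refine ⟨fun x => (f x).1, by simp [hf0], fun x => ?_⟩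
  have := hfst x
  rwa [hone, one_smul] at this

end Flow

section ComplexFlow

variable {E : Type*} [NormedAddCommGroup E] [NormedSpace ℂ E]

lemma continuous_restrictScalars {A : ℝ → E →L[ℂ] E} (hA : Continuous A) :
    Continuous fun x => (A x).restrictScalars ℝ :=
  (ContinuousLinearMap.restrictScalarsL ℂ E E ℝ ℝ).continuous.comp hA

variable [CompleteSpace E]

open Classical in
/-- The solution of `f' = A f`, `f 0 = v`. -/
def flow (A : ℝ → E →L[ℂ] E) (v : E) : ℝ → E :=
  if hA : Continuous A then (exists_linear_solution (continuous_restrictScalars hA) v).choose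
  else 0

lemma flow_zero {A : ℝ → E →L[ℂ] E} (hA : Continuous A) (v : E) : flow A v 0 = v := by
  unfold flow
  rw [dif_pos hA]
  exact (exists_linear_solution (continuous_restrictScalars hA) v).choose_spec.1

lemma hasDerivAt_flow {A : ℝ → E →L[ℂ] E} (hA : Continuous A) (v : E) (x : ℝ) :
    HasDerivAt (flow A v) (A x (flow A v x)) x := by
  unfold flow
  rw [dif_pos hA]
  exact (exists_linear_solution (continuous_restrictScalars hA) v).choose_spec.2 x

/-- The flow of `M₀ + s M₁ + s⁻¹ M₂` depends holomorphically on `s`. -/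
theorem differentiableAt_flow {M₀ M₁ M₂ : ℝ → E →L[ℂ] E} (h₀ : Continuous M₀) (h₁ : Continuous M₁)
    (h₂ : Continuous M₂) {v : ℂ → E} {s₀ : ℂ} (hs₀ : s₀ ≠ 0) (hv : DifferentiableAt ℂ v s₀)
    {x : ℝ} (hx : 0 ≤ x) :
    DifferentiableAt ℂ (fun s => flow (fun ξ => M₀ ξ + s • M₁ ξ + s⁻¹ • M₂ ξ) (v s) x) s₀ := by
  have hA : ∀ s : ℂ, Continuous fun ξ => M₀ ξ + s • M₁ ξ + s⁻¹ • M₂ ξ := fun s =>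
    (h₀.add (h₁.const_smul s)).add (h₂.const_smul s⁻¹)
  have hA' : Continuous fun ξ => M₁ ξ - (s₀ ^ 2)⁻¹ • M₂ ξ := h₁.sub (h₂.const_smul ((s₀ ^ 2)⁻¹))
  have hψc : Continuous (flow (fun ξ => M₀ ξ + s₀ • M₁ ξ + s₀⁻¹ • M₂ ξ) (v s₀)) :=
    continuous_iff_continuousAt.2 fun ξ => (hasDerivAt_flow (hA s₀) _ ξ).continuousAt
  -- The candidate for the derivative solves the variational equation.
  obtain ⟨Z, hZ0, hZ⟩ := exists_affine_solution (continuous_restrictScalars (hA s₀))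
    (hA'.clm_apply hψc) (deriv v s₀)
  refine (hasDerivAt_of_linear_family (𝕜 := ℂ) (Z := Z)
    (A := fun s ξ => M₀ ξ + s • M₁ ξ + s⁻¹ • M₂ ξ) (A' := fun ξ => M₁ ξ - (s₀ ^ 2)⁻¹ • M₂ ξ)
    (ψ := fun s => flow (fun ξ => M₀ ξ + s • M₁ ξ + s⁻¹ • M₂ ξ) (v s)) hx
    (hA s₀).continuousOn hA'.continuousOn (fun s ξ _ => hasDerivAt_flow (hA s) _ ξ)
    (fun ξ _ => hZ ξ) ?_ ?_).differentiableAt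
  · simp only [flow_zero (hA _)]
    rw [hZ0]
    exact hv.hasDerivAt
  · intro ε hε
    obtain ⟨B, hB⟩ := (isCompact_Icc (a := (0 : ℝ)) (b := x)).exists_bound_of_continuousOn
      h₂.continuousOn
    have hB0 : 0 ≤ B := (norm_nonneg _).trans (hB 0 ⟨le_rfl, hx⟩)
    have h := (Asymptotics.isLittleO_iff.1 (hasDerivAt_iff_isLittleO.1 (hasDerivAt_inv hs₀)))
      (show 0 < ε / (B + 1) by positivity)
    filter_upwards [h] with s hs ξ hξ
    -- The coefficient is affine in s apart from s⁻¹, so the Taylor remainder of s⁻¹ is the only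
    -- one.
    have e : M₀ ξ + s • M₁ ξ + s⁻¹ • M₂ ξ - (M₀ ξ + s₀ • M₁ ξ + s₀⁻¹ • M₂ ξ)
        - (s - s₀) • (M₁ ξ - (s₀ ^ 2)⁻¹ • M₂ ξ)
        = (s⁻¹ - s₀⁻¹ - (s - s₀) • -(s₀ ^ 2)⁻¹) • M₂ ξ := by
      rw [smul_eq_mul]
      module
    rw [e, norm_smul]
    calc _ ≤ ε / (B + 1) * ‖s - s₀‖ * B := mul_le_mul hs (hB ξ hξ) (norm_nonneg _) (by positivity)
      _ ≤ ε / (B + 1) * ‖s - s₀‖ * (B + 1) :=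
          mul_le_mul_of_nonneg_left (by linarith) (by positivity)
      _ = ε * ‖s - s₀‖ := by field_simp

end ComplexFlow

/-! ### The polynomial form of the Lax pair -/

/-- The action of a matrix on vectors, as a continuous linear map. -/
def mulCLM (M : Matrix (Fin 3) (Fin 3) ℂ) : (Fin 3 → ℂ) →L[ℂ] (Fin 3 → ℂ) :=
  LinearMap.toContinuousLinearMap M.mulVecLin

@[simp] lemma mulCLM_apply (M : Matrix (Fin 3) (Fin 3) ℂ) (v : Fin 3 → ℂ) :
    mulCLM M v = M.mulVec v := rfl

lemma continuous_mulCLM {X : Type*} [TopologicalSpace X] {M : X → Matrix (Fin 3) (Fin 3) ℂ}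
    (hM : ∀ i j, Continuous fun x => M x i j) : Continuous fun x => mulCLM (M x) := by
  have h : Continuous (((LinearMap.toContinuousLinearMap (𝕜 := ℂ) (E := Fin 3 → ℂ)
      (F' := Fin 3 → ℂ)).toLinearMap.comp (Matrix.toLin' (R := ℂ) (m := Fin 3)
      (n := Fin 3)).toLinearMap)) := LinearMap.continuous_of_finiteDimensional _
  exact h.comp (continuous_matrix hM)

/-- The part of the `x`-matrix independent of `λ`. -/
def laxA₀ : Matrix (Fin 3) (Fin 3) ℂ := !![0, 1, 0; 0, 0, 1; 0, 1, 0]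

/-- The coefficient of `λ m` in the `x`-matrix. -/
def laxA₁ : Matrix (Fin 3) (Fin 3) ℂ := !![0, 0, 0; 0, 0, 0; 1, 0, 0]

/-- The coefficient of `λ⁻¹` in the `t`-matrix. -/
def laxB₂ : Matrix (Fin 3) (Fin 3) ℂ := !![-2 / 3, 0, 1; 0, 1 / 3, 0; 0, 0, 1 / 3]

/-- The coefficient of `λ⁰` in the `t`-matrix. -/
def laxB₀ (u : ℝ → ℝ → ℝ) (x t : ℝ) : Matrix (Fin 3) (Fin 3) ℂ :=
  !![(dx 1 u x t : ℂ), -(u x t : ℂ), 0; (u x t : ℂ) + 1, 0, -(u x t : ℂ);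
    (dx 1 u x t : ℂ), 1, -(dx 1 u x t : ℂ)]

/-- The `x`-matrix. -/
def laxA (u : ℝ → ℝ → ℝ) (t : ℝ) (lm : ℂ) (x : ℝ) : (Fin 3 → ℂ) →L[ℂ] (Fin 3 → ℂ) :=
  mulCLM laxA₀ + lm • ((mass u x t : ℂ) • mulCLM laxA₁) + lm⁻¹ • (0 : (Fin 3 → ℂ) →L[ℂ] (Fin 3 → ℂ))

/-- The `t`-matrix. -/
def laxB (u : ℝ → ℝ → ℝ) (x : ℝ) (lm : ℂ) (t : ℝ) : (Fin 3 → ℂ) →L[ℂ] (Fin 3 → ℂ) :=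
  mulCLM (laxB₀ u x t) + lm • (-(u x t * mass u x t : ℂ) • mulCLM laxA₁) + lm⁻¹ • mulCLM laxB₂

lemma laxA_apply (u : ℝ → ℝ → ℝ) (t : ℝ) (lm : ℂ) (x : ℝ) (v : Fin 3 → ℂ) :
    laxA u t lm x v = ![v 1, v 2, lm * mass u x t * v 0 + v 1] := by
  ext i
  fin_cases i <;>
    (simp [laxA, laxA₀, laxA₁, dotProduct, Fin.sum_univ_three]; try ring)

lemma laxB_apply (u : ℝ → ℝ → ℝ) (x : ℝ) (lm : ℂ) (t : ℝ) (v : Fin 3 → ℂ) :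
    laxB u x lm t v = ![(dx 1 u x t - 2 / 3 * lm⁻¹) * v 0 - u x t * v 1 + lm⁻¹ * v 2,
      (u x t + 1) * v 0 + lm⁻¹ / 3 * v 1 - u x t * v 2,
      (dx 1 u x t - lm * (u x t * mass u x t)) * v 0 + v 1 + (lm⁻¹ / 3 - dx 1 u x t) * v 2] := by
  ext i
  fin_cases i <;>
    simp [laxB, laxB₀, laxA₁, laxB₂, dotProduct, Fin.sum_univ_three] <;> ring

namespace Regular

variable {T : ℝ} {u : ℝ → ℝ → ℝ} (S : Regular T u)

include S

lemma continuous_mass_x (t : ℝ) : Continuous fun x => mass u x t :=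
  S.sol.contDiff_mass.continuous.comp (by fun_prop : Continuous fun x : ℝ => (x, t))

lemma continuous_mass_t (x : ℝ) : Continuous fun t => mass u x t :=
  S.sol.contDiff_mass.continuous.comp (by fun_prop : Continuous fun s : ℝ => (x, s))

lemma continuous_u_t (x : ℝ) : Continuous fun t => u x t :=
  S.sol.continuous_u.comp (by fun_prop : Continuous fun s : ℝ => (x, s))

lemma continuous_dx_t {a : ℕ} (ha : a ≤ 4) (x : ℝ) : Continuous fun t => dx a u x t :=
  (S.sol.continuous_dx ha).comp (by fun_prop : Continuous fun s : ℝ => (x, s))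

lemma continuous_lax_mass (t : ℝ) : Continuous fun x => (mass u x t : ℂ) • mulCLM laxA₁ :=
  (Complex.continuous_ofReal.comp (S.continuous_mass_x t)).smul continuous_const

lemma continuous_laxA (t : ℝ) (lm : ℂ) : Continuous (laxA u t lm) :=
  (continuous_const.add ((S.continuous_lax_mass t).const_smul lm)).add continuous_const

lemma continuous_laxB₀ (x : ℝ) : Continuous fun t => mulCLM (laxB₀ u x t) := by
  have h1 := Complex.continuous_ofReal.comp (S.continuous_u_t x)
  have h2 := Complex.continuous_ofReal.comp (S.continuous_dx_t (a := 1) (by norm_num) x)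
  refine continuous_mulCLM fun i j => ?_
  fin_cases i <;> fin_cases j <;> simp [laxB₀]
  all_goals first
    | exact continuous_const
    | exact h2
    | exact h1.neg
    | exact h1.add continuous_const
    | exact h2.neg

lemma continuous_laxB₁ (x : ℝ) :
    Continuous fun t => (-(u x t * mass u x t : ℂ)) • mulCLM laxA₁ :=
  ((Complex.continuous_ofReal.comp (S.continuous_u_t x)).mul
    (Complex.continuous_ofReal.comp (S.continuous_mass_t x))).neg.smul continuous_const

lemma continuous_laxB (x : ℝ) (lm : ℂ) : Continuous (laxB u x lm) :=
  ((S.continuous_laxB₀ x).add ((S.continuous_laxB₁ x).const_smul lm)).add continuous_const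

omit S in
/-- The solution of the Lax pair in polynomial form with value `v` at the origin. -/
def _root_.DegasperisProcesi.laxSol (u : ℝ → ℝ → ℝ) (lm : ℂ) (v : Fin 3 → ℂ) (x t : ℝ) :
    Fin 3 → ℂ :=
  flow (laxA u t lm) (flow (laxB u 0 lm) v t) x

lemma laxSol_zero_left (lm : ℂ) (v : Fin 3 → ℂ) (t : ℝ) :
    laxSol u lm v 0 t = flow (laxB u 0 lm) v t :=
  flow_zero (S.continuous_laxA t lm) _

lemma laxSol_zero (lm : ℂ) (v : Fin 3 → ℂ) : laxSol u lm v 0 0 = v := by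
  rw [S.laxSol_zero_left, flow_zero (S.continuous_laxB 0 lm)]

lemma hasDerivAt_laxSol_x (lm : ℂ) (v : Fin 3 → ℂ) (x t : ℝ) :
    HasDerivAt (fun ξ => laxSol u lm v ξ t) (laxA u t lm x (laxSol u lm v x t)) x :=
  hasDerivAt_flow (S.continuous_laxA t lm) _ x

/-- The two flows are composed, in t along x = 0 and then in x; both generators have the form M₀ +
λM₁ + λ⁻¹M₂, which is why the x-matrix carries a zero λ⁻¹ term. -/
lemma differentiableAt_laxSol {lm : ℂ} (hlm : lm ≠ 0) (v : Fin 3 → ℂ) {x t : ℝ} (hx : 0 ≤ x)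
    (ht : 0 ≤ t) : DifferentiableAt ℂ (fun lm => laxSol u lm v x t) lm :=
  differentiableAt_flow continuous_const (S.continuous_lax_mass t) continuous_const hlm
    (differentiableAt_flow (S.continuous_laxB₀ 0) (S.continuous_laxB₁ 0) continuous_const hlm
      (differentiableAt_const v) ht) hx

/-- The mean value inequality applied to the momentum minus its linear part; compactness of [0,X]
makes the modulus of continuity of m_t uniform in ξ. -/
lemma uniform_remainder_mass (t X : ℝ) : ∀ ε > 0, ∀ᶠ s in 𝓝 t, ∀ ξ ∈ Icc 0 X,
    |mass u ξ s - mass u ξ t - (s - t) * partialT (fun p => mass u p.1 p.2) (ξ, t)|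
      ≤ ε * |s - t| := by
  intro ε hε
  have c1 : Continuous fun z : ℝ × ℝ => partialT (fun p => mass u p.1 p.2) (z.2, z.1)
      - partialT (fun p => mass u p.1 p.2) (z.2, t) := by
    have h := (contDiff_partialT (n := 1) S.sol.contDiff_mass).continuous
    exact (h.comp continuous_swap).sub
      (h.comp (by fun_prop : Continuous fun z : ℝ × ℝ => (z.2, t)))
  have h1 : ∀ᶠ s in 𝓝 t, ∀ ξ ∈ Icc 0 X, |partialT (fun p => mass u p.1 p.2) (ξ, s)
      - partialT (fun p => mass u p.1 p.2) (ξ, t)| < ε := by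
    refine isCompact_Icc.eventually_forall_of_forall_eventually
      (P := fun s ξ => |partialT (fun p => mass u p.1 p.2) (ξ, s)
      - partialT (fun p => mass u p.1 p.2) (ξ, t)| < ε) fun ξ hξ => ?_
    refine (continuous_abs.comp c1).continuousAt.eventually (gt_mem_nhds ?_)
    simpa using hε
  obtain ⟨r, hr, hball⟩ := Metric.nhds_basis_ball.mem_iff.1 h1
  filter_upwards [Metric.ball_mem_nhds t hr] with s hs ξ hξ
  have key := (convex_ball t r).norm_image_sub_le_of_norm_hasDerivWithin_le
    (f := fun s => mass u ξ s - s * partialT (fun p => mass u p.1 p.2) (ξ, t)) (C := ε)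
    (f' := fun s => partialT (fun p => mass u p.1 p.2) (ξ, s)
      - 1 * partialT (fun p => mass u p.1 p.2) (ξ, t))
    (fun s _ => ((S.sol.hasDerivAt_mass_t ξ s).sub
      ((hasDerivAt_id s).mul_const _)).hasDerivWithinAt)
    (fun s hs => by rw [one_mul]; exact (hball hs ξ hξ).le) (Metric.mem_ball_self hr) hs
  simp only [Real.norm_eq_abs] at key
  convert key using 2
  ring

/-- Compatibility of the two equations. -/
lemma hasDerivAt_laxSol_t {lm : ℂ} (hlm : lm ≠ 0) (v : Fin 3 → ℂ) {x t : ℝ} (hx : 0 ≤ x)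
    (ht : t ∈ Icc 0 T) :
    HasDerivAt (fun s => laxSol u lm v x s) (laxB u x lm t (laxSol u lm v x t)) t := by
  -- The family of x-equations is parametrized by the time. The candidate for the t-derivative is
  -- Bψ: it has the right value at x = 0 by construction, and it remains to check that it solves the
  -- variational equation in x.
  refine hasDerivAt_of_linear_family (𝕜 := ℝ) (ψ := fun s ξ => laxSol u lm v ξ s)
    (Z := fun ξ => laxB u ξ lm t (laxSol u lm v ξ t))
    (A := fun s ξ => (laxA u s lm ξ).restrictScalars ℝ)
    (A' := fun ξ => (lm • ((partialT (fun p => mass u p.1 p.2) (ξ, t) : ℂ)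
      • mulCLM laxA₁)).restrictScalars ℝ) hx
    (continuous_restrictScalars (S.continuous_laxA t lm)).continuousOn ?_
    (fun s ξ _ => S.hasDerivAt_laxSol_x lm v ξ s) ?_ ?_ ?_
  · refine (continuous_restrictScalars ?_).continuousOn
    have h : Continuous fun ξ => partialT (fun p => mass u p.1 p.2) (ξ, t) :=
      (contDiff_partialT (n := 1) S.sol.contDiff_mass).continuous.comp
        (by fun_prop : Continuous fun ξ : ℝ => (ξ, t))
    exact ((Complex.continuous_ofReal.comp h).smul continuous_const).const_smul lm
  -- The zero-curvature identity (Bψ)_x = A(Bψ) + A_t ψ. The momentum equation supplies m_t.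
  · intro ξ hξ
    have hψ := S.hasDerivAt_laxSol_x lm v ξ t
    rw [laxA_apply] at hψ
    set ψ := laxSol u lm v
    have h0 : HasDerivAt (fun ξ => ψ ξ t 0) (ψ ξ t 1) ξ := (hasDerivAt_pi.1 hψ 0)
    have h1 : HasDerivAt (fun ξ => ψ ξ t 1) (ψ ξ t 2) ξ := (hasDerivAt_pi.1 hψ 1)
    have h2 : HasDerivAt (fun ξ => ψ ξ t 2) (lm * mass u ξ t * ψ ξ t 0 + ψ ξ t 1) ξ :=
      (hasDerivAt_pi.1 hψ 2)
    have hu := (S.sol.hasDerivAt_u ξ t).ofReal_comp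
    have hux := (S.sol.hasDerivAt_dx (a := 1) (by norm_num) ξ t).ofReal_comp
    have hm := (S.sol.hasDerivAt_mass ξ t).ofReal_comp
    have hmt := S.sol.partialT_mass S.pos hξ.1 ht
    have hmd : (mass u ξ t : ℂ) = u ξ t - dx 2 u ξ t + 1 := by simp [mass]
    simp only [laxB_apply]
    rw [hasDerivAt_pi]
    intro i
    fin_cases i
    · refine ((((hux.sub_const (2 / 3 * lm⁻¹)).mul h0).sub (hu.mul h1)).add
        (h2.const_mul lm⁻¹)).congr_deriv ?_
      simp [laxA_apply, laxA₁, dotProduct, Fin.sum_univ_three]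
      field_simp
      rw [hmd]
      ring
    · refine ((((hu.add_const 1).mul h0).add (h1.const_mul (lm⁻¹ / 3))).sub
        (hu.mul h2)).congr_deriv ?_
      simp [laxA_apply, laxA₁, dotProduct, Fin.sum_univ_three]
      field_simp
      ring
    · refine ((((hux.sub ((hu.mul hm).const_mul lm)).mul h0).add h1).add
        ((hux.const_sub (lm⁻¹ / 3)).mul h2)).congr_deriv ?_
      simp [laxA_apply, laxA₁, dotProduct, Fin.sum_univ_three, hmt]
      field_simp
      rw [hmd]
      ring
  · simp only [S.laxSol_zero_left]
    exact hasDerivAt_flow (S.continuous_laxB 0 lm) v t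
  · intro ε hε
    set B := ‖lm‖ * ‖mulCLM laxA₁‖
    have hB : 0 ≤ B := by positivity
    filter_upwards [S.uniform_remainder_mass t x (ε / (B + 1)) (by positivity)] with s hs ξ hξ
    have e : (laxA u s lm ξ).restrictScalars ℝ - (laxA u t lm ξ).restrictScalars ℝ
        - (s - t) • (lm • ((partialT (fun p => mass u p.1 p.2) (ξ, t) : ℂ)
          • mulCLM laxA₁)).restrictScalars ℝ
        = (lm • (((mass u ξ s - mass u ξ t - (s - t)
          * partialT (fun p => mass u p.1 p.2) (ξ, t) : ℝ) : ℂ) • mulCLM laxA₁)).restrictScalars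
            ℝ := by
      ext w i
      simp [laxA]
      ring
    rw [e, ContinuousLinearMap.norm_restrictScalars, norm_smul, norm_smul, Complex.norm_real,
      Real.norm_eq_abs, Real.norm_eq_abs]
    calc ‖lm‖ * (|mass u ξ s - mass u ξ t - (s - t)
          * partialT (fun p => mass u p.1 p.2) (ξ, t)| * ‖mulCLM laxA₁‖)
        = |mass u ξ s - mass u ξ t - (s - t)
          * partialT (fun p => mass u p.1 p.2) (ξ, t)| * B := by ring
      _ ≤ ε / (B + 1) * |s - t| * B := mul_le_mul_of_nonneg_right (hs ξ hξ) hB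
      _ ≤ ε / (B + 1) * |s - t| * (B + 1) :=
          mul_le_mul_of_nonneg_left (by linarith) (by positivity)
      _ = ε * |s - t| := by field_simp

end Regular


/-! ### The spectral quantities -/

lemma om_isPrimitiveRoot : IsPrimitiveRoot om 3 := by
  have := Complex.isPrimitiveRoot_exp 3 (by norm_num)
  simpa [om] using this

lemma om_cube : om ^ 3 = 1 := om_isPrimitiveRoot.pow_eq_one

lemma om_sum : om ^ 2 + om + 1 = 0 := by
  have h := om_isPrimitiveRoot.geom_sum_eq_zero (by norm_num)
  simp [Finset.sum_range_succ] at h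
  linear_combination h

lemma om_ne_zero : om ≠ 0 := Complex.exp_ne_zero _

lemma norm_om : ‖om‖ = 1 := om_isPrimitiveRoot.norm'_eq_one (by norm_num)

/-- The rotated spectral parameter `ω^{j+1} k`. -/
def rot (k : ℂ) (j : Fin 3) : ℂ := om ^ (j.val + 1) * k

lemma rot_ne_zero {k : ℂ} (hk : k ≠ 0) (j : Fin 3) : rot k j ≠ 0 :=
  mul_ne_zero (pow_ne_zero _ om_ne_zero) hk

lemma norm_rot (k : ℂ) (j : Fin 3) : ‖rot k j‖ = ‖k‖ := by
  simp [rot, norm_om]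

lemma rot_cube (k : ℂ) (j : Fin 3) : rot k j ^ 3 = k ^ 3 := by
  rw [rot, mul_pow, ← pow_mul, mul_comm (j.val + 1) 3, pow_mul, om_cube, one_pow, one_mul]

lemma sqrt_three_sq : (Real.sqrt 3 : ℂ) ^ 2 = 3 := by
  rw [← Complex.ofReal_pow, Real.sq_sqrt (by norm_num)]
  norm_num

lemma sqrt_three_ne_zero : (Real.sqrt 3 : ℂ) ≠ 0 := by
  intro h
  have := sqrt_three_sq
  rw [h] at this
  norm_num at this

lemma l_eq (k : ℂ) (j : Fin 3) : l k j = 1 / (Real.sqrt 3 : ℂ) * (rot k j + 1 / rot k j) := rfl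

lemma three_mul_l_sq {k : ℂ} (hk : k ≠ 0) (j : Fin 3) :
    3 * l k j ^ 2 = rot k j ^ 2 + 2 + 1 / rot k j ^ 2 := by
  have h := rot_ne_zero hk j
  have hs := sqrt_three_ne_zero
  rw [l_eq]
  field_simp
  rw [sqrt_three_sq]
  ring

/-- The characteristic equation l³ = l + λ of the x-equation with m = 1; k uniformizes this cubic.
-/
lemma l_cube {k : ℂ} (hk : k ≠ 0) (j : Fin 3) : l k j ^ 3 = l k j + lam k := by
  have h := rot_ne_zero hk j
  have hs := sqrt_three_ne_zero
  have hlam : lam k = 1 / (3 * (Real.sqrt 3 : ℂ)) * (rot k j ^ 3 + 1 / rot k j ^ 3) := by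
    rw [rot_cube, lam]
  rw [hlam, l_eq]
  field_simp
  rw [sqrt_three_sq]
  ring

/-- The same quadratic expression in l gives all three z_j. Hence the constant t-matrix is a
polynomial in the constant x-matrix and is diagonalized by the same P. -/
lemma z_eq {k : ℂ} (hk : k ≠ 0) (j : Fin 3) : z k j = (l k j ^ 2 - 2 / 3) / lam k := by
  have h1 := three_mul_l_sq hk j
  have hs := sqrt_three_ne_zero
  have h2 : l k j ^ 2 - 2 / 3 = (rot k j ^ 2 + 1 / rot k j ^ 2) / 3 := by
    linear_combination h1 / 3
  rw [h2]
  unfold z lam rot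
  rw [one_div_mul_eq_div, div_div_div_eq, mul_comm 3 (k ^ 3 + 1 / k ^ 3)]
  have : ((om ^ (j.val + 1) * k) ^ 2 + 1 / (om ^ (j.val + 1) * k) ^ 2) * (3 * (Real.sqrt 3 : ℂ))
      / ((k ^ 3 + 1 / k ^ 3) * 3) = ((om ^ (j.val + 1) * k) ^ 2 + 1 / (om ^ (j.val + 1) * k) ^ 2)
      * (Real.sqrt 3 : ℂ) / (k ^ 3 + 1 / k ^ 3) := by
    rw [mul_left_comm, mul_comm (k ^ 3 + 1 / k ^ 3) 3, mul_div_mul_left _ _ three_ne_zero]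
  rw [this]
  ring

lemma l_form {k : ℂ} (hk : k ≠ 0) (j : Fin 3) :
    l k j = om ^ (j.val + 1) * (k / (Real.sqrt 3 : ℂ))
      + om ^ (2 * (j.val + 1)) * (1 / ((Real.sqrt 3 : ℂ) * k)) := by
  have hs := sqrt_three_ne_zero
  have ho := om_ne_zero
  have h1 : om ^ (2 * (j.val + 1)) * om ^ (j.val + 1) = 1 := by
    rw [← pow_add, show 2 * (j.val + 1) + (j.val + 1) = 3 * (j.val + 1) by ring, pow_mul, om_cube,
      one_pow]
  have h2 : om ^ (2 * (j.val + 1)) = 1 / om ^ (j.val + 1) := by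
    field_simp
    exact h1
  rw [h2, l_eq, rot]
  field_simp

/-- For distinct roots this is the divided difference of l³ - l = λ. The computation with ω also
covers coinciding roots with different indices. -/
lemma l_quadratic {k : ℂ} (hk : k ≠ 0) {i j : Fin 3} (hij : i ≠ j) :
    l k i ^ 2 + l k i * l k j + l k j ^ 2 = 1 := by
  have hs := sqrt_three_ne_zero
  have hac : (k / (Real.sqrt 3 : ℂ)) * (1 / ((Real.sqrt 3 : ℂ) * k)) = 1 / 3 := by
    field_simp
    rw [sqrt_three_sq]
  have h3 := om_cube
  have h2 := om_sum
  rw [l_form hk, l_form hk]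
  generalize k / (Real.sqrt 3 : ℂ) = a at *
  generalize 1 / ((Real.sqrt 3 : ℂ) * k) = c at *
  have h4 : om ^ 4 = om := by linear_combination om * h3
  have h6 : om ^ 6 = 1 := by linear_combination (om ^ 3 + 1) * h3
  have e2 : om ^ 2 = -1 - om := by linear_combination h2
  fin_cases i <;> fin_cases j <;>
    first
    | exact absurd rfl hij
    | (simp only [zero_add, mul_one, Nat.reduceAdd, Nat.reduceMul, pow_one, h3, h4, h6, one_mul, e2]
       ring_nf
       simp only [e2]
       linear_combination 3 * hac)

/-- The parameters at which the construction is regular. -/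
def Good (k : ℂ) : Prop := k ≠ 0 ∧ k ^ 6 ≠ 1 ∧ k ^ 6 ≠ -1

/-- The derivative `3 l² - 1` of the characteristic polynomial at its roots. -/
def charDeriv (k : ℂ) (j : Fin 3) : ℂ := 3 * l k j ^ 2 - 1

lemma charDeriv_eq {k : ℂ} (hk : k ≠ 0) (j : Fin 3) :
    charDeriv k j = rot k j ^ 2 + 1 + 1 / rot k j ^ 2 := by
  rw [charDeriv, three_mul_l_sq hk]
  ring

lemma rot_six (k : ℂ) (j : Fin 3) : rot k j ^ 6 = k ^ 6 := by
  rw [show rot k j ^ 6 = (rot k j ^ 3) ^ 2 by ring, rot_cube]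
  ring

/-- With w = ω^{j+1}k this is (w⁴ + w² + 1)(w² - 1) = w⁶ - 1, so away from k = 0 the derivative can
vanish only where k⁶ = 1. -/
lemma charDeriv_mul {k : ℂ} (hk : k ≠ 0) (j : Fin 3) :
    charDeriv k j * (rot k j ^ 2 * (rot k j ^ 2 - 1)) = k ^ 6 - 1 := by
  have h := rot_ne_zero hk j
  rw [charDeriv_eq hk, ← rot_six k j]
  field_simp
  ring

lemma Good.charDeriv_ne_zero {k : ℂ} (hk : Good k) (j : Fin 3) : charDeriv k j ≠ 0 := by
  intro h
  have := charDeriv_mul hk.1 j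
  rw [h, zero_mul] at this
  exact hk.2.1 (by linear_combination -this)

lemma lam_mul {k : ℂ} (hk : k ≠ 0) : lam k * (3 * (Real.sqrt 3 : ℂ) * k ^ 3) = k ^ 6 + 1 := by
  have hs := sqrt_three_ne_zero
  unfold lam
  field_simp

lemma Good.lam_ne_zero {k : ℂ} (hk : Good k) : lam k ≠ 0 := by
  intro h
  have := lam_mul hk.1
  rw [h, zero_mul] at this
  exact hk.2.2 (by linear_combination -this)

lemma charDeriv_factor {k : ℂ} (hk : k ≠ 0) {i j r : Fin 3} (hij : i ≠ j) (hir : i ≠ r)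
    (hjr : j ≠ r) : charDeriv k i = (l k i - l k j) * (l k i - l k r) := by
  by_cases h : l k j = l k r
  · have h1 := l_quadratic hk hij
    have h2 := l_quadratic hk hjr
    rw [← h] at h2 ⊢
    unfold charDeriv
    have h3 : (l k i - l k j) * (l k i + 2 * l k j) = 0 := by linear_combination h1 - h2
    rcases mul_eq_zero.1 h3 with h4 | h4
    · have h5 : l k i = l k j := by linear_combination h4
      rw [h5]
      linear_combination h2
    · have h5 : l k i = -2 * l k j := by linear_combination h4
      rw [h5]
      linear_combination h2
  · have h1 := l_quadratic hk hij
    have h2 := l_quadratic hk hir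
    have h3 : (l k j - l k r) * (l k i + l k j + l k r) = 0 := by linear_combination h1 - h2
    have h4 : l k i + l k j + l k r = 0 := by
      rcases mul_eq_zero.1 h3 with h4 | h4
      · exact absurd (by linear_combination h4) h
      · exact h4
    unfold charDeriv
    linear_combination h1 + (l k i - l k j) * h4

/-- The inverse of the matrix `P`. -/
def Pinv (k : ℂ) : Matrix (Fin 3) (Fin 3) ℂ :=
  Matrix.of fun j i => ![l k j ^ 2 - 1, l k j, 1] i / charDeriv k j

/-- The inverse of a Vandermonde matrix is made of Lagrange interpolation coefficients: (X³ - X -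
λ)/(X - l) = X² + lX + (l² - 1), normalized by its value 3l² - 1 at l. -/
lemma Good.Pinv_mul {k : ℂ} (hk : Good k) : Pinv k * P k = 1 := by
  ext i j
  have h := hk.charDeriv_ne_zero i
  rw [Matrix.mul_apply, Fin.sum_univ_three]
  simp only [Pinv, P, Matrix.of_apply, Matrix.cons_val_zero, Matrix.cons_val_one,
    Matrix.cons_val]
  by_cases hij : i = j
  · subst hij
    rw [Matrix.one_apply_eq]
    simp
    field_simp
    unfold charDeriv
    ring
  · rw [Matrix.one_apply_ne hij]
    have := l_quadratic hk.1 hij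
    simp
    field_simp
    linear_combination this

lemma Good.P_inv {k : ℂ} (hk : Good k) : (P k)⁻¹ = Pinv k := Matrix.inv_eq_left_inv hk.Pinv_mul

lemma Good.P_mul_Pinv {k : ℂ} (hk : Good k) : P k * Pinv k = 1 :=
  mul_eq_one_comm.1 hk.Pinv_mul

/-! ### The exceptional points -/

lemma mem_kappas {k : ℂ} (h : k ^ 6 = 1) : k ∈ kappas := by
  obtain ⟨i, hi, rfl⟩ := (Complex.isPrimitiveRoot_exp 6 (by norm_num)).eq_pow_of_pow_eq_one h
  refine ⟨i + 1, by omega, by omega, ?_⟩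
  rw [← Complex.exp_nat_mul]
  congr 1
  push_cast
  ring

lemma mem_Kpts {k : ℂ} (h : k ^ 6 = -1) : k ∈ Kpts := by
  set k₀ := Complex.exp (Real.pi * Complex.I / 6) with hk₀
  have h0 : k₀ ^ 6 = -1 := by
    rw [hk₀, ← Complex.exp_nat_mul, ← Complex.exp_pi_mul_I]
    congr 1
    push_cast
    ring
  have hne : k₀ ≠ 0 := Complex.exp_ne_zero _
  have h1 : (k / k₀) ^ 6 = 1 := by rw [div_pow, h, h0]; norm_num
  obtain ⟨i, hi, hi'⟩ := (Complex.isPrimitiveRoot_exp 6 (by norm_num)).eq_pow_of_pow_eq_one h1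
  refine ⟨i + 1, by omega, by omega, ?_⟩
  rw [eq_div_iff hne, ← Complex.exp_nat_mul, hk₀, ← Complex.exp_add] at hi'
  rw [← hi']
  congr 1
  push_cast
  ring

lemma good_of_notMem {k : ℂ} (h0 : k ≠ 0) (h1 : k ∉ kappas) (h2 : k ∉ Kpts) : Good k :=
  ⟨h0, fun h => h1 (mem_kappas h), fun h => h2 (mem_Kpts h)⟩

lemma Good.notMem_kappas {k : ℂ} (h : Good k) : k ∉ kappas := by
  rintro ⟨j, _, _, rfl⟩
  apply h.2.1
  rw [← Complex.exp_nat_mul, Complex.exp_eq_one_iff]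
  exact ⟨(j : ℤ) - 1, by push_cast; ring⟩

lemma Good.notMem_Kpts {k : ℂ} (h : Good k) : k ∉ Kpts := by
  rintro ⟨j, _, _, rfl⟩
  apply h.2.2
  rw [← Complex.exp_nat_mul, ← Complex.exp_pi_mul_I, Complex.exp_eq_exp_iff_exists_int]
  exact ⟨(j : ℤ) - 1, by push_cast; ring⟩

lemma isOpen_good : IsOpen {k : ℂ | Good k} := by
  refine isOpen_ne.inter (IsOpen.inter ?_ ?_)
  · exact isOpen_ne_fun (by fun_prop) continuous_const
  · exact isOpen_ne_fun (by fun_prop) continuous_const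

/-! ### Analyticity -/

lemma differentiableAt_l {k : ℂ} (hk : k ≠ 0) (j : Fin 3) : DifferentiableAt ℂ (fun k => l k j) k := by
  unfold l
  have := rot_ne_zero hk j
  unfold rot at this
  fun_prop (disch := assumption)

lemma differentiableAt_lam {k : ℂ} (hk : k ≠ 0) : DifferentiableAt ℂ lam k := by
  unfold lam
  have : k ^ 3 ≠ 0 := pow_ne_zero _ hk
  fun_prop (disch := assumption)

lemma Good.differentiableAt_z {k : ℂ} (hk : Good k) (j : Fin 3) :
    DifferentiableAt ℂ (fun k => z k j) k := by
  have h1 : (fun k => z k j) =ᶠ[𝓝 k] fun k => (l k j ^ 2 - 2 / 3) / lam k := by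
    filter_upwards [isOpen_good.mem_nhds hk] with k' hk'
    exact z_eq hk'.1 j
  exact ((((differentiableAt_l hk.1 j).pow 2).sub_const _).div (differentiableAt_lam hk.1)
    hk.lam_ne_zero).congr_of_eventuallyEq h1

lemma Good.differentiableAt_Pinv {k : ℂ} (hk : Good k) (i j : Fin 3) :
    DifferentiableAt ℂ (fun k => Pinv k i j) k := by
  have h1 := differentiableAt_l hk.1 i
  have h2 : DifferentiableAt ℂ (fun k => charDeriv k i) k := by
    unfold charDeriv
    exact ((h1.pow 2).const_mul 3).sub_const 1
  have h3 := hk.charDeriv_ne_zero i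
  simp only [Pinv, Matrix.of_apply]
  refine DifferentiableAt.div ?_ h2 h3
  fin_cases j <;> simp <;> fun_prop

lemma differentiableAt_P {k : ℂ} (hk : k ≠ 0) (i j : Fin 3) :
    DifferentiableAt ℂ (fun k => P k i j) k :=
  (differentiableAt_l hk j).pow _


/-! ### Conjugation by `P` -/

/-- The lower shift. -/
def lowShift : Matrix (Fin 3) (Fin 3) ℂ := !![0, 0, 0; 1, 0, 0; 0, 1, 0]

/-- The numerator is of first and the denominator of second order in l: strictly lower triangular
perturbations become small far out, unlike diagonal ones. -/
lemma conj_lowShift (k : ℂ) (i j : Fin 3) :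
    (Pinv k * lowShift * P k) i j = (l k i + l k j) / charDeriv k i := by
  simp [Matrix.mul_apply, Fin.sum_univ_three, lowShift, Pinv, P]
  ring

lemma conj_laxA₁ (k : ℂ) (i j : Fin 3) :
    (Pinv k * laxA₁ * P k) i j = 1 / charDeriv k i := by
  simp [Matrix.mul_apply, Fin.sum_univ_three, laxA₁, Pinv, P]

lemma norm_conj_le (k : ℂ) {M : Matrix (Fin 3) (Fin 3) ℂ} {m : ℝ} (hM : ∀ r s, ‖M r s‖ ≤ m)
    (i j : Fin 3) :
    ‖(Pinv k * M * P k) i j‖ ≤ (∑ r, ‖Pinv k i r‖) * (∑ s, ‖P k s j‖) * m := by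
  have e : (Pinv k * M * P k) i j = ∑ s, ∑ r, Pinv k i r * M r s * P k s j := by
    rw [Matrix.mul_apply]
    refine Finset.sum_congr rfl fun s _ => ?_
    rw [Matrix.mul_apply, Finset.sum_mul]
  rw [e, Finset.sum_mul_sum, Finset.sum_comm, Finset.sum_mul]
  refine norm_sum_le_of_le _ fun r _ => ?_
  rw [Finset.sum_mul]
  refine norm_sum_le_of_le _ fun s _ => ?_
  rw [norm_mul, norm_mul]
  have := mul_le_mul_of_nonneg_left (hM r s)
    (mul_nonneg (norm_nonneg (Pinv k i r)) (norm_nonneg (P k s j)))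
  linarith

/-- The size, as a function of `k`, of the perturbations in the Lax pair. -/
def beta (k : ℂ) : ℝ :=
  ∑ i, ∑ j, (‖(l k i + l k j) / charDeriv k i‖ + ‖1 / charDeriv k i‖
    + (∑ r, ‖Pinv k i r‖) * (∑ s, ‖P k s j‖) * ‖(lam k)⁻¹‖)

lemma beta_term_le (k : ℂ) (i j : Fin 3) :
    ‖(l k i + l k j) / charDeriv k i‖ + ‖1 / charDeriv k i‖
      + (∑ r, ‖Pinv k i r‖) * (∑ s, ‖P k s j‖) * ‖(lam k)⁻¹‖ ≤ beta k := by
  have h : ∀ i j, 0 ≤ ‖(l k i + l k j) / charDeriv k i‖ + ‖1 / charDeriv k i‖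
      + (∑ r, ‖Pinv k i r‖) * (∑ s, ‖P k s j‖) * ‖(lam k)⁻¹‖ := fun i j => by positivity
  unfold beta
  refine le_trans ?_ (Finset.single_le_sum
    (f := fun i => ∑ j, (‖(l k i + l k j) / charDeriv k i‖ + ‖1 / charDeriv k i‖
    + (∑ r, ‖Pinv k i r‖) * (∑ s, ‖P k s j‖) * ‖(lam k)⁻¹‖))
    (fun i _ => Finset.sum_nonneg fun j _ => h i j) (Finset.mem_univ i))
  exact Finset.single_le_sum (f := fun j => ‖(l k i + l k j) / charDeriv k i‖ + ‖1 / charDeriv k i‖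
    + (∑ r, ‖Pinv k i r‖) * (∑ s, ‖P k s j‖) * ‖(lam k)⁻¹‖) (fun j _ => h i j) (Finset.mem_univ j)

lemma beta_nonneg (k : ℂ) : 0 ≤ beta k :=
  le_trans (by positivity) (beta_term_le k 0 0)

lemma norm_conj_lowShift_le (k : ℂ) (i j : Fin 3) :
    ‖(Pinv k * lowShift * P k) i j‖ ≤ beta k := by
  rw [conj_lowShift]
  refine le_trans ?_ (beta_term_le k i j)
  rw [add_assoc]
  exact le_add_of_nonneg_right (by positivity)

lemma norm_conj_laxA₁_le (k : ℂ) (i j : Fin 3) :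
    ‖(Pinv k * laxA₁ * P k) i j‖ ≤ beta k := by
  rw [conj_laxA₁]
  refine le_trans ?_ (beta_term_le k i j)
  have : 0 ≤ ‖(l k i + l k j) / charDeriv k i‖ := norm_nonneg _
  have : 0 ≤ (∑ r, ‖Pinv k i r‖) * (∑ s, ‖P k s j‖) * ‖(lam k)⁻¹‖ := by positivity
  linarith

lemma norm_conj_inv_lam_le (k : ℂ) {M : Matrix (Fin 3) (Fin 3) ℂ} {m : ℝ}
    (hM : ∀ r s, ‖M r s‖ ≤ m) (i j : Fin 3) :
    ‖(lam k)⁻¹ * (Pinv k * M * P k) i j‖ ≤ beta k * m := by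
  have hm : 0 ≤ m := (norm_nonneg _).trans (hM 0 0)
  rw [norm_mul]
  calc ‖(lam k)⁻¹‖ * ‖(Pinv k * M * P k) i j‖
      ≤ ‖(lam k)⁻¹‖ * ((∑ r, ‖Pinv k i r‖) * (∑ s, ‖P k s j‖) * m) :=
        mul_le_mul_of_nonneg_left (norm_conj_le k hM i j) (norm_nonneg _)
    _ = ((∑ r, ‖Pinv k i r‖) * (∑ s, ‖P k s j‖) * ‖(lam k)⁻¹‖) * m := by ring
    _ ≤ beta k * m := by
        refine mul_le_mul_of_nonneg_right (le_trans ?_ (beta_term_le k i j)) hm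
        have : 0 ≤ ‖(l k i + l k j) / charDeriv k i‖ := norm_nonneg _
        have : 0 ≤ ‖1 / charDeriv k i‖ := norm_nonneg _
        linarith

lemma Good.continuousAt_beta {k : ℂ} (hk : Good k) : ContinuousAt beta k := by
  have hl := fun j => (differentiableAt_l hk.1 j).continuousAt
  have hd : ∀ j, ContinuousAt (fun k => charDeriv k j) k := fun j => by
    unfold charDeriv
    exact (((hl j).pow 2).const_mul 3).sub continuousAt_const
  have hP := fun i j => (differentiableAt_P hk.1 i j).continuousAt
  have hPi := fun i j => (hk.differentiableAt_Pinv i j).continuousAt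
  have hlam := ((differentiableAt_lam hk.1).continuousAt.inv₀ hk.lam_ne_zero).norm
  unfold beta
  refine tendsto_finsetSum _ fun i _ => tendsto_finsetSum _ fun j _ => ?_
  refine Tendsto.add (Tendsto.add ?_ ?_) (Tendsto.mul (Tendsto.mul ?_ ?_) hlam)
  · exact (((hl i).add (hl j)).div (hd i) (hk.charDeriv_ne_zero i)).norm
  · exact (continuousAt_const.div (hd i) (hk.charDeriv_ne_zero i)).norm
  · exact tendsto_finsetSum _ fun r _ => (hPi i r).norm
  · exact tendsto_finsetSum _ fun s _ => (hP s j).norm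

/-! ### Behaviour at zero and infinity -/

/-- The larger one of `|k|` and `|k|⁻¹`. -/
def height (k : ℂ) : ℝ := max ‖k‖ ‖k‖⁻¹

/-- Of |w|ⁿ and |w|⁻ⁿ one equals the n-th power of the height and the other is at most 1. The two
ends k → 0 and k → ∞ are thus treated alike. -/
lemma norm_pow_add_ge {w : ℂ} {k : ℂ} (hk : k ≠ 0) (hw : ‖w‖ = ‖k‖) (n : ℕ) :
    height k ^ n - 1 ≤ ‖w ^ n + 1 / w ^ n‖ := by
  have h0 : 0 < ‖k‖ := norm_pos_iff.2 hk
  have e1 : ‖w ^ n‖ = ‖k‖ ^ n := by rw [norm_pow, hw]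
  have e2 : ‖1 / w ^ n‖ = (‖k‖⁻¹) ^ n := by rw [norm_div, norm_one, norm_pow, hw]; simp
  rcases le_total 1 ‖k‖ with h | h
  · have h1 : ‖k‖⁻¹ ≤ 1 := inv_le_one_of_one_le₀ h
    have h2 : height k = ‖k‖ := max_eq_left (h1.trans h)
    have h3 := norm_sub_le_norm_add (w ^ n) (1 / w ^ n)
    have h4 : (‖k‖⁻¹) ^ n ≤ 1 := pow_le_one₀ (by positivity) h1
    rw [h2]
    rw [e1, e2] at h3
    linarith
  · have h1 : 1 ≤ ‖k‖⁻¹ := (one_le_inv₀ h0).2 h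
    have h2 : height k = ‖k‖⁻¹ := max_eq_right (h.trans h1)
    have h3 := norm_sub_le_norm_add (1 / w ^ n) (w ^ n)
    have h4 : ‖k‖ ^ n ≤ 1 := pow_le_one₀ h0.le h
    rw [h2]
    rw [e1, e2, add_comm] at h3
    linarith

lemma sqrt_three_bounds : 1 ≤ √3 ∧ √3 ≤ 2 :=
  ⟨Real.le_sqrt_of_sq_le (by norm_num), Real.sqrt_le_iff.2 ⟨by norm_num, by norm_num⟩⟩

lemma norm_l_le {k : ℂ} (j : Fin 3) : ‖l k j‖ ≤ 2 * height k := by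
  rw [l_eq, norm_mul]
  have h1 : ‖1 / (Real.sqrt 3 : ℂ)‖ ≤ 1 := by
    rw [norm_div, norm_one, Complex.norm_real, Real.norm_eq_abs, abs_of_nonneg (Real.sqrt_nonneg _)]
    exact div_le_one_of_le₀ sqrt_three_bounds.1 (Real.sqrt_nonneg _)
  have h2 : ‖rot k j + 1 / rot k j‖ ≤ 2 * height k := by
    refine (norm_add_le _ _).trans ?_
    rw [norm_div, norm_one, norm_rot, one_div]
    have := le_max_left ‖k‖ ‖k‖⁻¹
    have := le_max_right ‖k‖ ‖k‖⁻¹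
    unfold height
    linarith
  calc _ ≤ 1 * (2 * height k) := mul_le_mul h1 h2 (norm_nonneg _) one_pos.le
    _ = _ := one_mul _

lemma norm_charDeriv_ge {k : ℂ} (hk : k ≠ 0) (h4 : 4 ≤ height k) (j : Fin 3) :
    height k ^ 2 / 2 ≤ ‖charDeriv k j‖ := by
  have h1 := norm_pow_add_ge hk (norm_rot k j) 2
  have h2 : ‖rot k j ^ 2 + 1 / rot k j ^ 2‖ - 1 ≤ ‖charDeriv k j‖ := by
    rw [charDeriv_eq hk, show rot k j ^ 2 + 1 + 1 / rot k j ^ 2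
      = (rot k j ^ 2 + 1 / rot k j ^ 2) + 1 by ring]
    have := norm_sub_le_norm_add (rot k j ^ 2 + 1 / rot k j ^ 2) 1
    rwa [norm_one] at this
  nlinarith

lemma norm_lam_ge {k : ℂ} (hk : k ≠ 0) (h4 : 4 ≤ height k) :
    height k ^ 3 / 12 ≤ ‖lam k‖ := by
  have h1 := norm_pow_add_ge hk rfl 3
  have h5 : 1 / 6 ≤ ‖1 / (3 * (Real.sqrt 3 : ℂ))‖ := by
    rw [norm_div, norm_one, norm_mul, Complex.norm_real, Real.norm_eq_abs,
      abs_of_nonneg (Real.sqrt_nonneg _), Complex.norm_ofNat]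
    exact one_div_le_one_div_of_le (by linarith [sqrt_three_bounds.1])
      (by linarith [sqrt_three_bounds.2])
  have h6 : (4 : ℝ) ^ 3 ≤ height k ^ 3 := pow_le_pow_left₀ (by norm_num) h4 3
  rw [lam, norm_mul]
  calc height k ^ 3 / 12 ≤ 1 / 6 * (height k ^ 3 - 1) := by linarith
    _ ≤ _ := mul_le_mul h5 h1 (by linarith) (by positivity)

/-- With ρ the height, l = O(ρ), |3l² - 1| ≥ ρ²/2 and |λ| ≥ ρ³/12. The inverse of P is then bounded
and P is O(ρ²), so each of the nine terms is O(1/ρ). The constants are generous. -/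
lemma beta_le {k : ℂ} (hk : k ≠ 0) (h4 : 4 ≤ height k) : beta k ≤ 20000 / height k := by
  set ρ := height k with hρ
  have hρ0 : 0 < ρ := by linarith
  have hl := fun j => norm_l_le (k := k) j
  have hd := fun j => norm_charDeriv_ge hk h4 j
  have hd0 : ∀ j, 0 < ‖charDeriv k j‖ := fun j => lt_of_lt_of_le (by positivity) (hd j)
  have hdi : ∀ j, ‖charDeriv k j‖⁻¹ ≤ 2 / ρ ^ 2 := fun j => by
    rw [show 2 / ρ ^ 2 = (ρ ^ 2 / 2)⁻¹ by rw [inv_div]]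
    exact inv_anti₀ (by positivity) (hd j)
  have hlam : ‖(lam k)⁻¹‖ ≤ 12 / ρ ^ 3 := by
    rw [norm_inv, show 12 / ρ ^ 3 = (ρ ^ 3 / 12)⁻¹ by rw [inv_div]]
    exact inv_anti₀ (by positivity) (norm_lam_ge hk h4)
  have hterm : ∀ i j, ‖(l k i + l k j) / charDeriv k i‖ + ‖1 / charDeriv k i‖
      + (∑ r, ‖Pinv k i r‖) * (∑ s, ‖P k s j‖) * ‖(lam k)⁻¹‖ ≤ 2000 / ρ := by
    intro i j
    have t1 : ‖(l k i + l k j) / charDeriv k i‖ ≤ 8 / ρ := by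
      rw [norm_div, div_eq_mul_inv]
      calc _ ≤ (4 * ρ) * (2 / ρ ^ 2) := mul_le_mul
            ((norm_add_le _ _).trans (by linarith [hl i, hl j])) (hdi i) (by positivity)
            (by positivity)
        _ = 8 / ρ := by field_simp; norm_num
    have t2 : ‖1 / charDeriv k i‖ ≤ 1 / ρ := by
      rw [norm_div, norm_one, one_div]
      refine (hdi i).trans ?_
      rw [div_le_div_iff₀ (by positivity) hρ0]
      nlinarith
    have t3 : ∑ r, ‖Pinv k i r‖ ≤ 12 := by
      have e : ∑ r, ‖Pinv k i r‖
          = (‖l k i ^ 2 - 1‖ + ‖l k i‖ + 1) * ‖charDeriv k i‖⁻¹ := by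
        simp [Fin.sum_univ_three, Pinv, div_eq_mul_inv]
        ring
      rw [e]
      have e1 : ‖l k i ^ 2 - 1‖ ≤ 4 * ρ ^ 2 + 1 := by
        refine (norm_sub_le _ _).trans ?_
        rw [norm_pow, norm_one]
        have := pow_le_pow_left₀ (norm_nonneg _) (hl i) 2
        nlinarith
      have e2 : ‖l k i ^ 2 - 1‖ + ‖l k i‖ + 1 ≤ 6 * ρ ^ 2 := by nlinarith [hl i]
      calc _ ≤ (6 * ρ ^ 2) * (2 / ρ ^ 2) := mul_le_mul e2 (hdi i) (by positivity) (by positivity)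
        _ = 12 := by field_simp; norm_num
    have t4 : ∑ s, ‖P k s j‖ ≤ 6 * ρ ^ 2 := by
      have e : ∑ s, ‖P k s j‖ = 1 + ‖l k j‖ + ‖l k j‖ ^ 2 := by
        simp [Fin.sum_univ_three, P]
      rw [e]
      have := pow_le_pow_left₀ (norm_nonneg _) (hl j) 2
      nlinarith [hl j]
    have t5 : (∑ r, ‖Pinv k i r‖) * (∑ s, ‖P k s j‖) * ‖(lam k)⁻¹‖ ≤ 864 / ρ := by
      calc _ ≤ 12 * (6 * ρ ^ 2) * (12 / ρ ^ 3) := by gcongr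
        _ = 864 / ρ := by field_simp; norm_num
    have : 8 / ρ + 1 / ρ + 864 / ρ ≤ 2000 / ρ := by
      rw [← add_div, ← add_div]
      gcongr
      norm_num
    linarith
  unfold beta
  refine (Finset.sum_le_sum fun i _ => Finset.sum_le_sum fun j _ => hterm i j).trans ?_
  simp only [Finset.sum_const, Finset.card_univ, Fintype.card_fin, nsmul_eq_mul]
  rw [show ((3 : ℕ) : ℝ) * (((3 : ℕ) : ℝ) * (2000 / ρ)) = 18000 / ρ by push_cast; ring]
  gcongr
  norm_num

lemma norm_z_le {k : ℂ} (hk : k ≠ 0) (h4 : 4 ≤ height k) (j : Fin 3) :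
    ‖z k j‖ ≤ 100 / height k := by
  set ρ := height k with hρ
  have hρ0 : 0 < ρ := by linarith
  rw [z_eq hk, norm_div, div_eq_mul_inv, ← norm_inv]
  have hlam : ‖(lam k)⁻¹‖ ≤ 12 / ρ ^ 3 := by
    rw [norm_inv, show 12 / ρ ^ 3 = (ρ ^ 3 / 12)⁻¹ by rw [inv_div]]
    exact inv_anti₀ (by positivity) (norm_lam_ge hk h4)
  have e1 : ‖l k j ^ 2 - 2 / 3‖ ≤ 5 * ρ ^ 2 := by
    refine (norm_sub_le _ _).trans ?_
    rw [norm_pow]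
    have := pow_le_pow_left₀ (norm_nonneg _) (norm_l_le (k := k) j) 2
    have h3 : ‖(2 / 3 : ℂ)‖ ≤ 1 := by norm_num
    nlinarith
  calc _ ≤ (5 * ρ ^ 2) * (12 / ρ ^ 3) := mul_le_mul e1 hlam (norm_nonneg _) (by positivity)
    _ = 60 / ρ := by field_simp; norm_num
    _ ≤ 100 / ρ := by gcongr; norm_num

lemma good_of_height {k : ℂ} (hk : k ≠ 0) (h : 1 < height k) : Good k := by
  refine ⟨hk, fun h6 => ?_, fun h6 => ?_⟩ <;>
  · have h1 : ‖k‖ ^ 6 = 1 := by rw [← norm_pow, h6]; simp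
    have h2 : ‖k‖ = 1 := (pow_eq_one_iff_of_nonneg (norm_nonneg _) (by norm_num)).1 h1
    simp [height, h2] at h

/-! ### Sectors -/

/-- All three numbers ω^{j+1}k have the same modulus, so Re l_j is a common positive multiple of
Re(ω^{j+1}k) for k ≠ 0. The order of the Re l_j depends only on arg k and is preserved along rays.
-/
lemma re_l {k : ℂ} (j : Fin 3) :
    (l k j).re = 1 / √3 * (1 + (Complex.normSq k)⁻¹) * (rot k j).re := by
  have hn : Complex.normSq (rot k j) = Complex.normSq k := by
    rw [Complex.normSq_eq_norm_sq, Complex.normSq_eq_norm_sq, norm_rot]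
  rw [l_eq, show (1 / (Real.sqrt 3 : ℂ)) = ((1 / √3 : ℝ) : ℂ) by push_cast; rfl,
    Complex.re_ofReal_mul, Complex.add_re, one_div (rot k j), Complex.inv_re, hn]
  ring

lemma re_l_lt_iff {k : ℂ} (i j : Fin 3) :
    (l k i).re < (l k j).re ↔ (rot k i).re < (rot k j).re := by
  rw [re_l, re_l]
  refine mul_lt_mul_iff_right₀ ?_
  have h : 0 ≤ (Complex.normSq k)⁻¹ := inv_nonneg.2 (Complex.normSq_nonneg k)
  have : 0 < √3 := Real.sqrt_pos.2 (by norm_num)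
  positivity

lemma rot_zero (j : Fin 3) : rot 0 j = 0 := by simp [rot]

/-- Strict order makes the l_j distinct, so no 3l_j² - 1 vanishes. At k⁶ = 1 the factorization would
then force (ω^{j+1}k)² = 1 for j = 0 and 1, hence ω = ω². -/
lemma good_of_strict {k : ℂ} {a b c : Fin 3} (hab : (l k a).re < (l k b).re)
    (hbc : (l k b).re < (l k c).re) (h : k ^ 6 ≠ -1) : Good k := by
  have hk : k ≠ 0 := by
    rintro rfl
    rw [re_l_lt_iff, rot_zero, rot_zero] at hab
    exact lt_irrefl _ hab
  refine ⟨hk, fun h6 => ?_, h⟩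
  have hinj : ∀ i j : Fin 3, i ≠ j → l k i ≠ l k j := by
    have e1 : l k a ≠ l k b := fun h => by rw [h] at hab; exact lt_irrefl _ hab
    have e2 : l k b ≠ l k c := fun h => by rw [h] at hbc; exact lt_irrefl _ hbc
    have e3 : l k a ≠ l k c := fun h => by rw [h] at hab; exact lt_irrefl _ (hab.trans hbc)
    have n1 : a ≠ b := fun h => e1 (by rw [h])
    have n2 : b ≠ c := fun h => e2 (by rw [h])
    have n3 : a ≠ c := fun h => e3 (by rw [h])
    have hcov : ∀ i : Fin 3, i = a ∨ i = b ∨ i = c := by omega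
    intro i j hij
    rcases hcov i with rfl | rfl | rfl <;> rcases hcov j with rfl | rfl | rfl <;>
      first
      | exact absurd rfl hij
      | assumption
      | exact Ne.symm (by assumption)
  have hne : ∀ i, charDeriv k i ≠ 0 := by
    intro i
    obtain ⟨j, r, hij, hir, hjr⟩ : ∃ j r : Fin 3, i ≠ j ∧ i ≠ r ∧ j ≠ r := by
      fin_cases i
      · exact ⟨1, 2, by decide, by decide, by decide⟩
      · exact ⟨0, 2, by decide, by decide, by decide⟩
      · exact ⟨0, 1, by decide, by decide, by decide⟩
    rw [charDeriv_factor hk hij hir hjr]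
    exact mul_ne_zero (sub_ne_zero.2 (hinj i j hij)) (sub_ne_zero.2 (hinj i r hir))
  have hsq : ∀ i, rot k i ^ 2 = 1 := by
    intro i
    have h1 := charDeriv_mul hk i
    rw [h6, sub_self] at h1
    rcases mul_eq_zero.1 h1 with h2 | h2
    · exact absurd h2 (hne i)
    · rcases mul_eq_zero.1 h2 with h3 | h3
      · exact absurd h3 (pow_ne_zero _ (rot_ne_zero hk i))
      · linear_combination h3
  have h0 := hsq 0
  have h1 := hsq 1
  simp only [rot, Fin.val_zero, Fin.val_one] at h0 h1
  have h3 := om_cube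
  have h4 : om = om ^ 2 := by
    have e1 : (om ^ 2) * k ^ 2 = 1 := by linear_combination h0
    have e2 : om * k ^ 2 = 1 := by linear_combination h1 - om * k ^ 2 * h3
    have hk2 : k ^ 2 ≠ 0 := pow_ne_zero _ hk
    exact mul_right_cancel₀ hk2 (e2.trans e1.symm)
  have h5 := om_sum
  have : om = 1 := by
    have : om * (om - 1) = 0 := by linear_combination -h4
    rcases mul_eq_zero.1 this with h | h
    · exact absurd h om_ne_zero
    · linear_combination h
  rw [this] at h5
  norm_num at h5

/-- On every sector, an analytic function which does not vanish far out on rays has isolated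
zeros. -/
theorem eventually_ne_zero_of_ray {f : ℂ → ℂ} {a b c : Fin 3} {k₀ : ℂ}
    (hab : (l k₀ a).re < (l k₀ b).re) (hbc : (l k₀ b).re < (l k₀ c).re) (hgood : k₀ ^ 6 ≠ -1)
    (hf : ∀ k : ℂ, (l k a).re < (l k b).re → (l k b).re < (l k c).re → Good k → AnalyticAt ℂ f k)
    (hfar : ∀ k : ℂ, (l k a).re < (l k b).re → (l k b).re < (l k c).re →
      ∀ᶠ r : ℝ in atTop, f (r * k) ≠ 0) :
    ∀ᶠ k in 𝓝[≠] k₀, f k ≠ 0 := by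
  have hk₀ := good_of_strict hab hbc hgood
  rcases (hf k₀ hab hbc hk₀).eventually_eq_zero_or_eventually_ne_zero with h | h
  swap
  · exact h
  exfalso
  have hcont : ∀ j, ContinuousAt (fun k => (l k j).re) k₀ := fun j =>
    Complex.continuous_re.continuousAt.comp (differentiableAt_l hk₀.1 j).continuousAt
  obtain ⟨k₁, hk₁, hab₁, hbc₁, hray⟩ : ∃ k₁ : ℂ, (∀ᶠ k in 𝓝 k₁, f k = 0) ∧
      (l k₁ a).re < (l k₁ b).re ∧ (l k₁ b).re < (l k₁ c).re ∧
      ∀ r : ℝ, 1 ≤ r → ((r : ℂ) * k₁) ^ 6 ≠ -1 := by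
    by_cases hr : ∀ r : ℝ, 1 ≤ r → ((r : ℂ) * k₀) ^ 6 ≠ -1
    · exact ⟨k₀, h, hab, hbc, hr⟩
    · push Not at hr
      -- The ray from k₀ may meet a point with k⁶ = -1, where analyticity is not available. A
      -- slightly rotated ray, through a nearby point at which `f` also vanishes locally, avoids all
      -- of them.
      obtain ⟨r₀, hr₀, hr₀'⟩ := hr
      have htend : Tendsto (fun ε : ℝ => k₀ * (1 + ε * Complex.I)) (𝓝[>] 0) (𝓝 k₀) := by
        have : Continuous fun ε : ℝ => k₀ * (1 + ε * Complex.I) := by fun_prop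
        have h := (this.tendsto 0).mono_left (nhdsWithin_le_nhds (s := Ioi 0))
        simpa using h
      have hev := htend.eventually ((eventually_eventually_nhds.2 h).and
        (((hcont a).eventually_lt (hcont b) hab).and ((hcont b).eventually_lt (hcont c) hbc)))
      obtain ⟨ε, ⟨h1, h2, h3⟩, h4⟩ :=
        (hev.and (Ioo_mem_nhdsGT (show (0 : ℝ) < 1 / 2 by norm_num))).exists
      refine ⟨_, h1, h2, h3, fun r hr hcontra => ?_⟩
      have h5 : ((r : ℂ) * (k₀ * (1 + ε * Complex.I))) ^ 6 * (r₀ : ℂ) ^ 6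
          = ((r₀ : ℂ) * k₀) ^ 6 * (r : ℂ) ^ 6 * (1 + ε * Complex.I) ^ 6 := by ring
      rw [hcontra, hr₀'] at h5
      have h6 : ((r₀ ^ 6 : ℝ) : ℂ) = ((r ^ 6 : ℝ) : ℂ) * (1 + ε * Complex.I) ^ 6 := by
        push_cast
        linear_combination -h5
      -- For 0 < ε < 1/2 the imaginary part is positive, so (1 + εi)⁶ cannot be a quotient of the
      -- real numbers r₀⁶ and r⁶.
      have h7 : (1 + (ε : ℂ) * Complex.I) ^ 6
          = ((1 - 15 * ε ^ 2 + 15 * ε ^ 4 - ε ^ 6 : ℝ) : ℂ)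
            + ((6 * ε - 20 * ε ^ 3 + 6 * ε ^ 5 : ℝ) : ℂ) * Complex.I := by
        have hI : Complex.I ^ 2 = -1 := Complex.I_sq
        push_cast
        linear_combination (15 * (ε : ℂ) ^ 2 + 20 * ε ^ 3 * Complex.I
          + 15 * ε ^ 4 * (Complex.I ^ 2 - 1) + 6 * ε ^ 5 * Complex.I * (Complex.I ^ 2 - 1)
          + ε ^ 6 * (Complex.I ^ 4 - Complex.I ^ 2 + 1)) * hI
      have h8 := congrArg Complex.im h6
      rw [h7, Complex.ofReal_im, Complex.im_ofReal_mul] at h8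
      simp only [Complex.add_im, Complex.ofReal_im, Complex.im_ofReal_mul, Complex.I_im,
        mul_one, zero_add] at h8
      have h9 : 0 < r ^ 6 * (6 * ε - 20 * ε ^ 3 + 6 * ε ^ 5) := by
        have hε := h4.1
        have hε2 := h4.2
        refine mul_pos (by positivity) ?_
        have : 0 < ε * (6 - 20 * ε ^ 2 + 6 * ε ^ 4) := by
          refine mul_pos hε ?_
          have : ε ^ 2 < 1 / 4 := by nlinarith
          nlinarith [pow_nonneg hε.le 4]
        nlinarith
      linarith
  have hscale : ∀ r : ℝ, 0 < r → ∀ i j : Fin 3, (l k₁ i).re < (l k₁ j).re →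
      (l (r * k₁) i).re < (l (r * k₁) j).re := by
    intro r hr i j hij
    rw [re_l_lt_iff] at hij ⊢
    have e : ∀ j, rot (r * k₁) j = r * rot k₁ j := fun j => by unfold rot; ring
    rw [e, e, Complex.re_ofReal_mul, Complex.re_ofReal_mul]
    exact mul_lt_mul_of_pos_left hij hr
  have hU : IsPreconnected ((fun r : ℝ => (r : ℂ) * k₁) '' Ici 1) :=
    isPreconnected_Ici.image _ (by fun_prop)
  have hA : AnalyticOnNhd ℂ f ((fun r : ℝ => (r : ℂ) * k₁) '' Ici 1) := by
    rintro _ ⟨r, hr, rfl⟩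
    have hr0 : 0 < r := one_pos.trans_le hr
    have h1 := hscale r hr0 a b hab₁
    have h2 := hscale r hr0 b c hbc₁
    exact hf _ h1 h2 (good_of_strict h1 h2 (hray r hr))
  -- The ray is connected, so vanishing near its starting point propagates by the identity theorem
  -- to where `f` is nonzero.
  have hz := hA.eqOn_zero_of_preconnected_of_eventuallyEq_zero hU
    ⟨1, mem_Ici.2 le_rfl, by simp⟩ hk₁
  obtain ⟨r, hr, hr1⟩ := ((hfar k₁ hab₁ hbc₁).and (eventually_ge_atTop 1)).exists
  exact hr (hz ⟨r, hr1, rfl⟩)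

/-! ### The sets `D n` -/

/-- At such k the denominator of the z_j is zero and division by zero gives the value 0, so all z_j
agree and the strict order of their real parts fails. -/
lemma D_pow_six {n : Fin 18} {k : ℂ} (hk : k ∈ D n) : k ^ 6 ≠ -1 := by
  intro h
  have h0 : k ≠ 0 := by rintro rfl; norm_num at h
  have h1 : k ^ 3 + 1 / k ^ 3 = 0 := by
    field_simp
    linear_combination h
  have h2 : ∀ j, z k j = 0 := fun j => by unfold z; rw [h1, div_zero, mul_zero]
  have := hk.2.2.1
  rw [h2, h2] at this
  exact lt_irrefl _ this

lemma D_good {n : Fin 18} {k : ℂ} (hk : k ∈ D n) : Good k :=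
  good_of_strict hk.1 hk.2.1 (D_pow_six hk)

/-- Only the order of the Re l_j matters on the closure; the order of the Re z_j enters solely
through the choice of contours, which is fixed by the index. -/
lemma closure_D_re_le {n : Fin 18} {k : ℂ} (hk : k ∈ closure (D n)) (h0 : k ≠ 0) :
    (l k (lOrder n 0)).re ≤ (l k (lOrder n 1)).re ∧
      (l k (lOrder n 1)).re ≤ (l k (lOrder n 2)).re := by
  have hl : ∀ j, Tendsto (fun k => (l k j).re) (𝓝[D n] k) (𝓝 (l k j).re) := fun j =>
    (Complex.continuous_re.continuousAt.comp (differentiableAt_l h0 j).continuousAt).mono_left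
      nhdsWithin_le_nhds
  have : (𝓝[D n] k).NeBot := mem_closure_iff_nhdsWithin_neBot.1 hk
  constructor
  · exact le_of_tendsto_of_tendsto (hl _) (hl _)
      (eventually_nhdsWithin_of_forall fun k' hk' => hk'.1.le)
  · exact le_of_tendsto_of_tendsto (hl _) (hl _)
      (eventually_nhdsWithin_of_forall fun k' hk' => hk'.2.1.le)


/-! ### Diagonalization of the constant part -/

/-- The companion matrix of `l³ - l - λ`. -/
def comp (k : ℂ) : Matrix (Fin 3) (Fin 3) ℂ := !![0, 1, 0; 0, 0, 1; lam k, 1, 0]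

/-- The rows of the inverse Vandermonde matrix are left eigenvectors of the companion matrix. -/
lemma Good.Pinv_mul_comp {k : ℂ} (hk : Good k) : Pinv k * comp k = calL k * Pinv k := by
  ext i j
  have h := hk.charDeriv_ne_zero i
  have h3 := l_cube hk.1 i
  rw [calL, Matrix.diagonal_mul, Matrix.mul_apply, Fin.sum_univ_three]
  fin_cases j <;> simp [Pinv, comp] <;> field_simp
  · linear_combination -h3
  · ring

/-- The constant part of the `t`-equation. -/
def compT (k : ℂ) : Matrix (Fin 3) (Fin 3) ℂ :=
  !![-(2 / 3) * (lam k)⁻¹, 0, (lam k)⁻¹; 1, (lam k)⁻¹ / 3, 0; 0, 1, (lam k)⁻¹ / 3]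

/-- Here `compT` is λ⁻¹(C² - 2/3), C being the companion matrix, and z_j = λ⁻¹(l_j² - 2/3); so the
eigenvectors are the same. -/
lemma Good.Pinv_mul_compT {k : ℂ} (hk : Good k) : Pinv k * compT k = calZ k * Pinv k := by
  ext i j
  have h := hk.charDeriv_ne_zero i
  have hl := hk.lam_ne_zero
  have h3 := l_cube hk.1 i
  rw [calZ, Matrix.diagonal_mul, Matrix.mul_apply, Fin.sum_univ_three, z_eq hk.1]
  fin_cases j <;> simp [Pinv, compT] <;> field_simp
  · linear_combination -3 * l k i * h3
  · linear_combination -3 * h3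
  · ring

lemma Good.Pinv_mul_split {k : ℂ} (hk : Good k) (c d : ℂ) (N : Matrix (Fin 3) (Fin 3) ℂ) :
    Pinv k * (d • compT k + c • comp k + N)
      = (d • calZ k + c • calL k + Pinv k * N * P k) * Pinv k := by
  rw [Matrix.mul_add, Matrix.mul_add, Matrix.mul_smul, Matrix.mul_smul, hk.Pinv_mul_comp,
    hk.Pinv_mul_compT, Matrix.add_mul, Matrix.add_mul, Matrix.smul_mul, Matrix.smul_mul,
    Matrix.mul_assoc (Pinv k * N), hk.P_mul_Pinv, Matrix.mul_one]

lemma hasDerivWithinAt_mul_mul {F : ℝ → Matrix (Fin 3) (Fin 3) ℂ} {F' : Matrix (Fin 3) (Fin 3) ℂ}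
    {s : Set ℝ} {x : ℝ} (A C : Matrix (Fin 3) (Fin 3) ℂ)
    (h : ∀ i j, HasDerivWithinAt (fun x => F x i j) (F' i j) s x) (i j : Fin 3) :
    HasDerivWithinAt (fun x => (A * F x * C) i j) ((A * F' * C) i j) s x := by
  simp only [Matrix.mul_apply]
  exact HasDerivWithinAt.fun_sum fun r _ =>
    (HasDerivWithinAt.fun_sum fun s _ => (h s r).const_mul _).mul_const _

/-! ### The fundamental matrix -/

/-- The fundamental matrix of the Lax pair in polynomial form. -/
def laxMat (u : ℝ → ℝ → ℝ) (lm : ℂ) (x t : ℝ) : Matrix (Fin 3) (Fin 3) ℂ :=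
  Matrix.of fun i j => laxSol u lm (Pi.single j 1) x t i

/-- The gauge in which the Lax pair of the problem is written. -/
def gaugeG (u : ℝ → ℝ → ℝ) (x t : ℝ) : Matrix (Fin 3) (Fin 3) ℂ :=
  !![(q u x t : ℂ), 0, 0; 0, 1, 0; 0, 0, (q u x t : ℂ)⁻¹]

/-- `(b² + q⁻² - 1) / 2`. -/
def eP (u : ℝ → ℝ → ℝ) (x t : ℝ) : ℝ := (bq u x t ^ 2 + (q u x t)⁻¹ ^ 2 - 1) / 2

/-- `(b² - q⁻² + 1) / 2`. -/
def eM (u : ℝ → ℝ → ℝ) (x t : ℝ) : ℝ := (bq u x t ^ 2 - (q u x t)⁻¹ ^ 2 + 1) / 2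

/-- The change of gauge which makes the perturbation small for large spectral parameter. -/
def shear (u : ℝ → ℝ → ℝ) (x t : ℝ) : Matrix (Fin 3) (Fin 3) ℂ :=
  1 + ((bq u x t : ℂ) • lowShift + (eM u x t : ℂ) • laxA₁)

/-- The inverse of `shear`. -/
def unshear (u : ℝ → ℝ → ℝ) (x t : ℝ) : Matrix (Fin 3) (Fin 3) ℂ :=
  1 + ((-bq u x t : ℂ) • lowShift + (eP u x t : ℂ) • laxA₁)

/-- The square of the lower shift is `laxA₁` and its cube is 0, so the inverse of 1 + bN + eN² is 1
- bN + (b² - e)N²; the two coefficients `eP` and `eM` add up to b². -/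
lemma unshear_mul_shear (u : ℝ → ℝ → ℝ) (x t : ℝ) : unshear u x t * shear u x t = 1 := by
  ext i j
  rw [Matrix.mul_apply, Fin.sum_univ_three]
  fin_cases i <;> fin_cases j <;>
    simp [unshear, shear, lowShift, laxA₁, eP, eM] <;> ring

/-- The perturbation of the `x`-equation in the original gauge. -/
def pertX (u : ℝ → ℝ → ℝ) (x t : ℝ) : Matrix (Fin 3) (Fin 3) ℂ :=
  !![((qx u x t / q u x t : ℝ) : ℂ), 0, 0;
       0, 0, 0;
       0, ((1 / q u x t - q u x t : ℝ) : ℂ), ((-(qx u x t / q u x t) : ℝ) : ℂ)]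

/-- The perturbation of the `t`-equation in the original gauge. -/
def pertT (u : ℝ → ℝ → ℝ) (x t : ℝ) (k : ℂ) : Matrix (Fin 3) (Fin 3) ℂ :=
  !![((-(u x t * qx u x t / q u x t) : ℝ) : ℂ), 0, 0;
        (((u x t + 1) / q u x t - 1 : ℝ) : ℂ), 0, 0;
        ((dx 1 u x t / q u x t ^ 2 : ℝ) : ℂ), ((1 / q u x t - 1 + u x t * q u x t : ℝ) : ℂ),
          ((u x t * qx u x t / q u x t : ℝ) : ℂ)]
      + (((q u x t ^ 2 - 1 : ℝ) : ℂ) / lam k) • !![0, 0, 1; 0, 0, 0; 0, 0, 0]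

lemma Good.V1_eq {k : ℂ} (hk : Good k) (u : ℝ → ℝ → ℝ) (x t : ℝ) :
    V1 u x t k = Pinv k * pertX u x t * P k := by rw [V1, hk.P_inv]; rfl

lemma Good.V2_eq {k : ℂ} (hk : Good k) (u : ℝ → ℝ → ℝ) (x t : ℝ) :
    V2 u x t k = Pinv k * pertT u x t k * P k := by rw [V2, hk.P_inv]; rfl

/-- The coefficient of the perturbation of the `x`-equation after the shear. -/
def hCoef (u : ℝ → ℝ → ℝ) (x t : ℝ) : ℝ :=
  (2 * bqx u x t * (q u x t)⁻¹ + bq u x t ^ 2 + (q u x t)⁻¹ ^ 2 - 1) / 2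

/-- The `λ`-independent coefficient of the perturbation of the `t`-equation after the shear. -/
def nCoef (u : ℝ → ℝ → ℝ) (x t : ℝ) : ℝ :=
  q u x t ^ 2 - 1 - u x t * bqx u x t - u x t * q u x t * eP u x t

/-- The coefficient of `λ⁻¹` in the perturbation of the `t`-equation after the shear. -/
def nMat (u : ℝ → ℝ → ℝ) (x t : ℝ) : Matrix (Fin 3) (Fin 3) ℝ :=
  !![q u x t ^ 2 * eP u x t, -(q u x t ^ 2 * bq u x t), q u x t ^ 2 - 1;
    bq u x t * (q u x t ^ 2 * eP u x t - 1), -(bq u x t ^ 2 * q u x t ^ 2),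
      bq u x t * q u x t ^ 2;
    eM u x t * (q u x t ^ 2 * eP u x t - 1), -(eM u x t * q u x t ^ 2 * bq u x t),
      eM u x t * q u x t ^ 2]

/-- The propagator of the Lax pair of the problem, equal to the identity at the origin. -/
def propT (u : ℝ → ℝ → ℝ) (k : ℂ) (x t : ℝ) : Matrix (Fin 3) (Fin 3) ℂ :=
  Pinv k * (gaugeG u x t * laxMat u (lam k) x t)
    * (!![(q u 0 0 : ℂ)⁻¹, 0, 0; 0, 1, 0; 0, 0, (q u 0 0 : ℂ)] * P k)

/-- The same propagator after the shear at its end point. -/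
def propS (u : ℝ → ℝ → ℝ) (k : ℂ) (x t : ℝ) : Matrix (Fin 3) (Fin 3) ℂ :=
  Pinv k * (shear u x t * gaugeG u x t * laxMat u (lam k) x t)
    * (!![(q u 0 0 : ℂ)⁻¹, 0, 0; 0, 1, 0; 0, 0, (q u 0 0 : ℂ)] * P k)

namespace Regular

variable {T : ℝ} {u : ℝ → ℝ → ℝ} (S : Regular T u)

include S

lemma hasDerivAt_eM_x {x t : ℝ} (hx : 0 ≤ x) (ht : t ∈ Icc 0 T) :
    HasDerivAt (fun ξ => eM u ξ t) (bq u x t * bqx u x t + bq u x t * (q u x t)⁻¹) x := by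
  have h0 : q u x t ≠ 0 := (S.q_pos hx ht).ne'
  refine (((((S.hasDerivAt_bq_x hx ht).pow 2).sub (((S.hasDerivAt_q_x hx ht).inv h0).pow 2)).add_const
    1).div_const 2).congr_deriv ?_
  simp only [Pi.inv_apply, Nat.add_one_sub_one, pow_one, Nat.cast_ofNat]
  field_simp
  ring

lemma hasDerivAt_eM_t {x t : ℝ} (hx : 0 ≤ x) (ht : t ∈ Icc 0 T) :
    HasDerivAt (fun s => eM u x s)
      (bq u x t * (-(dx 2 u x t / q u x t) - u x t * bqx u x t)
        - (q u x t)⁻¹ ^ 3 * (dx 1 u x t * q u x t + u x t * bq u x t * q u x t ^ 2)) t := by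
  have h0 : q u x t ≠ 0 := (S.q_pos hx ht).ne'
  refine (((((S.hasDerivAt_bq_t hx ht).pow 2).sub (((S.hasDerivAt_q_t hx ht).inv h0).pow 2)).add_const
    1).div_const 2).congr_deriv ?_
  simp only [Pi.inv_apply, Nat.add_one_sub_one, pow_one, Nat.cast_ofNat]
  field_simp

lemma hasDerivAt_laxMat_x (lm : ℂ) (x t : ℝ) (j : Fin 3) :
    HasDerivAt (fun ξ => laxMat u lm ξ t 0 j) (laxMat u lm x t 1 j) x ∧
    HasDerivAt (fun ξ => laxMat u lm ξ t 1 j) (laxMat u lm x t 2 j) x ∧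
    HasDerivAt (fun ξ => laxMat u lm ξ t 2 j)
      (lm * mass u x t * laxMat u lm x t 0 j + laxMat u lm x t 1 j) x := by
  have h := S.hasDerivAt_laxSol_x lm (Pi.single j 1) x t
  rw [laxA_apply] at h
  exact ⟨hasDerivAt_pi.1 h 0, hasDerivAt_pi.1 h 1, hasDerivAt_pi.1 h 2⟩

lemma hasDerivAt_laxMat_t {lm : ℂ} (hlm : lm ≠ 0) {x t : ℝ} (hx : 0 ≤ x) (ht : t ∈ Icc 0 T)
    (j : Fin 3) :
    HasDerivAt (fun s => laxMat u lm x s 0 j) ((dx 1 u x t - 2 / 3 * lm⁻¹) * laxMat u lm x t 0 j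
      - u x t * laxMat u lm x t 1 j + lm⁻¹ * laxMat u lm x t 2 j) t ∧
    HasDerivAt (fun s => laxMat u lm x s 1 j) ((u x t + 1) * laxMat u lm x t 0 j
      + lm⁻¹ / 3 * laxMat u lm x t 1 j - u x t * laxMat u lm x t 2 j) t ∧
    HasDerivAt (fun s => laxMat u lm x s 2 j)
      ((dx 1 u x t - lm * (u x t * mass u x t)) * laxMat u lm x t 0 j + laxMat u lm x t 1 j
        + (lm⁻¹ / 3 - dx 1 u x t) * laxMat u lm x t 2 j) t := by
  have h := S.hasDerivAt_laxSol_t hlm (Pi.single j 1) hx ht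
  rw [laxB_apply] at h
  exact ⟨hasDerivAt_pi.1 h 0, hasDerivAt_pi.1 h 1, hasDerivAt_pi.1 h 2⟩

lemma laxMat_zero (lm : ℂ) : laxMat u lm 0 0 = 1 := by
  ext i j
  simp [laxMat, S.laxSol_zero, Matrix.one_apply, Pi.single_apply]

/-- Liouville's formula: both Lax matrices have trace zero. -/
lemma det_laxMat {lm : ℂ} {x t : ℝ} : (laxMat u lm x t).det = 1 := by
  have hx : ∀ x, HasDerivAt (fun ξ => (laxMat u lm ξ t).det) 0 x := by
    intro x
    obtain ⟨a0, a1, a2⟩ := S.hasDerivAt_laxMat_x lm x t 0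
    obtain ⟨b0, b1, b2⟩ := S.hasDerivAt_laxMat_x lm x t 1
    obtain ⟨c0, c1, c2⟩ := S.hasDerivAt_laxMat_x lm x t 2
    simp only [Matrix.det_fin_three]
    refine ((((((a0.mul b1).mul c2).sub ((a0.mul c1).mul b2)).sub ((b0.mul a1).mul c2)).add
      ((b0.mul c1).mul a2)).add ((c0.mul a1).mul b2)).sub ((c0.mul b1).mul a2) |>.congr_deriv ?_
    simp only [Pi.mul_apply]
    ring
  have ht : ∀ t, HasDerivAt (fun s => (laxMat u lm 0 s).det) 0 t := by
    intro t
    have h : ∀ j, HasDerivAt (fun s => laxSol u lm (Pi.single j 1) 0 s)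
        (laxB u 0 lm t (laxSol u lm (Pi.single j 1) 0 t)) t := fun j => by
      simp only [S.laxSol_zero_left]
      exact hasDerivAt_flow (S.continuous_laxB 0 lm) _ t
    simp only [laxB_apply] at h
    have a0 := hasDerivAt_pi.1 (h 0) 0
    have a1 := hasDerivAt_pi.1 (h 0) 1
    have a2 := hasDerivAt_pi.1 (h 0) 2
    have b0 := hasDerivAt_pi.1 (h 1) 0
    have b1 := hasDerivAt_pi.1 (h 1) 1
    have b2 := hasDerivAt_pi.1 (h 1) 2
    have c0 := hasDerivAt_pi.1 (h 2) 0
    have c1 := hasDerivAt_pi.1 (h 2) 1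
    have c2 := hasDerivAt_pi.1 (h 2) 2
    simp only [Matrix.det_fin_three, laxMat, Matrix.of_apply]
    refine ((((((a0.mul b1).mul c2).sub ((a0.mul c1).mul b2)).sub ((b0.mul a1).mul c2)).add
      ((b0.mul c1).mul a2)).add ((c0.mul a1).mul b2)).sub ((c0.mul b1).mul a2) |>.congr_deriv ?_
    simp only [Pi.mul_apply, Matrix.cons_val_zero, Matrix.cons_val_one, Matrix.cons_val]
    ring
  have e1 := is_const_of_deriv_eq_zero (fun x => (hx x).differentiableAt) (fun x => (hx x).deriv) x 0
  have e2 := is_const_of_deriv_eq_zero (fun x => (ht x).differentiableAt) (fun x => (ht x).deriv) t 0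
  rw [e1, e2, S.laxMat_zero, Matrix.det_one]

/-- The gauge diag(q, 1, 1/q) replaces m = q³ by a common factor q in front of the companion matrix.
The zero multiple of `compT` gives this equation the same shape as the t-equation. -/
lemma hasDerivAt_gauge_x (k : ℂ) {x t : ℝ} (hx : 0 ≤ x) (ht : t ∈ Icc 0 T) (i j : Fin 3) :
    HasDerivAt (fun ξ => (gaugeG u ξ t * laxMat u (lam k) ξ t) i j)
      ((((0 : ℂ) • compT k + (q u x t : ℂ) • comp k + pertX u x t)
        * (gaugeG u x t * laxMat u (lam k) x t)) i j) x := by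
  obtain ⟨a0, a1, a2⟩ := S.hasDerivAt_laxMat_x (lam k) x t j
  have h0 : q u x t ≠ 0 := (S.q_pos hx ht).ne'
  have h0' : (q u x t : ℂ) ≠ 0 := by exact_mod_cast h0
  have hq := (S.hasDerivAt_q_x hx ht).ofReal_comp
  have hm : (mass u x t : ℂ) = (q u x t : ℂ) ^ 3 := by rw [← S.q_cube hx ht]; push_cast; ring
  have hqx := S.qx_eq hx ht
  simp only [Matrix.mul_apply, Fin.sum_univ_three, gaugeG]
  fin_cases i
  · simp [comp, pertX, hqx]
    refine (hq.mul a0).congr_deriv ?_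
    push_cast
    field_simp
  · simp [comp, pertX]
    refine a1.congr_deriv ?_
    field_simp
  · simp [comp, pertX, hqx]
    refine ((hq.inv h0').mul a2).congr_deriv ?_
    simp only [Pi.inv_apply, hm]
    push_cast
    field_simp
    ring

lemma hasDerivAt_gauge_t {k : ℂ} (hk : Good k) {x t : ℝ} (hx : 0 ≤ x) (ht : t ∈ Icc 0 T)
    (i j : Fin 3) :
    HasDerivAt (fun s => (gaugeG u x s * laxMat u (lam k) x s) i j)
      ((((1 : ℂ) • compT k + (-(u x t * q u x t) : ℂ) • comp k + pertT u x t k)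
        * (gaugeG u x t * laxMat u (lam k) x t)) i j) t := by
  obtain ⟨a0, a1, a2⟩ := S.hasDerivAt_laxMat_t hk.lam_ne_zero hx ht j
  have hl := hk.lam_ne_zero
  have h0 : q u x t ≠ 0 := (S.q_pos hx ht).ne'
  have h0' : (q u x t : ℂ) ≠ 0 := by exact_mod_cast h0
  have hq := (S.hasDerivAt_q_t hx ht).ofReal_comp
  have hm : (mass u x t : ℂ) = (q u x t : ℂ) ^ 3 := by rw [← S.q_cube hx ht]; push_cast; ring
  have hqx := S.qx_eq hx ht
  simp only [Matrix.mul_apply, Fin.sum_univ_three, gaugeG]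
  fin_cases i
  · simp [comp, compT, pertT, hqx]
    refine (hq.mul a0).congr_deriv ?_
    push_cast
    field_simp
    ring
  · simp [comp, compT, pertT]
    refine a1.congr_deriv ?_
    field_simp
    ring
  · simp [comp, compT, pertT, hqx]
    refine ((hq.inv h0').mul a2).congr_deriv ?_
    simp only [Pi.inv_apply, hm]
    push_cast
    field_simp
    ring

/-- The shear is chosen to cancel the diagonal perturbation q_x/q and leave only a multiple of the
lower shift, which is small after conjugation by P. -/
lemma hasDerivAt_shear_x (k : ℂ) {x t : ℝ} (hx : 0 ≤ x) (ht : t ∈ Icc 0 T) (i j : Fin 3) :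
    HasDerivAt (fun ξ => (shear u ξ t * gaugeG u ξ t * laxMat u (lam k) ξ t) i j)
      ((((0 : ℂ) • compT k + (q u x t : ℂ) • comp k
        + ((q u x t * hCoef u x t : ℝ) : ℂ) • lowShift)
        * (shear u x t * gaugeG u x t * laxMat u (lam k) x t)) i j) x := by
  obtain ⟨a0, a1, a2⟩ := S.hasDerivAt_laxMat_x (lam k) x t j
  have h0 : q u x t ≠ 0 := (S.q_pos hx ht).ne'
  have h0' : (q u x t : ℂ) ≠ 0 := by exact_mod_cast h0
  have hq := (S.hasDerivAt_q_x hx ht).ofReal_comp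
  have hb := (S.hasDerivAt_bq_x hx ht).ofReal_comp
  have he := (S.hasDerivAt_eM_x hx ht).ofReal_comp
  have hm : (mass u x t : ℂ) = (q u x t : ℂ) ^ 3 := by rw [← S.q_cube hx ht]; push_cast; ring
  simp only [Matrix.mul_apply, Fin.sum_univ_three, gaugeG]
  fin_cases i
  · simp [comp, shear, lowShift, laxA₁]
    refine (hq.mul a0).congr_deriv ?_
    push_cast
    ring
  · simp [comp, shear, lowShift, laxA₁, hCoef]
    refine (((hb.mul hq).mul a0).add a1).congr_deriv ?_
    simp only [Pi.mul_apply, eM]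
    push_cast
    field_simp
    ring
  · simp [comp, shear, lowShift, laxA₁, hCoef]
    refine ((((he.mul hq).mul a0).add (hb.mul a1)).add ((hq.inv h0').mul a2)).congr_deriv ?_
    simp only [Pi.mul_apply, Pi.inv_apply, hm, eM]
    push_cast
    field_simp
    ring

/-- The same shear also removes the large part from the t-equation: what is independent of λ is
again a multiple of the lower shift, and the rest carries a factor λ⁻¹. -/
lemma hasDerivAt_shear_t {k : ℂ} (hk : Good k) {x t : ℝ} (hx : 0 ≤ x) (ht : t ∈ Icc 0 T)
    (i j : Fin 3) :
    HasDerivAt (fun s => (shear u x s * gaugeG u x s * laxMat u (lam k) x s) i j)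
      ((((1 : ℂ) • compT k + (-(u x t * q u x t) : ℂ) • comp k
        + ((nCoef u x t : ℂ) • lowShift + (lam k)⁻¹ • (nMat u x t).map (fun r : ℝ => (r : ℂ))))
        * (shear u x t * gaugeG u x t * laxMat u (lam k) x t)) i j) t := by
  obtain ⟨a0, a1, a2⟩ := S.hasDerivAt_laxMat_t hk.lam_ne_zero hx ht j
  have hl := hk.lam_ne_zero
  have h0 : q u x t ≠ 0 := (S.q_pos hx ht).ne'
  have h0' : (q u x t : ℂ) ≠ 0 := by exact_mod_cast h0
  have hq := (S.hasDerivAt_q_t hx ht).ofReal_comp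
  have hb := (S.hasDerivAt_bq_t hx ht).ofReal_comp
  have he := (S.hasDerivAt_eM_t hx ht).ofReal_comp
  have hm : (mass u x t : ℂ) = (q u x t : ℂ) ^ 3 := by rw [← S.q_cube hx ht]; push_cast; ring
  have hu2 : (dx 2 u x t : ℂ) = u x t + 1 - (q u x t : ℂ) ^ 3 := by
    have := S.q_cube hx ht
    unfold mass at this
    have h2 : dx 2 u x t = u x t + 1 - q u x t ^ 3 := by linarith
    rw [h2]
    push_cast
    ring
  simp only [Matrix.mul_apply, Fin.sum_univ_three, gaugeG]
  fin_cases i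
  · simp [comp, compT, shear, lowShift, laxA₁, nMat]
    refine (hq.mul a0).congr_deriv ?_
    simp only [eM, eP]
    push_cast
    field_simp
    ring
  · simp [comp, compT, shear, lowShift, laxA₁, nMat, nCoef]
    refine (((hb.mul hq).mul a0).add a1).congr_deriv ?_
    simp only [Pi.mul_apply, eM, eP]
    push_cast
    rw [hu2]
    field_simp
    ring
  · simp [comp, compT, shear, lowShift, laxA₁, nMat, nCoef]
    refine ((((he.mul hq).mul a0).add (hb.mul a1)).add ((hq.inv h0').mul a2)).congr_deriv ?_
    simp only [Pi.mul_apply, Pi.inv_apply, hm, eM, eP]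
    push_cast
    rw [hu2]
    field_simp
    ring

end Regular


/-! ### Propagators and the size of their perturbations -/

/-- A fundamental matrix of a pair of compatible linear systems with diagonal leading part and
integrable perturbations. -/
structure Propagator (T : ℝ) (u : ℝ → ℝ → ℝ) (B : ℝ) (l z : Fin 3 → ℂ)
    (Y a U : ℝ → ℝ → Matrix (Fin 3) (Fin 3) ℂ) : Prop where
  nonneg : 0 ≤ B
  deriv_x : ∀ {x t : ℝ}, 0 ≤ x → t ∈ Icc 0 T → ∀ i j, HasDerivAt (fun ξ => Y ξ t i j)
    (q u x t * l i * Y x t i j + ∑ r, a x t i r * Y x t r j) x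
  deriv_t : ∀ {x t : ℝ}, 0 ≤ x → t ∈ Icc 0 T → ∀ i j, HasDerivAt (fun s => Y x s i j)
    ((z i - u x t * q u x t * l i) * Y x t i j + ∑ r, U x t i r * Y x t r j) t
  norm_a : ∀ {x t : ℝ}, 0 ≤ x → t ∈ Icc 0 T → ∀ i r, ‖a x t i r‖ ≤ B / (1 + x) ^ 2
  norm_U : ∀ {x t : ℝ}, 0 ≤ x → t ∈ Icc 0 T → ∀ i r, ‖U x t i r‖ ≤ B / (1 + x) ^ 2
  det_eq : ∀ {x t : ℝ}, 0 ≤ x → t ∈ Icc 0 T → (Y x t).det = 1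
  sum_l : l 0 + l 1 + l 2 = 0

lemma sum_three_perm {M : Type*} [AddCommMonoid M] (f : Fin 3 → M) (σ : Equiv.Perm (Fin 3)) :
    f (σ 0) + f (σ 1) + f (σ 2) = f 0 + f 1 + f 2 := by
  rw [← Fin.sum_univ_three f, ← Fin.sum_univ_three fun i => f (σ i)]
  exact Equiv.sum_comp σ f

/-- Reordering of the components. -/
lemma Propagator.perm {T : ℝ} {u : ℝ → ℝ → ℝ} {B : ℝ} {l z : Fin 3 → ℂ}
    {Y a U : ℝ → ℝ → Matrix (Fin 3) (Fin 3) ℂ} (h : Propagator T u B l z Y a U)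
    (σ : Equiv.Perm (Fin 3)) :
    Propagator T u B (l ∘ σ) (z ∘ σ) (fun x t => (Y x t).submatrix σ σ)
      (fun x t => (a x t).submatrix σ σ) (fun x t => (U x t).submatrix σ σ) where
  nonneg := h.nonneg
  deriv_x hx ht i j := by
    refine (h.deriv_x hx ht (σ i) (σ j)).congr_deriv ?_
    simp only [Matrix.submatrix_apply, Function.comp_apply]
    rw [← Equiv.sum_comp σ]
  deriv_t hx ht i j := by
    refine (h.deriv_t hx ht (σ i) (σ j)).congr_deriv ?_
    simp only [Matrix.submatrix_apply, Function.comp_apply]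
    rw [← Equiv.sum_comp σ]
  norm_a hx ht i r := h.norm_a hx ht _ _
  norm_U hx ht i r := h.norm_U hx ht _ _
  det_eq hx ht := by rw [Matrix.det_submatrix_equiv_self, h.det_eq hx ht]
  sum_l := by
    simp only [Function.comp_apply]
    rw [sum_three_perm, h.sum_l]

lemma sum_l_eq_zero {k : ℂ} (hk : k ≠ 0) : l k 0 + l k 1 + l k 2 = 0 := by
  have h3 := om_cube
  have h2 := om_sum
  rw [l_form hk, l_form hk, l_form hk]
  simp only [Fin.val_zero, Fin.val_one, Fin.val_two]
  linear_combination (k / (Real.sqrt 3 : ℂ) * om + 1 / ((Real.sqrt 3 : ℂ) * k) * om ^ 2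
    * (om ^ 2 - om + 1)) * h2

/-- The perturbation of the `x`-equation after the shear. -/
def shearX (u : ℝ → ℝ → ℝ) (k : ℂ) (x t : ℝ) : Matrix (Fin 3) (Fin 3) ℂ :=
  Pinv k * (((q u x t * hCoef u x t : ℝ) : ℂ) • lowShift) * P k

/-- The perturbation of the `t`-equation after the shear. -/
def shearT (u : ℝ → ℝ → ℝ) (k : ℂ) (x t : ℝ) : Matrix (Fin 3) (Fin 3) ℂ :=
  Pinv k * ((nCoef u x t : ℂ) • lowShift + (lam k)⁻¹ • (nMat u x t).map (fun r : ℝ => (r : ℂ)))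
    * P k

/-- The deviation of the shear from the identity, in the diagonalizing basis. -/
def shearDev (u : ℝ → ℝ → ℝ) (k : ℂ) (x t : ℝ) : Matrix (Fin 3) (Fin 3) ℂ :=
  Pinv k * ((bq u x t : ℂ) • lowShift + (eM u x t : ℂ) • laxA₁) * P k

/-- The deviation of the inverse shear from the identity, in the diagonalizing basis. -/
def unshearDev (u : ℝ → ℝ → ℝ) (k : ℂ) (x t : ℝ) : Matrix (Fin 3) (Fin 3) ℂ :=
  Pinv k * ((-bq u x t : ℂ) • lowShift + (eP u x t : ℂ) • laxA₁) * P k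

lemma Good.propS_eq {k : ℂ} (hk : Good k) (u : ℝ → ℝ → ℝ) (x t : ℝ) :
    propS u k x t = propT u k x t + shearDev u k x t * propT u k x t := by
  have h : Pinv k * shear u x t = (1 + shearDev u k x t) * Pinv k := by
    rw [shear, shearDev, Matrix.mul_add, Matrix.add_mul, Matrix.mul_one, Matrix.one_mul,
      Matrix.mul_assoc (Pinv k * _), hk.P_mul_Pinv, Matrix.mul_one]
  unfold propS propT
  rw [Matrix.mul_assoc (shear u x t), ← Matrix.mul_assoc (Pinv k), h, Matrix.add_mul,
    Matrix.one_mul, Matrix.add_mul, Matrix.add_mul]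
  simp only [Matrix.mul_assoc]

lemma Good.propT_eq {k : ℂ} (hk : Good k) (u : ℝ → ℝ → ℝ) (x t : ℝ) :
    propT u k x t = propS u k x t + unshearDev u k x t * propS u k x t := by
  have h : Pinv k * unshear u x t = (1 + unshearDev u k x t) * Pinv k := by
    rw [unshear, unshearDev, Matrix.mul_add, Matrix.add_mul, Matrix.mul_one, Matrix.one_mul,
      Matrix.mul_assoc (Pinv k * _), hk.P_mul_Pinv, Matrix.mul_one]
  have e : gaugeG u x t * laxMat u (lam k) x t
      = unshear u x t * (shear u x t * gaugeG u x t * laxMat u (lam k) x t) := by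
    rw [← Matrix.mul_assoc, ← Matrix.mul_assoc, unshear_mul_shear, Matrix.one_mul]
  unfold propT
  rw [e, ← Matrix.mul_assoc (Pinv k), h]
  unfold propS
  rw [Matrix.add_mul, Matrix.one_mul, Matrix.add_mul, Matrix.add_mul]
  simp only [Matrix.mul_assoc]

lemma norm_conj_comb_le (k c d : ℂ) (i j : Fin 3) :
    ‖(Pinv k * (c • lowShift + d • laxA₁) * P k) i j‖ ≤ beta k * (‖c‖ + ‖d‖) := by
  rw [Matrix.mul_add, Matrix.add_mul, Matrix.mul_smul, Matrix.smul_mul, Matrix.mul_smul,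
    Matrix.smul_mul, Matrix.add_apply, Matrix.smul_apply, Matrix.smul_apply, smul_eq_mul,
    smul_eq_mul]
  refine (norm_add_le _ _).trans ?_
  rw [norm_mul, norm_mul]
  have h1 := mul_le_mul_of_nonneg_left (norm_conj_lowShift_le k i j) (norm_nonneg c)
  have h2 := mul_le_mul_of_nonneg_left (norm_conj_laxA₁_le k i j) (norm_nonneg d)
  linarith

lemma exists_common_decay {ι : Type*} [Fintype ι] {T : ℝ} {f : ι → ℝ → ℝ → ℝ}
    (h : ∀ i, Decays T (f i)) : ∃ C : ℝ, 0 ≤ C ∧ ∀ i, ∀ x t : ℝ, 0 ≤ x → t ∈ Icc 0 T →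
      |f i x t| ≤ C / (1 + x) ^ 2 := by
  choose C hC h using h
  refine ⟨∑ i, C i, Finset.sum_nonneg fun i _ => hC i, fun i x t hx ht =>
    (h i x t hx ht).trans ?_⟩
  gcongr
  exact Finset.single_le_sum (fun i _ => hC i) (Finset.mem_univ i)

namespace Regular

variable {T : ℝ} {u : ℝ → ℝ → ℝ} (S : Regular T u)

include S

lemma decays_inv_sq : Decays T fun x t => (q u x t)⁻¹ ^ 2 - 1 := by
  have h := Decays.mul (((boundedOnStrip_const T (-1)).mul (S.bounded_q.add
    (boundedOnStrip_const T 1))).mul (S.bounded_inv_q.mul S.bounded_inv_q)) S.decays_q_sub_one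
  refine h.congr fun x t hx ht => ?_
  have h0 : q u x t ≠ 0 := (S.q_pos hx ht).ne'
  field_simp
  ring

lemma decays_q_sq : Decays T fun x t => q u x t ^ 2 - 1 := by
  have h := Decays.mul (S.bounded_q.add (boundedOnStrip_const T 1)) S.decays_q_sub_one
  exact h.congr fun x t hx ht => by ring

lemma decays_eP : Decays T (eP u) := by
  have h := Decays.mul (boundedOnStrip_const T (1 / 2))
    ((Decays.mul S.decays_bq.bounded S.decays_bq).add S.decays_inv_sq)
  exact h.congr fun x t hx ht => by unfold eP; ring

lemma decays_eM : Decays T (eM u) := by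
  have h := Decays.mul (boundedOnStrip_const T (1 / 2))
    ((Decays.mul S.decays_bq.bounded S.decays_bq).add
      (Decays.mul (boundedOnStrip_const T (-1)) S.decays_inv_sq))
  exact h.congr fun x t hx ht => by unfold eM; ring

lemma decays_hCoef : Decays T fun x t => q u x t * hCoef u x t := by
  have h := S.decays_bqx.add (Decays.mul S.bounded_q S.decays_eP)
  refine h.congr fun x t hx ht => ?_
  have h0 : q u x t ≠ 0 := (S.q_pos hx ht).ne'
  unfold hCoef eP
  field_simp
  ring

lemma decays_nCoef : Decays T (nCoef u) := by
  have h := S.decays_q_sq.add (Decays.mul (boundedOnStrip_const T (-1))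
    ((Decays.mul S.decays_u.bounded S.decays_bqx).add
      (Decays.mul (S.decays_u.bounded.mul S.bounded_q) S.decays_eP)))
  exact h.congr fun x t hx ht => by unfold nCoef; ring

lemma decays_nMat (i j : Fin 3) : Decays T fun x t => nMat u x t i j := by
  have hq2 := S.bounded_q.mul S.bounded_q
  have hb := S.decays_bq
  have he := S.decays_eP
  have hm := S.decays_eM
  have hc := boundedOnStrip_const T (-1)
  have h1 := Decays.mul hq2 he
  have h2 := (Decays.mul hq2 he).bounded.add hc
  fin_cases i <;> fin_cases j
  · exact h1.congr fun x t hx ht => by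
      simp [nMat, -mul_eq_mul_left_iff, -mul_eq_mul_right_iff]
      ring
  · exact (Decays.mul (hc.mul hq2) hb).congr fun x t hx ht => by
      simp [nMat, -mul_eq_mul_left_iff, -mul_eq_mul_right_iff]
      ring
  · exact S.decays_q_sq.congr fun x t hx ht => by simp [nMat]
  · exact (Decays.mul h2 hb).congr fun x t hx ht => by
      simp [nMat, -mul_eq_mul_left_iff, -mul_eq_mul_right_iff]
      ring
  · exact (Decays.mul ((hc.mul hq2).mul hb.bounded) hb).congr fun x t hx ht => by
      simp [nMat, -mul_eq_mul_left_iff, -mul_eq_mul_right_iff]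
      ring
  · exact (Decays.mul hq2 hb).congr fun x t hx ht => by
      simp [nMat, -mul_eq_mul_left_iff, -mul_eq_mul_right_iff]
      ring
  · exact (Decays.mul h2 hm).congr fun x t hx ht => by
      simp [nMat, -mul_eq_mul_left_iff, -mul_eq_mul_right_iff]
      ring
  · exact (Decays.mul ((hc.mul hq2).mul hm.bounded) hb).congr fun x t hx ht => by
      simp [nMat, -mul_eq_mul_left_iff, -mul_eq_mul_right_iff]
      ring
  · exact (Decays.mul hq2 hm).congr fun x t hx ht => by
      simp [nMat, -mul_eq_mul_left_iff, -mul_eq_mul_right_iff]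
      ring

lemma decays_pertX : ∃ C : ℝ, 0 ≤ C ∧ ∀ x t : ℝ, 0 ≤ x → t ∈ Icc 0 T → ∀ i j,
    ‖pertX u x t i j‖ ≤ C / (1 + x) ^ 2 := by
  have h1 : Decays T fun x t => qx u x t / q u x t := (Decays.mul S.bounded_q S.decays_bq).congr
    fun x t hx ht => by
      have h0 : q u x t ≠ 0 := (S.q_pos hx ht).ne'
      rw [S.qx_eq hx ht]
      field_simp
  have h2 : Decays T fun x t => 1 / q u x t - q u x t :=
    (Decays.mul S.bounded_q S.decays_inv_sq).congr fun x t hx ht => by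
      have h0 : q u x t ≠ 0 := (S.q_pos hx ht).ne'
      field_simp
  obtain ⟨C, hC, h⟩ := exists_common_decay (ι := Bool)
    (f := fun i => if i then fun x t => qx u x t / q u x t else fun x t => 1 / q u x t - q u x t)
    (fun i => by cases i; exacts [h2, h1])
  refine ⟨C, hC, fun x t hx ht i j => ?_⟩
  have h1 := h true x t hx ht
  have h2 := h false x t hx ht
  simp only [if_true, Bool.false_eq_true, if_false] at h1 h2
  have h3 : 0 ≤ C / (1 + x) ^ 2 := by positivity
  fin_cases i <;> fin_cases j <;> simp only [pertX] <;>
    simp only [Fin.mk_one, Fin.zero_eta, Fin.reduceFinMk, Matrix.of_apply, Matrix.cons_val_zero,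
      Matrix.cons_val_one, Matrix.cons_val, Complex.norm_real, Real.norm_eq_abs, norm_zero,
      abs_neg] <;> assumption

lemma decays_pertT (k : ℂ) : ∃ C : ℝ, 0 ≤ C ∧ ∀ x t : ℝ, 0 ≤ x → t ∈ Icc 0 T → ∀ i j,
    ‖pertT u x t k i j‖ ≤ C / (1 + x) ^ 2 := by
  have hi := S.bounded_inv_q
  have h1 : Decays T fun x t => u x t * qx u x t / q u x t :=
    (Decays.mul (S.decays_u.bounded.mul S.bounded_q) S.decays_bq).congr
    fun x t hx ht => by
      have h0 : q u x t ≠ 0 := (S.q_pos hx ht).ne'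
      rw [S.qx_eq hx ht]
      field_simp
  have hi1 : Decays T fun x t => 1 / q u x t - 1 :=
    (Decays.mul ((boundedOnStrip_const T (-1)).mul hi) S.decays_q_sub_one).congr fun x t hx ht => by
      have h0 : q u x t ≠ 0 := (S.q_pos hx ht).ne'
      field_simp
      ring
  have h2 : Decays T fun x t => (u x t + 1) / q u x t - 1 :=
    ((Decays.mul hi S.decays_u).add hi1).congr fun x t hx ht => by
      have h0 : q u x t ≠ 0 := (S.q_pos hx ht).ne'
      field_simp
      ring
  have h3 : Decays T fun x t => dx 1 u x t / q u x t ^ 2 :=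
    (Decays.mul (hi.mul hi) (S.decays_dx (a := 1) (by norm_num))).congr fun x t hx ht => by
      have h0 : q u x t ≠ 0 := (S.q_pos hx ht).ne'
      field_simp
  have h4 : Decays T fun x t => 1 / q u x t - 1 + u x t * q u x t :=
    (hi1.add (Decays.mul S.bounded_q S.decays_u)).congr fun x t hx ht => by ring
  have h5 : Decays T fun x t => (q u x t ^ 2 - 1) * ‖lam k‖⁻¹ :=
    (Decays.mul (boundedOnStrip_const T ‖lam k‖⁻¹) S.decays_q_sq).congr fun x t hx ht => by ring
  obtain ⟨C, hC, h⟩ := exists_common_decay (ι := Fin 5)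
    (f := ![fun x t => u x t * qx u x t / q u x t, fun x t => (u x t + 1) / q u x t - 1,
      fun x t => dx 1 u x t / q u x t ^ 2, fun x t => 1 / q u x t - 1 + u x t * q u x t,
      fun x t => (q u x t ^ 2 - 1) * ‖lam k‖⁻¹])
    (fun i => by fin_cases i; exacts [h1, h2, h3, h4, h5])
  refine ⟨C, hC, fun x t hx ht i j => ?_⟩
  have e1 := h 0 x t hx ht
  have e2 := h 1 x t hx ht
  have e3 := h 2 x t hx ht
  have e4 := h 3 x t hx ht
  have e5 := h 4 x t hx ht
  simp only [Matrix.cons_val_zero, Matrix.cons_val_one, Matrix.cons_val] at e1 e2 e3 e4 e5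
  rw [abs_mul, abs_inv, abs_norm, ← div_eq_mul_inv, ← Real.norm_eq_abs, ← Complex.norm_real,
    ← norm_div] at e5
  have h3 : 0 ≤ C / (1 + x) ^ 2 := by positivity
  fin_cases i <;> fin_cases j <;> simp only [pertT] <;>
    simp only [Fin.mk_one, Fin.zero_eta, Fin.reduceFinMk, Matrix.of_apply, Matrix.cons_val_zero,
      Matrix.cons_val_one, Matrix.cons_val, Matrix.add_apply, Matrix.smul_apply, smul_eq_mul,
      mul_zero, mul_one, add_zero, zero_add, Complex.norm_real, Real.norm_eq_abs, norm_zero,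
      abs_neg] <;> assumption

lemma det_gaugeG {x t : ℝ} (hx : 0 ≤ x) (ht : t ∈ Icc 0 T) : (gaugeG u x t).det = 1 := by
  have h0' : (q u x t : ℂ) ≠ 0 := by exact_mod_cast (S.q_pos hx ht).ne'
  simp [gaugeG, Matrix.det_fin_three, h0']

lemma det_base {k : ℂ} (hk : Good k) :
    (Pinv k).det * (!![(q u 0 0 : ℂ)⁻¹, 0, 0; 0, 1, 0; 0, 0, (q u 0 0 : ℂ)] * P k).det = 1 := by
  have h0' : (q u 0 0 : ℂ) ≠ 0 := by
    exact_mod_cast (S.q_pos le_rfl ⟨le_rfl, S.pos.le⟩).ne'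
  have h1 : (Pinv k).det * (P k).det = 1 := by rw [← Matrix.det_mul, hk.Pinv_mul, Matrix.det_one]
  have h2 : (!![(q u 0 0 : ℂ)⁻¹, 0, 0; 0, 1, 0; 0, 0, (q u 0 0 : ℂ)]).det = 1 := by
    simp [Matrix.det_fin_three, h0']
  rw [Matrix.det_mul, h2, one_mul, h1]

lemma det_propT {k : ℂ} (hk : Good k) {x t : ℝ} (hx : 0 ≤ x) (ht : t ∈ Icc 0 T) :
    (propT u k x t).det = 1 := by
  rw [propT, Matrix.det_mul, Matrix.det_mul, Matrix.det_mul, S.det_gaugeG hx ht, S.det_laxMat,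
    mul_one, mul_one, S.det_base hk]

lemma det_propS {k : ℂ} (hk : Good k) {x t : ℝ} (hx : 0 ≤ x) (ht : t ∈ Icc 0 T) :
    (propS u k x t).det = 1 := by
  have h2 : (shear u x t).det = 1 := by
    simp [Matrix.det_fin_three, shear, lowShift, laxA₁]
  rw [propS, Matrix.det_mul, Matrix.det_mul, Matrix.det_mul, Matrix.det_mul, S.det_gaugeG hx ht,
    S.det_laxMat, h2, mul_one, mul_one, mul_one, S.det_base hk]

lemma propT_zero {k : ℂ} (hk : Good k) : propT u k 0 0 = 1 := by
  have h0' : (q u 0 0 : ℂ) ≠ 0 := by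
    exact_mod_cast (S.q_pos le_rfl ⟨le_rfl, S.pos.le⟩).ne'
  have e : gaugeG u 0 0 * !![(q u 0 0 : ℂ)⁻¹, 0, 0; 0, 1, 0; 0, 0, (q u 0 0 : ℂ)] = 1 := by
    ext i j
    rw [Matrix.mul_apply, Fin.sum_univ_three]
    fin_cases i <;> fin_cases j <;> simp [gaugeG, h0']
  rw [propT, S.laxMat_zero, Matrix.mul_one, Matrix.mul_assoc, ← Matrix.mul_assoc (gaugeG u 0 0), e,
    Matrix.one_mul, hk.Pinv_mul]

omit S in
-- Conjugation by P diagonalizes both constant parts, so one statement serves the x- and the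
-- t-equation in either gauge.
lemma hasDerivAt_conj {k : ℂ} (hk : Good k) {c d : ℂ} {N C : Matrix (Fin 3) (Fin 3) ℂ}
    {F : ℝ → Matrix (Fin 3) (Fin 3) ℂ} {x : ℝ}
    (h : ∀ i j, HasDerivAt (fun ξ => F ξ i j)
      (((d • compT k + c • comp k + N) * F x) i j) x) (i j : Fin 3) :
    HasDerivAt (fun ξ => (Pinv k * F ξ * C) i j) ((d * z k i + c * l k i) * (Pinv k * F x * C) i j
      + ∑ r, (Pinv k * N * P k) i r * (Pinv k * F x * C) r j) x := by
  have h1 := hasDerivWithinAt_mul_mul (Pinv k) C (fun i j => (h i j).hasDerivWithinAt (s := univ))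
    i j
  rw [hasDerivWithinAt_univ] at h1
  refine h1.congr_deriv ?_
  rw [← Matrix.mul_assoc, hk.Pinv_mul_split, Matrix.mul_assoc _ (Pinv k), Matrix.mul_assoc _ _ C,
    Matrix.add_mul, Matrix.add_apply, Matrix.add_mul, Matrix.add_apply,
    Matrix.mul_apply (M := Pinv k * N * P k)]
  simp only [calZ, calL, Matrix.smul_mul, Matrix.smul_apply, Matrix.diagonal_mul, smul_eq_mul]
  ring

/-- The propagator in the original gauge. -/
lemma propagator_propT {k : ℂ} (hk : Good k) :
    ∃ B : ℝ, Propagator T u B (l k) (z k) (propT u k) (fun x t => V1 u x t k)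
      (fun x t => V2 u x t k) := by
  obtain ⟨C₁, hC₁, h₁⟩ := S.decays_pertX
  obtain ⟨C₂, hC₂, h₂⟩ := S.decays_pertT k
  set K : ℝ := ∑ i, ∑ j, (∑ r, ‖Pinv k i r‖) * (∑ s, ‖P k s j‖)
  have hK : ∀ i j, (∑ r, ‖Pinv k i r‖) * (∑ s, ‖P k s j‖) ≤ K := fun i j => by
    refine le_trans ?_ (Finset.single_le_sum
      (f := fun i => ∑ j, (∑ r, ‖Pinv k i r‖) * (∑ s, ‖P k s j‖))
      (fun i _ => Finset.sum_nonneg fun j _ => by positivity) (Finset.mem_univ i))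
    exact Finset.single_le_sum (f := fun j => (∑ r, ‖Pinv k i r‖) * (∑ s, ‖P k s j‖))
      (fun j _ => by positivity) (Finset.mem_univ j)
  have hK0 : 0 ≤ K := le_trans (by positivity) (hK 0 0)
  refine ⟨K * (C₁ + C₂), by positivity, ?_, ?_, ?_, ?_, fun hx ht => S.det_propT hk hx ht,
    sum_l_eq_zero hk.1⟩
  · intro x t hx ht i j
    refine (hasDerivAt_conj hk (S.hasDerivAt_gauge_x k hx ht) i j).congr_deriv ?_
    rw [hk.V1_eq, zero_mul, zero_add]
    rfl
  · intro x t hx ht i j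
    refine (hasDerivAt_conj hk (S.hasDerivAt_gauge_t hk hx ht) i j).congr_deriv ?_
    rw [hk.V2_eq, one_mul, neg_mul, ← sub_eq_add_neg]
    rfl
  · intro x t hx ht i j
    rw [hk.V1_eq]
    refine (norm_conj_le k (h₁ x t hx ht) i j).trans ?_
    rw [mul_div_assoc]
    refine mul_le_mul (hK i j) ?_ (by positivity) hK0
    gcongr
    linarith
  · intro x t hx ht i j
    rw [hk.V2_eq]
    refine (norm_conj_le k (h₂ x t hx ht) i j).trans ?_
    rw [mul_div_assoc]
    refine mul_le_mul (hK i j) ?_ (by positivity) hK0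
    gcongr
    linarith

/-- The propagator after the shear: the perturbation is of size `beta k`. -/
lemma exists_propagator : ∃ C : ℝ, 0 ≤ C ∧ ∀ k, Good k →
    Propagator T u (C * beta k) (l k) (z k) (propS u k) (shearX u k) (shearT u k) ∧
    ∀ x t : ℝ, 0 ≤ x → t ∈ Icc 0 T → ∀ i j,
      ‖shearDev u k x t i j‖ ≤ C * beta k / (1 + x) ^ 2 ∧
      ‖unshearDev u k x t i j‖ ≤ C * beta k / (1 + x) ^ 2 := by
  obtain ⟨C₁, hC₁, h₁⟩ := S.decays_hCoef
  obtain ⟨C₂, hC₂, h₂⟩ := S.decays_nCoef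
  obtain ⟨C₃, hC₃, h₃⟩ := exists_common_decay (ι := Fin 3 × Fin 3)
    (f := fun p x t => nMat u x t p.1 p.2) fun p => S.decays_nMat p.1 p.2
  obtain ⟨C₄, hC₄, h₄⟩ := S.decays_bq
  obtain ⟨C₅, hC₅, h₅⟩ := S.decays_eM
  obtain ⟨C₆, hC₆, h₆⟩ := S.decays_eP
  set C := C₁ + C₂ + C₃ + C₄ + C₅ + C₆ with hC
  refine ⟨C, by positivity, fun k hk => ⟨⟨?_, ?_, ?_, ?_, ?_, fun hx ht => S.det_propS hk hx ht,
    sum_l_eq_zero hk.1⟩, ?_⟩⟩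
  · exact mul_nonneg (by positivity) (beta_nonneg k)
  · intro x t hx ht i j
    refine (hasDerivAt_conj hk (S.hasDerivAt_shear_x k hx ht) i j).congr_deriv ?_
    rw [zero_mul, zero_add]
    rfl
  · intro x t hx ht i j
    refine (hasDerivAt_conj hk (S.hasDerivAt_shear_t hk hx ht) i j).congr_deriv ?_
    rw [one_mul, neg_mul, ← sub_eq_add_neg]
    rfl
  · intro x t hx ht i j
    rw [shearX, Matrix.mul_smul, Matrix.smul_mul, Matrix.smul_apply, smul_eq_mul, norm_mul,
      Complex.norm_real, Real.norm_eq_abs, mul_div_right_comm]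
    refine mul_le_mul ((h₁ x t hx ht).trans ?_) (norm_conj_lowShift_le k i j) (norm_nonneg _)
      (by positivity)
    gcongr
    linarith
  · intro x t hx ht i j
    rw [shearT, Matrix.mul_add, Matrix.add_mul, Matrix.add_apply, Matrix.mul_smul, Matrix.smul_mul,
      Matrix.smul_apply, smul_eq_mul, Matrix.mul_smul, Matrix.smul_mul,
      Matrix.smul_apply, smul_eq_mul]
    have e1 : ‖(nCoef u x t : ℂ) * (Pinv k * lowShift * P k) i j‖
        ≤ C₂ / (1 + x) ^ 2 * beta k := by
      rw [norm_mul, Complex.norm_real, Real.norm_eq_abs]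
      exact mul_le_mul (h₂ x t hx ht) (norm_conj_lowShift_le k i j) (norm_nonneg _) (by positivity)
    have e2 := norm_conj_inv_lam_le k (M := (nMat u x t).map (fun r : ℝ => (r : ℂ)))
      (m := C₃ / (1 + x) ^ 2) (fun r s => by
        rw [Matrix.map_apply, Complex.norm_real, Real.norm_eq_abs]
        exact h₃ (r, s) x t hx ht) i j
    refine (norm_add_le _ _).trans ((add_le_add e1 e2).trans ?_)
    rw [mul_comm (beta k), ← add_mul, ← add_div, mul_div_right_comm]
    refine mul_le_mul_of_nonneg_right ?_ (beta_nonneg k)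
    gcongr
    linarith
  · intro x t hx ht i j
    have hm : ∀ c d : ℝ, |c| + |d| ≤ C / (1 + x) ^ 2 →
        beta k * (‖(c : ℂ)‖ + ‖(d : ℂ)‖) ≤ C * beta k / (1 + x) ^ 2 := by
      intro c d h
      rw [Complex.norm_real, Complex.norm_real, Real.norm_eq_abs, Real.norm_eq_abs, mul_comm C,
        mul_div_assoc]
      exact mul_le_mul_of_nonneg_left h (beta_nonneg k)
    constructor
    · refine (norm_conj_comb_le k _ _ i j).trans (hm _ _ ?_)
      refine (add_le_add (h₄ x t hx ht) (h₅ x t hx ht)).trans ?_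
      rw [← add_div]
      gcongr
      linarith
    · refine (norm_conj_comb_le k _ _ i j).trans ?_
      rw [norm_neg]
      refine hm _ _ ((add_le_add (h₄ x t hx ht) (h₆ x t hx ht)).trans ?_)
      rw [← add_div]
      gcongr
      linarith

end Regular


/-! ### Weighted solutions and their behaviour as x → ∞ -/

/-- The scalar weight of the column `j`. -/
def wt (u : ℝ → ℝ → ℝ) (l z : Fin 3 → ℂ) (j : Fin 3) (x t : ℝ) : ℂ :=
  Complex.exp (-(l j * y u x t + z j * t))

/-- The weighted solution with base vector `v`. -/
def wav (u : ℝ → ℝ → ℝ) (l z : Fin 3 → ℂ) (Y : ℝ → ℝ → Matrix (Fin 3) (Fin 3) ℂ) (j : Fin 3)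
    (v : Fin 3 → ℂ) (x t : ℝ) (i : Fin 3) : ℂ :=
  wt u l z j x t * (Y x t).mulVec v i

lemma wt_ne_zero (u : ℝ → ℝ → ℝ) (l z : Fin 3 → ℂ) (j : Fin 3) (x t : ℝ) : wt u l z j x t ≠ 0 :=
  Complex.exp_ne_zero _

/-- A change of weight multiplies the solution by a scalar; by the order of the Re l_j this scalar
is bounded in x when passing to a later weight. -/
lemma wav_gauge (u : ℝ → ℝ → ℝ) (l z : Fin 3 → ℂ) (Y : ℝ → ℝ → Matrix (Fin 3) (Fin 3) ℂ)
    (j j' : Fin 3) (v : Fin 3 → ℂ) (x t : ℝ) (i : Fin 3) :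
    wav u l z Y j v x t i = wt u l z j x t / wt u l z j' x t * wav u l z Y j' v x t i := by
  unfold wav
  have := wt_ne_zero u l z j' x t
  field_simp

lemma wav_smul (u : ℝ → ℝ → ℝ) (l z : Fin 3 → ℂ) (Y : ℝ → ℝ → Matrix (Fin 3) (Fin 3) ℂ)
    (j : Fin 3) (c : ℂ) (v : Fin 3 → ℂ) (x t : ℝ) (i : Fin 3) :
    wav u l z Y j (c • v) x t i = c * wav u l z Y j v x t i := by
  simp only [wav, Matrix.mulVec_smul, Pi.smul_apply, smul_eq_mul]
  ring

lemma exists_limit_of_deriv_le {f f' : ℝ → ℂ} {C x₀ : ℝ} (hx₀ : 0 ≤ x₀) (hC : 0 ≤ C)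
    (hf : ∀ x, x₀ ≤ x → HasDerivAt f (f' x) x)
    (hf' : ∀ x, x₀ ≤ x → ‖f' x‖ ≤ C / (1 + x) ^ 2) :
    ∃ L : ℂ, Tendsto f atTop (𝓝 L) ∧ ∀ x, x₀ ≤ x → ‖f x - L‖ ≤ C / (1 + x) := by
  have hdiff : ∀ x x', x₀ ≤ x → x ≤ x' → ‖f x' - f x‖ ≤ C / (1 + x) := by
    intro x x' hx hxx'
    have hd : ∀ z ∈ Icc x x', HasDerivAt (fun z => C / (1 + x) + -(C / (1 + z)))
        (C / (1 + z) ^ 2) z := fun z hz =>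
      (hasDerivAt_neg_div_one_add C (hx₀.trans (hx.trans hz.1))).const_add _
    have key := image_norm_le_of_norm_deriv_right_le_deriv_boundary' (a := x) (b := x')
      (f := fun z => f z - f x) (f' := f') (B := fun z => C / (1 + x) + -(C / (1 + z)))
      (B' := fun z => C / (1 + z) ^ 2)
      (fun z hz => ((hf z (hx.trans hz.1)).continuousAt.sub continuousAt_const).continuousWithinAt)
      (fun z hz => ((hf z (hx.trans hz.1)).sub_const _).hasDerivWithinAt)
      (by simp) (fun z hz => (hd z hz).continuousAt.continuousWithinAt)
      (fun z hz => (hd z (Ico_subset_Icc_self hz)).hasDerivWithinAt)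
      (fun z hz => hf' z (hx.trans hz.1)) (right_mem_Icc.2 hxx')
    have : 0 ≤ C / (1 + x') := div_nonneg hC (by linarith)
    linarith
  have h1 : Tendsto (fun x : ℝ => C / (1 + x)) atTop (𝓝 0) :=
    tendsto_const_nhds.div_atTop (tendsto_atTop_add_const_left _ _ tendsto_id)
  have hcauchy : CauchySeq f := by
    rw [Metric.cauchySeq_iff']
    intro ε hε
    obtain ⟨x, hx, hx'⟩ := ((h1.eventually (gt_mem_nhds hε)).and (eventually_ge_atTop x₀)).exists
    refine ⟨x, fun x' hxx' => ?_⟩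
    rw [dist_eq_norm]
    exact (hdiff x x' hx' hxx').trans_lt hx
  obtain ⟨L, hL⟩ := cauchySeq_tendsto_of_complete hcauchy
  refine ⟨L, hL, fun x hx => ?_⟩
  rw [norm_sub_rev]
  exact le_of_tendsto (hL.sub_const _).norm
    ((eventually_ge_atTop x).mono fun x' hx' => hdiff x x' hx hx')

lemma tendsto_exp_sub_one (B : ℝ) :
    Tendsto (fun x : ℝ => Real.exp (12 * B / (1 + x)) - 1) atTop (𝓝 0) := by
  have h1 : Tendsto (fun x : ℝ => 12 * B / (1 + x)) atTop (𝓝 0) :=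
    tendsto_const_nhds.div_atTop (tendsto_atTop_add_const_left _ _ tendsto_id)
  have h2 := ((Real.continuous_exp.tendsto 0).comp h1).sub_const 1
  rwa [Real.exp_zero, sub_self] at h2

lemma tendsto_zero_mul_bdd {f g : ℝ → ℂ} {K : ℝ} (hf : Tendsto f atTop (𝓝 0))
    (hg : ∀ x, 0 ≤ x → ‖g x‖ ≤ K) : Tendsto (fun x => f x * g x) atTop (𝓝 0) := by
  have h := hf.norm.mul_const K
  rw [norm_zero, zero_mul] at h
  refine squeeze_zero_norm' ?_ h
  filter_upwards [eventually_ge_atTop 0] with x hx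
  rw [norm_mul]
  exact mul_le_mul_of_nonneg_left (hg x hx) (norm_nonneg _)

lemma partialNorm_le_of_forall {φ : Fin 3 → ℂ} {K : ℝ} (h : ∀ i, ‖φ i‖ ≤ K) :
    partialNorm Finset.univ φ ≤ 3 * K := by
  refine (partialNorm_le_sum _ _).trans ?_
  rw [Fin.sum_univ_three]
  linarith [h 0, h 1, h 2]

lemma partialNorm_single (i : Fin 3) :
    partialNorm Finset.univ (Pi.single i 1 : Fin 3 → ℂ) = 1 := by
  unfold partialNorm
  rw [Finset.sum_eq_single i (fun j _ hj => by simp [Pi.single_eq_of_ne hj]) (by simp)]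
  simp

namespace Regular

variable {T : ℝ} {u : ℝ → ℝ → ℝ} (S : Regular T u)

include S

lemma hasDerivAt_wt_x (l z : Fin 3 → ℂ) (j : Fin 3) (x t : ℝ) :
    HasDerivAt (fun ξ => wt u l z j ξ t) (-(q u x t * l j) * wt u l z j x t) x := by
  have h := ((((S.hasDerivAt_y_x x t).ofReal_comp.const_mul (l j)).add_const (z j * t)).neg).cexp
  refine h.congr_deriv ?_
  simp only [wt, Pi.neg_apply]
  ring

lemma hasDerivAt_wt_t (l z : Fin 3 → ℂ) (j : Fin 3) {x t : ℝ} (hx : 0 ≤ x) (ht : t ∈ Icc 0 T) :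
    HasDerivAt (fun s => wt u l z j x s) (-(z j - u x t * q u x t * l j) * wt u l z j x t) t := by
  have h0 := (hasDerivAt_id t).ofReal_comp.const_mul (z j)
  have h := ((((S.hasDerivAt_y_t hx ht).ofReal_comp.const_mul (l j)).add h0).neg).cexp
  refine h.congr_deriv ?_
  simp only [wt, id, Pi.neg_apply, Pi.add_apply]
  push_cast
  ring

omit S in
lemma wt_zero (l z : Fin 3 → ℂ) (j : Fin 3) : wt u l z j 0 0 = 1 := by
  simp [wt, y_zero_zero]

lemma y_mono {t x x' : ℝ} (ht : t ∈ Icc 0 T) (hx : 0 ≤ x) (hxx' : x ≤ x') :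
    y u x t ≤ y u x' t := by
  refine (monotoneOn_of_deriv_nonneg (convex_Ici 0) (fun z _ =>
    (S.hasDerivAt_y_x z t).continuousAt.continuousWithinAt) (fun z _ =>
    (S.hasDerivAt_y_x z t).differentiableAt.differentiableWithinAt) fun z hz => ?_)
    (mem_Ici.2 hx) (mem_Ici.2 (hx.trans hxx')) hxx'
  rw [(S.hasDerivAt_y_x z t).deriv]
  exact (S.q_pos (interior_subset hz : z ∈ Ici 0) ht).le

/-- The quotient of the weights of a later and an earlier column is bounded. -/
lemma exists_norm_wt_div_le {l : Fin 3 → ℂ} (z : Fin 3 → ℂ) {i j : Fin 3}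
    (hij : (l i).re ≤ (l j).re) {t : ℝ} (ht : t ∈ Icc 0 T) :
    ∃ K : ℝ, ∀ x, 0 ≤ x → ‖wt u l z j x t / wt u l z i x t‖ ≤ K := by
  refine ⟨‖wt u l z j 0 t / wt u l z i 0 t‖, fun x hx => ?_⟩
  have e : ∀ x, ‖wt u l z j x t / wt u l z i x t‖
      = Real.exp (-((l j).re - (l i).re) * y u x t + ((z i).re - (z j).re) * t) := by
    intro x
    rw [wt, wt, ← Complex.exp_sub, Complex.norm_exp]
    congr 1
    simp
    ring
  rw [e, e, Real.exp_le_exp]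
  have := S.y_mono ht le_rfl hx
  nlinarith

end Regular

namespace Propagator

variable {T : ℝ} {u : ℝ → ℝ → ℝ} {B : ℝ} {l z : Fin 3 → ℂ}
  {Y a U : ℝ → ℝ → Matrix (Fin 3) (Fin 3) ℂ} (S : Regular T u) (Pr : Propagator T u B l z Y a U)

include Pr

lemma hasDerivAt_mulVec_x {x t : ℝ} (hx : 0 ≤ x) (ht : t ∈ Icc 0 T) (v : Fin 3 → ℂ) (i : Fin 3) :
    HasDerivAt (fun ξ => (Y ξ t).mulVec v i)
      (q u x t * l i * (Y x t).mulVec v i + ∑ r, a x t i r * (Y x t).mulVec v r) x := by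
  simp only [Matrix.mulVec, dotProduct, Fin.sum_univ_three]
  refine ((((Pr.deriv_x hx ht i 0).mul_const _).add ((Pr.deriv_x hx ht i 1).mul_const _)).add
    ((Pr.deriv_x hx ht i 2).mul_const _)).congr_deriv ?_
  simp only [Fin.sum_univ_three]
  ring

lemma hasDerivAt_mulVec_t {x t : ℝ} (hx : 0 ≤ x) (ht : t ∈ Icc 0 T) (v : Fin 3 → ℂ) (i : Fin 3) :
    HasDerivAt (fun s => (Y x s).mulVec v i)
      ((z i - u x t * q u x t * l i) * (Y x t).mulVec v i
        + ∑ r, U x t i r * (Y x t).mulVec v r) t := by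
  simp only [Matrix.mulVec, dotProduct, Fin.sum_univ_three]
  refine ((((Pr.deriv_t hx ht i 0).mul_const _).add ((Pr.deriv_t hx ht i 1).mul_const _)).add
    ((Pr.deriv_t hx ht i 2).mul_const _)).congr_deriv ?_
  simp only [Fin.sum_univ_three]
  ring

include S

lemma hasDerivAt_wav_x {x t : ℝ} (hx : 0 ≤ x) (ht : t ∈ Icc 0 T) (j : Fin 3) (v : Fin 3 → ℂ)
    (i : Fin 3) :
    HasDerivAt (fun ξ => wav u l z Y j v ξ t i)
      (q u x t * (l i - l j) * wav u l z Y j v x t i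
        + ∑ r, a x t i r * wav u l z Y j v x t r) x := by
  refine ((S.hasDerivAt_wt_x l z j x t).mul (Pr.hasDerivAt_mulVec_x hx ht v i)).congr_deriv ?_
  simp only [wav, Fin.sum_univ_three]
  ring

lemma hasDerivAt_wav_t {x t : ℝ} (hx : 0 ≤ x) (ht : t ∈ Icc 0 T) (j : Fin 3) (v : Fin 3 → ℂ)
    (i : Fin 3) :
    HasDerivAt (fun s => wav u l z Y j v x s i)
      ((z i - z j - u x t * q u x t * (l i - l j)) * wav u l z Y j v x t i
        + ∑ r, U x t i r * wav u l z Y j v x t r) t := by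
  refine ((S.hasDerivAt_wt_t l z j hx ht).mul (Pr.hasDerivAt_mulVec_t hx ht v i)).congr_deriv ?_
  simp only [wav, Fin.sum_univ_three]
  ring

omit Pr in
lemma re_diag_nonpos {x t : ℝ} (hx : 0 ≤ x) (ht : t ∈ Icc 0 T) {i j : Fin 3}
    (hij : (l i).re ≤ (l j).re) : ((q u x t : ℂ) * (l i - l j)).re ≤ 0 := by
  rw [Complex.re_ofReal_mul, Complex.sub_re]
  exact mul_nonpos_of_nonneg_of_nonpos (S.q_pos hx ht).le (by linarith)

lemma partialNorm_last_le (h : ∀ i, (l i).re ≤ (l 2).re) (v : Fin 3 → ℂ) {x t : ℝ} (hx : 0 ≤ x)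
    (ht : t ∈ Icc 0 T) : partialNorm Finset.univ (wav u l z Y 2 v x t)
      ≤ Real.exp (12 * B) * partialNorm Finset.univ (wav u l z Y 2 v 0 t) := by
  have key := partialNorm_le_of_system (Λ := fun x i => q u x t * (l i - l 2))
    (V := fun x => a x t) le_rfl Pr.nonneg
    (fun x hx i => (Pr.hasDerivAt_wav_x S hx ht 2 v i).hasDerivWithinAt)
    (fun x hx i => re_diag_nonpos S hx ht (h i)) (fun x hx i r => Pr.norm_a hx ht i r) le_rfl hx
  refine key.trans (mul_le_mul_of_nonneg_right (Real.exp_le_exp.2 ?_) (partialNorm_nonneg _ _))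
  have : 0 ≤ 12 * B / (1 + x) := div_nonneg (by linarith [Pr.nonneg]) (by linarith)
  rw [add_zero, div_one]
  linarith

/-- Solutions in the weight of the last column are bounded, and the last component converges. -/
lemma last_column (h : ∀ i, (l i).re ≤ (l 2).re) (v : Fin 3 → ℂ) {t : ℝ} (ht : t ∈ Icc 0 T) :
    (∃ K : ℝ, ∀ x, 0 ≤ x → ∀ i, ‖wav u l z Y 2 v x t i‖ ≤ K) ∧
    ∃ L : ℂ, Tendsto (fun x => wav u l z Y 2 v x t 2) atTop (𝓝 L) ∧ ∀ x, 0 ≤ x →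
      ‖wav u l z Y 2 v x t 2 - L‖ ≤ (Real.exp (12 * B / (1 + x)) - 1)
        * partialNorm Finset.univ (wav u l z Y 2 v x t) := by
  refine ⟨⟨_, fun x hx i => (norm_le_partialNorm (Finset.mem_univ i)).trans
    (Pr.partialNorm_last_le S h v hx ht)⟩, ?_⟩
  exact exists_limit_of_system (Λ := fun x i => q u x t * (l i - l 2))
    (V := fun x => a x t) le_rfl Pr.nonneg
    (fun x hx i => (Pr.hasDerivAt_wav_x S hx ht 2 v i).hasDerivWithinAt)
    (fun x hx i => re_diag_nonpos S hx ht (h i)) (fun x hx i r => Pr.norm_a hx ht i r)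
    (fun x hx => by simp)

omit Pr in
lemma exists_diag_bound : ∃ D : ℝ, 0 ≤ D ∧ ∀ x t, 0 ≤ x → t ∈ Icc 0 T → ∀ i j : Fin 3,
    ‖z i - z j - u x t * q u x t * (l i - l j)‖ ≤ D := by
  obtain ⟨C, hC, h⟩ := S.decays_u.bounded.mul S.bounded_q
  set K : ℝ := ∑ i, (‖l i‖ + ‖z i‖)
  have hK : ∀ i, ‖l i‖ + ‖z i‖ ≤ K := fun i =>
    Finset.single_le_sum (f := fun i => ‖l i‖ + ‖z i‖) (fun i _ => by positivity)
      (Finset.mem_univ i)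
  have hK0 : 0 ≤ K := le_trans (by positivity) (hK 0)
  refine ⟨2 * K + C * (2 * K), by positivity, fun x t hx ht i j => ?_⟩
  refine (norm_sub_le _ _).trans (add_le_add ?_ ?_)
  · refine (norm_sub_le _ _).trans ?_
    linarith [hK i, hK j, norm_nonneg (l i), norm_nonneg (l j)]
  · rw [norm_mul, ← Complex.ofReal_mul, Complex.norm_real, Real.norm_eq_abs]
    refine mul_le_mul (h x t hx ht) ((norm_sub_le _ _).trans ?_) (norm_nonneg _) hC
    linarith [hK i, hK j, norm_nonneg (z i), norm_nonneg (z j)]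

omit S in
lemma norm_U_le {x t : ℝ} (hx : 0 ≤ x) (ht : t ∈ Icc 0 T) (i r : Fin 3) : ‖U x t i r‖ ≤ B :=
  (Pr.norm_U hx ht i r).trans (div_le_self Pr.nonneg (one_le_pow₀ (by linarith)))

/-- Grönwall in t at fixed x: the coefficients of the t-equation are bounded uniformly in x, and the
time interval is finite. -/
lemma bounded_transfer {j : Fin 3} {v : Fin 3 → ℂ} {K : ℝ}
    (h : ∀ x, 0 ≤ x → ∀ i, ‖wav u l z Y j v x 0 i‖ ≤ K) :
    ∃ K' : ℝ, 0 ≤ K' ∧ ∀ x t, 0 ≤ x → t ∈ Icc 0 T → ∀ i, ‖wav u l z Y j v x t i‖ ≤ K' := by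
  obtain ⟨D, hD, hD'⟩ := exists_diag_bound (l := l) (z := z) S
  have hB := Pr.nonneg
  have hK : 0 ≤ K := (norm_nonneg _).trans (h 0 le_rfl 0)
  refine ⟨Real.exp (4 * (D + 3 * B) * T) * (3 * K), by positivity, fun x t hx ht i => ?_⟩
  have key := energy_estimate (s := Finset.univ) (φ := fun s => wav u l z Y j v x s)
    (Λ := fun s i => z i - z j - u x s * q u x s * (l i - l j)) (c := 0)
    (f := fun s i => ∑ r, U x s i r * wav u l z Y j v x s r) (g := fun _ => D + 3 * B)
    (G := fun s => 4 * (D + 3 * B) * s) ht.1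
    (fun s hs i _ => (Pr.hasDerivAt_wav_t S hx ⟨hs.1, hs.2.trans ht.2⟩ j v i).hasDerivWithinAt)
    (fun s hs i _ => (Complex.re_le_norm _).trans
      ((hD' x s hx ⟨hs.1, hs.2.trans ht.2⟩ i j).trans (by linarith)))
    (fun s hs i _ => ?_) (fun s hs => ?_) (fun s hs => by positivity) le_rfl
  · refine (norm_le_partialNorm (Finset.mem_univ i)).trans ?_
    rw [add_zero, add_zero] at key
    refine key.trans (mul_le_mul ?_ (partialNorm_le_of_forall (h x hx)) (partialNorm_nonneg _ _)
      (Real.exp_pos _).le)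
    rw [Real.exp_le_exp, mul_zero, sub_zero]
    exact mul_le_mul_of_nonneg_left ht.2 (by positivity)
  · refine (norm_sum_mul_le hB (fun i r => Pr.norm_U_le hx ⟨hs.1, hs.2.trans ht.2⟩ i r) _ i).trans
      ?_
    rw [add_zero, Fintype.card_fin]
    refine mul_le_mul_of_nonneg_right ?_ (partialNorm_nonneg _ _)
    push_cast
    linarith
  · refine (((hasDerivAt_id s).const_mul (4 * (D + 3 * B))).hasDerivWithinAt).congr_deriv ?_
    rw [Finset.card_univ, Fintype.card_fin]
    push_cast
    ring

/-- Limits of bounded solutions as `x → ∞` do not depend on `t`. -/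
lemma tendsto_transfer {j : Fin 3} {v : Fin 3 → ℂ} {K : ℝ}
    (h : ∀ x, 0 ≤ x → ∀ i, ‖wav u l z Y j v x 0 i‖ ≤ K) {i : Fin 3} {M : ℂ} (hM : M = 0 ∨ i = j)
    (hlim : Tendsto (fun x => wav u l z Y j v x 0 i) atTop (𝓝 M)) {t : ℝ} (ht : t ∈ Icc 0 T) :
    Tendsto (fun x => wav u l z Y j v x t i) atTop (𝓝 M) := by
  obtain ⟨D, hD, hD'⟩ := exists_diag_bound (l := l) (z := z) S
  obtain ⟨K', hK', hb⟩ := Pr.bounded_transfer S h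
  have hB := Pr.nonneg
  have hsingle : ∀ φ : Fin 3 → ℂ, partialNorm {i} φ = ‖φ i‖ := fun φ => by
    simp [partialNorm, Real.sqrt_sq]
  have hest : ∀ x, 0 ≤ x → ‖wav u l z Y j v x t i - M‖ ≤ Real.exp (2 * (D + 1) * t)
      * (‖wav u l z Y j v x 0 i - M‖ + 9 * B * K' / (1 + x) ^ 2) := by
    intro x hx
    have hc : 0 ≤ 9 * B * K' / (1 + x) ^ 2 := by positivity
    have key := energy_estimate (s := {i}) (φ := fun s r => wav u l z Y j v x s r - M)
      (Λ := fun s i => z i - z j - u x s * q u x s * (l i - l j)) (c := 9 * B * K' / (1 + x) ^ 2)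
      (f := fun s i => ∑ r, U x s i r * wav u l z Y j v x s r) (g := fun _ => D + 1)
      (G := fun s => 2 * (D + 1) * s) ht.1
      (fun s hs r hr => ?_)
      (fun s hs r _ => (Complex.re_le_norm _).trans
        ((hD' x s hx ⟨hs.1, hs.2.trans ht.2⟩ r j).trans (by linarith)))
      (fun s hs r _ => ?_) (fun s hs => ?_) (fun s hs => by positivity) hc
    · rw [hsingle, hsingle, mul_zero, sub_zero] at key
      linarith
    · rw [Finset.mem_singleton] at hr
      subst hr
      refine (((Pr.hasDerivAt_wav_t S hx ⟨hs.1, hs.2.trans ht.2⟩ j v r).sub_const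
        M).hasDerivWithinAt).congr_deriv ?_
      -- Subtracting the limit leaves the equation unchanged: either the limit is 0, or the diagonal
      -- coefficient of this component is 0.
      have : (z r - z j - u x s * q u x s * (l r - l j)) * M = 0 := by
        rcases hM with h | h
        · rw [h, mul_zero]
        · rw [h]; ring
      linear_combination this
    · have h1 := norm_sum_mul_le (by positivity)
        (fun i r => Pr.norm_U hx ⟨hs.1, hs.2.trans ht.2⟩ i r) (wav u l z Y j v x s) r
      have h2 := partialNorm_le_of_forall (hb x s hx ⟨hs.1, hs.2.trans ht.2⟩)
      have h3 : ‖∑ r', U x s r r' * wav u l z Y j v x s r'‖ ≤ 9 * B * K' / (1 + x) ^ 2 := by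
        refine h1.trans ((mul_le_mul_of_nonneg_left h2 (by positivity)).trans (le_of_eq ?_))
        rw [Fintype.card_fin]
        push_cast
        ring
      refine h3.trans ?_
      have h4 : 0 ≤ partialNorm {i} (fun r => wav u l z Y j v x s r - M) := partialNorm_nonneg _ _
      nlinarith
    · refine (((hasDerivAt_id s).const_mul (2 * (D + 1))).hasDerivWithinAt).congr_deriv ?_
      rw [Finset.card_singleton]
      push_cast
      ring
  rw [tendsto_iff_norm_sub_tendsto_zero] at hlim ⊢
  have h1 : Tendsto (fun x : ℝ => 9 * B * K' / (1 + x) ^ 2) atTop (𝓝 0) := by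
    refine tendsto_const_nhds.div_atTop ((tendsto_pow_atTop (by norm_num)).comp
      (tendsto_atTop_add_const_left _ _ tendsto_id))
  have h2 := (hlim.add h1).const_mul (Real.exp (2 * (D + 1) * t))
  rw [add_zero, mul_zero] at h2
  refine squeeze_zero' (Eventually.of_forall fun _ => norm_nonneg _) ?_ h2
  filter_upwards [eventually_ge_atTop 0] with x hx
  exact hest x hx

end Propagator


/-! ### The limit functional and the distinguished solutions -/

/-- The functional giving the limit of the last component in the weight of the last column. -/
def rhoVec (u : ℝ → ℝ → ℝ) (l z : Fin 3 → ℂ) (Y : ℝ → ℝ → Matrix (Fin 3) (Fin 3) ℂ) (i : Fin 3) :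
    ℂ :=
  limUnder atTop fun x : ℝ => wt u l z 2 x 0 * Y x 0 2 i

/-- The base vector of the solution which tends to the first unit vector in the weight of the first
column. -/
def jVec (u : ℝ → ℝ → ℝ) (l z : Fin 3 → ℂ) (Y : ℝ → ℝ → Matrix (Fin 3) (Fin 3) ℂ) (i : Fin 3) :
    ℂ :=
  limUnder atTop fun x : ℝ => (wt u l z 0 x 0)⁻¹ * (Y x 0).adjugate i 0

/-- The weighted solution of the adjoint equation with base row `r`. -/
def adjWav (u : ℝ → ℝ → ℝ) (l z : Fin 3 → ℂ) (Y : ℝ → ℝ → Matrix (Fin 3) (Fin 3) ℂ)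
    (r : Fin 3 → ℂ) (x t : ℝ) (i : Fin 3) : ℂ :=
  (wt u l z 0 x t)⁻¹ * Matrix.vecMul r (Y x t).adjugate i

namespace Propagator

variable {T : ℝ} {u : ℝ → ℝ → ℝ} {B : ℝ} {l z : Fin 3 → ℂ}
  {Y a U : ℝ → ℝ → Matrix (Fin 3) (Fin 3) ℂ} (S : Regular T u) (Pr : Propagator T u B l z Y a U)

include Pr

lemma adjugate_mul {x t : ℝ} (hx : 0 ≤ x) (ht : t ∈ Icc 0 T) : (Y x t).adjugate * Y x t = 1 := by
  rw [Matrix.adjugate_mul, Pr.det_eq hx ht, one_smul]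

lemma mul_adjugate {x t : ℝ} (hx : 0 ≤ x) (ht : t ∈ Icc 0 T) : Y x t * (Y x t).adjugate = 1 := by
  rw [Matrix.mul_adjugate, Pr.det_eq hx ht, one_smul]

/-- The adjugate is the inverse, as the determinant is 1. Its derivative comes from differentiating
Y⁻¹Y = 1, an identity known only for x ≥ 0, hence derivatives within the half-line. -/
lemma hasDerivWithinAt_adjugate {x t : ℝ} (hx : 0 ≤ x) (ht : t ∈ Icc 0 T) (i j : Fin 3) :
    HasDerivWithinAt (fun ξ => (Y ξ t).adjugate i j)
      (-(q u x t * l j * (Y x t).adjugate i j + ∑ r, (Y x t).adjugate i r * a x t r j))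
      (Ici 0) x := by
  have hdiff : ∀ i j, DifferentiableWithinAt ℝ (fun ξ => (Y ξ t).adjugate i j) (Ici 0) x := by
    have h : ∀ i j, DifferentiableWithinAt ℝ (fun ξ => Y ξ t i j) (Ici 0) x := fun i j =>
      (Pr.deriv_x hx ht i j).differentiableAt.differentiableWithinAt
    intro i j
    simp only [Matrix.adjugate_fin_three]
    fin_cases i <;> fin_cases j <;>
      simp only [Fin.mk_one, Fin.zero_eta, Fin.reduceFinMk, Matrix.of_apply, Matrix.cons_val_zero,
        Matrix.cons_val_one, Matrix.cons_val] <;>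
      fun_prop
  set Z' : Matrix (Fin 3) (Fin 3) ℂ := Matrix.of fun i j =>
    derivWithin (fun ξ => (Y ξ t).adjugate i j) (Ici 0) x with hZ'
  have hZd : ∀ i j, HasDerivWithinAt (fun ξ => (Y ξ t).adjugate i j) (Z' i j) (Ici 0) x :=
    fun i j => (hdiff i j).hasDerivWithinAt
  set N : Matrix (Fin 3) (Fin 3) ℂ := Matrix.of fun i r =>
    (if i = r then (q u x t : ℂ) * l i else 0) + a x t i r with hN
  have hY : ∀ i j, HasDerivAt (fun ξ => Y ξ t i j) ((N * Y x t) i j) x := by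
    intro i j
    refine (Pr.deriv_x hx ht i j).congr_deriv ?_
    rw [Matrix.mul_apply]
    simp only [hN, Matrix.of_apply, add_mul, Finset.sum_add_distrib, ite_mul, zero_mul,
      Finset.sum_ite_eq, Finset.mem_univ, if_true]
  have hzero : Z' * Y x t + (Y x t).adjugate * (N * Y x t) = 0 := by
    ext i j
    have h1 : HasDerivWithinAt (fun ξ => ((Y ξ t).adjugate * Y ξ t) i j)
        ((Z' * Y x t + (Y x t).adjugate * (N * Y x t)) i j) (Ici 0) x := by
      rw [Matrix.add_apply, Matrix.mul_apply, Matrix.mul_apply (N := N * Y x t),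
        ← Finset.sum_add_distrib]
      simp only [Matrix.mul_apply (M := (Y _ t).adjugate)]
      exact HasDerivWithinAt.fun_sum fun r _ => (hZd i r).mul (hY r j).hasDerivWithinAt
    have h2 : HasDerivWithinAt (fun ξ => ((Y ξ t).adjugate * Y ξ t) i j) 0 (Ici 0) x := by
      refine (hasDerivWithinAt_const x (Ici 0) ((1 : Matrix (Fin 3) (Fin 3) ℂ) i j)).congr
        (fun ξ hξ => ?_) ?_
      · rw [Pr.adjugate_mul hξ ht]
      · rw [Pr.adjugate_mul hx ht]
    exact (uniqueDiffOn_Ici 0 x hx).eq_deriv _ h1 h2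
  have hZN : Z' = -((Y x t).adjugate * N) := by
    have h1 := congrArg (· * (Y x t).adjugate) hzero
    simp only [Matrix.add_mul, Matrix.mul_assoc, Pr.mul_adjugate hx ht, Matrix.mul_one,
      Matrix.zero_mul] at h1
    exact eq_neg_of_add_eq_zero_left h1
  refine (hZd i j).congr_deriv ?_
  rw [hZN, Matrix.neg_apply, Matrix.mul_apply]
  simp only [hN, Matrix.of_apply, mul_add, Finset.sum_add_distrib, mul_ite, mul_zero,
    Finset.sum_ite_eq', Finset.mem_univ, if_true]
  ring

include S

lemma hasDerivWithinAt_adjWav {x t : ℝ} (hx : 0 ≤ x) (ht : t ∈ Icc 0 T) (r : Fin 3 → ℂ)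
    (i : Fin 3) :
    HasDerivWithinAt (fun ξ => adjWav u l z Y r ξ t i)
      (q u x t * (l 0 - l i) * adjWav u l z Y r x t i
        + ∑ s, -a x t s i * adjWav u l z Y r x t s) (Ici 0) x := by
  have hw := ((S.hasDerivAt_wt_x l z 0 x t).inv (wt_ne_zero u l z 0 x t)).hasDerivWithinAt
    (s := Ici 0)
  simp only [adjWav, Matrix.vecMul, dotProduct, Fin.sum_univ_three]
  refine (hw.mul ((((Pr.hasDerivWithinAt_adjugate hx ht 0 i).const_mul (r 0)).add
    ((Pr.hasDerivWithinAt_adjugate hx ht 1 i).const_mul (r 1))).add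
    ((Pr.hasDerivWithinAt_adjugate hx ht 2 i).const_mul (r 2)))).congr_deriv ?_
  have := wt_ne_zero u l z 0 x t
  simp only [Fin.sum_univ_three, Pi.inv_apply, Pi.add_apply]
  field_simp
  ring

lemma partialNorm_adj_le (h : ∀ i, (l 0).re ≤ (l i).re) (r : Fin 3 → ℂ) {x t : ℝ} (hx : 0 ≤ x)
    (ht : t ∈ Icc 0 T) : partialNorm Finset.univ (adjWav u l z Y r x t)
      ≤ Real.exp (12 * B) * partialNorm Finset.univ (adjWav u l z Y r 0 t) := by
  have key := partialNorm_le_of_system (Λ := fun x i => q u x t * (l 0 - l i))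
    (V := fun x i s => -a x t s i) le_rfl Pr.nonneg
    (fun x hx i => Pr.hasDerivWithinAt_adjWav S hx ht r i)
    (fun x hx i => re_diag_nonpos S hx ht (h i))
    (fun x hx i s => (norm_neg _).trans_le (Pr.norm_a hx ht s i)) le_rfl hx
  refine key.trans (mul_le_mul_of_nonneg_right (Real.exp_le_exp.2 ?_) (partialNorm_nonneg _ _))
  have : 0 ≤ 12 * B / (1 + x) := div_nonneg (by linarith [Pr.nonneg]) (by linarith)
  rw [add_zero, div_one]
  linarith

lemma adj_column (h : ∀ i, (l 0).re ≤ (l i).re) (r : Fin 3 → ℂ) {t : ℝ} (ht : t ∈ Icc 0 T) :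
    (∃ K : ℝ, ∀ x, 0 ≤ x → ∀ i, ‖adjWav u l z Y r x t i‖ ≤ K) ∧
    ∃ L : ℂ, Tendsto (fun x => adjWav u l z Y r x t 0) atTop (𝓝 L) ∧ ∀ x, 0 ≤ x →
      ‖adjWav u l z Y r x t 0 - L‖ ≤ (Real.exp (12 * B / (1 + x)) - 1)
        * partialNorm Finset.univ (adjWav u l z Y r x t) := by
  refine ⟨⟨_, fun x hx i => (norm_le_partialNorm (Finset.mem_univ i)).trans
    (Pr.partialNorm_adj_le S h r hx ht)⟩, ?_⟩
  exact exists_limit_of_system (Λ := fun x i => q u x t * (l 0 - l i))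
    (V := fun x i s => -a x t s i) le_rfl Pr.nonneg
    (fun x hx i => Pr.hasDerivWithinAt_adjWav S hx ht r i)
    (fun x hx i => re_diag_nonpos S hx ht (h i))
    (fun x hx i s => (norm_neg _).trans_le (Pr.norm_a hx ht s i)) (fun x hx => by simp)

/-! ### The functional of the last column -/

/-- The functional is defined at t = 0. In its own weight the last component has no diagonal term as
x → ∞, so the same functional serves all t. -/
lemma tendsto_rhoVec (h : ∀ i, (l i).re ≤ (l 2).re) (v : Fin 3 → ℂ) {t : ℝ} (ht : t ∈ Icc 0 T) :
    Tendsto (fun x => wav u l z Y 2 v x t 2) atTop (𝓝 (rhoVec u l z Y ⬝ᵥ v)) := by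
  have h0 : (0 : ℝ) ∈ Icc 0 T := ⟨le_rfl, S.pos.le⟩
  have hi : ∀ i, Tendsto (fun x : ℝ => wt u l z 2 x 0 * Y x 0 2 i) atTop
      (𝓝 (rhoVec u l z Y i)) := by
    intro i
    obtain ⟨-, L, hL, -⟩ := Pr.last_column S h (Pi.single i 1) h0
    have e : (fun x : ℝ => wt u l z 2 x 0 * Y x 0 2 i)
        = fun x => wav u l z Y 2 (Pi.single i 1) x 0 2 := by
      ext x
      simp [wav]
    rw [rhoVec, e, hL.limUnder_eq]
    exact hL
  obtain ⟨⟨K, hK⟩, -⟩ := Pr.last_column S h v h0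
  refine Pr.tendsto_transfer S hK (Or.inr rfl) ?_ ht
  have h3 := (((hi 0).mul_const (v 0)).add ((hi 1).mul_const (v 1))).add ((hi 2).mul_const (v 2))
  simp only [dotProduct, Fin.sum_univ_three]
  refine h3.congr fun x => ?_
  simp only [wav, Matrix.mulVec, dotProduct, Fin.sum_univ_three]
  ring

lemma norm_sub_rhoVec_le (h : ∀ i, (l i).re ≤ (l 2).re) (v : Fin 3 → ℂ) {x t : ℝ} (hx : 0 ≤ x)
    (ht : t ∈ Icc 0 T) :
    ‖wav u l z Y 2 v x t 2 - rhoVec u l z Y ⬝ᵥ v‖ ≤ (Real.exp (12 * B / (1 + x)) - 1)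
        * partialNorm Finset.univ (wav u l z Y 2 v x t) := by
  obtain ⟨-, L, hL, hL'⟩ := Pr.last_column S h v ht
  rw [tendsto_nhds_unique (Pr.tendsto_rhoVec S h v ht) hL]
  exact hL' x hx

/-! ### The solution of the first column -/

lemma tendsto_adjWav (h : ∀ i, (l 0).re ≤ (l i).re) (r : Fin 3 → ℂ) :
    Tendsto (fun x => adjWav u l z Y r x 0 0) atTop (𝓝 (r ⬝ᵥ jVec u l z Y)) := by
  have h0 : (0 : ℝ) ∈ Icc 0 T := ⟨le_rfl, S.pos.le⟩
  have hi : ∀ i, Tendsto (fun x : ℝ => (wt u l z 0 x 0)⁻¹ * (Y x 0).adjugate i 0) atTop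
      (𝓝 (jVec u l z Y i)) := by
    intro i
    obtain ⟨-, L, hL, -⟩ := Pr.adj_column S h (Pi.single i 1) h0
    have e : (fun x : ℝ => (wt u l z 0 x 0)⁻¹ * (Y x 0).adjugate i 0)
        = fun x => adjWav u l z Y (Pi.single i 1) x 0 0 := by
      ext x
      simp [adjWav]
    rw [jVec, e, hL.limUnder_eq]
    exact hL
  have h3 := (((hi 0).const_mul (r 0)).add ((hi 1).const_mul (r 1))).add ((hi 2).const_mul (r 2))
  simp only [dotProduct, Fin.sum_univ_three]
  refine h3.congr fun x => ?_
  simp only [adjWav, Matrix.vecMul, dotProduct, Fin.sum_univ_three]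
  ring

omit S in
-- With row i of the weighted propagator at (x,t) as base row, the adjoint solution equals the i-th
-- unit vector at that very point. Forward information on J can thus be read off from the adjoint
-- equation, which is the one that is stable towards infinity.
lemma adjWav_row {x t : ℝ} (hx : 0 ≤ x) (ht : t ∈ Icc 0 T) (i : Fin 3) :
    adjWav u l z Y (fun m => wt u l z 0 x t * Y x t i m) x t = Pi.single i 1 := by
  ext m
  have h := congrFun (congrFun (Pr.mul_adjugate hx ht) i) m
  rw [Matrix.mul_apply, Fin.sum_univ_three] at h
  have hw := wt_ne_zero u l z 0 x t
  simp only [adjWav, Matrix.vecMul, dotProduct, Fin.sum_univ_three]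
  rw [show (wt u l z 0 x t)⁻¹ * (wt u l z 0 x t * Y x t i 0 * (Y x t).adjugate 0 m
      + wt u l z 0 x t * Y x t i 1 * (Y x t).adjugate 1 m
      + wt u l z 0 x t * Y x t i 2 * (Y x t).adjugate 2 m)
      = Y x t i 0 * (Y x t).adjugate 0 m + Y x t i 1 * (Y x t).adjugate 1 m
        + Y x t i 2 * (Y x t).adjugate 2 m by field_simp, h, Matrix.one_apply, Pi.single_apply]
  simp only [eq_comm]

/-- For the base row of `adjWav_row` the pairing with J is component i of the solution at (x,t). It
is also the limit of an adjoint solution of norm 1 at x, so the general rate of convergence applies.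
-/
lemma norm_sub_single_le_of_tendsto (h : ∀ i, (l 0).re ≤ (l i).re) {t : ℝ} (ht : t ∈ Icc 0 T)
    (hr : ∀ r : Fin 3 → ℂ, Tendsto (fun x => adjWav u l z Y r x t 0) atTop
      (𝓝 (r ⬝ᵥ jVec u l z Y))) {x : ℝ} (hx : 0 ≤ x) (i : Fin 3) :
    ‖wav u l z Y 0 (jVec u l z Y) x t i - (Pi.single 0 1 : Fin 3 → ℂ) i‖
      ≤ Real.exp (12 * B / (1 + x)) - 1 := by
  obtain ⟨-, L, hL, hL'⟩ := Pr.adj_column S h (fun m => wt u l z 0 x t * Y x t i m) ht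
  have h1 := hL' x hx
  rw [← tendsto_nhds_unique (hr _) hL, Pr.adjWav_row hx ht, partialNorm_single, mul_one,
    norm_sub_rev] at h1
  have e1 : (fun m => wt u l z 0 x t * Y x t i m) ⬝ᵥ jVec u l z Y
      = wav u l z Y 0 (jVec u l z Y) x t i := by
    simp only [wav, Matrix.mulVec, dotProduct, Fin.sum_univ_three]
    ring
  have e2 : (Pi.single i 1 : Fin 3 → ℂ) 0 = (Pi.single 0 1 : Fin 3 → ℂ) i := by
    simp only [Pi.single_apply, eq_comm]
  rwa [e1, e2] at h1

/-- At t = 0 the required pairing limits are the definition of J; the limits of the solution are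
then carried to the other times. -/
lemma tendsto_jVec (h : ∀ i, (l 0).re ≤ (l i).re) {t : ℝ} (ht : t ∈ Icc 0 T) (i : Fin 3) :
    Tendsto (fun x => wav u l z Y 0 (jVec u l z Y) x t i) atTop
      (𝓝 ((Pi.single 0 1 : Fin 3 → ℂ) i)) := by
  have h0 : (0 : ℝ) ∈ Icc 0 T := ⟨le_rfl, S.pos.le⟩
  have hest := fun x (hx : (0 : ℝ) ≤ x) i =>
    Pr.norm_sub_single_le_of_tendsto S h h0 (fun r => Pr.tendsto_adjWav S h r) hx i
  have hlim : ∀ i, Tendsto (fun x => wav u l z Y 0 (jVec u l z Y) x 0 i) atTop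
      (𝓝 ((Pi.single 0 1 : Fin 3 → ℂ) i)) := by
    intro i
    rw [tendsto_iff_norm_sub_tendsto_zero]
    refine squeeze_zero' (Eventually.of_forall fun _ => norm_nonneg _) ?_ (tendsto_exp_sub_one B)
    filter_upwards [eventually_ge_atTop 0] with x hx
    exact hest x hx i
  refine Pr.tendsto_transfer S (K := Real.exp (12 * B)) (fun x hx i => ?_) ?_ (hlim i) ht
  · have h1 := hest x hx i
    have h2 : ‖(Pi.single 0 1 : Fin 3 → ℂ) i‖ ≤ 1 := by
      rw [Pi.single_apply]
      split_ifs <;> simp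
    have h3 : 12 * B / (1 + x) ≤ 12 * B := div_le_self (by linarith [Pr.nonneg]) (by linarith)
    have h4 := Real.exp_le_exp.2 h3
    have h5 := norm_le_norm_sub_add (wav u l z Y 0 (jVec u l z Y) x 0 i)
      ((Pi.single 0 1 : Fin 3 → ℂ) i)
    linarith
  · by_cases hi : i = 0
    · exact Or.inr hi
    · exact Or.inl (Pi.single_eq_of_ne hi _)

/-- Uniform estimate for the solution of the first column. -/
lemma norm_jVec_sub_le (h : ∀ i, (l 0).re ≤ (l i).re) {x t : ℝ} (hx : 0 ≤ x) (ht : t ∈ Icc 0 T)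
    (i : Fin 3) :
    ‖wav u l z Y 0 (jVec u l z Y) x t i - (Pi.single 0 1 : Fin 3 → ℂ) i‖
      ≤ Real.exp (12 * B / (1 + x)) - 1 := by
  refine Pr.norm_sub_single_le_of_tendsto S h ht (fun r => ?_) hx i
  obtain ⟨⟨K, hK⟩, L, hL, -⟩ := Pr.adj_column S h r ht
  have h1 := fun i => Pr.tendsto_jVec S h ht i
  -- The weights cancel in the pairing of the adjoint with the forward solution, which is therefore
  -- constantly r·J. Its limit identifies the limit of the adjoint solution for every t, not only t
  -- = 0.
  have h2 : Tendsto (fun x => wav u l z Y 0 (jVec u l z Y) x t 0 * adjWav u l z Y r x t 0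
      + wav u l z Y 0 (jVec u l z Y) x t 1 * adjWav u l z Y r x t 1
      + wav u l z Y 0 (jVec u l z Y) x t 2 * adjWav u l z Y r x t 2) atTop
      (𝓝 (1 * L + 0 + 0)) :=
    (((h1 0).mul hL).add (tendsto_zero_mul_bdd (h1 1) fun x hx => hK x hx 1)).add
      (tendsto_zero_mul_bdd (h1 2) fun x hx => hK x hx 2)
  have h3 : (fun x => wav u l z Y 0 (jVec u l z Y) x t 0 * adjWav u l z Y r x t 0
      + wav u l z Y 0 (jVec u l z Y) x t 1 * adjWav u l z Y r x t 1
      + wav u l z Y 0 (jVec u l z Y) x t 2 * adjWav u l z Y r x t 2)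
      =ᶠ[atTop] fun _ => r ⬝ᵥ jVec u l z Y := by
    filter_upwards [eventually_ge_atTop 0] with x hx
    have e : r ⬝ᵥ jVec u l z Y
        = Matrix.vecMul r (Y x t).adjugate ⬝ᵥ (Y x t).mulVec (jVec u l z Y) := by
      rw [← Matrix.dotProduct_mulVec, Matrix.mulVec_mulVec, Pr.adjugate_mul hx ht,
        Matrix.one_mulVec]
    have hw := wt_ne_zero u l z 0 x t
    rw [e]
    simp only [wav, adjWav]
    simp only [dotProduct, Fin.sum_univ_three]
    field_simp
  have h4 := tendsto_nhds_unique (h2.congr' h3) tendsto_const_nhds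
  rw [one_mul, add_zero, add_zero] at h4
  rw [← h4]
  exact hL

lemma jVec_ne_zero (h : ∀ i, (l 0).re ≤ (l i).re) : jVec u l z Y ≠ 0 := by
  intro h0
  have h1 := Pr.tendsto_jVec S h (left_mem_Icc.2 S.pos.le) 0
  rw [h0] at h1
  have h2 : (fun x : ℝ => wav u l z Y 0 0 x 0 0) = fun _ => 0 := by
    ext x
    simp [wav]
  rw [h2] at h1
  simpa using tendsto_nhds_unique h1 tendsto_const_nhds

/-! ### The middle column -/

/-- When the limit of the last component is 0, that component is a small fraction of the whole
solution. Such an inequality is homogeneous, so it holds in every weight. -/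
lemma norm_last_le (h : ∀ i, (l i).re ≤ (l 2).re) {v : Fin 3 → ℂ} (hv : rhoVec u l z Y ⬝ᵥ v = 0)
    (j : Fin 3) {x t : ℝ} (hx : 0 ≤ x) (ht : t ∈ Icc 0 T) :
    ‖wav u l z Y j v x t 2‖ ≤ (Real.exp (12 * B / (1 + x)) - 1)
      * partialNorm Finset.univ (wav u l z Y j v x t) := by
  have h1 := Pr.norm_sub_rhoVec_le S h v hx ht
  rw [hv, sub_zero] at h1
  have e : wav u l z Y j v x t
      = fun i => wt u l z j x t / wt u l z 2 x t * wav u l z Y 2 v x t i :=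
    funext fun i => wav_gauge u l z Y j 2 v x t i
  rw [e, partialNorm_smul, norm_mul]
  nlinarith [mul_le_mul_of_nonneg_left h1 (norm_nonneg (wt u l z j x t / wt u l z 2 x t))]

omit S Pr in
-- The last component can be absorbed, so the first two control everything; for these the middle
-- weight does not expand.
lemma partialNorm_univ_le {φ : Fin 3 → ℂ} {ε : ℝ} (hε : ε ≤ 1 / 4)
    (h : ‖φ 2‖ ≤ ε * partialNorm Finset.univ φ) :
    partialNorm Finset.univ φ ≤ 3 * partialNorm {0, 1} φ ∧ ‖φ 2‖ ≤ partialNorm {0, 1} φ := by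
  have h1 := partialNorm_le_sum Finset.univ φ
  rw [Fin.sum_univ_three] at h1
  have h2 : ‖φ 0‖ ≤ partialNorm {0, 1} φ := norm_le_partialNorm (by simp)
  have h3 : ‖φ 1‖ ≤ partialNorm {0, 1} φ := norm_le_partialNorm (by simp)
  have h4 := partialNorm_nonneg Finset.univ φ
  have h5 : ε * partialNorm Finset.univ φ ≤ 1 / 4 * partialNorm Finset.univ φ :=
    mul_le_mul_of_nonneg_right hε h4
  have h6 := partialNorm_nonneg {0, 1} φ
  constructor <;> linarith

/-- In the middle weight only the last component can grow. Far out it is dominated by the other two,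
so an energy estimate for the first two components suffices; the remaining interval is compact. -/
lemma middle_bounded (h01 : (l 0).re ≤ (l 1).re) (h12 : (l 1).re ≤ (l 2).re) {v : Fin 3 → ℂ}
    (hv : rhoVec u l z Y ⬝ᵥ v = 0) :
    ∃ K : ℝ, ∀ x, 0 ≤ x → ∀ i, ‖wav u l z Y 1 v x 0 i‖ ≤ K := by
  have h0 : (0 : ℝ) ∈ Icc 0 T := ⟨le_rfl, S.pos.le⟩
  have h2 : ∀ i, (l i).re ≤ (l 2).re := fun i => by fin_cases i <;> simp <;> linarith
  have hB := Pr.nonneg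
  obtain ⟨x₀, hx₀, hε⟩ : ∃ x₀ : ℝ, 0 ≤ x₀ ∧ ∀ x, x₀ ≤ x →
      Real.exp (12 * B / (1 + x)) - 1 ≤ 1 / 4 := by
    have h1 := ((tendsto_exp_sub_one B).eventually (ge_mem_nhds (by norm_num : (0 : ℝ) < 1 / 4)))
    obtain ⟨x₀, h⟩ := eventually_atTop.1 h1
    exact ⟨max x₀ 0, le_max_right _ _, fun x hx => h x ((le_max_left _ _).trans hx)⟩
  have hN := fun x (hx : x₀ ≤ x) => partialNorm_univ_le (hε x hx)
    (Pr.norm_last_le S h2 hv 1 (hx₀.trans hx) h0)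
  have hfar : ∀ x, x₀ ≤ x → ∀ i, ‖wav u l z Y 1 v x 0 i‖
      ≤ 3 * (Real.exp (27 * B) * partialNorm {0, 1} (wav u l z Y 1 v x₀ 0)) := by
    intro x hx i
    have key := energy_estimate (s := ({0, 1} : Finset (Fin 3)))
      (φ := fun x => wav u l z Y 1 v x 0)
      (Λ := fun x i => q u x 0 * (l i - l 1)) (c := 0)
      (f := fun x i => ∑ r, a x 0 i r * wav u l z Y 1 v x 0 r)
      (g := fun x => 9 * B / (1 + x) ^ 2) (G := fun x => -(27 * B / (1 + x))) hx
      (fun s hs i _ => (Pr.hasDerivAt_wav_x S (hx₀.trans hs.1) h0 1 v i).hasDerivWithinAt)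
      (fun s hs i hi => (re_diag_nonpos S (hx₀.trans hs.1) h0 ?_).trans ?_)
      (fun s hs i _ => ?_) (fun s hs => ?_) (fun s hs => by positivity) le_rfl
    · refine (norm_le_partialNorm (Finset.mem_univ i)).trans ((hN x hx).1.trans ?_)
      rw [add_zero, add_zero] at key
      refine mul_le_mul_of_nonneg_left (key.trans ?_) (by norm_num)
      refine mul_le_mul_of_nonneg_right (Real.exp_le_exp.2 ?_) (partialNorm_nonneg _ _)
      have e1 : 0 ≤ 27 * B / (1 + x) := div_nonneg (by positivity) (by linarith)
      have e2 : 27 * B / (1 + x₀) ≤ 27 * B := div_le_self (by positivity) (by linarith)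
      linarith
    · simp only [Finset.mem_insert, Finset.mem_singleton] at hi
      rcases hi with rfl | rfl
      · exact h01
      · exact le_rfl
    · positivity
    · refine (norm_sum_mul_le (by positivity)
        (fun i r => Pr.norm_a (hx₀.trans hs.1) h0 i r) _ i).trans ?_
      rw [add_zero, Fintype.card_fin]
      refine (mul_le_mul_of_nonneg_left (hN s hs.1).1 (by positivity)).trans (le_of_eq ?_)
      push_cast
      ring
    · refine (hasDerivAt_neg_div_one_add (27 * B) (hx₀.trans hs.1)).hasDerivWithinAt.congr_deriv ?_
      rw [Finset.card_pair (by decide)]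
      push_cast
      ring
  have hcont : ∀ i, ContinuousOn (fun x => wav u l z Y 1 v x 0 i) (Icc 0 x₀) := fun i x hx =>
    (Pr.hasDerivAt_wav_x S hx.1 h0 1 v i).continuousAt.continuousWithinAt
  choose M hM using fun i => isCompact_Icc.exists_bound_of_continuousOn (hcont i)
  have hM0 : ∀ i, 0 ≤ M i := fun i => (norm_nonneg _).trans (hM i 0 ⟨le_rfl, hx₀⟩)
  refine ⟨3 * (Real.exp (27 * B) * partialNorm {0, 1} (wav u l z Y 1 v x₀ 0)) + ∑ i, M i,
    fun x hx i => ?_⟩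
  have e1 : M i ≤ ∑ i, M i := Finset.single_le_sum (fun i _ => hM0 i) (Finset.mem_univ i)
  have e2 : 0 ≤ Real.exp (27 * B) * partialNorm {0, 1} (wav u l z Y 1 v x₀ 0) :=
    mul_nonneg (Real.exp_pos _).le (partialNorm_nonneg _ _)
  rcases le_total x x₀ with h | h
  · linarith [hM i x ⟨hx, h⟩]
  · linarith [hfar x h i, hM0 i]

/-- If the limit functional of the last column vanishes, the solution is bounded in the weight of the
middle column, with a limit for every later component. -/
lemma middle_column (h01 : (l 0).re ≤ (l 1).re) (h12 : (l 1).re ≤ (l 2).re) {v : Fin 3 → ℂ}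
    (hv : rhoVec u l z Y ⬝ᵥ v = 0) :
    ∃ κ : ℂ, ∀ t ∈ Icc 0 T, (∃ K : ℝ, ∀ x, 0 ≤ x → ∀ i, ‖wav u l z Y 1 v x t i‖ ≤ K) ∧
      Tendsto (fun x => wav u l z Y 1 v x t 1) atTop (𝓝 κ) ∧
      Tendsto (fun x => wav u l z Y 1 v x t 2) atTop (𝓝 0) := by
  have h0 : (0 : ℝ) ∈ Icc 0 T := ⟨le_rfl, S.pos.le⟩
  have h2 : ∀ i, (l i).re ≤ (l 2).re := fun i => by fin_cases i <;> simp <;> linarith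
  have hB := Pr.nonneg
  obtain ⟨K, hK⟩ := Pr.middle_bounded S h01 h12 hv
  have hK0 : 0 ≤ K := (norm_nonneg _).trans (hK 0 le_rfl 0)
  obtain ⟨K', hK', hb⟩ := Pr.bounded_transfer S hK
  -- In its own weight the middle component has no diagonal term, so boundedness makes its
  -- derivative O((1+x)⁻²).
  obtain ⟨κ, hκ, -⟩ := exists_limit_of_deriv_le (C := 9 * B * K) le_rfl (by positivity)
    (fun x hx => Pr.hasDerivAt_wav_x S hx h0 1 v 1) fun x hx => by
      rw [sub_self, mul_zero, zero_mul, zero_add]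
      refine (norm_sum_mul_le (by positivity) (fun i r => Pr.norm_a hx h0 i r) _ 1).trans ?_
      refine (mul_le_mul_of_nonneg_left (partialNorm_le_of_forall (hK x hx))
        (by positivity)).trans (le_of_eq ?_)
      rw [Fintype.card_fin]
      push_cast
      ring
  refine ⟨κ, fun t ht => ⟨⟨K', fun x hx i => hb x t hx ht i⟩,
    Pr.tendsto_transfer S hK (Or.inr rfl) hκ ht, ?_⟩⟩
  have h3 := (tendsto_exp_sub_one B).mul_const (3 * K')
  rw [zero_mul] at h3
  refine squeeze_zero_norm' ?_ h3
  filter_upwards [eventually_ge_atTop 0] with x hx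
  refine (Pr.norm_last_le S h2 hv 1 hx ht).trans (mul_le_mul_of_nonneg_left
    (partialNorm_le_of_forall fun i => hb x t hx ht i) ?_)
  have : 0 ≤ 12 * B / (1 + x) := div_nonneg (by linarith) (by linarith)
  linarith [Real.one_le_exp this]

/-! ### Relations between the columns -/

lemma tendsto_jVec_later (h01 : (l 0).re ≤ (l 1).re) (h12 : (l 1).re ≤ (l 2).re) (j : Fin 3)
    {i : Fin 3} (hi : i ≠ 0) {t : ℝ} (ht : t ∈ Icc 0 T) :
    Tendsto (fun x => wav u l z Y j (jVec u l z Y) x t i) atTop (𝓝 0) := by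
  have h : ∀ i, (l 0).re ≤ (l i).re := fun i => by fin_cases i <;> simp <;> linarith
  obtain ⟨K, hK⟩ := S.exists_norm_wt_div_le z (h j) ht
  have h1 := Pr.tendsto_jVec S h ht i
  rw [Pi.single_eq_of_ne hi] at h1
  refine (tendsto_zero_mul_bdd h1 hK).congr fun x => ?_
  rw [wav_gauge u l z Y j 0, mul_comm]

lemma bounded_jVec (h01 : (l 0).re ≤ (l 1).re) (h12 : (l 1).re ≤ (l 2).re) (j : Fin 3)
    {t : ℝ} (ht : t ∈ Icc 0 T) :
    ∃ K : ℝ, ∀ x, 0 ≤ x → ∀ i, ‖wav u l z Y j (jVec u l z Y) x t i‖ ≤ K := by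
  have h : ∀ i, (l 0).re ≤ (l i).re := fun i => by fin_cases i <;> simp <;> linarith
  obtain ⟨K, hK⟩ := S.exists_norm_wt_div_le z (h j) ht
  have hK0 : 0 ≤ K := (norm_nonneg _).trans (hK 0 le_rfl)
  refine ⟨K * Real.exp (12 * B), fun x hx i => ?_⟩
  rw [wav_gauge u l z Y j 0, norm_mul]
  refine mul_le_mul (hK x hx) ?_ (norm_nonneg _) hK0
  have h1 := Pr.norm_jVec_sub_le S h hx ht i
  have h2 : ‖(Pi.single 0 1 : Fin 3 → ℂ) i‖ ≤ 1 := by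
    rw [Pi.single_apply]
    split_ifs <;> simp
  have h3 : 12 * B / (1 + x) ≤ 12 * B := div_le_self (by linarith [Pr.nonneg]) (by linarith)
  have h4 := Real.exp_le_exp.2 h3
  have h5 := norm_le_norm_sub_add (wav u l z Y 0 (jVec u l z Y) x t i)
    ((Pi.single 0 1 : Fin 3 → ℂ) i)
  linarith

/-- The last component of the first solution tends to 0 in the first weight, and a fortiori in the
last. -/
lemma rhoVec_dotProduct_jVec (h01 : (l 0).re ≤ (l 1).re) (h12 : (l 1).re ≤ (l 2).re) :
    rhoVec u l z Y ⬝ᵥ jVec u l z Y = 0 := by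
  have h0 : (0 : ℝ) ∈ Icc 0 T := ⟨le_rfl, S.pos.le⟩
  have h2 : ∀ i, (l i).re ≤ (l 2).re := fun i => by fin_cases i <;> simp <;> linarith
  exact tendsto_nhds_unique (Pr.tendsto_rhoVec S h2 _ h0)
    (Pr.tendsto_jVec_later S h01 h12 2 (by decide) h0)

/-- The determinant identity between the three columns. -/
lemma triple_product_eq (h01 : (l 0).re ≤ (l 1).re) (h12 : (l 1).re ≤ (l 2).re) {v : Fin 3 → ℂ}
    (hv : rhoVec u l z Y ⬝ᵥ v = 0) {κ : ℂ}
    (hκ : Tendsto (fun x => wav u l z Y 1 v x 0 1) atTop (𝓝 κ)) (w : Fin 3 → ℂ) :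
    jVec u l z Y ⬝ᵥ (crossProduct v w) = κ * (rhoVec u l z Y ⬝ᵥ w) := by
  have h0 : (0 : ℝ) ∈ Icc 0 T := ⟨le_rfl, S.pos.le⟩
  have h2 : ∀ i, (l i).re ≤ (l 2).re := fun i => by fin_cases i <;> simp <;> linarith
  have h : ∀ i, (l 0).re ≤ (l i).re := fun i => by fin_cases i <;> simp <;> linarith
  have hJ := fun i => Pr.tendsto_jVec S h h0 i
  obtain ⟨κ', hκ'⟩ := Pr.middle_column S h01 h12 hv
  obtain ⟨⟨K, hK⟩, -, hv2⟩ := hκ' 0 h0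
  obtain ⟨⟨K₂, hK₂⟩, -⟩ := Pr.last_column S h2 w h0
  have hw := Pr.tendsto_rhoVec S h2 w h0
  set p := fun i x => wav u l z Y 0 (jVec u l z Y) x 0 i
  set r := fun i x => wav u l z Y 1 v x 0 i
  set s := fun i x => wav u l z Y 2 w x 0 i
  have hbb : ∀ i j m n x, 0 ≤ x → ‖r i x * s j x - r m x * s n x‖ ≤ K * K₂ + K * K₂ := by
    intro i j m n x hx
    have hK0 : 0 ≤ K := (norm_nonneg _).trans (hK 0 le_rfl 0)
    refine (norm_sub_le _ _).trans (add_le_add ?_ ?_) <;>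
    · rw [norm_mul]
      exact mul_le_mul (hK x hx _) (hK₂ x hx _) (norm_nonneg _) hK0
  -- As x → ∞ the determinant of the three weighted columns J, v, w reduces to the product of its
  -- diagonal entries, with limits 1, κ and ρ·w.
  have t1 : Tendsto (fun x => p 0 x * (r 1 x * s 2 x - r 2 x * s 1 x)
      + p 1 x * (r 2 x * s 0 x - r 0 x * s 2 x) + p 2 x * (r 0 x * s 1 x - r 1 x * s 0 x))
      atTop (𝓝 (1 * (κ * (rhoVec u l z Y ⬝ᵥ w) - 0) + 0 + 0)) :=
    (((hJ 0).mul ((hκ.mul hw).sub (tendsto_zero_mul_bdd hv2 fun x hx => hK₂ x hx 1))).add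
      (tendsto_zero_mul_bdd (hJ 1) (hbb _ _ _ _))).add
      (tendsto_zero_mul_bdd (hJ 2) (hbb _ _ _ _))
  have t2 : (fun x => p 0 x * (r 1 x * s 2 x - r 2 x * s 1 x)
      + p 1 x * (r 2 x * s 0 x - r 0 x * s 2 x) + p 2 x * (r 0 x * s 1 x - r 1 x * s 0 x))
      =ᶠ[atTop] fun _ => jVec u l z Y ⬝ᵥ (crossProduct v w) := by
    filter_upwards [eventually_ge_atTop 0] with x hx
    have hdet := Pr.det_eq hx h0
    -- At t = 0 the three weights multiply to 1 because the l_j sum to 0; with det Y = 1 the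
    -- determinant of the weighted columns is that of their base vectors.
    have hwt : wt u l z 0 x 0 * wt u l z 1 x 0 * wt u l z 2 x 0 = 1 := by
      simp only [wt, ← Complex.exp_add]
      rw [Complex.exp_eq_one_iff]
      exact ⟨0, by push_cast; linear_combination -(y u x 0 : ℂ) * Pr.sum_l⟩
    rw [Matrix.det_fin_three] at hdet
    simp only [p, r, s, wav, Matrix.mulVec, dotProduct, Fin.sum_univ_three, cross_apply]
    simp only [Matrix.cons_val_zero, Matrix.cons_val_one, Matrix.cons_val]
    generalize jVec u l z Y = J
    linear_combination (wt u l z 0 x 0 * wt u l z 1 x 0 * wt u l z 2 x 0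
      * (J 0 * (v 1 * w 2 - v 2 * w 1) + J 1 * (v 2 * w 0 - v 0 * w 2)
        + J 2 * (v 0 * w 1 - v 1 * w 0))) * hdet
      + (J 0 * (v 1 * w 2 - v 2 * w 1) + J 1 * (v 2 * w 0 - v 0 * w 2)
        + J 2 * (v 0 * w 1 - v 1 * w 0)) * hwt
  have h4 := tendsto_nhds_unique (t1.congr' t2) tendsto_const_nhds
  rw [← h4]
  ring

/-- A solution for which both limits vanish is a multiple of the first column. -/
lemma eq_smul_jVec (h01 : (l 0).re ≤ (l 1).re) (h12 : (l 1).re ≤ (l 2).re) {v : Fin 3 → ℂ}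
    (hv : rhoVec u l z Y ⬝ᵥ v = 0)
    (hκ : Tendsto (fun x => wav u l z Y 1 v x 0 1) atTop (𝓝 0)) :
    ∃ α : ℂ, v = α • jVec u l z Y := by
  have h : ∀ i, (l 0).re ≤ (l i).re := fun i => by fin_cases i <;> simp <;> linarith
  have h3 := fun w => Pr.triple_product_eq S h01 h12 hv hκ w
  have hne := Pr.jVec_ne_zero S h
  generalize jVec u l z Y = J at *
  -- With κ = 0 the triple product J·(v×w) vanishes for every w. The three unit vectors give the
  -- components of J×v = 0.
  have e0 := h3 (Pi.single 0 1)
  have e1 := h3 (Pi.single 1 1)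
  have e2 := h3 (Pi.single 2 1)
  simp [cross_apply, dotProduct, Fin.sum_univ_three] at e0 e1 e2
  obtain ⟨m, hm⟩ := Function.ne_iff.1 hne
  refine ⟨v m / J m, ?_⟩
  ext i
  simp only [Pi.smul_apply, smul_eq_mul, Pi.zero_apply] at hm ⊢
  field_simp
  fin_cases m <;> fin_cases i <;> simp <;> grind

end Propagator


/-! ### From the integral equations to conditions on base vectors -/

lemma eq_zero_of_linear_system {φ Λ : ℝ → Fin 3 → ℂ} {V : ℝ → Fin 3 → Fin 3 → ℂ} {a b D B : ℝ}
    (hab : a ≤ b) (hD : 0 ≤ D) (hB : 0 ≤ B)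
    (hφ : ∀ x ∈ Icc a b, ∀ i, HasDerivWithinAt (fun x => φ x i)
      (Λ x i * φ x i + ∑ r, V x i r * φ x r) (Icc a b) x)
    (hΛ : ∀ x ∈ Icc a b, ∀ i, ‖Λ x i‖ ≤ D) (hV : ∀ x ∈ Icc a b, ∀ i r, ‖V x i r‖ ≤ B)
    (h0 : φ a = 0) : φ b = 0 := by
  have key := energy_estimate (s := Finset.univ) (φ := φ) (Λ := Λ) (c := 0)
    (f := fun s i => ∑ r, V s i r * φ s r) (g := fun _ => D + 3 * B)
    (G := fun s => 4 * (D + 3 * B) * s) hab (fun s hs i _ => hφ s hs i)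
    (fun s hs i _ => (Complex.re_le_norm _).trans ((hΛ s hs i).trans (by linarith)))
    (fun s hs i _ => ?_) (fun s hs => ?_) (fun s hs => by positivity) le_rfl
  · have h1 : partialNorm Finset.univ (φ a) = 0 := by simp [h0, partialNorm]
    rw [h1, add_zero, add_zero, mul_zero] at key
    ext i
    exact norm_le_zero_iff.1 ((norm_le_partialNorm (Finset.mem_univ i)).trans key)
  · refine (norm_sum_mul_le hB (hV s hs) _ i).trans ?_
    rw [add_zero, Fintype.card_fin]
    refine mul_le_mul_of_nonneg_right ?_ (partialNorm_nonneg _ _)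
    push_cast
    linarith
  · refine (((hasDerivAt_id s).const_mul (4 * (D + 3 * B))).hasDerivWithinAt).congr_deriv ?_
    rw [Finset.card_univ, Fintype.card_fin]
    push_cast
    ring

/-- A derivative is measurable, so a bound alone gives integrability; continuity of the coefficients
need not be examined. -/
lemma intervalIntegrable_of_hasDerivAt {F F' : ℝ → ℂ} {a b M : ℝ}
    (h : ∀ s ∈ uIcc a b, HasDerivAt F (F' s) s) (hM : ∀ s ∈ uIcc a b, ‖F' s‖ ≤ M) :
    IntervalIntegrable F' volume a b := by
  rw [intervalIntegrable_iff]
  have h1 : IntegrableOn (fun _ : ℝ => M) (uIoc a b) := integrableOn_const measure_Ioc_lt_top.ne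
  refine Integrable.mono' h1 ?_ ?_
  · refine (aestronglyMeasurable_deriv F _).congr ?_
    filter_upwards [self_mem_ae_restrict measurableSet_uIoc] with s hs
    exact (h s (uIoc_subset_uIcc hs)).deriv
  · filter_upwards [self_mem_ae_restrict measurableSet_uIoc] with s hs
    exact hM s (uIoc_subset_uIcc hs)

lemma integrableOn_Ioi_of_hasDerivAt {F F' : ℝ → ℂ} {x C : ℝ} (hx : 0 ≤ x)
    (h : ∀ s, x ≤ s → HasDerivAt F (F' s) s) (hC : ∀ s, x ≤ s → ‖F' s‖ ≤ C / (1 + s) ^ 2) :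
    IntegrableOn F' (Ioi x) := by
  have h1 : IntegrableOn (fun s : ℝ => C / (1 + s) ^ 2) (Ioi x) := by
    refine integrableOn_Ioi_deriv_of_nonneg' (g := fun s : ℝ => -(C / (1 + s))) (l := 0)
      (fun s hs => hasDerivAt_neg_div_one_add C (hx.trans hs)) (fun s hs => ?_) ?_
    · exact (norm_nonneg _).trans (hC s (le_of_lt hs))
    · have : Tendsto (fun s : ℝ => C / (1 + s)) atTop (𝓝 0) :=
        tendsto_const_nhds.div_atTop (tendsto_atTop_add_const_left _ _ tendsto_id)
      simpa using this.neg
  refine Integrable.mono' h1 ?_ ?_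
  · refine (aestronglyMeasurable_deriv F _).congr ?_
    filter_upwards [self_mem_ae_restrict measurableSet_Ioi] with s hs
    exact (h s (le_of_lt hs)).deriv
  · filter_upwards [self_mem_ae_restrict measurableSet_Ioi] with s hs
    exact hC s (le_of_lt hs)

lemma lax_entry_x (c : ℂ) (k : ℂ) (V Φ : Matrix (Fin 3) (Fin 3) ℂ) (i j : Fin 3) :
    ((c • calL k) * Φ - Φ * (c • calL k) + V * Φ) i j
      = c * (l k i - l k j) * Φ i j + ∑ r, V i r * Φ r j := by
  rw [Matrix.add_apply, Matrix.sub_apply, Matrix.smul_mul, Matrix.mul_smul, Matrix.smul_apply,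
    Matrix.smul_apply, calL, Matrix.diagonal_mul, Matrix.mul_diagonal, smul_eq_mul, smul_eq_mul,
    Matrix.mul_apply]
  ring

lemma lax_entry_t (c : ℂ) (k : ℂ) (V Φ : Matrix (Fin 3) (Fin 3) ℂ) (i j : Fin 3) :
    ((calZ k - c • calL k) * Φ - Φ * (calZ k - c • calL k) + V * Φ) i j
      = (z k i - z k j - c * (l k i - l k j)) * Φ i j + ∑ r, V i r * Φ r j := by
  rw [Matrix.add_apply, Matrix.sub_apply, Matrix.sub_mul, Matrix.mul_sub, Matrix.sub_apply,
    Matrix.sub_apply, Matrix.smul_mul, Matrix.mul_smul, Matrix.smul_apply,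
    Matrix.smul_apply, calL, calZ, Matrix.diagonal_mul, Matrix.mul_diagonal, Matrix.diagonal_mul,
    Matrix.mul_diagonal, smul_eq_mul, smul_eq_mul, Matrix.mul_apply]
  ring

/-- The matrix whose columns are weighted solutions with the given base vectors. -/
def waveMat (u : ℝ → ℝ → ℝ) (k : ℂ) (V : Fin 3 → Fin 3 → ℂ) (x t : ℝ) :
    Matrix (Fin 3) (Fin 3) ℂ :=
  Matrix.of fun i j => wav u (l k) (z k) (propT u k) j (V j) x t i

/-- The conditions on the base vectors which express the integral equations. -/
def EndConditions (T : ℝ) (u : ℝ → ℝ → ℝ) (n : Fin 18) (k : ℂ) (A : Matrix (Fin 3) (Fin 3) ℂ)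
    (V : Fin 3 → Fin 3 → ℂ) : Prop :=
  ∀ i j, (contour n i j = .γ₁ → (propT u k 0 T).mulVec (V j) i = 0) ∧
    (contour n i j = .γ₂ → V j i = 0) ∧
    (contour n i j = .γ₃ →
      Tendsto (fun x => wav u (l k) (z k) (propT u k) i (V j) x 0 i) atTop (𝓝 (A i j)))

/-- The exponential in equation (i,j) turns the weight of column j at the running point into the
weight of column i, up to a factor depending on the endpoint only. -/
lemma expFactor_mul (u : ℝ → ℝ → ℝ) (k : ℂ) (i j : Fin 3) (v : Fin 3 → ℂ) (x t x' t' : ℝ)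
    (r : Fin 3) :
    expFactor u k i j x t x' t' * wav u (l k) (z k) (propT u k) j v x' t' r
      = wt u (l k) (z k) j x t / wt u (l k) (z k) i x t
        * wav u (l k) (z k) (propT u k) i v x' t' r := by
  have e : expFactor u k i j x t x' t' * wt u (l k) (z k) j x' t'
      = wt u (l k) (z k) j x t / wt u (l k) (z k) i x t * wt u (l k) (z k) i x' t' := by
    simp only [expFactor, wt, ← Complex.exp_add, ← Complex.exp_sub]
    congr 1
    push_cast
    ring
  unfold wav
  rw [← mul_assoc, e, mul_assoc]

lemma expFactor_sum (u : ℝ → ℝ → ℝ) (k : ℂ) (i j : Fin 3) (V : Fin 3 → Fin 3 → ℂ)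
    (M : Matrix (Fin 3) (Fin 3) ℂ) (x t x' t' : ℝ) :
    expFactor u k i j x t x' t' * (M * waveMat u k V x' t') i j
      = wt u (l k) (z k) j x t / wt u (l k) (z k) i x t
        * ∑ r, M i r * wav u (l k) (z k) (propT u k) i (V j) x' t' r := by
  rw [Matrix.mul_apply, Finset.mul_sum, Finset.mul_sum]
  refine Finset.sum_congr rfl fun r _ => ?_
  have := expFactor_mul u k i j (V j) x t x' t' r
  simp only [waveMat, Matrix.of_apply]
  linear_combination M i r * this

namespace Regular

variable {T : ℝ} {u : ℝ → ℝ → ℝ} (S : Regular T u) {k : ℂ} (hk : Good k)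

include S hk

lemma solvesLaxPair_waveMat (V : Fin 3 → Fin 3 → ℂ) : SolvesLaxPair T u k (waveMat u k V) := by
  obtain ⟨B, Pr⟩ := S.propagator_propT hk
  intro x t hxt i j
  have ht : t ∈ Icc 0 T := ⟨hxt.2.1, hxt.2.2.le⟩
  rw [lax_entry_x, lax_entry_t]
  refine ⟨(Pr.hasDerivAt_wav_x S hxt.1 ht j (V j) i).hasDerivWithinAt, ?_⟩
  refine (Pr.hasDerivAt_wav_t S hxt.1 ht j (V j) i).hasDerivWithinAt.congr_deriv ?_
  push_cast
  rfl

/-- Every solution of the Lax pair is made of weighted solutions. -/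
lemma eq_waveMat {Φ : ℝ → ℝ → Matrix (Fin 3) (Fin 3) ℂ} (h : SolvesLaxPair T u k Φ) {x t : ℝ}
    (hxt : (x, t) ∈ halfLine T) : Φ x t = waveMat u k (fun j i => Φ 0 0 i j) x t := by
  obtain ⟨B, Pr⟩ := S.propagator_propT hk
  obtain ⟨D, hD, hD'⟩ := Propagator.exists_diag_bound (l := l k) (z := z k) S
  obtain ⟨C, hC, hC'⟩ := S.bounded_q
  set V : Fin 3 → Fin 3 → ℂ := fun j i => Φ 0 0 i j with hV
  have hW := S.solvesLaxPair_waveMat hk V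
  have ht : t ∈ Icc 0 T := ⟨hxt.2.1, hxt.2.2.le⟩
  have h00 : waveMat u k V 0 0 = Φ 0 0 := by
    ext i j
    simp [waveMat, wav, wt_zero, S.propT_zero hk, hV]
  have hT0 : ∀ j, (fun i => Φ 0 t i j - waveMat u k V 0 t i j) = 0 := by
    intro j
    refine eq_zero_of_linear_system (φ := fun s i => Φ 0 s i j - waveMat u k V 0 s i j)
      (Λ := fun s i => z k i - z k j - u 0 s * q u 0 s * (l k i - l k j))
      (V := fun s => V2 u 0 s k) hxt.2.1 hD Pr.nonneg (fun s hs i => ?_)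
      (fun s hs i => hD' 0 s le_rfl ⟨hs.1, hs.2.trans ht.2⟩ i j)
      (fun s hs i r => Pr.norm_U_le le_rfl ⟨hs.1, hs.2.trans ht.2⟩ i r) ?_
    · have hs' : ((0 : ℝ), s) ∈ halfLine T := ⟨le_rfl, hs.1, hs.2.trans_lt hxt.2.2⟩
      have hsub : Icc 0 t ⊆ Ico 0 T := fun r hr => ⟨hr.1, hr.2.trans_lt hxt.2.2⟩
      have h1 := (h 0 s hs' i j).2.mono hsub
      have h2 := (hW 0 s hs' i j).2.mono hsub
      rw [lax_entry_t] at h1 h2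
      refine (h1.sub h2).congr_deriv ?_
      simp only [mul_sub, Finset.sum_sub_distrib]
      push_cast
      ring
    · ext i
      simp [h00]
  have hx0 : ∀ j, (fun i => Φ x t i j - waveMat u k V x t i j) = 0 := by
    intro j
    set L : ℝ := ∑ i, ‖l k i‖
    have hL : ∀ i, ‖l k i‖ ≤ L := fun i =>
      Finset.single_le_sum (f := fun i => ‖l k i‖) (fun i _ => norm_nonneg _) (Finset.mem_univ i)
    have hL0 : 0 ≤ L := (norm_nonneg _).trans (hL 0)
    refine eq_zero_of_linear_system (φ := fun s i => Φ s t i j - waveMat u k V s t i j)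
      (Λ := fun s i => q u s t * (l k i - l k j)) (D := C * (2 * L))
      (V := fun s => V1 u s t k) hxt.1 (by positivity) Pr.nonneg (fun s hs i => ?_)
      (fun s hs i => ?_)
      (fun s hs i r => (Pr.norm_a hs.1 ht i r).trans
        (div_le_self Pr.nonneg (one_le_pow₀ (by linarith [hs.1])))) (hT0 j)
    · have hs' : (s, t) ∈ halfLine T := ⟨hs.1, hxt.2⟩
      have hsub : Icc 0 x ⊆ Ici 0 := fun r hr => hr.1
      have h1 := (h s t hs' i j).1.mono hsub
      have h2 := (hW s t hs' i j).1.mono hsub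
      rw [lax_entry_x] at h1 h2
      refine (h1.sub h2).congr_deriv ?_
      simp only [mul_sub, Finset.sum_sub_distrib]
      ring
    · rw [norm_mul, Complex.norm_real, Real.norm_eq_abs]
      refine mul_le_mul (hC' s t hs.1 ht) ((norm_sub_le _ _).trans ?_) (norm_nonneg _) hC
      linarith [hL i, hL j]
  ext i j
  exact sub_eq_zero.1 (congrFun (hx0 j) i)

/-- In weight i the diagonal coefficient of component i is l_i - l_i = 0: the integrand of the
integral equation is exactly a derivative. -/
lemma hasDerivAt_diag_x {x t : ℝ} (hx : 0 ≤ x) (ht : t ∈ Icc 0 T) (i : Fin 3) (v : Fin 3 → ℂ) :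
    HasDerivAt (fun ξ => wav u (l k) (z k) (propT u k) i v ξ t i)
      (∑ r, V1 u x t k i r * wav u (l k) (z k) (propT u k) i v x t r) x := by
  obtain ⟨B, Pr⟩ := S.propagator_propT hk
  refine (Pr.hasDerivAt_wav_x S hx ht i v i).congr_deriv ?_
  ring

lemma hasDerivAt_diag_t {x t : ℝ} (hx : 0 ≤ x) (ht : t ∈ Icc 0 T) (i : Fin 3) (v : Fin 3 → ℂ) :
    HasDerivAt (fun s => wav u (l k) (z k) (propT u k) i v x s i)
      (∑ r, V2 u x t k i r * wav u (l k) (z k) (propT u k) i v x t r) t := by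
  obtain ⟨B, Pr⟩ := S.propagator_propT hk
  refine (Pr.hasDerivAt_wav_t S hx ht i v i).congr_deriv ?_
  ring

lemma intervalIntegrable_diag_x {x t : ℝ} (hx : 0 ≤ x) (ht : t ∈ Icc 0 T) (i : Fin 3)
    (v : Fin 3 → ℂ) :
    IntervalIntegrable (fun ξ => ∑ r, V1 u ξ t k i r * wav u (l k) (z k) (propT u k) i v ξ t r)
      volume 0 x := by
  obtain ⟨B, Pr⟩ := S.propagator_propT hk
  have hc : ∀ r, ContinuousOn (fun ξ => wav u (l k) (z k) (propT u k) i v ξ t r) (Icc 0 x) :=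
    fun r ξ hξ => (Pr.hasDerivAt_wav_x S hξ.1 ht i v r).continuousAt.continuousWithinAt
  choose M hM using fun r => isCompact_Icc.exists_bound_of_continuousOn (hc r)
  refine intervalIntegrable_of_hasDerivAt (M := ∑ r, B * M r)
    (F := fun ξ => wav u (l k) (z k) (propT u k) i v ξ t i) (fun s hs => ?_) fun s hs => ?_
  · rw [uIcc_of_le hx] at hs
    exact S.hasDerivAt_diag_x hk hs.1 ht i v
  · rw [uIcc_of_le hx] at hs
    refine norm_sum_le_of_le _ fun r _ => ?_
    rw [norm_mul]
    exact mul_le_mul ((Pr.norm_a hs.1 ht i r).trans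
        (div_le_self Pr.nonneg (one_le_pow₀ (by linarith [hs.1])))) (hM r s hs) (norm_nonneg _)
      Pr.nonneg

lemma intervalIntegrable_diag_t {a b : ℝ} (ha : a ∈ Icc 0 T) (hb : b ∈ Icc 0 T) (i : Fin 3)
    (v : Fin 3 → ℂ) :
    IntervalIntegrable (fun s => ∑ r, V2 u 0 s k i r * wav u (l k) (z k) (propT u k) i v 0 s r)
      volume a b := by
  obtain ⟨B, Pr⟩ := S.propagator_propT hk
  have hsub : uIcc a b ⊆ Icc 0 T := uIcc_subset_Icc ha hb
  have hc : ∀ r, ContinuousOn (fun s => wav u (l k) (z k) (propT u k) i v 0 s r) (uIcc a b) :=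
    fun r s hs => (Pr.hasDerivAt_wav_t S le_rfl (hsub hs) i v r).continuousAt.continuousWithinAt
  choose M hM using fun r => isCompact_uIcc.exists_bound_of_continuousOn (hc r)
  refine intervalIntegrable_of_hasDerivAt (M := ∑ r, B * M r)
    (fun s hs => S.hasDerivAt_diag_t hk le_rfl (hsub hs) i v) fun s hs => ?_
  refine norm_sum_le_of_le _ fun r _ => ?_
  rw [norm_mul]
  exact mul_le_mul (Pr.norm_U_le le_rfl (hsub hs) i r) (hM r s hs) (norm_nonneg _) Pr.nonneg

lemma integral_diag_x {x t : ℝ} (hx : 0 ≤ x) (ht : t ∈ Icc 0 T) (i : Fin 3) (v : Fin 3 → ℂ) :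
    ∫ ξ in (0 : ℝ)..x, ∑ r, V1 u ξ t k i r * wav u (l k) (z k) (propT u k) i v ξ t r
      = wav u (l k) (z k) (propT u k) i v x t i - wav u (l k) (z k) (propT u k) i v 0 t i :=
  intervalIntegral.integral_eq_sub_of_hasDerivAt (fun s hs => by
    rw [uIcc_of_le hx] at hs
    exact S.hasDerivAt_diag_x hk hs.1 ht i v) (S.intervalIntegrable_diag_x hk hx ht i v)

lemma integral_diag_t {a b : ℝ} (ha : a ∈ Icc 0 T) (hb : b ∈ Icc 0 T) (i : Fin 3)
    (v : Fin 3 → ℂ) :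
    ∫ s in a..b, ∑ r, V2 u 0 s k i r * wav u (l k) (z k) (propT u k) i v 0 s r
      = wav u (l k) (z k) (propT u k) i v 0 b i - wav u (l k) (z k) (propT u k) i v 0 a i :=
  intervalIntegral.integral_eq_sub_of_hasDerivAt
    (fun _ hs => S.hasDerivAt_diag_t hk le_rfl (uIcc_subset_Icc ha hb hs) i v)
    (S.intervalIntegrable_diag_t hk ha hb i v)

/-- Weighted solutions with the right behaviour at the starting points of the contours solve the
system of integral equations. -/
lemma solvesSystem_waveMat {n : Fin 18} {A : Matrix (Fin 3) (Fin 3) ℂ}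
    (hA : ∀ i j, i ≠ j → A i j = 0) {V : Fin 3 → Fin 3 → ℂ}
    (h₁ : ∀ i j, contour n i j = .γ₁ → i ≠ j ∧ (propT u k 0 T).mulVec (V j) i = 0)
    (h₂ : ∀ i j, contour n i j = .γ₂ → i ≠ j ∧ V j i = 0)
    (h₃ : ∀ i j, contour n i j = .γ₃ → ∀ t ∈ Icc 0 T,
      (∃ K : ℝ, ∀ x, 0 ≤ x → ∀ r, ‖wav u (l k) (z k) (propT u k) i (V j) x t r‖ ≤ K) ∧
      Tendsto (fun x => wav u (l k) (z k) (propT u k) i (V j) x t i) atTop (𝓝 (A i j))) :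
    SolvesSystem T u n k A (waveMat u k V) := by
  refine ⟨S.solvesLaxPair_waveMat hk V, fun x t hxt i j => ?_⟩
  have hx : 0 ≤ x := hxt.1
  have ht : t ∈ Icc 0 T := ⟨hxt.2.1, hxt.2.2.le⟩
  have h0 : (0 : ℝ) ∈ Icc 0 T := ⟨le_rfl, S.pos.le⟩
  have hT : T ∈ Icc 0 T := ⟨S.pos.le, le_rfl⟩
  simp only [expFactor_sum]
  set c := wt u (l k) (z k) j x t / wt u (l k) (z k) i x t with hc
  have hΦ : waveMat u k V x t i j = c * wav u (l k) (z k) (propT u k) i (V j) x t i := by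
    rw [hc, ← wav_gauge]
    rfl
  -- For both finite contours the integral telescopes to the value at (x,t) minus the value at the
  -- starting point (0,a), and the latter is zero.
  have hpath : ∀ a ∈ Icc 0 T, wav u (l k) (z k) (propT u k) i (V j) 0 a i = 0 →
      waveMat u k V x t i j
        = (∫ s in a..t, c * ∑ r, V2 u 0 s k i r * wav u (l k) (z k) (propT u k) i (V j) 0 s r)
        + ∫ ξ in (0 : ℝ)..x, c * ∑ r, V1 u ξ t k i r
          * wav u (l k) (z k) (propT u k) i (V j) ξ t r := by
    intro a ha hz
    rw [intervalIntegral.integral_const_mul, intervalIntegral.integral_const_mul,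
      S.integral_diag_x hk hx ht, S.integral_diag_t hk ha ht, hz, hΦ]
    ring
  cases hcon : contour n i j with
  | γ₁ =>
    obtain ⟨hij, hv⟩ := h₁ i j hcon
    refine ⟨⟨(S.intervalIntegrable_diag_t hk hT ht i (V j)).const_mul c,
      (S.intervalIntegrable_diag_x hk hx ht i (V j)).const_mul c⟩, ?_⟩
    rw [hA i j hij, zero_add]
    exact hpath T hT (by rw [wav, hv, mul_zero])
  | γ₂ =>
    obtain ⟨hij, hv⟩ := h₂ i j hcon
    refine ⟨⟨(S.intervalIntegrable_diag_t hk h0 ht i (V j)).const_mul c,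
      (S.intervalIntegrable_diag_x hk hx ht i (V j)).const_mul c⟩, ?_⟩
    rw [hA i j hij, zero_add]
    exact hpath 0 h0 (by rw [wav, S.propT_zero hk, Matrix.one_mulVec, hv, mul_zero])
  | γ₃ =>
    obtain ⟨⟨K, hK⟩, hlim⟩ := h₃ i j hcon t ht
    obtain ⟨B, Pr⟩ := S.propagator_propT hk
    have hB := Pr.nonneg
    have hInt : IntegrableOn (fun ξ => ∑ r, V1 u ξ t k i r
        * wav u (l k) (z k) (propT u k) i (V j) ξ t r) (Ioi x) := by
      refine integrableOn_Ioi_of_hasDerivAt (C := 9 * B * K) hx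
        (fun s hs => S.hasDerivAt_diag_x hk (hx.trans hs) ht i (V j)) fun s hs => ?_
      have hs0 := hx.trans hs
      refine (norm_sum_mul_le (by positivity) (fun i r => Pr.norm_a hs0 ht i r) _ i).trans ?_
      refine (mul_le_mul_of_nonneg_left (partialNorm_le_of_forall (hK s hs0))
        (by positivity)).trans (le_of_eq ?_)
      rw [Fintype.card_fin]
      push_cast
      ring
    refine ⟨hInt.const_mul c, ?_⟩
    have hFTC := integral_Ioi_of_hasDerivAt_of_tendsto'
      (fun s hs => S.hasDerivAt_diag_x hk (hx.trans hs) ht i (V j)) hInt hlim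
    rw [contourIntegral, integral_const_mul, hFTC, hΦ]
    -- On the diagonal the two weights in `c` agree, so the limit 1 appears with coefficient 1; off
    -- the diagonal the limit is 0 and `c` is irrelevant.
    by_cases hij : i = j
    · have : c = 1 := by rw [hc, hij, div_self (wt_ne_zero _ _ _ _ _ _)]
      rw [this]
      ring
    · rw [hA i j hij]
      ring

/-- The behaviour at the starting points of the contours of a solution of the system of integral
equations. -/
lemma endConditions_of_solvesSystem {n : Fin 18} {A : Matrix (Fin 3) (Fin 3) ℂ}
    (hA : ∀ i j, i ≠ j → A i j = 0) (hn : ∀ i j, contour n i j ≠ .γ₃ → i ≠ j)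
    {Φ : ℝ → ℝ → Matrix (Fin 3) (Fin 3) ℂ} (h : SolvesSystem T u n k A Φ) :
    EndConditions T u n k A (fun j i => Φ 0 0 i j) := by
  set V : Fin 3 → Fin 3 → ℂ := fun j i => Φ 0 0 i j with hV
  have h0 : (0 : ℝ) ∈ Icc 0 T := ⟨le_rfl, S.pos.le⟩
  have hT : T ∈ Icc 0 T := ⟨S.pos.le, le_rfl⟩
  have h00 : ((0 : ℝ), (0 : ℝ)) ∈ halfLine T := ⟨le_rfl, le_rfl, S.pos⟩
  have heq := fun x t (hxt : (x, t) ∈ halfLine T) => S.eq_waveMat hk h.1 hxt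
  have hw1 : ∀ i j, wav u (l k) (z k) (propT u k) i (V j) 0 0 i = V j i := fun i j => by
    simp [wav, wt_zero, S.propT_zero hk]
  intro i j
  -- The equations at the origin alone already contain all the conditions.
  obtain ⟨hInt, hsol⟩ := h.2 0 0 h00 i j
  refine ⟨fun hcon => ?_, fun hcon => ?_, fun hcon => ?_⟩
  · have hij := hn i j (by rw [hcon]; simp)
    rw [hcon, hA i j hij, zero_add] at hsol
    simp only [contourIntegral, intervalIntegral.integral_same, add_zero] at hsol
    have e : ∫ s in T..0, expFactor u k i j 0 0 0 s * (V2 u 0 s k * Φ 0 s) i j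
        = ∫ s in T..0, ∑ r, V2 u 0 s k i r * wav u (l k) (z k) (propT u k) i (V j) 0 s r := by
      refine intervalIntegral.integral_congr_ae ?_
      -- The starting time T lies outside the domain, where `Φ` is not controlled; the integrands
      -- agree except at this one point.
      have hne : ∀ᵐ s : ℝ, s ≠ T := by simp [ae_iff, measure_singleton]
      filter_upwards [hne] with s hs hs'
      rw [uIoc_of_ge S.pos.le] at hs'
      rw [heq 0 s ⟨le_rfl, hs'.1.le, lt_of_le_of_ne hs'.2 hs⟩, expFactor_sum]
      simp [wt_zero, hV]
    rw [e, S.integral_diag_t hk hT h0, hw1] at hsol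
    have h1 : wav u (l k) (z k) (propT u k) i (V j) 0 T i = 0 := by
      have : Φ 0 0 i j = V j i := rfl
      rw [this] at hsol
      linear_combination hsol
    exact (mul_eq_zero.1 h1).resolve_left (wt_ne_zero _ _ _ _ _ _)
  · have hij := hn i j (by rw [hcon]; simp)
    rw [hcon, hA i j hij, zero_add] at hsol
    simpa [contourIntegral] using hsol
  · rw [hcon] at hsol hInt
    have hE : ∀ s, s ∈ Ioi (0 : ℝ) → expFactor u k i j 0 0 s 0 * (V1 u s 0 k * Φ s 0) i j
        = ∑ r, V1 u s 0 k i r * wav u (l k) (z k) (propT u k) i (V j) s 0 r := by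
      intro s hs
      rw [heq s 0 ⟨le_of_lt hs, le_rfl, S.pos⟩, expFactor_sum]
      simp [wt_zero, hV]
    have hInt' : IntegrableOn (fun s => ∑ r, V1 u s 0 k i r
        * wav u (l k) (z k) (propT u k) i (V j) s 0 r) (Ioi 0) :=
      IntegrableOn.congr_fun hInt hE measurableSet_Ioi
    have hd := fun s (hs : s ∈ Ici (0 : ℝ)) => S.hasDerivAt_diag_x hk hs h0 i (V j)
    -- The limit at infinity exists because its derivative is integrable; this is where the
    -- convergence of the integral is used.
    have hlim := tendsto_limUnder_of_hasDerivAt_of_integrableOn_Ioi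
      (fun s hs => hd s (Ioi_subset_Ici_self hs)) hInt'
    have hFTC := integral_Ioi_of_hasDerivAt_of_tendsto' hd hInt' hlim
    simp only [contourIntegral] at hsol
    rw [setIntegral_congr_fun measurableSet_Ioi hE, hFTC, hw1] at hsol
    have : Φ 0 0 i j = V j i := rfl
    rw [this] at hsol
    rw [show A i j = limUnder atTop fun x => wav u (l k) (z k) (propT u k) i (V j) x 0 i by
      linear_combination -hsol]
    exact hlim

end Regular


/-! ### Change of gauge -/

namespace Propagator

variable {T : ℝ} {u : ℝ → ℝ → ℝ} {B : ℝ} {l z : Fin 3 → ℂ}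
  {Y a U : ℝ → ℝ → Matrix (Fin 3) (Fin 3) ℂ} (S : Regular T u) (Pr : Propagator T u B l z Y a U)
  {Yt H : ℝ → ℝ → Matrix (Fin 3) (Fin 3) ℂ} (hYt : ∀ x t, Yt x t = Y x t + H x t * Y x t)
  (hH : ∀ x t, 0 ≤ x → t ∈ Icc 0 T → ∀ i j, ‖H x t i j‖ ≤ B / (1 + x) ^ 2)

include hYt

omit Pr in
lemma wav_gauge_change (j : Fin 3) (v : Fin 3 → ℂ) (x t : ℝ) (i : Fin 3) :
    wav u l z Yt j v x t i = wav u l z Y j v x t i + ∑ r, H x t i r * wav u l z Y j v x t r := by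
  unfold wav
  rw [hYt, Matrix.add_mulVec, ← Matrix.mulVec_mulVec, Pi.add_apply]
  simp only [Matrix.mulVec, dotProduct, Fin.sum_univ_three]
  ring

include Pr hH

lemma norm_gauge_change_le {j : Fin 3} {v : Fin 3 → ℂ} {x t : ℝ} (hx : 0 ≤ x) (ht : t ∈ Icc 0 T)
    {K : ℝ} (hK : ∀ i, ‖wav u l z Y j v x t i‖ ≤ K) (i : Fin 3) :
    ‖wav u l z Yt j v x t i - wav u l z Y j v x t i‖ ≤ 9 * B * K / (1 + x) ^ 2 := by
  have hB := Pr.nonneg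
  rw [wav_gauge_change hYt, add_sub_cancel_left]
  refine (norm_sum_mul_le (by positivity) (fun i r => hH x t hx ht i r) _ i).trans ?_
  refine (mul_le_mul_of_nonneg_left (partialNorm_le_of_forall hK)
    (by positivity)).trans (le_of_eq ?_)
  rw [Fintype.card_fin]
  push_cast
  ring

lemma bounded_gauge_change {j : Fin 3} {v : Fin 3 → ℂ} {t : ℝ} (ht : t ∈ Icc 0 T)
    (h : ∃ K : ℝ, ∀ x, 0 ≤ x → ∀ i, ‖wav u l z Y j v x t i‖ ≤ K) :
    ∃ K : ℝ, ∀ x, 0 ≤ x → ∀ i, ‖wav u l z Yt j v x t i‖ ≤ K := by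
  obtain ⟨K, hK⟩ := h
  have hB := Pr.nonneg
  have hK0 : 0 ≤ K := (norm_nonneg _).trans (hK 0 le_rfl 0)
  refine ⟨9 * B * K + K, fun x hx i => ?_⟩
  have h1 := Pr.norm_gauge_change_le hYt hH hx ht (hK x hx) i
  have h2 : 9 * B * K / (1 + x) ^ 2 ≤ 9 * B * K :=
    div_le_self (by positivity) (one_le_pow₀ (by linarith))
  have h3 := norm_le_norm_sub_add (wav u l z Yt j v x t i) (wav u l z Y j v x t i)
  linarith [hK x hx i]

/-- The two gauges differ by a factor 1 + O((1+x)⁻²), so bounded solutions have the same limits in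
both. The conditions at infinity may be studied in the sheared gauge, where the estimates are
uniform in k. -/
lemma tendsto_gauge_change {j : Fin 3} {v : Fin 3 → ℂ} {t : ℝ} (ht : t ∈ Icc 0 T)
    (h : ∃ K : ℝ, ∀ x, 0 ≤ x → ∀ i, ‖wav u l z Y j v x t i‖ ≤ K) {i : Fin 3} {M : ℂ}
    (hM : Tendsto (fun x => wav u l z Y j v x t i) atTop (𝓝 M)) :
    Tendsto (fun x => wav u l z Yt j v x t i) atTop (𝓝 M) := by
  obtain ⟨K, hK⟩ := h
  have h1 : Tendsto (fun x : ℝ => 9 * B * K / (1 + x) ^ 2) atTop (𝓝 0) :=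
    tendsto_const_nhds.div_atTop ((tendsto_pow_atTop (by norm_num)).comp
      (tendsto_atTop_add_const_left _ _ tendsto_id))
  have h2 : Tendsto (fun x => wav u l z Yt j v x t i - wav u l z Y j v x t i) atTop (𝓝 0) := by
    refine squeeze_zero_norm' ?_ h1
    filter_upwards [eventually_ge_atTop 0] with x hx
    exact Pr.norm_gauge_change_le hYt hH hx ht (hK x hx) i
  have h3 := h2.add hM
  rw [zero_add] at h3
  exact h3.congr fun x => by ring

include S

lemma last_tilde (h : ∀ i, (l i).re ≤ (l 2).re) (v : Fin 3 → ℂ) {t : ℝ} (ht : t ∈ Icc 0 T) :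
    (∃ K : ℝ, ∀ x, 0 ≤ x → ∀ i, ‖wav u l z Yt 2 v x t i‖ ≤ K) ∧
    Tendsto (fun x => wav u l z Yt 2 v x t 2) atTop (𝓝 (rhoVec u l z Y ⬝ᵥ v)) :=
  ⟨Pr.bounded_gauge_change hYt hH ht (Pr.last_column S h v ht).1,
    Pr.tendsto_gauge_change hYt hH ht (Pr.last_column S h v ht).1 (Pr.tendsto_rhoVec S h v ht)⟩

lemma middle_tilde (h01 : (l 0).re ≤ (l 1).re) (h12 : (l 1).re ≤ (l 2).re) {v : Fin 3 → ℂ}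
    (hv : rhoVec u l z Y ⬝ᵥ v = 0) :
    ∃ κ : ℂ, (∀ w, jVec u l z Y ⬝ᵥ (crossProduct v w) = κ * (rhoVec u l z Y ⬝ᵥ w)) ∧
      (κ = 0 → ∃ α : ℂ, v = α • jVec u l z Y) ∧
      ∀ t ∈ Icc 0 T, (∃ K : ℝ, ∀ x, 0 ≤ x → ∀ i, ‖wav u l z Yt 1 v x t i‖ ≤ K) ∧
        Tendsto (fun x => wav u l z Yt 1 v x t 1) atTop (𝓝 κ) := by
  have h0 : (0 : ℝ) ∈ Icc 0 T := ⟨le_rfl, S.pos.le⟩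
  obtain ⟨κ, hκ⟩ := Pr.middle_column S h01 h12 hv
  refine ⟨κ, fun w => Pr.triple_product_eq S h01 h12 hv (hκ 0 h0).2.1 w, fun h => ?_,
    fun t ht => ⟨Pr.bounded_gauge_change hYt hH ht (hκ t ht).1,
      Pr.tendsto_gauge_change hYt hH ht (hκ t ht).1 (hκ t ht).2.1⟩⟩
  subst h
  exact Pr.eq_smul_jVec S h01 h12 hv (hκ 0 h0).2.1

lemma first_tilde (h01 : (l 0).re ≤ (l 1).re) (h12 : (l 1).re ≤ (l 2).re) (i : Fin 3) {t : ℝ}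
    (ht : t ∈ Icc 0 T) :
    (∃ K : ℝ, ∀ x, 0 ≤ x → ∀ r, ‖wav u l z Yt i (jVec u l z Y) x t r‖ ≤ K) ∧
    Tendsto (fun x => wav u l z Yt i (jVec u l z Y) x t i) atTop
      (𝓝 ((Pi.single 0 1 : Fin 3 → ℂ) i)) := by
  have hb := Pr.bounded_jVec S h01 h12 i ht
  refine ⟨Pr.bounded_gauge_change hYt hH ht hb, Pr.tendsto_gauge_change hYt hH ht hb ?_⟩
  by_cases hi : i = 0
  · subst hi
    exact Pr.tendsto_jVec S (fun i => by fin_cases i <;> simp <;> linarith) ht 0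
  · rw [Pi.single_eq_of_ne hi]
    exact Pr.tendsto_jVec_later S h01 h12 i hi ht

end Propagator

/-! ### The ordered problem -/

/-- The increasing order of the real parts of the `l_j`, as a permutation. -/
def ord (n : Fin 18) : Equiv.Perm (Fin 3) :=
  Equiv.ofBijective (lOrder n) (by revert n; decide)

lemma precedes_ord (n : Fin 18) (i j : Fin 3) :
    Precedes (lOrder n) (ord n i) (ord n j) ↔ i < j := by
  constructor
  · rintro ⟨a, b, hab, ha, hb⟩
    rw [← (ord n).injective ha, ← (ord n).injective hb]
    exact hab
  · exact fun h => ⟨i, j, h, rfl, rfl⟩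

lemma contour_eq_of_le (n : Fin 18) {i j : Fin 3} (h : j ≤ i) :
    contour n (ord n i) (ord n j) = .γ₃ := by
  unfold contour
  rw [if_neg]
  rw [precedes_ord]
  exact not_lt.2 h

lemma contour_ne_of_lt (n : Fin 18) {i j : Fin 3} (h : i < j) :
    contour n (ord n i) (ord n j) ≠ .γ₃ := by
  unfold contour
  rw [if_pos ((precedes_ord n i j).2 h)]
  split_ifs <;> simp

/-- The functional which has to vanish at the starting point of a finite contour. -/
def eta (T : ℝ) (u : ℝ → ℝ → ℝ) (n : Fin 18) (k : ℂ) (i j m : Fin 3) : ℂ :=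
  match contour n (ord n i) (ord n j) with
  | .γ₁ => propT u k 0 T (ord n i) (ord n m)
  | _ => (Pi.single i 1 : Fin 3 → ℂ) m

/-- The ordered propagator after the shear. -/
def ordS (u : ℝ → ℝ → ℝ) (n : Fin 18) (k : ℂ) (x t : ℝ) : Matrix (Fin 3) (Fin 3) ℂ :=
  (propS u k x t).submatrix (ord n) (ord n)

/-- The ordered propagator. -/
def ordT (u : ℝ → ℝ → ℝ) (n : Fin 18) (k : ℂ) (x t : ℝ) : Matrix (Fin 3) (Fin 3) ℂ :=
  (propT u k x t).submatrix (ord n) (ord n)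

/-- The functional of the last column of the ordered problem. -/
def rhoN (u : ℝ → ℝ → ℝ) (n : Fin 18) (k : ℂ) : Fin 3 → ℂ :=
  rhoVec u (l k ∘ ord n) (z k ∘ ord n) (ordS u n k)

/-- The base vector of the first column of the ordered problem. -/
def jN (u : ℝ → ℝ → ℝ) (n : Fin 18) (k : ℂ) : Fin 3 → ℂ :=
  jVec u (l k ∘ ord n) (z k ∘ ord n) (ordS u n k)

/-- The denominator of the middle column. -/
def denMid (T : ℝ) (u : ℝ → ℝ → ℝ) (n : Fin 18) (k : ℂ) : ℂ := eta T u n k 0 1 ⬝ᵥ jN u n k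

/-- The denominator of the last column. -/
def denLast (T : ℝ) (u : ℝ → ℝ → ℝ) (n : Fin 18) (k : ℂ) : ℂ :=
  rhoN u n k ⬝ᵥ crossProduct (eta T u n k 0 2) (eta T u n k 1 2)

/-- The base vectors of the columns of the ordered problem. -/
def col (T : ℝ) (u : ℝ → ℝ → ℝ) (n : Fin 18) (k : ℂ) : Fin 3 → Fin 3 → ℂ :=
  ![jN u n k, (denMid T u n k)⁻¹ • crossProduct (rhoN u n k) (eta T u n k 0 1),
    (denLast T u n k)⁻¹ • crossProduct (eta T u n k 0 2) (eta T u n k 1 2)]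

/-- Base vectors in the original order. -/
def reorder (n : Fin 18) (W : Fin 3 → Fin 3 → ℂ) (j i : Fin 3) : ℂ :=
  W ((ord n).symm j) ((ord n).symm i)

lemma wav_ord (u : ℝ → ℝ → ℝ) (n : Fin 18) (k : ℂ) (i r : Fin 3) (v : Fin 3 → ℂ) (x t : ℝ) :
    wav u (l k) (z k) (propT u k) (ord n i) v x t (ord n r)
      = wav u (l k ∘ ord n) (z k ∘ ord n) (ordT u n k) i (v ∘ ord n) x t r := by
  have h : (propT u k x t).mulVec v (ord n r) = (ordT u n k x t).mulVec (v ∘ ord n) r := by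
    simp only [ordT, Matrix.mulVec, dotProduct, Matrix.submatrix_apply, Function.comp_apply]
    exact (Equiv.sum_comp (ord n) fun m => propT u k x t (ord n r) m * v m).symm
  rw [wav, h]
  rfl

lemma reorder_apply_ord (n : Fin 18) (W : Fin 3 → Fin 3 → ℂ) (j i : Fin 3) :
    reorder n W (ord n j) (ord n i) = W j i := by
  rw [reorder, Equiv.symm_apply_apply, Equiv.symm_apply_apply]

lemma reorder_comp (n : Fin 18) (W : Fin 3 → Fin 3 → ℂ) (j : Fin 3) :
    reorder n W (ord n j) ∘ ord n = W j := by
  exact funext fun i => reorder_apply_ord n W j i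

lemma eta_dotProduct_of_γ₁ {T : ℝ} {u : ℝ → ℝ → ℝ} {n : Fin 18} {k : ℂ} {i j : Fin 3}
    (h : contour n (ord n i) (ord n j) = .γ₁) (v : Fin 3 → ℂ) :
    (propT u k 0 T).mulVec v (ord n i) = eta T u n k i j ⬝ᵥ (v ∘ ord n) := by
  simp only [Matrix.mulVec, dotProduct, eta, h, Function.comp_apply]
  exact (Equiv.sum_comp (ord n) fun m => propT u k 0 T (ord n i) m * v m).symm

lemma eta_dotProduct_of_γ₂ {T : ℝ} {u : ℝ → ℝ → ℝ} {n : Fin 18} {k : ℂ} {i j : Fin 3}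
    (h : contour n (ord n i) (ord n j) = .γ₂) (v : Fin 3 → ℂ) :
    v (ord n i) = eta T u n k i j ⬝ᵥ (v ∘ ord n) := by
  simp only [dotProduct, eta, h, Pi.single_apply, ite_mul, one_mul, zero_mul, Finset.sum_ite_eq',
    Finset.mem_univ, if_true, Function.comp_apply]

namespace Regular

variable {T : ℝ} {u : ℝ → ℝ → ℝ} (S : Regular T u) {k : ℂ} (hk : Good k) {n : Fin 18}
  (h01 : (l k (ord n 0)).re ≤ (l k (ord n 1)).re) (h12 : (l k (ord n 1)).re ≤ (l k (ord n 2)).re)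

include S

lemma exists_ordered_propagator (n : Fin 18) : ∃ C : ℝ, 0 ≤ C ∧ ∀ k, Good k →
    ∃ a U H H' : ℝ → ℝ → Matrix (Fin 3) (Fin 3) ℂ,
    Propagator T u (C * beta k) (l k ∘ ord n) (z k ∘ ord n) (ordS u n k) a U ∧
    (∀ x t, ordT u n k x t = ordS u n k x t + H x t * ordS u n k x t) ∧
    (∀ x t, ordS u n k x t = ordT u n k x t + H' x t * ordT u n k x t) ∧
    ∀ x t, 0 ≤ x → t ∈ Icc 0 T → ∀ i j, ‖H x t i j‖ ≤ C * beta k / (1 + x) ^ 2 ∧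
      ‖H' x t i j‖ ≤ C * beta k / (1 + x) ^ 2 := by
  obtain ⟨C, hC, h⟩ := S.exists_propagator
  refine ⟨C, hC, fun k hk => ?_⟩
  obtain ⟨Pr, hdev⟩ := h k hk
  refine ⟨_, _, fun x t => (unshearDev u k x t).submatrix (ord n) (ord n),
    fun x t => (shearDev u k x t).submatrix (ord n) (ord n), Pr.perm (ord n), ?_, ?_,
    fun x t hx ht i j => ⟨(hdev x t hx ht _ _).2, (hdev x t hx ht _ _).1⟩⟩
  · intro x t
    rw [ordT, ordS, hk.propT_eq, Matrix.submatrix_mul_equiv]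
    rfl
  · intro x t
    rw [ordT, ordS, hk.propS_eq, Matrix.submatrix_mul_equiv]
    rfl

include hk

lemma exists_ordered (n : Fin 18) : ∃ (B : ℝ) (a U H : ℝ → ℝ → Matrix (Fin 3) (Fin 3) ℂ),
    Propagator T u B (l k ∘ ord n) (z k ∘ ord n) (ordS u n k) a U ∧
    (∀ x t, ordT u n k x t = ordS u n k x t + H x t * ordS u n k x t) ∧
    ∀ x t, 0 ≤ x → t ∈ Icc 0 T → ∀ i j, ‖H x t i j‖ ≤ B / (1 + x) ^ 2 := by
  obtain ⟨C, -, h⟩ := S.exists_ordered_propagator n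
  obtain ⟨a, U, H, H', Pr, hT, -, hH⟩ := h k hk
  exact ⟨_, a, U, H, Pr, hT, fun x t hx ht i j => (hH x t hx ht i j).1⟩

include h01 h12

lemma rhoN_dotProduct_jN : rhoN u n k ⬝ᵥ jN u n k = 0 := by
  obtain ⟨B, a, U, H, Pr, -, -⟩ := S.exists_ordered hk n
  exact Pr.rhoVec_dotProduct_jVec S h01 h12

lemma jN_ne_zero : jN u n k ≠ 0 := by
  obtain ⟨B, a, U, H, Pr, -, -⟩ := S.exists_ordered hk n
  exact Pr.jVec_ne_zero S (fun i => by fin_cases i <;> simp at * <;> linarith)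

/-- Columns with the right limits and end conditions give a solution of the system. -/
lemma solvesSystem_of_columns {α : ℂ} {W : Fin 3 → Fin 3 → ℂ} (hW₀ : W 0 = α • jN u n k)
    (hW₁ : rhoN u n k ⬝ᵥ W 1 = 0)
    (hκ : (∃ γ : ℂ, W 1 = γ • jN u n k ∧ α = 0) ∨
      ∀ κ : ℂ, (∀ w, jN u n k ⬝ᵥ (crossProduct (W 1) w) = κ * (rhoN u n k ⬝ᵥ w)) → κ = α)
    (hW₂ : rhoN u n k ⬝ᵥ W 2 = α)
    (heta : ∀ i j, i < j → eta T u n k i j ⬝ᵥ W j = 0) :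
    SolvesSystem T u n k (α • (1 : Matrix (Fin 3) (Fin 3) ℂ)) (waveMat u k (reorder n W)) := by
  obtain ⟨B, a, U, H, Pr, hYt, hH⟩ := S.exists_ordered hk n
  have h2 : ∀ i, ((l k ∘ ord n) i).re ≤ ((l k ∘ ord n) 2).re :=
    fun i => by fin_cases i <;> simp at * <;> linarith
  have hsurj : ∀ i, ∃ i', i = ord n i' := fun i => ⟨(ord n).symm i, by simp⟩
  refine S.solvesSystem_waveMat hk (fun i j hij => by simp [hij]) ?_ ?_ ?_
  · intro i j hc
    obtain ⟨i, rfl⟩ := hsurj i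
    obtain ⟨j, rfl⟩ := hsurj j
    have hij : i < j := by
      by_contra h
      rw [contour_eq_of_le n (not_lt.1 h)] at hc
      simp at hc
    refine ⟨fun h => hij.ne ((ord n).injective h), ?_⟩
    rw [eta_dotProduct_of_γ₁ hc (reorder n W (ord n j)), reorder_comp]
    exact heta i j hij
  · intro i j hc
    obtain ⟨i, rfl⟩ := hsurj i
    obtain ⟨j, rfl⟩ := hsurj j
    have hij : i < j := by
      by_contra h
      rw [contour_eq_of_le n (not_lt.1 h)] at hc
      simp at hc
    refine ⟨fun h => hij.ne ((ord n).injective h), ?_⟩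
    rw [eta_dotProduct_of_γ₂ (T := T) (u := u) (k := k) hc (reorder n W (ord n j)), reorder_comp]
    exact heta i j hij
  · intro i j hc t ht
    obtain ⟨i, rfl⟩ := hsurj i
    obtain ⟨j, rfl⟩ := hsurj j
    have hij : j ≤ i := by
      by_contra h
      exact contour_ne_of_lt n (not_le.1 h) hc
    have hA : (α • (1 : Matrix (Fin 3) (Fin 3) ℂ)) (ord n i) (ord n j)
        = α * (Pi.single j 1 : Fin 3 → ℂ) i := by
      rw [Matrix.smul_apply, smul_eq_mul, Matrix.one_apply, Pi.single_apply]
      simp only [EmbeddingLike.apply_eq_iff_eq]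
    rw [hA]
    suffices h : (∃ K : ℝ, ∀ x, 0 ≤ x → ∀ r,
        ‖wav u (l k ∘ ord n) (z k ∘ ord n) (ordT u n k) i (W j) x t r‖ ≤ K) ∧
        Tendsto (fun x => wav u (l k ∘ ord n) (z k ∘ ord n) (ordT u n k) i (W j) x t i) atTop
          (𝓝 (α * (Pi.single j 1 : Fin 3 → ℂ) i)) by
      obtain ⟨⟨K, hK⟩, hlim⟩ := h
      refine ⟨⟨K, fun x hx r => ?_⟩, ?_⟩
      · obtain ⟨r, rfl⟩ := hsurj r
        rw [wav_ord, reorder_comp]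
        exact hK x hx r
      · simp only [wav_ord, reorder_comp]
        exact hlim
    have hcase : j = 0 ∨ (j = 1 ∧ i = 1) ∨ (j = 1 ∧ i = 2) ∨ (j = 2 ∧ i = 2) := by omega
    rcases hcase with rfl | ⟨rfl, rfl⟩ | ⟨rfl, rfl⟩ | ⟨rfl, rfl⟩
    · obtain ⟨⟨K, hK⟩, hlim⟩ := Pr.first_tilde S hYt hH h01 h12 i ht
      rw [hW₀]
      refine ⟨⟨‖α‖ * K, fun x hx r => ?_⟩, ?_⟩
      · rw [wav_smul, norm_mul]
        exact mul_le_mul_of_nonneg_left (hK x hx r) (norm_nonneg _)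
      · simp only [wav_smul]
        exact hlim.const_mul α
    · obtain ⟨κ, h1, -, h4⟩ := Pr.middle_tilde S hYt hH h01 h12 hW₁
      rw [Pi.single_eq_same, mul_one]
      -- Either the problem is homogeneous and the middle column is a multiple of J, whose middle
      -- component tends to 0, or κ is determined by the triple product identity.
      rcases hκ with ⟨γ, hγ, rfl⟩ | hκ
      · refine ⟨(h4 t ht).1, ?_⟩
        have h5 := (Pr.first_tilde S hYt hH h01 h12 1 ht).2.const_mul γ
        rw [Pi.single_eq_of_ne (by decide), mul_zero] at h5
        rw [hγ]
        simp only [wav_smul]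
        exact h5
      · rw [← hκ κ h1]
        exact h4 t ht
    · have := Pr.last_tilde S hYt hH h2 (W 1) ht
      rw [Pi.single_eq_of_ne (by decide), mul_zero]
      rwa [show rhoVec u (l k ∘ ord n) (z k ∘ ord n) (ordS u n k) ⬝ᵥ W 1 = 0 from hW₁] at this
    · have := Pr.last_tilde S hYt hH h2 (W 2) ht
      rw [Pi.single_eq_same, mul_one]
      rwa [show rhoVec u (l k ∘ ord n) (z k ∘ ord n) (ordS u n k) ⬝ᵥ W 2 = α from hW₂] at this

lemma solvesSystem_col (hm : denMid T u n k ≠ 0) (hl : denLast T u n k ≠ 0) :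
    SolvesSystem T u n k 1 (waveMat u k (reorder n (col T u n k))) := by
  have h := S.rhoN_dotProduct_jN hk h01 h12
  rw [← one_smul ℂ (1 : Matrix (Fin 3) (Fin 3) ℂ)]
  refine S.solvesSystem_of_columns hk h01 h12 (by simp [col]) ?_ ?_ ?_ ?_
  · simp [col, dotProduct_smul]
  · refine Or.inr fun κ h1 => ?_
    -- Test the identity for κ on w = η₀₂×η₁₂, for which ρ·w is the nonzero last denominator. As ρ·J
    -- = 0, the left side is the product of the normalizing factor, η₀₁·J and ρ·w.
    have h2 := h1 (crossProduct (eta T u n k 0 2) (eta T u n k 1 2))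
    have h3 : jN u n k ⬝ᵥ crossProduct (col T u n k 1)
        (crossProduct (eta T u n k 0 2) (eta T u n k 1 2)) = denLast T u n k := by
      have e : ∀ J ρ η w : Fin 3 → ℂ, J ⬝ᵥ crossProduct (crossProduct ρ η) w
          = (η ⬝ᵥ J) * (ρ ⬝ᵥ w) - (ρ ⬝ᵥ J) * (η ⬝ᵥ w) := by
        intro J ρ η w
        simp only [cross_apply, dotProduct, Fin.sum_univ_three, Matrix.cons_val_zero,
          Matrix.cons_val_one, Matrix.cons_val]
        ring
      simp only [col, Matrix.cons_val_one, Matrix.cons_val_zero, map_smul, LinearMap.smul_apply,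
        dotProduct_smul, e, h, smul_eq_mul]
      rw [zero_mul, sub_zero, ← mul_assoc]
      change (denMid T u n k)⁻¹ * denMid T u n k * denLast T u n k = _
      rw [inv_mul_cancel₀ hm, one_mul]
    rw [h3] at h2
    exact (mul_eq_right₀ hl).1 h2.symm
  · simp only [col, Matrix.cons_val, dotProduct_smul, smul_eq_mul]
    exact inv_mul_cancel₀ hl
  · intro i j hij
    have hcase : (i = 0 ∧ j = 1) ∨ (i = 0 ∧ j = 2) ∨ (i = 1 ∧ j = 2) := by omega
    rcases hcase with ⟨rfl, rfl⟩ | ⟨rfl, rfl⟩ | ⟨rfl, rfl⟩ <;>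
      simp [col, dotProduct_smul, dot_cross_self, dot_self_cross]

/-- Off the zeros of the denominators the homogeneous conditions have only the trivial solution. -/
lemma eq_zero_of_endConditions (hm : denMid T u n k ≠ 0) (hl : denLast T u n k ≠ 0)
    {V : Fin 3 → Fin 3 → ℂ} (h : EndConditions T u n k 0 V) : V = 0 := by
  obtain ⟨B, a, U, H, Pr, hYt, hH⟩ := S.exists_ordered hk n
  have h0 : (0 : ℝ) ∈ Icc 0 T := ⟨le_rfl, S.pos.le⟩
  have h2 : ∀ i, ((l k ∘ ord n) i).re ≤ ((l k ∘ ord n) 2).re :=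
    fun i => by fin_cases i <;> simp at * <;> linarith
  set W : Fin 3 → Fin 3 → ℂ := fun j => V (ord n j) ∘ ord n with hW
  have hlim : ∀ i j, j ≤ i → Tendsto (fun x => wav u (l k ∘ ord n) (z k ∘ ord n) (ordT u n k) i
      (W j) x 0 i) atTop (𝓝 0) := by
    intro i j hij
    have := (h (ord n i) (ord n j)).2.2 (contour_eq_of_le n hij)
    simp only [wav_ord] at this
    exact this
  have heta : ∀ i j, i < j → eta T u n k i j ⬝ᵥ W j = 0 := by
    intro i j hij
    have hne := contour_ne_of_lt n hij
    cases hc : contour n (ord n i) (ord n j) with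
    | γ₁ =>
      rw [hW, ← eta_dotProduct_of_γ₁ hc]
      exact (h _ _).1 hc
    | γ₂ =>
      rw [hW, ← eta_dotProduct_of_γ₂ (T := T) (u := u) (k := k) hc]
      exact (h _ _).2.1 hc
    | γ₃ => exact absurd hc hne
  have hρ : ∀ j, rhoN u n k ⬝ᵥ W j = 0 := fun j =>
    tendsto_nhds_unique (Pr.last_tilde S hYt hH h2 (W j) h0).2 (hlim 2 j (by omega))
  have hJ : ∀ j, j ≤ 1 → ∃ α : ℂ, W j = α • jN u n k := by
    intro j hj
    obtain ⟨κ, -, h3, h4⟩ := Pr.middle_tilde S hYt hH h01 h12 (hρ j)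
    exact h3 (tendsto_nhds_unique (h4 0 h0).2 (hlim 1 j hj))
  have hW0 : W 0 = 0 := by
    obtain ⟨α, hα⟩ := hJ 0 (by decide)
    have h3 := hlim 0 0 le_rfl
    rw [hα] at h3
    simp only [wav_smul] at h3
    have h4 := (Pr.first_tilde S hYt hH h01 h12 0 h0).2.const_mul α
    have h5 := tendsto_nhds_unique h3 h4
    rw [Pi.single_eq_same, mul_one] at h5
    rw [hα, ← h5, zero_smul]
  have hW1 : W 1 = 0 := by
    obtain ⟨α, hα⟩ := hJ 1 le_rfl
    have h3 := heta 0 1 (by decide)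
    rw [hα, dotProduct_smul, smul_eq_mul] at h3
    rw [hα, (mul_eq_zero.1 h3).resolve_right hm, zero_smul]
  have hW2 : W 2 = 0 := by
    have e1 := hρ 2
    have e2 := heta 0 2 (by decide)
    have e3 := heta 1 2 (by decide)
    have e4 : denLast T u n k ≠ 0 := hl
    unfold denLast at e4
    generalize rhoN u n k = p at *
    generalize eta T u n k 0 2 = r at *
    generalize eta T u n k 1 2 = s at *
    generalize W 2 = w at *
    -- Cramer's rule: three independent functionals determine a vector, and here all three vanish on
    -- w.
    have key : (p ⬝ᵥ crossProduct r s) • w = (p ⬝ᵥ w) • crossProduct r s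
        + (r ⬝ᵥ w) • crossProduct s p + (s ⬝ᵥ w) • crossProduct p r := by
      ext i
      simp only [cross_apply, dotProduct, Fin.sum_univ_three, Pi.smul_apply, Pi.add_apply,
        smul_eq_mul]
      fin_cases i <;> simp <;> ring
    rw [e1, e2, e3, zero_smul, zero_smul, zero_smul, add_zero, add_zero] at key
    exact (smul_eq_zero.1 key).resolve_left e4
  have hW' : ∀ j, W j = 0 := fun j => by fin_cases j <;> assumption
  ext j i
  have := congrFun (hW' ((ord n).symm j)) ((ord n).symm i)
  simpa [hW] using this

omit h01 h12 in
lemma waveMat_zero (V : Fin 3 → Fin 3 → ℂ) (i j : Fin 3) : waveMat u k V 0 0 i j = V j i := by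
  simp [waveMat, wav, wt_zero, S.propT_zero hk]

/-- At the zeros of the denominators the homogeneous system has a nonzero solution. -/
lemma exists_homogeneous (h : denMid T u n k * denLast T u n k = 0) :
    ∃ Φ : ℝ → ℝ → Matrix (Fin 3) (Fin 3) ℂ, SolvesSystem T u n k 0 Φ ∧
      ∃ x t : ℝ, (x, t) ∈ halfLine T ∧ Φ x t ≠ 0 := by
  have hJ := S.jN_ne_zero hk h01 h12
  obtain ⟨W, hW, hS⟩ : ∃ W : Fin 3 → Fin 3 → ℂ, W ≠ 0 ∧
      SolvesSystem T u n k 0 (waveMat u k (reorder n W)) := by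
    rw [← zero_smul ℂ (1 : Matrix (Fin 3) (Fin 3) ℂ)]
    rcases mul_eq_zero.1 h with h | h
    -- If η₀₁·J = 0, the vector J itself satisfies all the homogeneous conditions of the middle
    -- column.
    · refine ⟨![0, jN u n k, 0], fun h0 => hJ (by simpa using congrFun h0 1),
        S.solvesSystem_of_columns hk h01 h12 (by simp)
          (by simpa using S.rhoN_dotProduct_jN hk h01 h12) (Or.inl ⟨1, by simp, rfl⟩) (by simp) ?_⟩
      intro i j hij
      have hcase : (i = 0 ∧ j = 1) ∨ j = 2 := by omega
      rcases hcase with ⟨rfl, rfl⟩ | rfl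
      · exact h
      · simp
    -- The last denominator is the determinant of the three functionals imposed on the last column;
    -- when it vanishes they have a common null vector.
    · obtain ⟨w, hw, hMw⟩ := Matrix.exists_mulVec_eq_zero_iff
        (M := Matrix.of ![rhoN u n k, eta T u n k 0 2, eta T u n k 1 2]) |>.2 (by
          exact (triple_product_eq_det _ _ _).symm.trans h)
      have hrow : ∀ i, (![rhoN u n k, eta T u n k 0 2, eta T u n k 1 2] : Fin 3 → Fin 3 → ℂ) i
          ⬝ᵥ w = 0 := fun i => congrFun hMw i
      refine ⟨![0, 0, w], fun h0 => hw (by simpa using congrFun h0 2),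
        S.solvesSystem_of_columns hk h01 h12 (by simp) (by simp) (Or.inl ⟨0, by simp, rfl⟩)
          (by simpa using hrow 0) ?_⟩
      intro i j hij
      have hcase : (i = 0 ∧ j = 1) ∨ (i = 0 ∧ j = 2) ∨ (i = 1 ∧ j = 2) := by omega
      rcases hcase with ⟨rfl, rfl⟩ | ⟨rfl, rfl⟩ | ⟨rfl, rfl⟩
      · simp
      · simpa using hrow 1
      · simpa using hrow 2
  refine ⟨_, hS, 0, 0, ⟨le_rfl, le_rfl, S.pos⟩, fun h0 => hW ?_⟩
  ext j i
  have := congrFun (congrFun h0 (ord n i)) (ord n j)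
  rw [S.waveMat_zero hk, ← Function.comp_apply (f := reorder n W (ord n j)),
    reorder_comp] at this
  simpa using this

end Regular


/-! ### Rates of convergence -/

namespace Propagator

variable {T : ℝ} {u : ℝ → ℝ → ℝ} {B : ℝ} {l z : Fin 3 → ℂ}
  {Y a U : ℝ → ℝ → Matrix (Fin 3) (Fin 3) ℂ} (S : Regular T u) (Pr : Propagator T u B l z Y a U)

include S Pr

/-- The rate is explicit and involves k only through `B` and the propagator at the origin, so
convergence is locally uniform in k and the limit inherits analyticity. -/
lemma norm_rhoVec_sub_entry_le (h : ∀ i, (l i).re ≤ (l 2).re) {x : ℝ} (hx : 0 ≤ x) (i : Fin 3) :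
    ‖wt u l z 2 x 0 * Y x 0 2 i - rhoVec u l z Y i‖ ≤ (Real.exp (12 * B / (1 + x)) - 1)
      * (Real.exp (12 * B) * partialNorm Finset.univ fun m => Y 0 0 m i) := by
  have h0 : (0 : ℝ) ∈ Icc 0 T := ⟨le_rfl, S.pos.le⟩
  have h1 := Pr.norm_sub_rhoVec_le S h (Pi.single i 1) hx h0
  have e : ∀ x m, wav u l z Y 2 (Pi.single i 1) x 0 m = wt u l z 2 x 0 * Y x 0 m i := by
    intro x m
    simp [wav]
  rw [e, dotProduct_single, mul_one] at h1
  refine h1.trans (mul_le_mul_of_nonneg_left ((Pr.partialNorm_last_le S h _ hx h0).trans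
    (le_of_eq ?_)) ?_)
  · congr 2
    ext m
    rw [e, Regular.wt_zero, one_mul]
  · have : 0 ≤ 12 * B / (1 + x) := div_nonneg (by linarith [Pr.nonneg]) (by linarith)
    linarith [Real.one_le_exp this]

lemma norm_jVec_sub_entry_le (h : ∀ i, (l 0).re ≤ (l i).re) {x : ℝ} (hx : 0 ≤ x) (i : Fin 3) :
    ‖(wt u l z 0 x 0)⁻¹ * (Y x 0).adjugate i 0 - jVec u l z Y i‖
      ≤ (Real.exp (12 * B / (1 + x)) - 1)
        * (Real.exp (12 * B) * partialNorm Finset.univ fun m => (Y 0 0).adjugate i m) := by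
  have h0 : (0 : ℝ) ∈ Icc 0 T := ⟨le_rfl, S.pos.le⟩
  obtain ⟨-, L, hL, hL'⟩ := Pr.adj_column S h (Pi.single i 1) h0
  have h1 := hL' x hx
  rw [tendsto_nhds_unique hL (Pr.tendsto_adjWav S h (Pi.single i 1)), single_dotProduct,
    one_mul] at h1
  have e : ∀ x m, adjWav u l z Y (Pi.single i 1) x 0 m
      = (wt u l z 0 x 0)⁻¹ * (Y x 0).adjugate i m := by
    intro x m
    simp [adjWav]
  rw [e] at h1
  refine h1.trans (mul_le_mul_of_nonneg_left ((Pr.partialNorm_adj_le S h _ hx h0).trans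
    (le_of_eq ?_)) ?_)
  · congr 2
    ext m
    rw [e, Regular.wt_zero, inv_one, one_mul]
  · have : 0 ≤ 12 * B / (1 + x) := div_nonneg (by linarith [Pr.nonneg]) (by linarith)
    linarith [Real.one_le_exp this]

end Propagator

lemma tendstoLocallyUniformlyOn_of_rate {F : ℝ → ℂ → ℂ} {f : ℂ → ℂ} {b M : ℂ → ℝ} {s : Set ℂ}
    (hb : ContinuousOn b s) (hM : ContinuousOn M s)
    (h : ∀ k ∈ s, ∀ x : ℝ, 0 ≤ x → ‖F x k - f k‖ ≤ (Real.exp (12 * b k / (1 + x)) - 1) * M k)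
    (hb0 : ∀ k ∈ s, 0 ≤ b k) :
    TendstoLocallyUniformlyOn F f atTop s := by
  rw [Metric.tendstoLocallyUniformlyOn_iff]
  intro ε hε k₀ hk₀
  have h1 : ∀ᶠ k in 𝓝[s] k₀, b k ≤ b k₀ + 1 := (hb k₀ hk₀).eventually_le_const (by linarith)
  have h2 : ∀ᶠ k in 𝓝[s] k₀, M k ≤ |M k₀| + 1 :=
    (hM k₀ hk₀).eventually_le_const (by linarith [le_abs_self (M k₀)])
  refine ⟨_, (h1.and (h2.and self_mem_nhdsWithin)), ?_⟩
  have h3 := (tendsto_exp_sub_one (b k₀ + 1)).mul_const (|M k₀| + 1)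
  rw [zero_mul] at h3
  filter_upwards [h3.eventually (gt_mem_nhds hε), eventually_ge_atTop 0] with x hx hx0
  rintro k ⟨hk1, hk2, hks⟩
  rw [dist_comm, dist_eq_norm]
  refine (h k hks x hx0).trans_lt (lt_of_le_of_lt ?_ hx)
  have e1 : 12 * b k / (1 + x) ≤ 12 * (b k₀ + 1) / (1 + x) := by gcongr
  have e2 : 0 ≤ 12 * b k / (1 + x) :=
    div_nonneg (by linarith [hb0 k hks]) (by linarith)
  have e3 := Real.exp_le_exp.2 e1
  have e4 := Real.one_le_exp e2
  exact (mul_le_mul_of_nonneg_left hk2 (by linarith)).trans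
    (mul_le_mul_of_nonneg_right (by linarith) (by positivity))

/-! ### Dependence on the spectral parameter -/

lemma differentiableAt_mul_entry {M N : ℂ → Matrix (Fin 3) (Fin 3) ℂ} {k : ℂ}
    (hM : ∀ i j, DifferentiableAt ℂ (fun k => M k i j) k)
    (hN : ∀ i j, DifferentiableAt ℂ (fun k => N k i j) k) (i j : Fin 3) :
    DifferentiableAt ℂ (fun k => (M k * N k) i j) k := by
  simp only [Matrix.mul_apply]
  exact DifferentiableAt.fun_sum fun r _ => (hM i r).mul (hN r j)

lemma differentiableAt_const_mul_entry (A : Matrix (Fin 3) (Fin 3) ℂ)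
    {N : ℂ → Matrix (Fin 3) (Fin 3) ℂ} {k : ℂ}
    (hN : ∀ i j, DifferentiableAt ℂ (fun k => N k i j) k) (i j : Fin 3) :
    DifferentiableAt ℂ (fun k => (A * N k) i j) k :=
  differentiableAt_mul_entry (M := fun _ => A) (fun _ _ => differentiableAt_const _) hN i j

lemma differentiableAt_adjugate_entry {M : ℂ → Matrix (Fin 3) (Fin 3) ℂ} {k : ℂ}
    (h : ∀ i j, DifferentiableAt ℂ (fun k => M k i j) k) (i j : Fin 3) :
    DifferentiableAt ℂ (fun k => (M k).adjugate i j) k := by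
  simp only [Matrix.adjugate_fin_three]
  fin_cases i <;> fin_cases j <;>
    simp only [Fin.mk_one, Fin.zero_eta, Fin.reduceFinMk, Matrix.of_apply, Matrix.cons_val_zero,
      Matrix.cons_val_one, Matrix.cons_val] <;>
    fun_prop

lemma Good.differentiableAt_wt {k : ℂ} (hk : Good k) (u : ℝ → ℝ → ℝ) (σ : Fin 3 → Fin 3)
    (j : Fin 3) (x t : ℝ) :
    DifferentiableAt ℂ (fun k => wt u (l k ∘ σ) (z k ∘ σ) j x t) k := by
  have h1 := differentiableAt_l hk.1 (σ j)
  have h2 := hk.differentiableAt_z (σ j)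
  exact (((h1.mul_const _).add (h2.mul_const _)).neg).cexp

/-- The closed sector of the order `n`. -/
def sectorLE (n : Fin 18) : Set ℂ :=
  {k | Good k ∧ (l k (ord n 0)).re ≤ (l k (ord n 1)).re ∧
    (l k (ord n 1)).re ≤ (l k (ord n 2)).re}

/-- The open sector of the order `n`. -/
def sectorLT (n : Fin 18) : Set ℂ :=
  {k | Good k ∧ (l k (ord n 0)).re < (l k (ord n 1)).re ∧
    (l k (ord n 1)).re < (l k (ord n 2)).re}

lemma sectorLT_subset (n : Fin 18) : sectorLT n ⊆ sectorLE n :=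
  fun _ h => ⟨h.1, h.2.1.le, h.2.2.le⟩

lemma isOpen_sectorLT (n : Fin 18) : IsOpen (sectorLT n) := by
  rw [isOpen_iff_mem_nhds]
  rintro k ⟨hg, h1, h2⟩
  have hl : ∀ j, ContinuousAt (fun k => (l k j).re) k := fun j =>
    Complex.continuous_re.continuousAt.comp (differentiableAt_l hg.1 j).continuousAt
  filter_upwards [isOpen_good.mem_nhds hg, (hl _).eventually_lt (hl _) h1,
    (hl _).eventually_lt (hl _) h2] with k' h1 h2 h3
  exact ⟨h1, h2, h3⟩

namespace Regular

variable {T : ℝ} {u : ℝ → ℝ → ℝ} (S : Regular T u)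

include S

lemma differentiableAt_laxMat {k : ℂ} (hk : Good k) {x t : ℝ} (hx : 0 ≤ x) (ht : 0 ≤ t)
    (i j : Fin 3) : DifferentiableAt ℂ (fun k => laxMat u (lam k) x t i j) k := by
  have h1 := (S.differentiableAt_laxSol hk.lam_ne_zero (Pi.single j 1) hx ht).comp k
    (differentiableAt_lam hk.1)
  exact differentiableAt_pi.1 h1 i

lemma differentiableAt_conj_laxMat (A A' : Matrix (Fin 3) (Fin 3) ℂ) {k : ℂ} (hk : Good k)
    {x t : ℝ} (hx : 0 ≤ x) (ht : 0 ≤ t) (i j : Fin 3) :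
    DifferentiableAt ℂ (fun k => (Pinv k * (A * laxMat u (lam k) x t) * (A' * P k)) i j) k :=
  differentiableAt_mul_entry (M := fun k => Pinv k * (A * laxMat u (lam k) x t))
    (N := fun k => A' * P k)
    (differentiableAt_mul_entry (M := Pinv) (N := fun k => A * laxMat u (lam k) x t)
      hk.differentiableAt_Pinv
      (differentiableAt_const_mul_entry A (S.differentiableAt_laxMat hk hx ht)))
    (differentiableAt_const_mul_entry A' (differentiableAt_P hk.1)) i j

lemma differentiableAt_propT {k : ℂ} (hk : Good k) {x t : ℝ} (hx : 0 ≤ x) (ht : 0 ≤ t)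
    (i j : Fin 3) : DifferentiableAt ℂ (fun k => propT u k x t i j) k := by
  unfold propT
  exact S.differentiableAt_conj_laxMat _ _ hk hx ht i j

lemma differentiableAt_propS {k : ℂ} (hk : Good k) {x t : ℝ} (hx : 0 ≤ x) (ht : 0 ≤ t)
    (i j : Fin 3) : DifferentiableAt ℂ (fun k => propS u k x t i j) k := by
  unfold propS
  exact S.differentiableAt_conj_laxMat _ _ hk hx ht i j

lemma tendstoLocallyUniformlyOn_rhoN (n : Fin 18) (i : Fin 3) :
    TendstoLocallyUniformlyOn
      (fun x k => wt u (l k ∘ ord n) (z k ∘ ord n) 2 x 0 * ordS u n k x 0 2 i)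
      (fun k => rhoN u n k i) atTop (sectorLE n) := by
  obtain ⟨C, hC, h⟩ := S.exists_ordered_propagator n
  refine tendstoLocallyUniformlyOn_of_rate (b := fun k => C * beta k)
    (M := fun k => Real.exp (12 * (C * beta k)) * partialNorm Finset.univ fun m => ordS u n k 0 0 m i)
    ?_ ?_ (fun k hk x hx => ?_) fun k hk => mul_nonneg hC (beta_nonneg k)
  · exact fun k hk => (continuousAt_const.mul hk.1.continuousAt_beta).continuousWithinAt
  · intro k hk
    have h1 := hk.1.continuousAt_beta
    have h2 : ∀ m, ContinuousAt (fun k => ordS u n k 0 0 m i) k := fun m =>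
      (S.differentiableAt_propS hk.1 le_rfl le_rfl _ _).continuousAt
    unfold partialNorm
    exact ContinuousAt.continuousWithinAt (by fun_prop)
  · obtain ⟨a, U, H, H', Pr, -⟩ := h k hk.1
    exact Pr.norm_rhoVec_sub_entry_le S
      (fun i => by have := hk.2.1; have := hk.2.2; fin_cases i <;> simp at * <;> linarith) hx i

lemma tendstoLocallyUniformlyOn_jN (n : Fin 18) (i : Fin 3) :
    TendstoLocallyUniformlyOn
      (fun x k => (wt u (l k ∘ ord n) (z k ∘ ord n) 0 x 0)⁻¹ * (ordS u n k x 0).adjugate i 0)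
      (fun k => jN u n k i) atTop (sectorLE n) := by
  obtain ⟨C, hC, h⟩ := S.exists_ordered_propagator n
  refine tendstoLocallyUniformlyOn_of_rate (b := fun k => C * beta k)
    (M := fun k => Real.exp (12 * (C * beta k))
      * partialNorm Finset.univ fun m => (ordS u n k 0 0).adjugate i m)
    ?_ ?_ (fun k hk x hx => ?_) fun k hk => mul_nonneg hC (beta_nonneg k)
  · exact fun k hk => (continuousAt_const.mul hk.1.continuousAt_beta).continuousWithinAt
  · intro k hk
    have h1 := hk.1.continuousAt_beta
    have h2 : ∀ m, ContinuousAt (fun k => (ordS u n k 0 0).adjugate i m) k := fun m =>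
      (differentiableAt_adjugate_entry (fun _ _ =>
        S.differentiableAt_propS hk.1 le_rfl le_rfl _ _) i m).continuousAt
    unfold partialNorm
    exact ContinuousAt.continuousWithinAt (by fun_prop)
  · obtain ⟨a, U, H, H', Pr, -⟩ := h k hk.1
    exact Pr.norm_jVec_sub_entry_le S
      (fun i => by have := hk.2.1; have := hk.2.2; fin_cases i <;> simp at * <;> linarith) hx i

lemma differentiableAt_rho_approx {n : Fin 18} {k : ℂ} (hk : Good k) {x : ℝ} (hx : 0 ≤ x)
    (i : Fin 3) : DifferentiableAt ℂ
      (fun k => wt u (l k ∘ ord n) (z k ∘ ord n) 2 x 0 * ordS u n k x 0 2 i) k :=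
  (hk.differentiableAt_wt u (ord n) 2 x 0).mul (S.differentiableAt_propS hk hx le_rfl _ _)

lemma differentiableAt_j_approx {n : Fin 18} {k : ℂ} (hk : Good k) {x : ℝ} (hx : 0 ≤ x)
    (i : Fin 3) : DifferentiableAt ℂ (fun k => (wt u (l k ∘ ord n) (z k ∘ ord n) 0 x 0)⁻¹
      * (ordS u n k x 0).adjugate i 0) k :=
  ((hk.differentiableAt_wt u (ord n) 0 x 0).inv (wt_ne_zero _ _ _ _ _ _)).mul
    (differentiableAt_adjugate_entry (fun _ _ => S.differentiableAt_propS hk hx le_rfl _ _) i 0)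

lemma continuousOn_rhoN (n : Fin 18) (i : Fin 3) :
    ContinuousOn (fun k => rhoN u n k i) (sectorLE n) :=
  (S.tendstoLocallyUniformlyOn_rhoN n i).continuousOn
    ((eventually_ge_atTop 0).mono fun _ hx _ hk =>
      (S.differentiableAt_rho_approx hk.1 hx i).continuousAt.continuousWithinAt).frequently

lemma continuousOn_jN (n : Fin 18) (i : Fin 3) :
    ContinuousOn (fun k => jN u n k i) (sectorLE n) :=
  (S.tendstoLocallyUniformlyOn_jN n i).continuousOn
    ((eventually_ge_atTop 0).mono fun _ hx _ hk =>
      (S.differentiableAt_j_approx hk.1 hx i).continuousAt.continuousWithinAt).frequently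

lemma differentiableOn_rhoN (n : Fin 18) (i : Fin 3) :
    DifferentiableOn ℂ (fun k => rhoN u n k i) (sectorLT n) :=
  ((S.tendstoLocallyUniformlyOn_rhoN n i).mono (sectorLT_subset n)).differentiableOn
    ((eventually_ge_atTop 0).mono fun _ hx _ hk =>
      (S.differentiableAt_rho_approx hk.1 hx i).differentiableWithinAt) (isOpen_sectorLT n)

lemma differentiableOn_jN (n : Fin 18) (i : Fin 3) :
    DifferentiableOn ℂ (fun k => jN u n k i) (sectorLT n) :=
  ((S.tendstoLocallyUniformlyOn_jN n i).mono (sectorLT_subset n)).differentiableOn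
    ((eventually_ge_atTop 0).mono fun _ hx _ hk =>
      (S.differentiableAt_j_approx hk.1 hx i).differentiableWithinAt) (isOpen_sectorLT n)

lemma differentiableAt_eta {n : Fin 18} {k : ℂ} (hk : Good k) (i j m : Fin 3) :
    DifferentiableAt ℂ (fun k => eta T u n k i j m) k := by
  unfold eta
  cases contour n (ord n i) (ord n j)
  · exact S.differentiableAt_propT hk le_rfl S.pos.le _ _
  · exact differentiableAt_const _
  · exact differentiableAt_const _

lemma continuousOn_denMid (n : Fin 18) : ContinuousOn (denMid T u n) (sectorLE n) := by
  unfold denMid dotProduct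
  exact continuousOn_finsetSum _ fun m _ => ContinuousOn.mul (fun k hk =>
    (S.differentiableAt_eta hk.1 0 1 m).continuousAt.continuousWithinAt) (S.continuousOn_jN n m)

lemma differentiableOn_denMid (n : Fin 18) : DifferentiableOn ℂ (denMid T u n) (sectorLT n) := by
  unfold denMid dotProduct
  exact DifferentiableOn.fun_sum fun m _ => DifferentiableOn.mul (fun k hk =>
    (S.differentiableAt_eta hk.1 0 1 m).differentiableWithinAt) (S.differentiableOn_jN n m)

lemma continuousOn_denLast (n : Fin 18) : ContinuousOn (denLast T u n) (sectorLE n) := by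
  have h : ∀ i j m, ContinuousOn (fun k => eta T u n k i j m) (sectorLE n) := fun i j m k hk =>
    (S.differentiableAt_eta hk.1 i j m).continuousAt.continuousWithinAt
  have h' := S.continuousOn_rhoN n
  unfold denLast
  simp only [cross_apply, dotProduct, Fin.sum_univ_three, Matrix.cons_val_zero,
    Matrix.cons_val_one, Matrix.cons_val]
  fun_prop

lemma differentiableOn_denLast (n : Fin 18) :
    DifferentiableOn ℂ (denLast T u n) (sectorLT n) := by
  have h : ∀ i j m, DifferentiableOn ℂ (fun k => eta T u n k i j m) (sectorLT n) :=
    fun i j m k hk => (S.differentiableAt_eta hk.1 i j m).differentiableWithinAt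
  have h' := S.differentiableOn_rhoN n
  unfold denLast
  simp only [cross_apply, dotProduct, Fin.sum_univ_three, Matrix.cons_val_zero,
    Matrix.cons_val_one, Matrix.cons_val]
  fun_prop

/-- The part of the closed sector where the denominators do not vanish. -/
def _root_.DegasperisProcesi.regularSet (T : ℝ) (u : ℝ → ℝ → ℝ) (n : Fin 18) : Set ℂ :=
  {k | denMid T u n k ≠ 0 ∧ denLast T u n k ≠ 0}

lemma continuousOn_col (n : Fin 18) (j i : Fin 3) :
    ContinuousOn (fun k => col T u n k j i) (sectorLE n ∩ regularSet T u n) := by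
  have h : ∀ i j m, ContinuousOn (fun k => eta T u n k i j m) (sectorLE n ∩ regularSet T u n) :=
    fun i j m k hk => (S.differentiableAt_eta hk.1.1 i j m).continuousAt.continuousWithinAt
  have h₁ := fun i => (S.continuousOn_rhoN n i).mono (inter_subset_left (t := regularSet T u n))
  have h₂ := fun i => (S.continuousOn_jN n i).mono (inter_subset_left (t := regularSet T u n))
  have h₃ := ((S.continuousOn_denMid n).mono (inter_subset_left (t := regularSet T u n))).inv₀
    fun k hk => hk.2.1
  have h₄ := ((S.continuousOn_denLast n).mono (inter_subset_left (t := regularSet T u n))).inv₀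
    fun k hk => hk.2.2
  fin_cases j
  · exact h₂ i
  · refine h₃.mul (f := fun k => (denMid T u n k)⁻¹)
      (g := fun k => crossProduct (rhoN u n k) (eta T u n k 0 1) i) ?_
    simp only [cross_apply]
    fin_cases i <;> simp <;> fun_prop
  · refine h₄.mul (f := fun k => (denLast T u n k)⁻¹)
      (g := fun k => crossProduct (eta T u n k 0 2) (eta T u n k 1 2) i) ?_
    simp only [cross_apply]
    fin_cases i <;> simp <;> fun_prop

lemma differentiableOn_col (n : Fin 18) (j i : Fin 3) :
    DifferentiableOn ℂ (fun k => col T u n k j i) (sectorLT n ∩ regularSet T u n) := by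
  have h : ∀ i j m, DifferentiableOn ℂ (fun k => eta T u n k i j m)
      (sectorLT n ∩ regularSet T u n) :=
    fun i j m k hk => (S.differentiableAt_eta hk.1.1 i j m).differentiableWithinAt
  have h₁ := fun i => (S.differentiableOn_rhoN n i).mono (inter_subset_left (t := regularSet T u n))
  have h₂ := fun i => (S.differentiableOn_jN n i).mono (inter_subset_left (t := regularSet T u n))
  have h₃ := ((S.differentiableOn_denMid n).mono (inter_subset_left (t := regularSet T u n))).fun_inv
    fun k hk => hk.2.1
  have h₄ := ((S.differentiableOn_denLast n).mono
    (inter_subset_left (t := regularSet T u n))).fun_inv fun k hk => hk.2.2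
  fin_cases j
  · exact h₂ i
  · refine h₃.mul (b := fun k => crossProduct (rhoN u n k) (eta T u n k 0 1) i) ?_
    simp only [cross_apply]
    fin_cases i <;> simp <;> fun_prop
  · refine h₄.mul (b := fun k => crossProduct (eta T u n k 0 2) (eta T u n k 1 2) i) ?_
    simp only [cross_apply]
    fin_cases i <;> simp <;> fun_prop

lemma continuousOn_waveMat (n : Fin 18) {x t : ℝ} (hx : 0 ≤ x) (ht : 0 ≤ t) (i j : Fin 3) :
    ContinuousOn (fun k => waveMat u k (reorder n (col T u n k)) x t i j)
      (sectorLE n ∩ regularSet T u n) := by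
  simp only [waveMat, Matrix.of_apply, wav, Matrix.mulVec, dotProduct, reorder]
  refine ContinuousOn.mul (fun k hk =>
    (hk.1.1.differentiableAt_wt u id j x t).continuousAt.continuousWithinAt)
    (continuousOn_finsetSum _ fun r _ => ContinuousOn.fun_mul (fun k hk =>
      (S.differentiableAt_propT hk.1.1 hx ht i r).continuousAt.continuousWithinAt)
      (S.continuousOn_col n _ _))

lemma differentiableOn_waveMat (n : Fin 18) {x t : ℝ} (hx : 0 ≤ x) (ht : 0 ≤ t) (i j : Fin 3) :
    DifferentiableOn ℂ (fun k => waveMat u k (reorder n (col T u n k)) x t i j)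
      (sectorLT n ∩ regularSet T u n) := by
  simp only [waveMat, Matrix.of_apply, wav, Matrix.mulVec, dotProduct, reorder]
  refine DifferentiableOn.mul (fun k hk =>
    (hk.1.1.differentiableAt_wt u id j x t).differentiableWithinAt)
    (DifferentiableOn.fun_sum fun r _ => DifferentiableOn.fun_mul (fun k hk =>
      (S.differentiableAt_propT hk.1.1 hx ht i r).differentiableWithinAt)
      (S.differentiableOn_col n _ _))

end Regular


/-! ### Estimates for small perturbations -/

lemma partialNorm_le_sub_single (s : Finset (Fin 3)) (j : Fin 3) (φ : Fin 3 → ℂ) :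
    partialNorm s φ ≤ 3 * partialNorm s (fun i => φ i - (Pi.single j 1 : Fin 3 → ℂ) i) + 1 := by
  have h1 := sum_norm_le_partialNorm s (fun i => φ i - (Pi.single j 1 : Fin 3 → ℂ) i)
  have h2 : (s.card : ℝ) ≤ 3 := by exact_mod_cast (Finset.card_le_univ s)
  have h3 : ∑ i ∈ s, ‖(Pi.single j 1 : Fin 3 → ℂ) i‖ ≤ 1 := by
    refine (Finset.sum_le_univ_sum_of_nonneg fun i => norm_nonneg _).trans (le_of_eq ?_)
    rw [Finset.sum_eq_single j (fun i _ hi => by simp [Pi.single_eq_of_ne hi]) (by simp)]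
    simp
  have h4 : ∑ i ∈ s, ‖φ i‖ ≤ ∑ i ∈ s, (‖φ i - (Pi.single j 1 : Fin 3 → ℂ) i‖
      + ‖(Pi.single j 1 : Fin 3 → ℂ) i‖) := Finset.sum_le_sum fun i _ => norm_le_norm_sub_add _ _
  rw [Finset.sum_add_distrib] at h4
  have h5 := partialNorm_nonneg s (fun i => φ i - (Pi.single j 1 : Fin 3 → ℂ) i)
  have h6 := partialNorm_le_sum s φ
  nlinarith

namespace Propagator

variable {T : ℝ} {u : ℝ → ℝ → ℝ} {B : ℝ} {l z : Fin 3 → ℂ}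
  {Y a U : ℝ → ℝ → Matrix (Fin 3) (Fin 3) ℂ} (S : Regular T u) (Pr : Propagator T u B l z Y a U)

omit Pr in
-- A perturbation of size c² acting on e_j + O(N) gives a forcing of order c²(N + 1) ≤ c(N + c).
-- This is the form the energy estimate accepts, with growth rate and offset both of order c.
lemma norm_perturbation_le {V : Fin 3 → Fin 3 → ℂ} {c w : ℝ} {φ : Fin 3 → ℂ} {s : Finset (Fin 3)}
    {j : Fin 3} (hV : ∀ i r, ‖V i r‖ ≤ c ^ 2 * w) (hc : 0 ≤ c) (hc1 : c ≤ 1) (hw : 0 ≤ w)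
    (hφ : partialNorm Finset.univ φ ≤ 3 * partialNorm s φ) (i : Fin 3) :
    ‖∑ r, V i r * φ r‖
      ≤ 27 * c * w * (partialNorm s (fun i => φ i - (Pi.single j 1 : Fin 3 → ℂ) i) + c) := by
  have h1 := norm_sum_mul_le (by positivity) hV φ i
  have h2 := partialNorm_le_sub_single s j φ
  set N := partialNorm s (fun i => φ i - (Pi.single j 1 : Fin 3 → ℂ) i)
  have hN : 0 ≤ N := partialNorm_nonneg _ _
  rw [Fintype.card_fin] at h1
  push_cast at h1
  have h3 : partialNorm Finset.univ φ ≤ 9 * N + 3 := by linarith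
  have h4 : c ^ 2 * N ≤ c * N := mul_le_mul_of_nonneg_right (by nlinarith) hN
  calc _ ≤ 3 * (c ^ 2 * w) * (9 * N + 3) := h1.trans (mul_le_mul_of_nonneg_left h3 (by positivity))
    _ = w * (27 * (c ^ 2 * N) + 9 * c ^ 2) := by ring
    _ ≤ w * (27 * (c * N) + 27 * c ^ 2) :=
        mul_le_mul_of_nonneg_left (by nlinarith [sq_nonneg c]) hw
    _ = _ := by ring

include S Pr

/-- Propagation of smallness along the path from the origin. -/
lemma partialNorm_sub_single_le {c : ℝ} (hc : 0 ≤ c) (hc1 : c ≤ 1) (hB : B ≤ c ^ 2)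
    (hz : ∀ i, ‖z i‖ ≤ c) {s : Finset (Fin 3)} {j : Fin 3}
    (hl : ∀ i ∈ s, (l i).re ≤ (l j).re) {v : Fin 3 → ℂ}
    (hs : ∀ x t, 0 ≤ x → t ∈ Icc 0 T →
      partialNorm Finset.univ (wav u l z Y j v x t) ≤ 3 * partialNorm s (wav u l z Y j v x t))
    {x t : ℝ} (hx : 0 ≤ x) (ht : t ∈ Icc 0 T) :
    partialNorm s (fun i => wav u l z Y j v x t i - (Pi.single j 1 : Fin 3 → ℂ) i)
      ≤ Real.exp (108 * c * (T + 1))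
        * (partialNorm s (fun i => wav u l z Y j v 0 0 i - (Pi.single j 1 : Fin 3 → ℂ) i) + c) := by
  have hcard : (s.card : ℝ) ≤ 3 := by exact_mod_cast (Finset.card_le_univ s)
  set m : ℝ := s.card + 1 with hm
  have hm0 : 0 ≤ m := by positivity
  have hm4 : m ≤ 4 := by linarith
  have hsingle : ∀ (i : Fin 3) (p r : ℂ), (p * (l i - l j) + r * (z i - z j))
      * (Pi.single j 1 : Fin 3 → ℂ) i = 0 := by
    intro i p r
    by_cases hij : i = j
    · rw [hij]; ring
    · rw [Pi.single_eq_of_ne hij, mul_zero]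
  have key₁ := energy_estimate (s := s)
    (φ := fun τ i => wav u l z Y j v 0 τ i - (Pi.single j 1 : Fin 3 → ℂ) i)
    (Λ := fun τ i => z i - z j - u 0 τ * q u 0 τ * (l i - l j)) (c := c)
    (f := fun τ i => ∑ r, U 0 τ i r * wav u l z Y j v 0 τ r) (g := fun _ => 27 * c * 1)
    (G := fun τ => m * (27 * c * 1) * τ) ht.1 ?_ ?_ ?_ ?_ (fun τ hτ => by positivity) hc
  · have key₂ := energy_estimate (s := s)
      (φ := fun ξ i => wav u l z Y j v ξ t i - (Pi.single j 1 : Fin 3 → ℂ) i)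
      (Λ := fun ξ i => q u ξ t * (l i - l j)) (c := c)
      (f := fun ξ i => ∑ r, a ξ t i r * wav u l z Y j v ξ t r)
      (g := fun ξ => 27 * c * (1 / (1 + ξ) ^ 2))
      (G := fun ξ => -(m * (27 * c) / (1 + ξ))) hx ?_ ?_ ?_ ?_
      (fun ξ hξ => by have := hξ.1; positivity) hc
    · set N₀ := partialNorm s (fun i => wav u l z Y j v 0 0 i - (Pi.single j 1 : Fin 3 → ℂ) i)
      have hN₀ : 0 ≤ N₀ := partialNorm_nonneg _ _
      have e1 : m * (27 * c * 1) * t - m * (27 * c * 1) * 0 ≤ 108 * c * T := by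
        have := ht.1; have := ht.2
        calc _ = m * (27 * c * t) := by ring
          _ ≤ 4 * (27 * c * T) := by gcongr
          _ = _ := by ring
      have e2 : -(m * (27 * c) / (1 + x)) - -(m * (27 * c) / (1 + 0)) ≤ 108 * c := by
        have h1 : 0 ≤ m * (27 * c) / (1 + x) := by positivity
        have h2 : m * (27 * c) ≤ 4 * (27 * c) := by gcongr
        rw [add_zero, div_one]
        linarith
      calc _ ≤ partialNorm s (fun i => wav u l z Y j v x t i - (Pi.single j 1 : Fin 3 → ℂ) i) + c :=
            by linarith
        _ ≤ _ := key₂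
        _ ≤ Real.exp (108 * c) * (Real.exp (108 * c * T) * (N₀ + c)) := by
            refine mul_le_mul (Real.exp_le_exp.2 e2) (key₁.trans ?_)
              (add_nonneg (partialNorm_nonneg _ _) hc) (Real.exp_pos _).le
            exact mul_le_mul_of_nonneg_right (Real.exp_le_exp.2 e1) (by positivity)
        _ = _ := by
            rw [← mul_assoc, ← Real.exp_add]
            ring_nf
    · intro ξ hξ i _
      refine (((Pr.hasDerivAt_wav_x S hξ.1 ht j v i).sub_const _).hasDerivWithinAt).congr_deriv ?_
      linear_combination hsingle i (q u ξ t) 0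
    · intro ξ hξ i hi
      have := hξ.1
      exact (re_diag_nonpos S hξ.1 ht (hl i hi)).trans (by positivity)
    · intro ξ hξ i _
      refine norm_perturbation_le (fun i r => (Pr.norm_a hξ.1 ht i r).trans ?_) hc hc1
        (by positivity) (hs ξ t hξ.1 ht) i
      rw [mul_one_div]
      gcongr
    · intro ξ hξ
      refine (hasDerivAt_neg_div_one_add (m * (27 * c)) hξ.1).hasDerivWithinAt.congr_deriv ?_
      rw [hm]
      ring
  · intro τ hτ i _
    have hτ' : τ ∈ Icc 0 T := ⟨hτ.1, hτ.2.trans ht.2⟩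
    refine (((Pr.hasDerivAt_wav_t S le_rfl hτ' j v i).sub_const _).hasDerivWithinAt).congr_deriv ?_
    linear_combination hsingle i (-(u 0 τ * q u 0 τ)) 1
  · intro τ hτ i hi
    have hτ' : τ ∈ Icc 0 T := ⟨hτ.1, hτ.2.trans ht.2⟩
    -- Along x = 0 the phase contributes u q Re(l_j - l_i). This is nonpositive since u(0,t) ≤ 0, so
    -- only the small z-terms remain.
    have h1 : (z i - z j - u 0 τ * q u 0 τ * (l i - l j)).re
        = (z i - z j).re + u 0 τ * q u 0 τ * ((l j).re - (l i).re) := by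
      rw [Complex.sub_re, ← Complex.ofReal_mul, Complex.re_ofReal_mul, Complex.sub_re (l i)]
      ring
    have h2 : u 0 τ * q u 0 τ * ((l j).re - (l i).re) ≤ 0 :=
      mul_nonpos_of_nonpos_of_nonneg (mul_nonpos_of_nonpos_of_nonneg (S.boundary τ hτ')
        (S.q_pos le_rfl hτ').le) (by linarith [hl i hi])
    have h3 := (Complex.re_le_norm (z i - z j)).trans (norm_sub_le _ _)
    rw [h1]
    linarith [hz i, hz j]
  · intro τ hτ i _
    have hτ' : τ ∈ Icc 0 T := ⟨hτ.1, hτ.2.trans ht.2⟩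
    exact norm_perturbation_le (fun i r => (Pr.norm_U_le le_rfl hτ' i r).trans (by linarith)) hc
      hc1 zero_le_one (hs 0 τ le_rfl hτ') i
  · intro τ hτ
    exact (((hasDerivAt_id τ).const_mul _).hasDerivWithinAt).congr_deriv (mul_one _)

lemma norm_jVec_sub_le_const (h : ∀ i, (l 0).re ≤ (l i).re) {x t : ℝ} (hx : 0 ≤ x)
    (ht : t ∈ Icc 0 T) (i : Fin 3) :
    ‖wav u l z Y 0 (jVec u l z Y) x t i - (Pi.single 0 1 : Fin 3 → ℂ) i‖
      ≤ Real.exp (12 * B) - 1 := by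
  have h3 : 12 * B / (1 + x) ≤ 12 * B := div_le_self (by linarith [Pr.nonneg]) (by linarith)
  linarith [Pr.norm_jVec_sub_le S h hx ht i, Real.exp_le_exp.2 h3]

omit S in
lemma norm_last_le_const {v : Fin 3 → ℂ} {j : Fin 3} {x t : ℝ} (hx : 0 ≤ x)
    (h : ‖wav u l z Y j v x t 2‖ ≤ (Real.exp (12 * B / (1 + x)) - 1)
      * partialNorm Finset.univ (wav u l z Y j v x t)) :
    ‖wav u l z Y j v x t 2‖ ≤ (Real.exp (12 * B) - 1)
      * partialNorm Finset.univ (wav u l z Y j v x t) := by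
  have h3 : 12 * B / (1 + x) ≤ 12 * B := div_le_self (by linarith [Pr.nonneg]) (by linarith)
  refine h.trans (mul_le_mul_of_nonneg_right ?_ (partialNorm_nonneg _ _))
  linarith [Real.exp_le_exp.2 h3]

end Propagator

/-! ### Large and small spectral parameters -/

/-- The filter of the spectral parameters in a closed sector which tend to `0` or `∞`. -/
def far (n : Fin 18) : Filter ℂ := comap height atTop ⊓ 𝓟 (sectorLE n)

lemma tendsto_height_far (n : Fin 18) : Tendsto height (far n) atTop :=
  tendsto_comap.mono_left inf_le_left

lemma eventually_mem_sectorLE (n : Fin 18) : ∀ᶠ k in far n, k ∈ sectorLE n :=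
  mem_inf_of_right (mem_principal_self _)

lemma tendsto_beta_far (n : Fin 18) : Tendsto beta (far n) (𝓝 0) := by
  have h : Tendsto (fun k => 20000 / height k) (far n) (𝓝 0) :=
    tendsto_const_nhds.div_atTop (tendsto_height_far n)
  refine squeeze_zero' (Eventually.of_forall beta_nonneg) ?_ h
  filter_upwards [eventually_mem_sectorLE n, (tendsto_height_far n).eventually_ge_atTop 4]
    with k hk h4
  exact beta_le hk.1.1 h4

lemma tendsto_z_far (n : Fin 18) (j : Fin 3) : Tendsto (fun k => z k j) (far n) (𝓝 0) := by
  have h : Tendsto (fun k => 100 / height k) (far n) (𝓝 0) :=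
    tendsto_const_nhds.div_atTop (tendsto_height_far n)
  refine squeeze_zero_norm' ?_ h
  filter_upwards [eventually_mem_sectorLE n, (tendsto_height_far n).eventually_ge_atTop 4]
    with k hk h4
  exact norm_z_le hk.1.1 h4 j

lemma sectorLE.first_le {n : Fin 18} {k : ℂ} (hk : k ∈ sectorLE n) (i : Fin 3) :
    ((l k ∘ ord n) 0).re ≤ ((l k ∘ ord n) i).re := by
  have := hk.2.1; have := hk.2.2; fin_cases i <;> simp at * <;> linarith

lemma sectorLE.le_last {n : Fin 18} {k : ℂ} (hk : k ∈ sectorLE n) (i : Fin 3) :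
    ((l k ∘ ord n) i).re ≤ ((l k ∘ ord n) 2).re := by
  have := hk.2.1; have := hk.2.2; fin_cases i <;> simp at * <;> linarith

/-- The weighted solutions of the ordered problem. -/
abbrev ordWav (u : ℝ → ℝ → ℝ) (n : Fin 18) (k : ℂ) (j : Fin 3) (v : Fin 3 → ℂ) (x t : ℝ) :
    Fin 3 → ℂ :=
  wav u (l k ∘ ord n) (z k ∘ ord n) (ordT u n k) j v x t

namespace Regular

variable {T : ℝ} {u : ℝ → ℝ → ℝ} (S : Regular T u)

include S

lemma ordT_zero (n : Fin 18) {k : ℂ} (hk : Good k) : ordT u n k 0 0 = 1 := by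
  rw [ordT, S.propT_zero hk]
  exact Matrix.submatrix_one_equiv (ord n)

/-- The two gauges have the same limits. -/
lemma tendsto_ordWav_of_sheared {n : Fin 18} {j : Fin 3} {v : ℂ → Fin 3 → ℂ} {x t : ℝ}
    (hx : 0 ≤ x) (ht : t ∈ Icc 0 T) {e : Fin 3 → ℂ}
    (h : ∀ i, Tendsto (fun k => wav u (l k ∘ ord n) (z k ∘ ord n) (ordS u n k) j (v k) x t i) (far n)
      (𝓝 (e i))) (i : Fin 3) :
    Tendsto (fun k => ordWav u n k j (v k) x t i) (far n) (𝓝 (e i)) := by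
  obtain ⟨C, hC, hP⟩ := S.exists_ordered_propagator n
  have hK : Tendsto (fun k => 9 * (C * beta k)
      * ∑ i, ‖wav u (l k ∘ ord n) (z k ∘ ord n) (ordS u n k) j (v k) x t i‖) (far n)
      (𝓝 (9 * (C * 0) * ∑ i, ‖e i‖)) :=
    (((tendsto_beta_far n).const_mul C).const_mul 9).mul (tendsto_finsetSum _ fun i _ => (h i).norm)
  rw [mul_zero, mul_zero, zero_mul] at hK
  have h2 : Tendsto (fun k => ordWav u n k j (v k) x t i
      - wav u (l k ∘ ord n) (z k ∘ ord n) (ordS u n k) j (v k) x t i) (far n) (𝓝 0) := by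
    refine squeeze_zero_norm' ?_ hK
    filter_upwards [eventually_mem_sectorLE n] with k hk
    obtain ⟨a, U, H, H', Pr, hYt, -, hH⟩ := hP k hk.1
    refine (Pr.norm_gauge_change_le hYt (fun x t hx ht i j => (hH x t hx ht i j).1) hx ht
      (fun i => Finset.single_le_sum (f := fun i => ‖wav u (l k ∘ ord n) (z k ∘ ord n) (ordS u n k) j
        (v k) x t i‖) (fun _ _ => norm_nonneg _) (Finset.mem_univ i)) i).trans ?_
    exact div_le_self (mul_nonneg (by linarith [Pr.nonneg]) (Finset.sum_nonneg fun _ _ =>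
      norm_nonneg _)) (one_le_pow₀ (by linarith))
  have h3 := h2.add (h i)
  rw [zero_add] at h3
  exact h3.congr fun k => by ring

/-- At the origin the sheared propagator is 1 + O(`beta k`), so initial data are asymptotically the
base vectors. -/
lemma tendsto_sheared_of_base {n : Fin 18} {j : Fin 3} {v : ℂ → Fin 3 → ℂ} {e : Fin 3 → ℂ}
    (h : ∀ i, Tendsto (fun k => v k i) (far n) (𝓝 (e i))) (i : Fin 3) :
    Tendsto (fun k => wav u (l k ∘ ord n) (z k ∘ ord n) (ordS u n k) j (v k) 0 0 i) (far n)
      (𝓝 (e i)) := by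
  have h0 : (0 : ℝ) ∈ Icc 0 T := ⟨le_rfl, S.pos.le⟩
  obtain ⟨C, hC, hP⟩ := S.exists_ordered_propagator n
  have hK : Tendsto (fun k => C * beta k * ∑ r, ‖v k r‖) (far n) (𝓝 (C * 0 * ∑ r, ‖e r‖)) :=
    ((tendsto_beta_far n).const_mul C).mul (tendsto_finsetSum _ fun i _ => (h i).norm)
  rw [mul_zero, zero_mul] at hK
  have h2 : Tendsto (fun k => wav u (l k ∘ ord n) (z k ∘ ord n) (ordS u n k) j (v k) 0 0 i - v k i)
      (far n) (𝓝 0) := by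
    refine squeeze_zero_norm' ?_ hK
    filter_upwards [eventually_mem_sectorLE n] with k hk
    obtain ⟨a, U, H, H', Pr, -, hYs, hH⟩ := hP k hk.1
    rw [wav, wt_zero, one_mul, hYs, S.ordT_zero n hk.1, Matrix.mul_one, Matrix.add_mulVec,
      Matrix.one_mulVec, Pi.add_apply, add_sub_cancel_left, Finset.mul_sum]
    refine norm_sum_le_of_le (E := ℂ) _ fun r _ => ?_
    rw [norm_mul]
    refine mul_le_mul_of_nonneg_right ((hH 0 0 le_rfl h0 i r).2.trans (le_of_eq ?_)) (norm_nonneg _)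
    simp
  have h3 := h2.add (h i)
  rw [zero_add] at h3
  exact h3.congr fun k => by ring

omit S in
lemma tendsto_exp_beta (C : ℝ) (n : Fin 18) :
    Tendsto (fun k => Real.exp (12 * (C * beta k)) - 1) (far n) (𝓝 0) := by
  have h := ((Real.continuous_exp.tendsto _).comp
    (((tendsto_beta_far n).const_mul C).const_mul 12)).sub_const 1
  simpa using h

/-- The first column far out. -/
lemma tendsto_ordWav_jN (n : Fin 18) {x t : ℝ} (hx : 0 ≤ x) (ht : t ∈ Icc 0 T) (i : Fin 3) :
    Tendsto (fun k => ordWav u n k 0 (jN u n k) x t i) (far n)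
      (𝓝 ((Pi.single 0 1 : Fin 3 → ℂ) i)) := by
  obtain ⟨C, hC, hP⟩ := S.exists_ordered_propagator n
  refine S.tendsto_ordWav_of_sheared hx ht (fun i => ?_) i
  rw [tendsto_iff_norm_sub_tendsto_zero]
  refine squeeze_zero' (Eventually.of_forall fun _ => norm_nonneg _) ?_ (tendsto_exp_beta C n)
  filter_upwards [eventually_mem_sectorLE n] with k hk
  obtain ⟨a, U, H, H', Pr, -⟩ := hP k hk.1
  exact Pr.norm_jVec_sub_le_const S (sectorLE.first_le hk) hx ht i

lemma tendsto_jN (n : Fin 18) (i : Fin 3) :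
    Tendsto (fun k => jN u n k i) (far n) (𝓝 ((Pi.single 0 1 : Fin 3 → ℂ) i)) := by
  refine (S.tendsto_ordWav_jN n le_rfl ⟨le_rfl, S.pos.le⟩ i).congr' ?_
  filter_upwards [eventually_mem_sectorLE n] with k hk
  rw [ordWav, wav, wt_zero, one_mul, S.ordT_zero n hk.1, Matrix.one_mulVec]

/-- At the origin the last component of the solution with base vector e_i is nearly δ_{2i}, and far
out its change up to x = ∞ is small. -/
lemma tendsto_rhoN (n : Fin 18) (i : Fin 3) :
    Tendsto (fun k => rhoN u n k i) (far n) (𝓝 ((Pi.single 2 1 : Fin 3 → ℂ) i)) := by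
  have h0 : (0 : ℝ) ∈ Icc 0 T := ⟨le_rfl, S.pos.le⟩
  obtain ⟨C, hC, hP⟩ := S.exists_ordered_propagator n
  have h1 : ∀ r, Tendsto (fun k => wav u (l k ∘ ord n) (z k ∘ ord n) (ordS u n k) 2
      (Pi.single i 1) 0 0 r) (far n) (𝓝 ((Pi.single i 1 : Fin 3 → ℂ) r)) :=
    S.tendsto_sheared_of_base fun r => tendsto_const_nhds
  have h2 := (tendsto_exp_beta C n).mul (tendsto_finsetSum Finset.univ fun r _ => (h1 r).norm)
  rw [zero_mul] at h2
  have h3 : Tendsto (fun k => rhoN u n k i - wav u (l k ∘ ord n) (z k ∘ ord n) (ordS u n k) 2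
      (Pi.single i 1) 0 0 2) (far n) (𝓝 0) := by
    refine squeeze_zero_norm' ?_ h2
    filter_upwards [eventually_mem_sectorLE n] with k hk
    obtain ⟨a, U, H, H', Pr, -⟩ := hP k hk.1
    have h4 := Pr.norm_sub_rhoVec_le S (sectorLE.le_last hk) (Pi.single i 1) le_rfl h0
    rw [dotProduct_single, mul_one, add_zero, div_one] at h4
    rw [norm_sub_rev]
    refine h4.trans (mul_le_mul_of_nonneg_left (partialNorm_le_sum _ _) ?_)
    linarith [Real.one_le_exp (by linarith [Pr.nonneg] : 0 ≤ 12 * (C * beta k))]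
  have h5 := h3.add (h1 2)
  rw [zero_add] at h5
  rw [show (Pi.single 2 1 : Fin 3 → ℂ) i = (Pi.single i 1 : Fin 3 → ℂ) 2 by
    simp only [Pi.single_apply, eq_comm]]
  exact h5.congr fun k => by ring

/-- The components of a column on which the weights do not grow, far out. -/
lemma tendsto_partialNorm_far {n : Fin 18} {j : Fin 3} {s : Finset (Fin 3)} {v : ℂ → Fin 3 → ℂ}
    (hl : ∀ k ∈ sectorLE n, ∀ i ∈ s, ((l k ∘ ord n) i).re ≤ ((l k ∘ ord n) j).re)
    (hv : ∀ i, Tendsto (fun k => v k i) (far n) (𝓝 ((Pi.single j 1 : Fin 3 → ℂ) i)))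
    (hs : ∀ᶠ k in far n, ∀ x t, 0 ≤ x → t ∈ Icc 0 T →
      partialNorm Finset.univ (wav u (l k ∘ ord n) (z k ∘ ord n) (ordS u n k) j (v k) x t)
        ≤ 3 * partialNorm s (wav u (l k ∘ ord n) (z k ∘ ord n) (ordS u n k) j (v k) x t))
    {x t : ℝ} (hx : 0 ≤ x) (ht : t ∈ Icc 0 T) :
    Tendsto (fun k => partialNorm s fun i => wav u (l k ∘ ord n) (z k ∘ ord n) (ordS u n k) j (v k)
      x t i - (Pi.single j 1 : Fin 3 → ℂ) i) (far n) (𝓝 0) := by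
  obtain ⟨C, hC, hP⟩ := S.exists_ordered_propagator n
  -- The square of c has to dominate the perturbation and c itself the z_j; hence the square root of
  -- Cβ plus the sum of the |z_j|.
  set c : ℂ → ℝ := fun k => √(C * beta k) + ∑ i, ‖z k i‖ with hc
  have hct : Tendsto c (far n) (𝓝 0) := by
    have h1 := (Real.continuous_sqrt.tendsto _).comp ((tendsto_beta_far n).const_mul C)
    have h2 := h1.add (tendsto_finsetSum Finset.univ fun i _ => (tendsto_z_far n i).norm)
    simpa using h2
  have h1 : Tendsto (fun k => partialNorm s fun i => wav u (l k ∘ ord n) (z k ∘ ord n) (ordS u n k) j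
      (v k) 0 0 i - (Pi.single j 1 : Fin 3 → ℂ) i) (far n) (𝓝 0) := by
    have h2 := tendsto_finsetSum s fun i _ =>
      (((S.tendsto_sheared_of_base (j := j) hv i).sub_const
        ((Pi.single j 1 : Fin 3 → ℂ) i)).norm.pow 2)
    have h3 := (Real.continuous_sqrt.tendsto _).comp h2
    simpa [partialNorm, Function.comp_def] using h3
  have h2 := ((Real.continuous_exp.tendsto _).comp ((hct.const_mul 108).mul_const (T + 1))).mul
    (h1.add hct)
  rw [add_zero, mul_zero] at h2
  refine squeeze_zero' (Eventually.of_forall fun _ => partialNorm_nonneg _ _) ?_ h2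
  filter_upwards [eventually_mem_sectorLE n, hs, hct.eventually (ge_mem_nhds zero_lt_one)]
    with k hk hk' hk1
  obtain ⟨a, U, H, H', Pr, -⟩ := hP k hk.1
  have hz0 : ∀ i, ‖z k i‖ ≤ ∑ i, ‖z k i‖ := fun i =>
    Finset.single_le_sum (f := fun i => ‖z k i‖) (fun _ _ => norm_nonneg _) (Finset.mem_univ i)
  have hsq := Real.sqrt_nonneg (C * beta k)
  have hz1 : 0 ≤ ∑ i, ‖z k i‖ := Finset.sum_nonneg fun _ _ => norm_nonneg _
  refine Pr.partialNorm_sub_single_le S (add_nonneg hsq hz1) hk1 ?_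
    (fun i => (hz0 (ord n i)).trans (le_add_of_nonneg_left hsq)) (hl k hk) hk' hx ht
  have := Real.sq_sqrt Pr.nonneg
  change C * beta k ≤ (√(C * beta k) + ∑ i, ‖z k i‖) ^ 2
  nlinarith

/-- The last column far out. -/
lemma tendsto_ordWav_last {n : Fin 18} {v : ℂ → Fin 3 → ℂ}
    (hv : ∀ i, Tendsto (fun k => v k i) (far n) (𝓝 ((Pi.single 2 1 : Fin 3 → ℂ) i)))
    {x t : ℝ} (hx : 0 ≤ x) (ht : t ∈ Icc 0 T) (i : Fin 3) :
    Tendsto (fun k => ordWav u n k 2 (v k) x t i) (far n)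
      (𝓝 ((Pi.single 2 1 : Fin 3 → ℂ) i)) := by
  refine S.tendsto_ordWav_of_sheared hx ht (fun i => ?_) i
  have h := S.tendsto_partialNorm_far (s := Finset.univ)
    (fun k hk i _ => sectorLE.le_last hk i) hv (Eventually.of_forall fun k x t _ _ =>
      le_mul_of_one_le_left (partialNorm_nonneg _ _) (by norm_num)) hx ht
  rw [tendsto_iff_norm_sub_tendsto_zero]
  exact squeeze_zero (fun _ => norm_nonneg _) (fun k => norm_le_partialNorm
    (φ := fun i => wav u (l k ∘ ord n) (z k ∘ ord n) (ordS u n k) 2 (v k) x t i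
      - (Pi.single 2 1 : Fin 3 → ℂ) i) (Finset.mem_univ i)) h

/-- The middle column far out. -/
lemma tendsto_ordWav_middle {n : Fin 18} {v : ℂ → Fin 3 → ℂ}
    (hv : ∀ i, Tendsto (fun k => v k i) (far n) (𝓝 ((Pi.single 1 1 : Fin 3 → ℂ) i)))
    (hρ : ∀ k, rhoN u n k ⬝ᵥ v k = 0)
    {x t : ℝ} (hx : 0 ≤ x) (ht : t ∈ Icc 0 T) (i : Fin 3) :
    Tendsto (fun k => ordWav u n k 1 (v k) x t i) (far n)
      (𝓝 ((Pi.single 1 1 : Fin 3 → ℂ) i)) := by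
  obtain ⟨C, hC, hP⟩ := S.exists_ordered_propagator n
  set φ := fun k x t => wav u (l k ∘ ord n) (z k ∘ ord n) (ordS u n k) 1 (v k) x t with hφ
  have hlast : ∀ k ∈ sectorLE n, ∀ x t, 0 ≤ x → t ∈ Icc 0 T → ‖φ k x t 2‖
      ≤ (Real.exp (12 * (C * beta k)) - 1) * partialNorm Finset.univ (φ k x t) := by
    intro k hk x t hx ht
    obtain ⟨a, U, H, H', Pr, -⟩ := hP k hk.1
    exact Pr.norm_last_le_const hx (Pr.norm_last_le S (sectorLE.le_last hk) (hρ k) 1 hx ht)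
  have hs : ∀ᶠ k in far n, ∀ x t, 0 ≤ x → t ∈ Icc 0 T →
      partialNorm Finset.univ (φ k x t) ≤ 3 * partialNorm {0, 1} (φ k x t) := by
    filter_upwards [eventually_mem_sectorLE n, (tendsto_exp_beta C n).eventually
      (ge_mem_nhds (by norm_num : (0 : ℝ) < 1 / 4))] with k hk hk' x t hx ht
    exact (Propagator.partialNorm_univ_le hk' (hlast k hk x t hx ht)).1
  have h := S.tendsto_partialNorm_far (s := {0, 1}) (fun k hk i hi => by
    simp only [Finset.mem_insert, Finset.mem_singleton] at hi
    rcases hi with rfl | rfl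
    · exact hk.2.1
    · exact le_rfl) hv hs hx ht
  have hmem : ∀ i ∈ ({0, 1} : Finset (Fin 3)), Tendsto (fun k => φ k x t i) (far n)
      (𝓝 ((Pi.single 1 1 : Fin 3 → ℂ) i)) := by
    intro i hi
    rw [tendsto_iff_norm_sub_tendsto_zero]
    exact squeeze_zero (fun _ => norm_nonneg _) (fun k => norm_le_partialNorm
      (φ := fun i => φ k x t i - (Pi.single 1 1 : Fin 3 → ℂ) i) hi) h
  refine S.tendsto_ordWav_of_sheared hx ht (fun i => ?_) i
  by_cases hi : i ∈ ({0, 1} : Finset (Fin 3))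
  · exact hmem i hi
  · have hi2 : i = 2 := by
      fin_cases i <;> simp at hi ⊢
    subst hi2
    rw [Pi.single_eq_of_ne (by decide)]
    have h2 := (tendsto_exp_beta C n).mul ((h.const_mul 3 |>.add_const 1).const_mul 3)
    rw [zero_mul] at h2
    refine squeeze_zero_norm' ?_ h2
    filter_upwards [eventually_mem_sectorLE n, hs] with k hk hk'
    obtain ⟨a, U, H, H', Pr, -⟩ := hP k hk.1
    refine (hlast k hk x t hx ht).trans (mul_le_mul_of_nonneg_left ((hk' x t hx ht).trans
      (mul_le_mul_of_nonneg_left (partialNorm_le_sub_single {0, 1} 1 (φ k x t))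
        (by norm_num))) ?_)
    linarith [Real.one_le_exp (by linarith [Pr.nonneg] : 0 ≤ 12 * (C * beta k))]

end Regular


/-! ### The contours of the ordered problem -/

/-- In all eighteen arrangements the first index in the order of Re l precedes the last one also in
the order of Re z, so η₀₂ is always a unit vector. -/
lemma contour_first_last (n : Fin 18) : contour n (ord n 0) (ord n 2) = .γ₂ := by
  have h : ∀ n : Fin 18, ∃ a b : Fin 3,
      a < b ∧ zOrder n a = lOrder n 0 ∧ zOrder n b = lOrder n 2 := by decide
  unfold contour
  rw [if_pos ((precedes_ord n 0 2).2 (by decide))]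
  exact if_pos (h n)

lemma contour_of_lt_six {n : Fin 18} (hn : n.val < 6) {i j : Fin 3} (h : i < j) :
    contour n (ord n i) (ord n j) = .γ₂ := by
  have hz : ∀ n : Fin 18, n.val < 6 → zOrder n = lOrder n := by decide
  unfold contour
  rw [hz n hn, if_pos ((precedes_ord n i j).2 h), if_pos ((precedes_ord n i j).2 h)]

lemma ne_of_contour_ne {n : Fin 18} (i j : Fin 3) (h : contour n i j ≠ .γ₃) : i ≠ j := by
  rintro rfl
  refine h ?_
  have := contour_eq_of_le n (le_refl ((ord n).symm i))
  rwa [Equiv.apply_symm_apply] at this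

lemma eta_eq_single {T : ℝ} {u : ℝ → ℝ → ℝ} {n : Fin 18} {k : ℂ} {i j : Fin 3}
    (h : contour n (ord n i) (ord n j) = .γ₂) : eta T u n k i j = Pi.single i 1 := by
  ext m
  simp only [eta, h]

/-- For a contour starting at (0,T) the functional η is, up to a nonzero weight, a component of the
weighted solution there; its behaviour far out is then known. -/
lemma wt_mul_eta_dotProduct {T : ℝ} {u : ℝ → ℝ → ℝ} {n : Fin 18} {k : ℂ} {i j : Fin 3}
    (h : contour n (ord n i) (ord n j) = .γ₁) (r : Fin 3) (v : Fin 3 → ℂ) :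
    wt u (l k ∘ ord n) (z k ∘ ord n) r 0 T * (eta T u n k i j ⬝ᵥ v) = ordWav u n k r v 0 T i := by
  unfold ordWav wav Matrix.mulVec
  congr 2
  ext m
  simp only [eta, h, ordT, Matrix.submatrix_apply]

/-! ### Uniqueness -/

lemma EndConditions.sub {T : ℝ} {u : ℝ → ℝ → ℝ} {n : Fin 18} {k : ℂ}
    {A : Matrix (Fin 3) (Fin 3) ℂ} {V V' : Fin 3 → Fin 3 → ℂ} (h : EndConditions T u n k A V)
    (h' : EndConditions T u n k A V') : EndConditions T u n k 0 (V - V') := by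
  intro i j
  refine ⟨fun hc => ?_, fun hc => ?_, fun hc => ?_⟩
  · rw [Pi.sub_apply, Matrix.mulVec_sub, Pi.sub_apply, (h i j).1 hc, (h' i j).1 hc, sub_zero]
  · rw [Pi.sub_apply, Pi.sub_apply, (h i j).2.1 hc, (h' i j).2.1 hc, sub_zero]
  · have h1 := ((h i j).2.2 hc).sub ((h' i j).2.2 hc)
    rw [sub_self] at h1
    refine h1.congr fun x => ?_
    simp only [wav, Pi.sub_apply, Matrix.mulVec_sub]
    ring

lemma mem_sectorLE_of_closure {n : Fin 18} {k : ℂ} (hk : k ∈ closure (D n)) (hg : Good k) :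
    k ∈ sectorLE n :=
  ⟨hg, closure_D_re_le hk hg.1⟩

lemma D_subset_sectorLT (n : Fin 18) : D n ⊆ sectorLT n :=
  fun _ hk => ⟨D_good hk, hk.1, hk.2.1⟩

/-- The eigenfunction. -/
def eigen (T : ℝ) (u : ℝ → ℝ → ℝ) (n : Fin 18) (x t : ℝ) (k : ℂ) : Matrix (Fin 3) (Fin 3) ℂ :=
  waveMat u k (reorder n (col T u n k)) x t

lemma eigen_ord (T : ℝ) (u : ℝ → ℝ → ℝ) (n : Fin 18) (x t : ℝ) (k : ℂ) (i j : Fin 3) :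
    eigen T u n x t k (ord n i) (ord n j) = ordWav u n k j (col T u n k j) x t i := by
  rw [eigen, waveMat, Matrix.of_apply, wav_ord, reorder_comp]

namespace Regular

variable {T : ℝ} {u : ℝ → ℝ → ℝ} (S : Regular T u)

include S

lemma solvesSystem_unique {n : Fin 18} {k : ℂ} (hk : k ∈ sectorLE n) (hr : k ∈ regularSet T u n)
    {A : Matrix (Fin 3) (Fin 3) ℂ} (hA : ∀ i j, i ≠ j → A i j = 0)
    {Φ Ψ : ℝ → ℝ → Matrix (Fin 3) (Fin 3) ℂ} (hΦ : SolvesSystem T u n k A Φ)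
    (hΨ : SolvesSystem T u n k A Ψ) {x t : ℝ} (hxt : (x, t) ∈ halfLine T) : Φ x t = Ψ x t := by
  have h := S.eq_zero_of_endConditions hk.1 hk.2.1 hk.2.2 hr.1 hr.2
    ((S.endConditions_of_solvesSystem hk.1 hA ne_of_contour_ne hΦ).sub
      (S.endConditions_of_solvesSystem hk.1 hA ne_of_contour_ne hΨ))
  rw [S.eq_waveMat hk.1 hΦ.1 hxt, S.eq_waveMat hk.1 hΨ.1 hxt, sub_eq_zero.1 h]

/-- Nonzero denominators force all base vectors of a homogeneous solution to vanish; a vanishing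
denominator yields a nonzero solution. -/
lemma mem_singularSet_iff {n : Fin 18} {k : ℂ} (hk : k ∈ closure (D n)) (hg : Good k) :
    k ∈ singularSet T u n ↔ k ∉ regularSet T u n := by
  have hs := mem_sectorLE_of_closure hk hg
  constructor
  · rintro ⟨-, -, -, -, Φ, hΦ, x, t, hxt, hne⟩ hr
    have h := S.eq_zero_of_endConditions hg hs.2.1 hs.2.2 hr.1 hr.2
      (S.endConditions_of_solvesSystem hg (fun _ _ _ => rfl) ne_of_contour_ne hΦ)
    refine hne ?_
    rw [S.eq_waveMat hg hΦ.1 hxt, h]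
    ext i j
    simp [waveMat, wav]
  · intro hr
    refine ⟨hk, hg.1, hg.notMem_kappas, hg.notMem_Kpts,
      S.exists_homogeneous hg hs.2.1 hs.2.2 (mul_eq_zero.2 ?_)⟩
    by_contra h
    exact hr (not_or.1 h)

lemma solvesSystem_eigen {n : Fin 18} {k : ℂ} (hk : k ∈ sectorLE n) (hr : k ∈ regularSet T u n) :
    SolvesSystem T u n k 1 (fun x t => eigen T u n x t k) :=
  S.solvesSystem_col hk.1 hk.2.1 hk.2.2 hr.1 hr.2

/-! ### Limits far out -/

lemma tendsto_cross_rhoN (n : Fin 18) (i : Fin 3) :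
    Tendsto (fun k => crossProduct (rhoN u n k) (Pi.single 0 1) i) (far n)
      (𝓝 ((Pi.single 1 1 : Fin 3 → ℂ) i)) := by
  have h := S.tendsto_rhoN n
  have h1 := h 1
  have h2 := h 2
  fin_cases i
  · simpa [cross_apply] using tendsto_const_nhds
  · simpa [cross_apply] using h2
  · simpa [cross_apply] using h1.neg

/-- Either the first component of J, or the first component at (0,T) of the weighted solution with
base vector J; both tend to 1. -/
lemma eventually_denMid_ne_zero (n : Fin 18) : ∀ᶠ k in far n, denMid T u n k ≠ 0 := by
  cases hc : contour n (ord n 0) (ord n 1) with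
  | γ₁ =>
    filter_upwards [(S.tendsto_ordWav_jN n le_rfl ⟨S.pos.le, le_rfl⟩ 0).eventually_ne
      (by simp : (Pi.single 0 1 : Fin 3 → ℂ) 0 ≠ 0)] with k hk h0
    rw [← wt_mul_eta_dotProduct hc] at hk
    exact hk (mul_eq_zero_of_right _ h0)
  | γ₂ =>
    filter_upwards [(S.tendsto_jN n 0).eventually_ne
      (by simp : (Pi.single 0 1 : Fin 3 → ℂ) 0 ≠ 0)] with k hk
    rwa [denMid, eta_eq_single hc, single_dotProduct, one_mul]
  | γ₃ => exact absurd hc (contour_ne_of_lt n (by decide))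

/-- Since η₀₂ is the unit vector e₀, the denominator is η₁₂·(ρ×e₀). The vector ρ×e₀ tends to e₁ and
is annihilated by ρ, so the asymptotics of the middle column apply. -/
lemma eventually_denLast_ne_zero (n : Fin 18) : ∀ᶠ k in far n, denLast T u n k ≠ 0 := by
  have h02 : ∀ k, eta T u n k 0 2 = Pi.single 0 1 := fun k => eta_eq_single (contour_first_last n)
  have e : ∀ k, denLast T u n k = eta T u n k 1 2 ⬝ᵥ crossProduct (rhoN u n k) (Pi.single 0 1) := by
    intro k
    rw [denLast, h02, triple_product_permutation, triple_product_permutation]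
  cases hc : contour n (ord n 1) (ord n 2) with
  | γ₁ =>
    filter_upwards [(S.tendsto_ordWav_middle (S.tendsto_cross_rhoN n)
      (fun k => dot_self_cross _ _) le_rfl ⟨S.pos.le, le_rfl⟩ 1).eventually_ne
      (by simp : (Pi.single 1 1 : Fin 3 → ℂ) 1 ≠ 0)] with k hk h0
    rw [← wt_mul_eta_dotProduct hc, ← e] at hk
    exact hk (mul_eq_zero_of_right _ h0)
  | γ₂ =>
    filter_upwards [(S.tendsto_cross_rhoN n 1).eventually_ne
      (by simp : (Pi.single 1 1 : Fin 3 → ℂ) 1 ≠ 0)] with k hk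
    rwa [e, eta_eq_single hc, single_dotProduct, one_mul]
  | γ₃ => exact absurd hc (contour_ne_of_lt n (by decide))

/-- For these indices every finite contour starts at the origin, so the η are unit vectors, all base
vectors tend to unit vectors, and the three asymptotic statements cover the columns. -/
lemma tendsto_eigen {n : Fin 18} (hn : n.val < 6) {x t : ℝ} (hx : 0 ≤ x) (ht : t ∈ Icc 0 T)
    (i j : Fin 3) : Tendsto (fun k => eigen T u n x t k i j) (far n)
      (𝓝 ((1 : Matrix (Fin 3) (Fin 3) ℂ) i j)) := by
  obtain ⟨i, rfl⟩ := (ord n).surjective i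
  obtain ⟨j, rfl⟩ := (ord n).surjective j
  have e1 : (1 : Matrix (Fin 3) (Fin 3) ℂ) (ord n i) (ord n j)
      = (Pi.single j 1 : Fin 3 → ℂ) i := by
    rw [Matrix.one_apply, Pi.single_apply]
    simp only [EmbeddingLike.apply_eq_iff_eq]
  have h01 : ∀ k, eta T u n k 0 1 = Pi.single 0 1 := fun k =>
    eta_eq_single (contour_of_lt_six hn (by decide))
  have h02 : ∀ k, eta T u n k 0 2 = Pi.single 0 1 := fun k =>
    eta_eq_single (contour_of_lt_six hn (by decide))
  have h12 : ∀ k, eta T u n k 1 2 = Pi.single 1 1 := fun k =>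
    eta_eq_single (contour_of_lt_six hn (by decide))
  have hcross : crossProduct (Pi.single 0 1 : Fin 3 → ℂ) (Pi.single 1 1) = Pi.single 2 1 := by
    ext i
    fin_cases i <;> simp [cross_apply]
  have hm : Tendsto (fun k => (denMid T u n k)⁻¹) (far n) (𝓝 1) := by
    have h := (S.tendsto_jN n 0).inv₀ (by simp)
    rw [Pi.single_eq_same, inv_one] at h
    refine h.congr fun k => ?_
    rw [denMid, h01, single_dotProduct, one_mul]
  have hd : Tendsto (fun k => (denLast T u n k)⁻¹) (far n) (𝓝 1) := by
    have h := (S.tendsto_rhoN n 2).inv₀ (by simp)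
    rw [Pi.single_eq_same, inv_one] at h
    refine h.congr fun k => ?_
    rw [denLast, h02, h12, hcross, dotProduct_single, mul_one]
  simp only [eigen_ord]
  rw [e1]
  have hj : j = 0 ∨ j = 1 ∨ j = 2 := by omega
  rcases hj with rfl | rfl | rfl
  · exact S.tendsto_ordWav_jN n hx ht i
  · refine S.tendsto_ordWav_middle (fun i => ?_) (fun k => ?_) hx ht i
    · have h := hm.mul (S.tendsto_cross_rhoN n i)
      rw [one_mul] at h
      refine h.congr fun k => ?_
      simp [col, h01]
    · simp [col, dotProduct_smul]
  · refine S.tendsto_ordWav_last (fun i => ?_) hx ht i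
    have h := hd.mul_const ((Pi.single 2 1 : Fin 3 → ℂ) i)
    rw [one_mul] at h
    refine h.congr fun k => ?_
    simp [col, h02, h12, hcross]

/-! ### The singular set and analyticity -/

omit S in
-- Sectors are cones: scaling preserves the order of the Re l_j, while the height tends to infinity.
lemma tendsto_ray_far {n : Fin 18} {k : ℂ} (h01 : (l k (ord n 0)).re < (l k (ord n 1)).re)
    (h12 : (l k (ord n 1)).re < (l k (ord n 2)).re) :
    Tendsto (fun r : ℝ => (r : ℂ) * k) atTop (far n) := by
  have hk : k ≠ 0 := by
    rintro rfl
    rw [re_l_lt_iff, rot_zero, rot_zero] at h01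
    exact lt_irrefl _ h01
  have hh : Tendsto (fun r : ℝ => height ((r : ℂ) * k)) atTop atTop := by
    refine tendsto_atTop_mono' _ ?_ (tendsto_id.atTop_mul_const (norm_pos_iff.2 hk))
    filter_upwards [eventually_ge_atTop 0] with r hr
    refine le_trans (le_of_eq ?_) (le_max_left _ _)
    rw [norm_mul, Complex.norm_real, Real.norm_of_nonneg hr, id]
  refine tendsto_inf.2 ⟨tendsto_comap_iff.2 hh, tendsto_principal.2 ?_⟩
  have hrot : ∀ (r : ℝ) j, (rot ((r : ℂ) * k) j).re = r * (rot k j).re := by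
    intro r j
    rw [← Complex.re_ofReal_mul]
    congr 1
    simp only [rot]
    ring
  rw [re_l_lt_iff] at h01 h12
  filter_upwards [eventually_gt_atTop 0, hh.eventually_gt_atTop 1] with r hr hr1
  refine ⟨good_of_height (mul_ne_zero (by exact_mod_cast hr.ne') hk) hr1, le_of_lt ?_, le_of_lt ?_⟩
  · rw [re_l_lt_iff, hrot, hrot]
    exact mul_lt_mul_of_pos_left h01 hr
  · rw [re_l_lt_iff, hrot, hrot]
    exact mul_lt_mul_of_pos_left h12 hr

lemma eventually_notMem_singularSet {n : Fin 18} {k : ℂ} (hk : k ∈ D n) :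
    ∀ᶠ k' in 𝓝[≠] k, k' ∉ singularSet T u n := by
  have h := eventually_ne_zero_of_ray (f := fun k => denMid T u n k * denLast T u n k)
    (a := ord n 0) (b := ord n 1) (c := ord n 2) hk.1 hk.2.1 (D_pow_six hk)
    (fun k h1 h2 hg => ((S.differentiableOn_denMid n).mul (S.differentiableOn_denLast n)).analyticAt
      ((isOpen_sectorLT n).mem_nhds ⟨hg, h1, h2⟩))
    (fun k h1 h2 => (tendsto_ray_far h1 h2).eventually
      (((S.eventually_denMid_ne_zero n).and (S.eventually_denLast_ne_zero n)).mono
        fun k hk => mul_ne_zero hk.1 hk.2))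
  filter_upwards [h] with k' hk' hs
  exact (S.mem_singularSet_iff hs.1 (good_of_notMem hs.2.1 hs.2.2.1 hs.2.2.2.1)).1 hs
    (mul_ne_zero_iff.1 hk')

lemma isOpen_regular (n : Fin 18) : IsOpen (sectorLT n ∩ regularSet T u n) := by
  have h1 := (S.differentiableOn_denMid n).continuousOn.isOpen_inter_preimage (isOpen_sectorLT n)
    (isOpen_compl_singleton (x := (0 : ℂ)))
  have h2 := (S.differentiableOn_denLast n).continuousOn.isOpen_inter_preimage (isOpen_sectorLT n)
    (isOpen_compl_singleton (x := (0 : ℂ)))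
  convert h1.inter h2 using 1
  ext k
  simp only [regularSet, mem_inter_iff, mem_ofPred_eq, mem_preimage, mem_compl_iff,
    mem_singleton_iff]
  tauto

lemma diff_singularSet_subset (n : Fin 18) :
    D n \ singularSet T u n ⊆ sectorLT n ∩ regularSet T u n := fun _ hk =>
  ⟨D_subset_sectorLT n hk.1, not_not.1 fun h =>
    hk.2 ((S.mem_singularSet_iff (subset_closure hk.1) (D_good hk.1)).2 h)⟩

lemma analyticOnNhd_eigen (n : Fin 18) {x t : ℝ} (hx : 0 ≤ x) (ht : 0 ≤ t) (i j : Fin 3) :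
    AnalyticOnNhd ℂ (fun k => eigen T u n x t k i j) (D n \ singularSet T u n) :=
  ((S.differentiableOn_waveMat n hx ht i j).analyticOnNhd (S.isOpen_regular n)).mono
    (S.diff_singularSet_subset n)

/-! ### The extension to the sphere -/

omit S in
open Classical in
/-- The extension of the eigenfunction to the Riemann sphere. -/
def _root_.DegasperisProcesi.eigenSphere (T : ℝ) (u : ℝ → ℝ → ℝ) (n : Fin 18) (x t : ℝ)
    (κ : OnePoint ℂ) : Matrix (Fin 3) (Fin 3) ℂ :=
  κ.elim 1 fun k => if k = 0 then 1 else eigen T u n x t k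

omit S in
lemma eigenSphere_coe (n : Fin 18) (x t : ℝ) {k : ℂ} (hk : k ≠ 0) :
    eigenSphere T u n x t (k : OnePoint ℂ) = eigen T u n x t k := if_neg hk

omit S in
lemma eigenSphere_zero (n : Fin 18) (x t : ℝ) :
    eigenSphere T u n x t ((0 : ℂ) : OnePoint ℂ) = 1 := if_pos rfl

lemma mem_of_mem_sphere {n : Fin 18} {k : ℂ} (hk : k ≠ 0)
    (h : (k : OnePoint ℂ) ∈ sphereClosure n \ exceptionalSet T u n) :
    k ∈ sectorLE n ∩ regularSet T u n := by
  have h1 : k ∈ closure (D n) := by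
    rw [OnePoint.isOpenEmbedding_coe.isInducing.closure_eq_preimage_closure_image]
    exact h.1
  have h2 : k ∉ kappas ∪ Kpts ∪ singularSet T u n := fun hm => h.2 ⟨k, hm, rfl⟩
  simp only [mem_union, not_or] at h2
  have hg := good_of_notMem hk h2.1.1 h2.1.2
  exact ⟨mem_sectorLE_of_closure h1 hg, not_not.1 fun h =>
    h2.2 ((S.mem_singularSet_iff h1 hg).2 h)⟩

lemma continuousOn_eigenSphere {n : Fin 18} (hn : n.val < 6) {x t : ℝ} (hx : 0 ≤ x)
    (ht : t ∈ Icc 0 T) (i j : Fin 3) :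
    ContinuousOn (fun κ => eigenSphere T u n x t κ i j)
      (sphereClosure n \ exceptionalSet T u n) := by
  intro κ hκ
  -- Large height means k near 0 or near ∞, so one limit statement settles continuity at both
  -- points, where the extension has the value 1.
  have hfar : ∀ W ∈ 𝓝 ((1 : Matrix (Fin 3) (Fin 3) ℂ) i j), ∀ᶠ k : ℂ in comap height atTop,
      (k : OnePoint ℂ) ∈ sphereClosure n \ exceptionalSet T u n →
        eigenSphere T u n x t (k : OnePoint ℂ) i j ∈ W := by
    intro W hW
    filter_upwards [eventually_inf_principal.1 ((S.tendsto_eigen hn hx ht i j).eventually hW)]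
      with k hk hks
    by_cases h0 : k = 0
    · rw [h0, eigenSphere_zero]
      exact mem_of_mem_nhds hW
    · rw [eigenSphere_coe n x t h0]
      exact hk (S.mem_of_mem_sphere h0 hks).1
  change Tendsto _ _ _
  intro W hW
  change W ∈ 𝓝 (eigenSphere T u n x t κ i j) at hW
  change ∀ᶠ κ' in 𝓝[_] κ, eigenSphere T u n x t κ' i j ∈ W
  rw [eventually_nhdsWithin_iff]
  induction κ using OnePoint.rec with
  | infty =>
    rw [OnePoint.nhds_infty_eq, eventually_sup, eventually_map, eventually_pure]
    refine ⟨?_, fun _ => mem_of_mem_nhds hW⟩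
    have h : Tendsto height (coclosedCompact ℂ) atTop := by
      rw [coclosedCompact_eq_cocompact]
      exact tendsto_atTop_mono (fun k => le_max_left _ _) (tendsto_norm_cocompact_atTop (E := ℂ))
    exact h.le_comap (hfar W hW)
  | coe k =>
    rw [OnePoint.nhds_coe_eq, eventually_map]
    by_cases h0 : k = 0
    · subst h0
      rw [eigenSphere_zero] at hW
      have h : Tendsto height (𝓝[≠] 0) atTop :=
        tendsto_atTop_mono (fun k => (norm_inv k).trans_le (le_max_right _ _))
          (tendsto_norm_inv_nhdsNE_zero_atTop (α := ℂ))
      have h1 := eventually_nhdsWithin_iff.1 (h.le_comap (hfar W hW))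
      filter_upwards [h1] with k hk hks
      by_cases h0 : k = 0
      · rw [h0, eigenSphere_zero]
        exact mem_of_mem_nhds hW
      · exact hk h0 hks
    · rw [eigenSphere_coe n x t h0] at hW
      have h := (S.continuousOn_waveMat n hx ht.1 i j) k (S.mem_of_mem_sphere h0 hκ)
      have h1 := eventually_nhdsWithin_iff.1 (h.eventually hW)
      filter_upwards [h1, isOpen_ne.mem_nhds h0] with k' hk' hk0 hks
      rw [eigenSphere_coe n x t hk0]
      exact hk' (S.mem_of_mem_sphere hk0 hks)

lemma exists_bound_eigenSphere {n : Fin 18} (hn : n.val < 6) {x t : ℝ} (hx : 0 ≤ x)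
    (ht : t ∈ Icc 0 T) {U : Set (OnePoint ℂ)} (hU : IsOpen U) (hE : exceptionalSet T u n ⊆ U) :
    ∃ C : ℝ, ∀ κ ∈ sphereClosure n \ U, ∀ i j : Fin 3, ‖eigenSphere T u n x t κ i j‖ ≤ C := by
  have hcomp : IsCompact (sphereClosure n \ U) := (isClosed_closure.sdiff hU).isCompact
  choose C hC using fun i j => hcomp.exists_bound_of_continuousOn
    ((S.continuousOn_eigenSphere hn hx ht i j).mono (sdiff_subset_sdiff_right hE))
  refine ⟨∑ i, ∑ j, |C i j|, fun κ hκ i j => (hC i j κ hκ).trans ((le_abs_self _).trans ?_)⟩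
  exact (Finset.single_le_sum (f := fun j => |C i j|) (fun _ _ => abs_nonneg _)
    (Finset.mem_univ j)).trans (Finset.single_le_sum (f := fun i => ∑ j, |C i j|)
      (fun _ _ => Finset.sum_nonneg fun _ _ => abs_nonneg _) (Finset.mem_univ i))

end Regular

end DegasperisProcesi

end

open DegasperisProcesi in
theorem mainTheorem6 (T : ℝ) (hT : 0 < T) (u : ℝ → ℝ → ℝ) (hu : IsHalfLineSolution T u)
    (hu₀ : ∀ x : ℝ, 0 ≤ x → 0 < u x 0 - dx 2 u x 0 + 1)
    (hg₂ : ∀ t : ℝ, 0 ≤ t → t < T → 0 < u 0 t - dx 2 u 0 t + 1)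
    (hg₀ : ∀ t : ℝ, 0 ≤ t → t < T → u 0 t ≤ 0) :
    ∃ Φ : Fin 18 → ℝ → ℝ → ℂ → Matrix (Fin 3) (Fin 3) ℂ, ∀ n : Fin 18,
      -- the singular set is discrete in `D_n`
      (∀ k ∈ D n, ∀ᶠ k' in 𝓝[≠] k, k' ∉ singularSet T u n) ∧
      -- off the singular set, the integral equations determine the eigenfunction
      (∀ k ∈ D n \ singularSet T u n,
        SolvesSystem T u n k 1 (fun x t => Φ n x t k) ∧
        ∀ Ψ : ℝ → ℝ → Matrix (Fin 3) (Fin 3) ℂ, SolvesSystem T u n k 1 Ψ →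
          ∀ x t : ℝ, (x, t) ∈ halfLine T → Ψ x t = Φ n x t k) ∧
      -- analyticity
      (∀ x t : ℝ, (x, t) ∈ halfLine T → ∀ i j : Fin 3,
        AnalyticOnNhd ℂ (fun k => Φ n x t k i j) (D n \ singularSet T u n)) ∧
      -- boundedness and continuous extension for the first six indices
      (n.val < 6 → ∀ x t : ℝ, (x, t) ∈ halfLine T →
        (∀ U : Set (OnePoint ℂ), IsOpen U → exceptionalSet T u n ⊆ U →
          ∃ C : ℝ, ∀ k ∈ D n, (k : OnePoint ℂ) ∉ U → ∀ i j : Fin 3, ‖Φ n x t k i j‖ ≤ C) ∧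
        ∃ F : OnePoint ℂ → Matrix (Fin 3) (Fin 3) ℂ,
          (∀ k ∈ D n \ singularSet T u n, F (k : OnePoint ℂ) = Φ n x t k) ∧
          (∀ i j : Fin 3,
            ContinuousOn (fun κ => F κ i j) (sphereClosure n \ exceptionalSet T u n)) ∧
          (∀ U : Set (OnePoint ℂ), IsOpen U → exceptionalSet T u n ⊆ U →
            ∃ C : ℝ, ∀ κ ∈ sphereClosure n \ U, ∀ i j : Fin 3, ‖F κ i j‖ ≤ C)) := by
  have S : Regular T u := by
    refine ⟨hT, hu, hu.exists_mass_ge hT hu₀ hg₀, fun t ht => ?_⟩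
    have hcl : t ∈ closure (Ico 0 T) := by rwa [closure_Ico hT.ne]
    have hc : Continuous fun s => u 0 s :=
      hu.continuous_u.comp (by fun_prop : Continuous fun s : ℝ => ((0 : ℝ), s))
    exact closure_minimal (fun s hs => hg₀ s hs.1 hs.2) (isClosed_le hc continuous_const) hcl
  refine ⟨eigen T u, fun n => ⟨fun k hk => S.eventually_notMem_singularSet hk, fun k hk => ?_,
    fun x t hxt i j => S.analyticOnNhd_eigen n hxt.1 hxt.2.1 i j, fun hn x t hxt => ?_⟩⟩
  · have hk' := S.diff_singularSet_subset n hk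
    have hs := S.solvesSystem_eigen (sectorLT_subset n hk'.1) hk'.2
    exact ⟨hs, fun Ψ hΨ x t hxt => S.solvesSystem_unique (sectorLT_subset n hk'.1) hk'.2
      (fun i j hij => Matrix.one_apply_ne hij) hΨ hs hxt⟩
  · have ht : t ∈ Icc 0 T := ⟨hxt.2.1, hxt.2.2.le⟩
    refine ⟨fun U hU hE => ?_, eigenSphere T u n x t,
      fun k hk => Regular.eigenSphere_coe n x t (D_good hk.1).1,
      fun i j => S.continuousOn_eigenSphere hn hxt.1 ht i j,
      fun U hU hE => S.exists_bound_eigenSphere hn hxt.1 ht hU hE⟩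
    obtain ⟨C, hC⟩ := S.exists_bound_eigenSphere hn hxt.1 ht hU hE
    refine ⟨C, fun k hk hkU i j => ?_⟩
    rw [← Regular.eigenSphere_coe n x t (D_good hk).1]
    exact hC k ⟨subset_closure ⟨k, hk, rfl⟩, hkU⟩ i j
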